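/- Let $k$ be a field and let $\mathbf{FB}$ be the category of finite sets and bijections. A $k(\mathbf{FB}\times\mathbf{FB})$-module is a functor $F$ from $\mathbf{FB}\times\mathbf{FB}$ to $k$-vector spaces. Write $(F\circledast G)(X,Y)=\bigoplus F(X_1,Y_1)\otimes G(X_2,Y_2)$, the sum over all ordered decompositions $X=X_1\sqcup X_2$, $Y=Y_1\sqcup Y_2$ (Day convolution), $(\delta_{a,b}F)(X,Y)=F(X\sqcup\{1,\dots,a\},Y\sqcup\{1,\dots,b\})$, and $$S_\circledast^*F=\bigoplus_{d\ge0}(F^{\circledast d})_{\mathfrak S_d},\qquad \Lambda_\circledast^*F=\bigoplus_{d\ge0}(F^{\circledast d}\otimes\mathrm{sgn}_d)_{\mathfrak S_d}.$$ *The category $(k\mathsf{dwb})_-$.* Let $\mathsf{uwb}^{\mathrm{ord}}$ be the category whose objects are pairs of finite sets, where a morphism $(X,Y)\to(U,V)$ of degree $n\ge 0$ is a pair of bijections $X\sqcup\{1,\dots,n\}\cong U$, $Y\sqcup\{1,\dots,n\}\cong V$; composition concatenates the labels, those of the first morphism coming first. $\mathfrak S_n$ acts on the morphisms of degree $n$ by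 permuting the labels in both bijections simultaneously. $(k\mathsf{uwb})_-$ is the $k$-linear category with the same objects and with morphisms $\bigoplus_n k[\mathsf{uwb}^{\mathrm{ord}}(-,-)_n]\otimes_{\mathfrak S_n}\mathrm{sgn}_n$, and $(k\mathsf{dwb})_-$ is its opposite. A $(k\mathsf{dwb})_-$-module is a $k$-linear functor $M$ from $(k\mathsf{dwb})_-$ to $k$-vector spaces. It has an underlying $k(\mathbf{FB}\times\mathbf{FB})$-module (identify $\mathbf{FB}\times\mathbf{FB}$ with its opposite by inversion of bijections), and the morphism $(X,Y)\to(X\sqcup\{1\},Y\sqcup\{1\})$ of degree $1$ given by the identities induces its contraction $\delta_{1,1}M\to M$. *Operads.* An operad (without unit) is a $k(\mathbf{FB}\times\mathbf{FB})$-module $\mathcal O$ with $\mathcal O(X,Y)=0$ unless $|Y|=1$ ($X$ labels the inputs, $Y$ the output), with a morphism $\tilde\mu\colon\delta_{1,0}\mathcal O\circledast\delta_{0,1}\mathcal O\to\mathcal O$, $p\otimes q\mapsto p\circ q$ (the distinguished output of $q$ is plugged into the distinguished input of $p$), that satisfies the sequential and the parallel associativity axiom of partial compositions. A morphism of operads is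 a morphism of $k(\mathbf{FB}\times\mathbf{FB})$-modules that commutes with $\tilde\mu$. Plugging the distinguished output of the second factor into the distinguished input of the first defines a product $\delta_{1,1}\mathcal O\circledast\delta_{1,1}\mathcal O\to\delta_{1,1}\mathcal O$. Let $\pi\colon\delta_{1,1}\mathcal O\to|\delta_{1,1}\mathcal O|$ be the coequalizer of this product and of its composite with the symmetry of $\circledast$. Partial composition at a further input of $\delta_{1,1}\mathcal O$ induces $\alpha\colon\delta_{1,0}|\delta_{1,1}\mathcal O|\circledast\delta_{0,1}\mathcal O\to|\delta_{1,1}\mathcal O|$. **Theorem.** For every operad $\mathcal O$ without unit, the structure maps $\tilde\mu$ and $\alpha$ induce a $(k\mathsf{dwb})_-$-module structure, natural with respect to morphisms of operads, on the $k(\mathbf{FB}\times\mathbf{FB})$-module $\Lambda_\circledast^*\mathcal O\circledast S_\circledast^*|\delta_{1,1}\mathcal O|$: there is a functor from operads to $(k\mathsf{dwb})_-$-modules with this underlying functor to $k(\mathbf{FB}\times\mathbf{FB})$-modules (up to natural isomorphism), whose contraction of a distinguished element $x$ of the first set with a distinguished element $y$ of the second set is given on decomposable elements by 1. $(w\wedge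 p\wedge q)\otimes v\mapsto (w\wedge (p\circ q))\otimes v$, if $x$ is an input of $p$ and $y$ is the output of $q$; 2. $(w\wedge q)\otimes(v\cdot a)\mapsto w\otimes (v\cdot\alpha(a\otimes q))$, if $x$ is an input of $a\in|\delta_{1,1}\mathcal O|$ and $y$ is the output of $q$; 3. $(w\wedge r)\otimes v\mapsto w\otimes (v\cdot\pi(r))$, if $x$ is an input of $r$ and $y$ is the output of $r$, where $p,q,r$ are elements of $\mathcal O$, $w$ is the class in $\Lambda_\circledast^*\mathcal O$ of an element of $\mathcal O^{\circledast d}$, and $v$ is the class in $S_\circledast^*|\delta_{1,1}\mathcal O|$ of an element of $|\delta_{1,1}\mathcal O|^{\circledast e}$ ($d,e\ge0$). Moreover, $\Lambda_\circledast^*\mathcal O$ carries a $(k\mathsf{dwb})_-$-module structure, natural in $\mathcal O$, for which the surjection $\Lambda_\circledast^*\mathcal O\circledast S_\circledast^*|\delta_{1,1}\mathcal O|\twoheadrightarrow\Lambda_\circledast^*\mathcal O$ induced by $|\delta_{1,1}\mathcal O|\to0$ is a natural morphism of $(k\mathsf{dwb})_-$-modules. -/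

import Mathlib

open CategoryTheory Opposite
open scoped DirectSum TensorProduct

noncomputable section

universe u

namespace Wheeled

/-- A pair `(X, Y)` of finite sets. -/
structure FB2 where
  fst : Type
  snd : Type
  [finFst : Finite fst]
  [finSnd : Finite snd]

attribute [instance] FB2.finFst FB2.finSnd

namespace FB2

/-- A morphism of `FB × FB`: a pair of bijections. -/
@[ext]
structure Hom (Z W : FB2) where
  fst : Z.fst ≃ W.fst
  snd : Z.snd ≃ W.snd

instance : Category FB2 where
  Hom := Hom
  id Z := ⟨Equiv.refl _, Equiv.refl _⟩
  comp f g := ⟨f.fst.trans g.fst, f.snd.trans g.snd⟩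

end FB2

/-- `k`-linear `FB × FB`-modules. -/
abbrev FBMod (k : Type u) [Field k] := FB2 ⥤ ModuleCat.{u} k

namespace FBMod

variable {k : Type u} [Field k]

/-- The value `F(A, A')`. -/
abbrev val (F : FBMod k) (A A' : Type) [Finite A] [Finite A'] : ModuleCat.{u} k := F.obj ⟨A, A'⟩

/-- The action of a pair of bijections. -/
def act (F : FBMod k) {A A' B B' : Type} [Finite A] [Finite A'] [Finite B] [Finite B']
    (e : A ≃ B) (e' : A' ≃ B') : val F A A' →ₗ[k] val F B B' :=
  (F.map (X := ⟨A, A'⟩) (Y := ⟨B, B'⟩) ⟨e, e'⟩).hom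

lemma act_refl (F : FBMod k) {A A' : Type} [Finite A] [Finite A'] (x : val F A A') :
    act F (Equiv.refl A) (Equiv.refl A') x = x := by
  have := F.map_id ⟨A, A'⟩
  exact congrArg (fun f => f.hom x) this

lemma act_act (F : FBMod k) {A A' B B' C C' : Type} [Finite A] [Finite A'] [Finite B] [Finite B']
    [Finite C] [Finite C'] (e : A ≃ B) (e' : A' ≃ B') (f : B ≃ C) (f' : B' ≃ C')
    (x : val F A A') : act F f f' (act F e e' x) = act F (e.trans f) (e'.trans f') x := by
  have := F.map_comp (X := ⟨A, A'⟩) (Y := ⟨B, B'⟩) (Z := ⟨C, C'⟩) ⟨e, e'⟩ ⟨f, f'⟩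
  exact (congrArg (fun f => f.hom x) this).symm

lemma app_act {F G : FBMod k} (η : F ⟶ G) {A A' B B' : Type} [Finite A] [Finite A'] [Finite B]
    [Finite B'] (e : A ≃ B) (e' : A' ≃ B') (x : val F A A') :
    (η.app ⟨B, B'⟩).hom (act F e e' x) = act G e e' ((η.app ⟨A, A'⟩).hom x) := by
  have := η.naturality (X := ⟨A, A'⟩) (Y := ⟨B, B'⟩) ⟨e, e'⟩
  exact congrArg (fun f => f.hom x) this

end FBMod

open FBMod

/-- An ordered decomposition of the pair `Z` indexed by `ι`: each element is assigned the index of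
the part that contains it. -/
@[ext]
structure Coloring (Z : FB2) (ι : Type) where
  fst : Z.fst → ι
  snd : Z.snd → ι

namespace Coloring

variable {Z W V : FB2} {ι : Type}

instance : DecidableEq (Coloring Z ι) := Classical.decEq _

/-- The part with index `i`. -/
def part (c : Coloring Z ι) (i : ι) : FB2 := ⟨{x // c.fst x = i}, {y // c.snd y = i}⟩

/-- Transport of a decomposition along a bijection. -/
def push (c : Coloring Z ι) (f : Z ⟶ W) : Coloring W ι :=
  ⟨c.fst ∘ f.fst.symm, c.snd ∘ f.snd.symm⟩

def partHom (c : Coloring Z ι) (f : Z ⟶ W) (i : ι) : c.part i ⟶ (c.push f).part i :=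
  ⟨f.fst.subtypeEquiv fun x => by simp [push], f.snd.subtypeEquiv fun y => by simp [push]⟩

/-- Renumbering of the parts: part `i` becomes part `σ i`. -/
def recolor (c : Coloring Z ι) (σ : Equiv.Perm ι) : Coloring Z ι := ⟨σ ∘ c.fst, σ ∘ c.snd⟩

def recolorHom (c : Coloring Z ι) (σ : Equiv.Perm ι) (i : ι) :
    c.part (σ.symm i) ⟶ (c.recolor σ).part i :=
  ⟨Equiv.subtypeEquivRight fun x => by simp [recolor, Equiv.eq_symm_apply],
   Equiv.subtypeEquivRight fun y => by simp [recolor, Equiv.eq_symm_apply]⟩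

lemma partHom_id (c : Coloring Z ι) (i : ι) : c.partHom (𝟙 Z) i = 𝟙 (c.part i) := rfl
lemma partHom_comp (c : Coloring Z ι) (f : Z ⟶ W) (g : W ⟶ V) (i : ι) :
    c.partHom (f ≫ g) i = c.partHom f i ≫ (c.push f).partHom g i := rfl

end Coloring


/-- `X ⊔ {1, …, n + m} ≅ (X ⊔ {1, …, n}) ⊔ {1, …, m}`. -/
def sumFinAdd (X : Type) (n m : ℕ) : X ⊕ Fin (n + m) ≃ (X ⊕ Fin n) ⊕ Fin m :=
  ((Equiv.refl X).sumCongr finSumFinEquiv.symm).trans (Equiv.sumAssoc X (Fin n) (Fin m)).symm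

/-- The objects of `uwb^ord`: pairs of finite sets. -/
structure UwbOrd where
  pair : FB2

namespace UwbOrd

/-- A morphism `(X, Y) → (U, V)` of degree `n` in `uwb^ord`: a pair of bijections
`X ⊔ {1, …, n} ≅ U` and `Y ⊔ {1, …, n} ≅ V`. -/
structure Hom (Z W : UwbOrd) where
  deg : ℕ
  fst : Z.pair.fst ⊕ Fin deg ≃ W.pair.fst
  snd : Z.pair.snd ⊕ Fin deg ≃ W.pair.snd

namespace Hom

variable {Z W V : UwbOrd}

lemma ext' {f g : Hom Z W} (h : f.deg = g.deg)
    (h1 : ∀ x, f.fst (Sum.inl x) = g.fst (Sum.inl x))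
    (h2 : ∀ x, f.snd (Sum.inl x) = g.snd (Sum.inl x))
    (h3 : ∀ i, f.fst (Sum.inr i) = g.fst (Sum.inr (Fin.cast h i)))
    (h4 : ∀ i, f.snd (Sum.inr i) = g.snd (Sum.inr (Fin.cast h i))) : f = g := by
  obtain ⟨n, a, b⟩ := f
  obtain ⟨m, a', b'⟩ := g
  dsimp only at h
  subst h
  have ha : a = a' := by
    ext (x | i)
    · exact h1 x
    · exact h3 i
  have hb : b = b' := by
    ext (x | i)
    · exact h2 x
    · exact h4 i
  rw [ha, hb]

/-- Composition; the labels of `f` come first, followed by those of `g`. -/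
@[reducible] def comp (f : Hom Z W) (g : Hom W V) : Hom Z V where
  deg := f.deg + g.deg
  fst := (sumFinAdd _ _ _).trans ((f.fst.sumCongr (Equiv.refl _)).trans g.fst)
  snd := (sumFinAdd _ _ _).trans ((f.snd.sumCongr (Equiv.refl _)).trans g.snd)

/-- The right action of `S_n` on morphisms of degree `n`. -/
@[reducible] def permute (f : Hom Z W) (σ : Equiv.Perm (Fin f.deg)) : Hom Z W where
  deg := f.deg
  fst := ((Equiv.refl _).sumCongr σ).trans f.fst
  snd := ((Equiv.refl _).sumCongr σ).trans f.snd

/-- A pair of bijections as a morphism of degree `0`. -/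
@[reducible] def ofIso {Z W : FB2} (f : Z ⟶ W) : Hom ⟨Z⟩ ⟨W⟩ where
  deg := 0
  fst := (Equiv.sumEmpty _ _).trans f.fst
  snd := (Equiv.sumEmpty _ _).trans f.snd

/-- The morphism `(X, Y) → (X ⊔ {1}, Y ⊔ {1})` of degree `1` given by the identities. -/
@[reducible] def pair (Z : FB2) : Hom ⟨Z⟩ ⟨⟨Z.fst ⊕ Fin 1, Z.snd ⊕ Fin 1⟩⟩ where
  deg := 1
  fst := Equiv.refl _
  snd := Equiv.refl _

end Hom

lemma sumFinAdd_castAdd (X : Type) (n m : ℕ) (i : Fin n) :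
    sumFinAdd X n m (Sum.inr (Fin.castAdd m i)) = Sum.inl (Sum.inr i) := by
  simp [sumFinAdd]

lemma sumFinAdd_natAdd (X : Type) (n m : ℕ) (i : Fin m) :
    sumFinAdd X n m (Sum.inr (Fin.natAdd n i)) = Sum.inr i := by
  simp [sumFinAdd]

namespace Hom

variable {Z W V : UwbOrd} (f : Hom Z W) (g : Hom W V)

lemma comp_fst_castAdd (i : Fin f.deg) :
    (comp f g).fst (Sum.inr (Fin.castAdd g.deg i)) = g.fst (Sum.inl (f.fst (Sum.inr i))) := by
  change g.fst (Sum.map f.fst id (sumFinAdd _ _ _ _)) = _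
  rw [sumFinAdd_castAdd]; rfl

lemma comp_snd_castAdd (i : Fin f.deg) :
    (comp f g).snd (Sum.inr (Fin.castAdd g.deg i)) = g.snd (Sum.inl (f.snd (Sum.inr i))) := by
  change g.snd (Sum.map f.snd id (sumFinAdd _ _ _ _)) = _
  rw [sumFinAdd_castAdd]; rfl

lemma comp_fst_natAdd (i : Fin g.deg) :
    (comp f g).fst (Sum.inr (Fin.natAdd f.deg i)) = g.fst (Sum.inr i) := by
  change g.fst (Sum.map f.fst id (sumFinAdd _ _ _ _)) = _
  rw [sumFinAdd_natAdd]; rfl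

lemma comp_snd_natAdd (i : Fin g.deg) :
    (comp f g).snd (Sum.inr (Fin.natAdd f.deg i)) = g.snd (Sum.inr i) := by
  change g.snd (Sum.map f.snd id (sumFinAdd _ _ _ _)) = _
  rw [sumFinAdd_natAdd]; rfl

lemma permute_comp (σ : Equiv.Perm (Fin f.deg)) :
    comp (permute f σ) g = permute (comp f g)
      (finSumFinEquiv.permCongr (σ.sumCongr (Equiv.refl (Fin g.deg)))) := by
  refine ext' rfl (fun _ => rfl) (fun _ => rfl) ?_ ?_
  · refine Fin.addCases (fun i => ?_) (fun i => ?_)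
    · refine (comp_fst_castAdd (permute f σ) g i).trans ?_
      refine Eq.trans ?_ (congrArg (fun j => (comp f g).fst (Sum.inr j))
        (show Fin.castAdd g.deg (σ i) = _ by simp [Equiv.permCongr_apply]))
      exact (comp_fst_castAdd f g (σ i)).symm
    · refine (comp_fst_natAdd (permute f σ) g i).trans ?_
      refine Eq.trans ?_ (congrArg (fun j => (comp f g).fst (Sum.inr j))
        (show Fin.natAdd f.deg i = _ by simp [Equiv.permCongr_apply, permute]))
      exact (comp_fst_natAdd f g i).symm
  · refine Fin.addCases (fun i => ?_) (fun i => ?_)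
    · refine (comp_snd_castAdd (permute f σ) g i).trans ?_
      refine Eq.trans ?_ (congrArg (fun j => (comp f g).snd (Sum.inr j))
        (show Fin.castAdd g.deg (σ i) = _ by simp [Equiv.permCongr_apply]))
      exact (comp_snd_castAdd f g (σ i)).symm
    · refine (comp_snd_natAdd (permute f σ) g i).trans ?_
      refine Eq.trans ?_ (congrArg (fun j => (comp f g).snd (Sum.inr j))
        (show Fin.natAdd f.deg i = _ by simp [Equiv.permCongr_apply, permute]))
      exact (comp_snd_natAdd f g i).symm

lemma comp_permute (σ : Equiv.Perm (Fin g.deg)) :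
    comp f (permute g σ) = permute (comp f g)
      (finSumFinEquiv.permCongr ((Equiv.refl (Fin f.deg)).sumCongr σ)) := by
  refine ext' rfl (fun _ => rfl) (fun _ => rfl) ?_ ?_
  · refine Fin.addCases (fun i => ?_) (fun i => ?_)
    · refine (comp_fst_castAdd f (permute g σ) i).trans ?_
      refine Eq.trans ?_ (congrArg (fun j => (comp f g).fst (Sum.inr j))
        (show Fin.castAdd g.deg i = _ by simp [Equiv.permCongr_apply, permute]))
      exact (comp_fst_castAdd f g i).symm
    · refine (comp_fst_natAdd f (permute g σ) i).trans ?_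
      refine Eq.trans ?_ (congrArg (fun j => (comp f g).fst (Sum.inr j))
        (show Fin.natAdd f.deg (σ i) = _ by simp [Equiv.permCongr_apply]))
      exact (comp_fst_natAdd f g (σ i)).symm
  · refine Fin.addCases (fun i => ?_) (fun i => ?_)
    · refine (comp_snd_castAdd f (permute g σ) i).trans ?_
      refine Eq.trans ?_ (congrArg (fun j => (comp f g).snd (Sum.inr j))
        (show Fin.castAdd g.deg i = _ by simp [Equiv.permCongr_apply, permute]))
      exact (comp_snd_castAdd f g i).symm
    · refine (comp_snd_natAdd f (permute g σ) i).trans ?_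
      refine Eq.trans ?_ (congrArg (fun j => (comp f g).snd (Sum.inr j))
        (show Fin.natAdd f.deg (σ i) = _ by simp [Equiv.permCongr_apply]))
      exact (comp_snd_natAdd f g (σ i)).symm

lemma ofIso_comp {Z W V : FB2} (f : Z ⟶ W) (g : W ⟶ V) :
    comp (ofIso f) (ofIso g) = ofIso (f ≫ g) :=
  ext' rfl (fun _ => rfl) (fun _ => rfl) (fun i => (i : Fin 0).elim0) (fun i => (i : Fin 0).elim0)

end Hom

instance : Category UwbOrd where
  Hom := Hom
  id Z := Hom.ofIso (𝟙 Z.pair)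
  comp := Hom.comp
  id_comp f := by
    refine Hom.ext' (Nat.zero_add _) (fun _ => rfl) (fun _ => rfl) ?_ ?_
    · refine Fin.addCases (fun i => i.elim0) (fun i => ?_)
      rw [Hom.comp_fst_natAdd]
      exact congrArg (fun j => f.fst (Sum.inr j)) (by ext; simp [Hom.ofIso])
    · refine Fin.addCases (fun i => i.elim0) (fun i => ?_)
      rw [Hom.comp_snd_natAdd]
      exact congrArg (fun j => f.snd (Sum.inr j)) (by ext; simp [Hom.ofIso])
  comp_id f := by
    refine Hom.ext' (Nat.add_zero _) (fun _ => rfl) (fun _ => rfl) ?_ ?_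
    · refine Fin.addCases (fun i => ?_) (fun i => i.elim0)
      rw [Hom.comp_fst_castAdd]
      rfl
    · refine Fin.addCases (fun i => ?_) (fun i => i.elim0)
      rw [Hom.comp_snd_castAdd]
      rfl
  assoc f g h := by
    refine Hom.ext' (Nat.add_assoc _ _ _) (fun _ => rfl) (fun _ => rfl) ?_ ?_
    · refine Fin.addCases (Fin.addCases (fun i => ?_) (fun i => ?_)) (fun i => ?_)
      · rw [Hom.comp_fst_natAdd]
        refine Eq.trans ?_ (congrArg (fun j => (Hom.comp f (Hom.comp g h)).fst (Sum.inr j))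
          (show Fin.natAdd f.deg (Fin.natAdd g.deg i) = _ by
            ext; simp [Hom.comp, Nat.add_assoc]))
        refine ((Hom.comp_fst_natAdd f (Hom.comp g h) (Fin.natAdd g.deg i)).trans ?_).symm
        rw [Hom.comp_fst_natAdd]
      · rw [Hom.comp_fst_castAdd, Hom.comp_fst_castAdd]
        exact (Hom.comp_fst_castAdd f (Hom.comp g h) i).symm
      · rw [Hom.comp_fst_castAdd, Hom.comp_fst_natAdd]
        refine ((Hom.comp_fst_natAdd f (Hom.comp g h) (Fin.castAdd h.deg i)).trans ?_).symm
        rw [Hom.comp_fst_castAdd]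
    · refine Fin.addCases (Fin.addCases (fun i => ?_) (fun i => ?_)) (fun i => ?_)
      · rw [Hom.comp_snd_natAdd]
        refine Eq.trans ?_ (congrArg (fun j => (Hom.comp f (Hom.comp g h)).snd (Sum.inr j))
          (show Fin.natAdd f.deg (Fin.natAdd g.deg i) = _ by
            ext; simp [Hom.comp, Nat.add_assoc]))
        refine ((Hom.comp_snd_natAdd f (Hom.comp g h) (Fin.natAdd g.deg i)).trans ?_).symm
        rw [Hom.comp_snd_natAdd]
      · rw [Hom.comp_snd_castAdd, Hom.comp_snd_castAdd]
        exact (Hom.comp_snd_castAdd f (Hom.comp g h) i).symm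
      · rw [Hom.comp_snd_castAdd, Hom.comp_snd_natAdd]
        refine ((Hom.comp_snd_natAdd f (Hom.comp g h) (Fin.castAdd h.deg i)).trans ?_).symm
        rw [Hom.comp_snd_castAdd]

end UwbOrd

section Twisted
variable (k : Type u) [Field k]

/-- A morphism of `uwb^ord` as a morphism of `k uwb^ord`. -/
def arrow {Z W : Free k UwbOrd} (f : UwbOrd.Hom Z W) : Z ⟶ W :=
  (Free.embedding k UwbOrd).map (X := Z) (Y := W) f

lemma arrow_comp {Z W V : Free k UwbOrd} (f : UwbOrd.Hom Z W) (g : UwbOrd.Hom W V) :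
    arrow k f ≫ arrow k g = arrow k (UwbOrd.Hom.comp f g) :=
  ((Free.embedding k UwbOrd).map_comp (X := Z) (Y := W) (Z := V) f g).symm

/-- The submodule of `k uwb^ord (Z, W)` spanned by the `f ∘ σ - sgn(σ) f`. -/
def twistSub (Z W : Free k UwbOrd) : Submodule k (Z ⟶ W) :=
  Submodule.span k {t | ∃ (f : UwbOrd.Hom Z W) (σ : Equiv.Perm (Fin f.deg)),
    t = arrow k (UwbOrd.Hom.permute f σ) -
      ((σ.sign : ℤˣ) : ℤ) • arrow k f}

lemma free_induction {Z W : Free k UwbOrd} (P : (Z ⟶ W) → Prop)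
    (h0 : P 0) (hadd : ∀ s t, P s → P t → P (s + t)) (hsmul : ∀ (a : k) s, P s → P (a • s))
    (hof : ∀ f : UwbOrd.Hom Z W, P (arrow k f)) (t) : P t := by
  refine Finsupp.induction_linear (motive := P) t h0 (fun s t => hadd s t) fun f a => ?_
  have := hsmul a _ (hof f)
  convert! this using 1
  exact (Finsupp.smul_single_one f a).symm

lemma twistSub_comp {Z W V : Free k UwbOrd} (s : Z ⟶ W) (t : W ⟶ V) (hs : s ∈ twistSub k Z W) : s ≫ t ∈ twistSub k Z V := by
  refine Submodule.span_induction ?_ ?_ ?_ ?_ hs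
  · rintro _ ⟨f, σ, rfl⟩
    refine free_induction k (fun t => _ ≫ t ∈ twistSub k Z V) ?_ ?_ ?_ ?_ t
    · rw [Limits.comp_zero]; exact zero_mem _
    · intro a b ha hb
      rw [Preadditive.comp_add]; exact add_mem ha hb
    · intro a b hb
      rw [Linear.comp_smul]; exact Submodule.smul_mem _ _ hb
    · intro g
      rw [Preadditive.sub_comp, Preadditive.zsmul_comp, arrow_comp, arrow_comp]
      refine Submodule.subset_span ⟨UwbOrd.Hom.comp f g,
        finSumFinEquiv.permCongr (σ.sumCongr (Equiv.refl (Fin g.deg))), ?_⟩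
      rw [← UwbOrd.Hom.permute_comp f g σ, Equiv.Perm.sign_permCongr, Equiv.Perm.sign_sumCongr,
        Equiv.Perm.sign_refl, mul_one]
  · rw [Limits.zero_comp]; exact zero_mem _
  · intro a b _ _ ha hb
    rw [Preadditive.add_comp]; exact add_mem ha hb
  · intro a b _ hb
    rw [Linear.smul_comp]; exact Submodule.smul_mem _ _ hb

lemma comp_twistSub {Z W V : Free k UwbOrd} (s : Z ⟶ W) (t : W ⟶ V) (ht : t ∈ twistSub k W V) : s ≫ t ∈ twistSub k Z V := by
  refine Submodule.span_induction ?_ ?_ ?_ ?_ ht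
  · rintro _ ⟨g, σ, rfl⟩
    refine free_induction k (fun s => s ≫ _ ∈ twistSub k Z V) ?_ ?_ ?_ ?_ s
    · rw [Limits.zero_comp]; exact zero_mem _
    · intro a b ha hb
      rw [Preadditive.add_comp]; exact add_mem ha hb
    · intro a b hb
      rw [Linear.smul_comp]; exact Submodule.smul_mem _ _ hb
    · intro f
      rw [Preadditive.comp_sub, Preadditive.comp_zsmul, arrow_comp, arrow_comp]
      refine Submodule.subset_span ⟨UwbOrd.Hom.comp f g,
        finSumFinEquiv.permCongr ((Equiv.refl (Fin f.deg)).sumCongr σ), ?_⟩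
      rw [← UwbOrd.Hom.comp_permute f g σ, Equiv.Perm.sign_permCongr, Equiv.Perm.sign_sumCongr,
        Equiv.Perm.sign_refl, one_mul]
  · rw [Limits.comp_zero]; exact zero_mem _
  · intro a b _ _ ha hb
    rw [Preadditive.comp_add]; exact add_mem ha hb
  · intro a b _ hb
    rw [Linear.comp_smul]; exact Submodule.smul_mem _ _ hb

def twistRel : HomRel (Free k UwbOrd) := fun Z W s t => s - t ∈ twistSub k Z W

instance : Congruence (twistRel k) where
  equivalence :=
    { refl := fun s => by simp [twistRel]
      symm := fun {s t} h => by
        have := neg_mem h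
        rwa [neg_sub] at this
      trans := fun {s t r} h h' => by
        have := add_mem h h'
        rwa [sub_add_sub_cancel] at this }
  comp_left f g g' h := by
    have := comp_twistSub k f (g - g') h
    rwa [Preadditive.comp_sub] at this
  comp_right g h := by
    have := twistSub_comp k _ g h
    rwa [Preadditive.sub_comp] at this

/-- `(k uwb)_-`: its morphisms of degree `n` are `k[uwb^ord(-, -)_n] ⊗_{S_n} sgn`. -/
abbrev KUwbTw := Quotient (twistRel k)

instance : Preadditive (KUwbTw k) :=
  Quotient.preadditive _ fun _ _ f₁ f₂ g₁ g₂ hf hg => by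
    have := add_mem hf hg
    rwa [sub_add_sub_comm] at this

instance : (Quotient.functor (twistRel k)).Additive := Quotient.functor_additive _ _

instance : Linear k (KUwbTw k) :=
  Quotient.linear k _ fun a _ _ f₁ f₂ h => by
    have := Submodule.smul_mem _ a h
    rwa [smul_sub] at this

instance linearOpposite (C : Type*) [Category* C] [Preadditive C] [Linear k C] :
    Linear k Cᵒᵖ where
  homModule _ _ :=
    { smul := fun a f => (a • f.unop).op
      one_smul := fun f => Quiver.Hom.unop_inj (one_smul k f.unop)
      mul_smul := fun a b f => Quiver.Hom.unop_inj (mul_smul a b f.unop)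
      smul_zero := fun a => Quiver.Hom.unop_inj (smul_zero a)
      smul_add := fun a f g => Quiver.Hom.unop_inj (smul_add a f.unop g.unop)
      add_smul := fun a b f => Quiver.Hom.unop_inj (add_smul a b f.unop)
      zero_smul := fun f => Quiver.Hom.unop_inj (zero_smul k f.unop) }
  smul_comp _ _ _ a f g := Quiver.Hom.unop_inj (Linear.comp_smul _ _ _ g.unop a f.unop)
  comp_smul _ _ _ f a g := Quiver.Hom.unop_inj (Linear.smul_comp _ _ _ a g.unop f.unop)

/-- `(k dwb)_-`, the opposite of `(k uwb)_-`. -/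
abbrev KDwbTw := (KUwbTw k)ᵒᵖ

/-- `(k dwb)_-`-modules: `k`-linear functors to `k`-vector spaces. -/
abbrev KDwbTwMod := ObjectProperty.FullSubcategory
  (fun F : KDwbTw k ⥤ ModuleCat.{u} k => F.Additive ∧ F.Linear k)

def uwbOrdToTw : UwbOrd ⥤ KUwbTw k := Free.embedding k UwbOrd ⋙ Quotient.functor (twistRel k)

/-- `FB × FB → (k dwb)_-`, through inversion of bijections. -/
def fb2ToKDwbTw : FB2 ⥤ KDwbTw k where
  obj Z := op ((uwbOrdToTw k).obj ⟨Z⟩)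
  map {Z W} f := ((uwbOrdToTw k).map (X := ⟨W⟩) (Y := ⟨Z⟩)
    (UwbOrd.Hom.ofIso ⟨f.fst.symm, f.snd.symm⟩)).op
  map_id Z := by
    apply Quiver.Hom.unop_inj
    exact (uwbOrdToTw k).map_id _
  map_comp f g := by
    apply Quiver.Hom.unop_inj
    refine Eq.trans ?_ ((uwbOrdToTw k).map_comp _ _)
    exact congrArg (fun h : UwbOrd.Hom _ _ => (uwbOrdToTw k).map h)
      (UwbOrd.Hom.ofIso_comp ⟨g.fst.symm, g.snd.symm⟩ ⟨f.fst.symm, f.snd.symm⟩).symm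

end Twisted

section Constructions

variable {k : Type u} [Field k]

/-- The quotient of an `FB × FB`-module by a submodule. -/
def quotFun (F : FBMod k) (N : ∀ Z, Submodule k (F.obj Z))
    (hN : ∀ {Z W : FB2} (f : Z ⟶ W), N Z ≤ (N W).comap (F.map f).hom) : FBMod k where
  obj Z := ModuleCat.of k (F.obj Z ⧸ N Z)
  map {Z W} f := ModuleCat.ofHom (Submodule.mapQ (N Z) (N W) (F.map f).hom (hN f))
  map_id Z := by
    apply ModuleCat.hom_ext
    apply Submodule.linearMap_qext
    ext x
    exact congrArg (fun f => (N Z).mkQ (f.hom x)) (F.map_id Z)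
  map_comp {Z W V} f g := by
    apply ModuleCat.hom_ext
    apply Submodule.linearMap_qext
    ext x
    exact congrArg (fun f => (N V).mkQ (f.hom x)) (F.map_comp f g)

/-- The map induced on quotients. -/
def quotFunMap {F G : FBMod k} {N : ∀ Z, Submodule k (F.obj Z)}
    {hN : ∀ {Z W : FB2} (f : Z ⟶ W), N Z ≤ (N W).comap (F.map f).hom}
    {P : ∀ Z, Submodule k (G.obj Z)}
    {hP : ∀ {Z W : FB2} (f : Z ⟶ W), P Z ≤ (P W).comap (G.map f).hom}
    (η : F ⟶ G) (hη : ∀ Z, N Z ≤ (P Z).comap (η.app Z).hom) :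
    quotFun F N hN ⟶ quotFun G P hP where
  app Z := ModuleCat.ofHom (Submodule.mapQ (N Z) (P Z) (η.app Z).hom (hη Z))
  naturality {Z W} f := by
    apply ModuleCat.hom_ext
    apply Submodule.linearMap_qext
    ext x
    exact congrArg (fun f => (P W).mkQ (f.hom x)) (η.naturality f)

/-- The direct sum of a sequence of `FB × FB`-modules. -/
def sumFun (F : ℕ → FBMod k) : FBMod k where
  obj Z := ModuleCat.of k (⨁ d, (F d).obj Z)
  map {Z W} f := ModuleCat.ofHom (DirectSum.lmap fun d => ((F d).map f).hom)
  map_id Z := by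
    apply ModuleCat.hom_ext
    apply DirectSum.linearMap_ext
    intro d
    apply LinearMap.ext
    intro x
    refine (DirectSum.lmap_lof (fun d => ((F d).map (𝟙 Z)).hom) d x).trans ?_
    exact congrArg (fun f => DirectSum.lof k ℕ (fun d => (F d).obj Z) d (f.hom x)) ((F d).map_id Z)
  map_comp {Z W V} f g := by
    apply ModuleCat.hom_ext
    apply DirectSum.linearMap_ext
    intro d
    apply LinearMap.ext
    intro x
    refine (DirectSum.lmap_lof (fun d => ((F d).map (f ≫ g)).hom) d x).trans ?_
    refine (congrArg (fun f => DirectSum.lof k ℕ (fun d => (F d).obj V) d (f.hom x))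
      ((F d).map_comp f g)).trans ?_
    symm
    refine (congrArg (DirectSum.lmap fun d => ((F d).map g).hom)
      (DirectSum.lmap_lof (fun d => ((F d).map f).hom) d x)).trans ?_
    exact DirectSum.lmap_lof _ d _

/-- The map induced on direct sums. -/
def sumFunMap {F G : ℕ → FBMod k} (η : ∀ d, F d ⟶ G d) : sumFun F ⟶ sumFun G where
  app Z := ModuleCat.ofHom (DirectSum.lmap fun d => ((η d).app Z).hom)
  naturality {Z W} f := by
    apply ModuleCat.hom_ext
    apply DirectSum.linearMap_ext
    intro d
    apply LinearMap.ext
    intro x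
    refine (congrArg (DirectSum.lmap fun d => ((η d).app W).hom)
      (DirectSum.lmap_lof (fun d => ((F d).map f).hom) d x)).trans ?_
    refine (DirectSum.lmap_lof _ d _).trans ?_
    symm
    refine (congrArg (DirectSum.lmap fun d => ((G d).map f).hom)
      (DirectSum.lmap_lof (fun d => ((η d).app Z).hom) d x)).trans ?_
    refine (DirectSum.lmap_lof _ d _).trans ?_
    exact congrArg (fun f => DirectSum.lof k ℕ (fun d => (G d).obj W) d (f.hom x))
      ((η d).naturality f).symm

/-! The Day convolution product. -/

abbrev DayObj (F G : FBMod k) (Z : FB2) : Type u :=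
  ⨁ c : Coloring Z Bool, F.obj (c.part false) ⊗[k] G.obj (c.part true)

def dayIncl (F G : FBMod k) {Z : FB2} (c : Coloring Z Bool) :
    F.obj (c.part false) ⊗[k] G.obj (c.part true) →ₗ[k] DayObj F G Z :=
  DirectSum.lof k _ (fun c : Coloring Z Bool => F.obj (c.part false) ⊗[k] G.obj (c.part true)) c

def dayDesc {F G : FBMod k} {Z : FB2} {M : Type u} [AddCommGroup M] [Module k M]
    (φ : ∀ c : Coloring Z Bool, F.obj (c.part false) ⊗[k] G.obj (c.part true) →ₗ[k] M) :
    DayObj F G Z →ₗ[k] M := DirectSum.toModule k _ _ φ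

lemma dayDesc_incl {F G : FBMod k} {Z : FB2} {M : Type u} [AddCommGroup M] [Module k M]
    (φ : ∀ c : Coloring Z Bool, F.obj (c.part false) ⊗[k] G.obj (c.part true) →ₗ[k] M)
    (c : Coloring Z Bool) (t) : dayDesc φ (dayIncl F G c t) = φ c t :=
  DirectSum.toModule_lof _ _ _

lemma day_ext {F G : FBMod k} {Z : FB2} {M : Type u} [AddCommGroup M] [Module k M]
    {f g : DayObj F G Z →ₗ[k] M}
    (h : ∀ c a b, f (dayIncl F G c (a ⊗ₜ[k] b)) = g (dayIncl F G c (a ⊗ₜ[k] b))) : f = g :=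
  DirectSum.linearMap_ext _ fun c => TensorProduct.ext' fun a b => h c a b

def dayTransport (F G : FBMod k) {Z W : FB2} (f : Z ⟶ W) : DayObj F G Z →ₗ[k] DayObj F G W :=
  dayDesc fun c => dayIncl F G (c.push f) ∘ₗ
    TensorProduct.map (F.map (c.partHom f false)).hom (G.map (c.partHom f true)).hom

lemma dayTransport_incl (F G : FBMod k) {Z W : FB2} (f : Z ⟶ W) (c : Coloring Z Bool) (a b) :
    dayTransport F G f (dayIncl F G c (a ⊗ₜ[k] b)) =
      dayIncl F G (c.push f) ((F.map (c.partHom f false)).hom a ⊗ₜ[k]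
        (G.map (c.partHom f true)).hom b) := by
  rw [dayTransport, dayDesc_incl]; rfl

/-- `F ⊛ G` -/
def dayConv (F G : FBMod k) : FBMod k where
  obj Z := ModuleCat.of k (DayObj F G Z)
  map {Z W} f := ModuleCat.ofHom (dayTransport F G f)
  map_id Z := by
    apply ModuleCat.hom_ext
    refine day_ext fun c a b => ?_
    refine (dayTransport_incl F G (𝟙 Z) c a b).trans ?_
    exact congrArg₂ (fun f g => dayIncl F G c (f.hom a ⊗ₜ[k] g.hom b)) (F.map_id (c.part false))
      (G.map_id (c.part true))
  map_comp {Z W V} f g := by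
    apply ModuleCat.hom_ext
    refine day_ext fun c a b => ?_
    refine (dayTransport_incl F G (f ≫ g) c a b).trans ?_
    refine (congrArg₂ (fun f' g' => dayIncl F G (c.push (f ≫ g)) (f'.hom a ⊗ₜ[k] g'.hom b))
      (F.map_comp (c.partHom f false) ((c.push f).partHom g false))
      (G.map_comp (c.partHom f true) ((c.push f).partHom g true))).trans ?_
    symm
    refine (congrArg (dayTransport F G g) (dayTransport_incl F G f c a b)).trans ?_
    exact dayTransport_incl F G g (c.push f) _ _

def dayApp {F G F' G' : FBMod k} (η : F ⟶ F') (θ : G ⟶ G') (Z : FB2) :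
    DayObj F G Z →ₗ[k] DayObj F' G' Z :=
  dayDesc fun c => dayIncl F' G' c ∘ₗ
    TensorProduct.map (η.app (c.part false)).hom (θ.app (c.part true)).hom

lemma dayApp_incl {F G F' G' : FBMod k} (η : F ⟶ F') (θ : G ⟶ G') {Z : FB2}
    (c : Coloring Z Bool) (a b) :
    dayApp η θ Z (dayIncl F G c (a ⊗ₜ[k] b)) =
      dayIncl F' G' c ((η.app (c.part false)).hom a ⊗ₜ[k] (θ.app (c.part true)).hom b) := by
  rw [dayApp, dayDesc_incl]; rfl

def dayConvMap {F G F' G' : FBMod k} (η : F ⟶ F') (θ : G ⟶ G') : dayConv F G ⟶ dayConv F' G' where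
  app Z := ModuleCat.ofHom (dayApp η θ Z)
  naturality {Z W} f := by
    apply ModuleCat.hom_ext
    refine day_ext fun c a b => ?_
    refine (congrArg (dayApp η θ W) (dayTransport_incl F G f c a b)).trans ?_
    refine (dayApp_incl η θ (c.push f) _ _).trans ?_
    symm
    refine (congrArg (dayTransport F' G' f) (dayApp_incl η θ c a b)).trans ?_
    refine (dayTransport_incl F' G' f c _ _).trans ?_
    refine congrArg (dayIncl F' G' (c.push f)) ?_
    exact congrArg₂ (fun f g => f.hom a ⊗ₜ[k] g.hom b) (η.naturality (c.partHom f false)).symm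
      (θ.naturality (c.partHom f true)).symm

def inlSub {A B : Type} {P : A ⊕ B → Prop} {p : A → Prop} (h1 : ∀ a, p a ↔ P (Sum.inl a))
    (h2 : ∀ b, ¬ P (Sum.inr b)) : {a // p a} ≃ {x // P x} where
  toFun a := ⟨Sum.inl a.1, (h1 a.1).1 a.2⟩
  invFun x := match x with
    | ⟨Sum.inl a, h⟩ => ⟨a, (h1 a).2 h⟩
    | ⟨Sum.inr b, h⟩ => (h2 b h).elim
  left_inv _ := rfl
  right_inv x := match x with
    | ⟨Sum.inl _, _⟩ => rfl
    | ⟨Sum.inr b, h⟩ => (h2 b h).elim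

def inlAll {A B : Type} {P : A ⊕ B → Prop} (h1 : ∀ a, P (Sum.inl a))
    (h2 : ∀ b, ¬ P (Sum.inr b)) : A ≃ {x // P x} where
  toFun a := ⟨Sum.inl a, h1 a⟩
  invFun x := match x with
    | ⟨Sum.inl a, _⟩ => a
    | ⟨Sum.inr b, h⟩ => (h2 b h).elim
  left_inv _ := rfl
  right_inv x := match x with
    | ⟨Sum.inl _, _⟩ => rfl
    | ⟨Sum.inr b, h⟩ => (h2 b h).elim

def inrAll {A B : Type} {P : A ⊕ B → Prop} (h1 : ∀ a, ¬ P (Sum.inl a))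
    (h2 : ∀ b, P (Sum.inr b)) : B ≃ {x // P x} where
  toFun b := ⟨Sum.inr b, h2 b⟩
  invFun x := match x with
    | ⟨Sum.inl a, h⟩ => (h1 a h).elim
    | ⟨Sum.inr b, _⟩ => b
  left_inv _ := rfl
  right_inv x := match x with
    | ⟨Sum.inl a, h⟩ => (h1 a h).elim
    | ⟨Sum.inr _, _⟩ => rfl

/-- The external product `F(A, A') ⊗ G(B, B') → (F ⊛ G)(A ⊔ B, A' ⊔ B')`. -/
def dayMk {F G : FBMod k} {A A' B B' : Type} [Finite A] [Finite A'] [Finite B] [Finite B'] :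
    val F A A' →ₗ[k] val G B B' →ₗ[k] val (dayConv F G) (A ⊕ B) (A' ⊕ B') :=
  let c : Coloring ⟨A ⊕ B, A' ⊕ B'⟩ Bool := ⟨Sum.isRight, Sum.isRight⟩
  (TensorProduct.mk k _ _).compr₂ (dayIncl F G c ∘ₗ TensorProduct.map
    (F.map (X := ⟨A, A'⟩) (Y := c.part false)
      ⟨inlAll (fun _ => rfl) (fun _ h => Bool.noConfusion h),
        inlAll (fun _ => rfl) (fun _ h => Bool.noConfusion h)⟩).hom
    (G.map (X := ⟨B, B'⟩) (Y := c.part true)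
      ⟨inrAll (fun _ h => Bool.noConfusion h) (fun _ => rfl),
        inrAll (fun _ h => Bool.noConfusion h) (fun _ => rfl)⟩).hom)

/-! Tensor powers and the functors `S*`, `Λ*`. -/

abbrev PowObj (F : FBMod k) (d : ℕ) (Z : FB2) : Type u :=
  ⨁ c : Coloring Z (Fin d), ⨂[k] i, F.obj (c.part i)

def powIncl (F : FBMod k) {d : ℕ} {Z : FB2} (c : Coloring Z (Fin d)) :
    (⨂[k] i, F.obj (c.part i)) →ₗ[k] PowObj F d Z :=
  DirectSum.lof k _ (fun c : Coloring Z (Fin d) => ⨂[k] i, F.obj (c.part i)) c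

def powDesc {F : FBMod k} {d : ℕ} {Z : FB2} {M : Type u} [AddCommGroup M] [Module k M]
    (φ : ∀ c : Coloring Z (Fin d), (⨂[k] i, F.obj (c.part i)) →ₗ[k] M) :
    PowObj F d Z →ₗ[k] M := DirectSum.toModule k _ _ φ

lemma powDesc_incl {F : FBMod k} {d : ℕ} {Z : FB2} {M : Type u} [AddCommGroup M] [Module k M]
    (φ : ∀ c : Coloring Z (Fin d), (⨂[k] i, F.obj (c.part i)) →ₗ[k] M)
    (c : Coloring Z (Fin d)) (t) : powDesc φ (powIncl F c t) = φ c t :=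
  DirectSum.toModule_lof _ _ _

lemma pow_ext {F : FBMod k} {d : ℕ} {Z : FB2} {M : Type u} [AddCommGroup M] [Module k M]
    {f g : PowObj F d Z →ₗ[k] M}
    (h : ∀ c x, f (powIncl F c (PiTensorProduct.tprod k x)) =
      g (powIncl F c (PiTensorProduct.tprod k x))) : f = g :=
  DirectSum.linearMap_ext _ fun c => PiTensorProduct.ext (MultilinearMap.ext fun x => h c x)

def powTransport (F : FBMod k) (d : ℕ) {Z W : FB2} (f : Z ⟶ W) : PowObj F d Z →ₗ[k] PowObj F d W :=
  powDesc fun c => powIncl F (c.push f) ∘ₗ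
    PiTensorProduct.map fun i => (F.map (c.partHom f i)).hom

lemma powTransport_incl (F : FBMod k) {d : ℕ} {Z W : FB2} (f : Z ⟶ W)
    (c : Coloring Z (Fin d)) (x) :
    powTransport F d f (powIncl F c (PiTensorProduct.tprod k x)) =
      powIncl F (c.push f) (PiTensorProduct.tprod k fun i => (F.map (c.partHom f i)).hom (x i)) := by
  rw [powTransport, powDesc_incl]
  exact congrArg (powIncl F (c.push f)) (PiTensorProduct.map_tprod _ _)

/-- `F^{⊛ d}` -/
def convPow (F : FBMod k) (d : ℕ) : FBMod k where
  obj Z := ModuleCat.of k (PowObj F d Z)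
  map {Z W} f := ModuleCat.ofHom (powTransport F d f)
  map_id Z := by
    apply ModuleCat.hom_ext
    refine pow_ext fun c x => ?_
    refine (powTransport_incl F (𝟙 Z) c x).trans ?_
    refine congrArg (fun y => powIncl F c (PiTensorProduct.tprod k y)) (funext fun i => ?_)
    exact congrArg (fun f => f.hom (x i)) (F.map_id (c.part i))
  map_comp {Z W V} f g := by
    apply ModuleCat.hom_ext
    refine pow_ext fun c x => ?_
    refine (powTransport_incl F (f ≫ g) c x).trans ?_
    symm
    refine (congrArg (powTransport F d g) (powTransport_incl F f c x)).trans ?_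
    refine (powTransport_incl F g (c.push f) _).trans ?_
    refine congrArg (fun y => powIncl F ((c.push f).push g) (PiTensorProduct.tprod k y))
      (funext fun i => ?_)
    exact (congrArg (fun f => f.hom (x i))
      (F.map_comp (c.partHom f i) ((c.push f).partHom g i))).symm

def powApp {F G : FBMod k} (η : F ⟶ G) (d : ℕ) (Z : FB2) : PowObj F d Z →ₗ[k] PowObj G d Z :=
  powDesc fun c => powIncl G c ∘ₗ PiTensorProduct.map fun i => (η.app (c.part i)).hom

lemma powApp_incl {F G : FBMod k} (η : F ⟶ G) {d : ℕ} {Z : FB2}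
    (c : Coloring Z (Fin d)) (x) :
    powApp η d Z (powIncl F c (PiTensorProduct.tprod k x)) =
      powIncl G c (PiTensorProduct.tprod k fun i => (η.app (c.part i)).hom (x i)) := by
  rw [powApp, powDesc_incl]
  exact congrArg (powIncl G c) (PiTensorProduct.map_tprod _ _)

def convPowMap {F G : FBMod k} (η : F ⟶ G) (d : ℕ) : convPow F d ⟶ convPow G d where
  app Z := ModuleCat.ofHom (powApp η d Z)
  naturality {Z W} f := by
    apply ModuleCat.hom_ext
    refine pow_ext fun c x => ?_
    refine (congrArg (powApp η d W) (powTransport_incl F f c x)).trans ?_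
    refine (powApp_incl η (c.push f) _).trans ?_
    symm
    refine (congrArg (powTransport G d f) (powApp_incl η c x)).trans ?_
    refine (powTransport_incl G f c _).trans ?_
    refine congrArg (fun y => powIncl G (c.push f) (PiTensorProduct.tprod k y))
      (funext fun i => ?_)
    exact (congrArg (fun f => f.hom (x i)) (η.naturality (c.partHom f i))).symm

/-- The place permutation action of `S_d` on `F^{⊛ d}`. -/
def powPerm (F : FBMod k) {d : ℕ} (σ : Equiv.Perm (Fin d)) (Z : FB2) :
    PowObj F d Z →ₗ[k] PowObj F d Z :=
  powDesc fun c => powIncl F (c.recolor σ) ∘ₗ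
    (PiTensorProduct.map fun i => (F.map (c.recolorHom σ i)).hom) ∘ₗ
    (PiTensorProduct.reindex k (fun i => F.obj (c.part i)) σ).toLinearMap

lemma powPerm_incl (F : FBMod k) {d : ℕ} (σ : Equiv.Perm (Fin d)) {Z : FB2}
    (c : Coloring Z (Fin d)) (x) :
    powPerm F σ Z (powIncl F c (PiTensorProduct.tprod k x)) =
      powIncl F (c.recolor σ) (PiTensorProduct.tprod k fun i =>
        (F.map (c.recolorHom σ i)).hom (x (σ.symm i))) := by
  rw [powPerm, powDesc_incl]
  refine congrArg (powIncl F (c.recolor σ)) ?_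
  refine (congrArg (fun t : ⨂[k] i, F.obj (c.part (σ.symm i)) =>
    PiTensorProduct.map (fun i => (F.map (c.recolorHom σ i)).hom) t)
    (PiTensorProduct.reindex_tprod (R := k) σ x)).trans ?_
  exact PiTensorProduct.map_tprod _ _

lemma powPerm_transport (F : FBMod k) {d : ℕ} (σ : Equiv.Perm (Fin d)) {Z W : FB2} (f : Z ⟶ W)
    (t : PowObj F d Z) :
    powTransport F d f (powPerm F σ Z t) = powPerm F σ W (powTransport F d f t) := by
  refine LinearMap.congr_fun (f := powTransport F d f ∘ₗ powPerm F σ Z)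
    (g := powPerm F σ W ∘ₗ powTransport F d f) (pow_ext fun c x => ?_) t
  refine (congrArg (powTransport F d f) (powPerm_incl F σ c x)).trans ?_
  refine (powTransport_incl F f (c.recolor σ) _).trans ?_
  symm
  refine (congrArg (powPerm F σ W) (powTransport_incl F f c x)).trans ?_
  refine (powPerm_incl F σ (c.push f) _).trans ?_
  refine congrArg (fun y => powIncl F ((c.recolor σ).push f) (PiTensorProduct.tprod k y))
    (funext fun i => ?_)
  refine (congrArg (fun f => f.hom (x (σ.symm i)))
    (F.map_comp (c.partHom f (σ.symm i)) ((c.push f).recolorHom σ i))).symm.trans ?_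
  exact (congrArg (fun f => f.hom (x (σ.symm i)))
    (F.map_comp (c.recolorHom σ i) ((c.recolor σ).partHom f i)))

lemma powPerm_app {F G : FBMod k} (η : F ⟶ G) {d : ℕ} (σ : Equiv.Perm (Fin d)) (Z : FB2)
    (t : PowObj F d Z) : powApp η d Z (powPerm F σ Z t) = powPerm G σ Z (powApp η d Z t) := by
  refine LinearMap.congr_fun (f := powApp η d Z ∘ₗ powPerm F σ Z)
    (g := powPerm G σ Z ∘ₗ powApp η d Z) (pow_ext fun c x => ?_) t
  refine (congrArg (powApp η d Z) (powPerm_incl F σ c x)).trans ?_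
  refine (powApp_incl η (c.recolor σ) _).trans ?_
  symm
  refine (congrArg (powPerm G σ Z) (powApp_incl η c x)).trans ?_
  refine (powPerm_incl G σ c _).trans ?_
  refine congrArg (fun y => powIncl G (c.recolor σ) (PiTensorProduct.tprod k y))
    (funext fun i => ?_)
  exact (congrArg (fun f => f.hom (x (σ.symm i))) (η.naturality (c.recolorHom σ i))).symm

/-- A family of characters `S_d → {±1}`: either trivial (for `S*`) or the signature (for `Λ*`). -/
def character : Bool → ∀ d : ℕ, Equiv.Perm (Fin d) →* ℤˣ
  | false => fun _ => 1
  | true => fun _ => Equiv.Perm.sign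

/-- The span of the elements `σ x - χ(σ) x`, where `χ` is trivial or the signature. -/
def symSub (s : Bool) (F : FBMod k) (d : ℕ) (Z : FB2) : Submodule k ((convPow F d).obj Z) :=
  Submodule.span k {t | ∃ (σ : Equiv.Perm (Fin d)) (x : PowObj F d Z),
    t = powPerm F σ Z x - ((character s d σ : ℤˣ) : ℤ) • x}

lemma symSub_transport (s : Bool) (F : FBMod k) (d : ℕ) {Z W : FB2} (f : Z ⟶ W) :
    symSub s F d Z ≤ (symSub s F d W).comap ((convPow F d).map f).hom := by
  refine Submodule.span_le.2 ?_
  rintro _ ⟨σ, x, rfl⟩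
  refine Submodule.subset_span ⟨σ, powTransport F d f x, ?_⟩
  rw [← powPerm_transport]
  exact (map_sub _ _ _).trans (congrArg _ (map_zsmul (powTransport F d f) _ x))

/-- `(F^{⊛ d})_{S_d}` for `s = false` and `(F^{⊛ d} ⊗ sgn)_{S_d}` for `s = true`. -/
def symPow (s : Bool) (F : FBMod k) (d : ℕ) : FBMod k :=
  quotFun (convPow F d) (symSub s F d) (symSub_transport s F d)

def symPowMap (s : Bool) {F G : FBMod k} (η : F ⟶ G) (d : ℕ) : symPow s F d ⟶ symPow s G d :=
  quotFunMap (convPowMap η d) fun Z => by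
    refine Submodule.span_le.2 ?_
    rintro _ ⟨σ, x, rfl⟩
    refine Submodule.subset_span ⟨σ, powApp η d Z x, ?_⟩
    rw [← powPerm_app]
    exact (map_sub _ _ _).trans (congrArg _ (map_zsmul (powApp η d Z) _ x))

def symTot (s : Bool) (F : FBMod k) : FBMod k := sumFun (symPow s F)

def symTotMap (s : Bool) {F G : FBMod k} (η : F ⟶ G) : symTot s F ⟶ symTot s G :=
  sumFunMap (symPowMap s η)

/-- The class in `S*` or `Λ*` of an element of `F^{⊛ d}`. -/
def cls (s : Bool) {F : FBMod k} {d : ℕ} {Z : FB2} : (convPow F d).obj Z →ₗ[k] (symTot s F).obj Z :=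
  DirectSum.lof k ℕ (fun d => (symPow s F d).obj Z) d ∘ₗ (symSub s F d Z).mkQ

lemma symTot_ext {s : Bool} {F : FBMod k} {Z : FB2} {M : Type u} [AddCommGroup M] [Module k M]
    {f g : (symTot s F).obj Z →ₗ[k] M}
    (h : ∀ d (x : PowObj F d Z), f (cls s x) = g (cls s x)) : f = g :=
  DirectSum.linearMap_ext _ fun d => Submodule.linearMap_qext _ (LinearMap.ext fun x => h d x)

lemma symTotMap_cls (s : Bool) {F G : FBMod k} (η : F ⟶ G) {d : ℕ} {Z : FB2} (x : PowObj F d Z) :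
    ((symTotMap s η).app Z).hom (cls s x) = cls s (powApp η d Z x) :=
  DirectSum.lmap_lof (fun d => ((symPowMap s η d).app Z).hom) d _

lemma symTot_map_cls (s : Bool) (F : FBMod k) {d : ℕ} {Z W : FB2} (f : Z ⟶ W) (x : PowObj F d Z) :
    ((symTot s F).map f).hom (cls s x) = cls s (powTransport F d f x) :=
  DirectSum.lmap_lof (fun d => ((symPow s F d).map f).hom) d _

lemma powApp_id (F : FBMod k) (d : ℕ) (Z : FB2) (x : PowObj F d Z) :
    powApp (𝟙 F) d Z x = x := by
  refine LinearMap.congr_fun (g := LinearMap.id) (pow_ext fun c x => ?_) x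
  exact powApp_incl (𝟙 F) c x

lemma powApp_comp {F G H : FBMod k} (η : F ⟶ G) (θ : G ⟶ H) (d : ℕ) (Z : FB2)
    (x : PowObj F d Z) : powApp (η ≫ θ) d Z x = powApp θ d Z (powApp η d Z x) := by
  refine LinearMap.congr_fun (g := powApp θ d Z ∘ₗ powApp η d Z) (pow_ext fun c x => ?_) x
  refine (powApp_incl (η ≫ θ) c x).trans ?_
  symm
  refine (congrArg (powApp θ d Z) (powApp_incl η c x)).trans ?_
  exact powApp_incl θ c _

/-- `S*` for `s = false`, `Λ*` for `s = true`, as functors. -/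
def symFunctor (k : Type u) [Field k] (s : Bool) : FBMod k ⥤ FBMod k where
  obj F := symTot s F
  map η := symTotMap s η
  map_id F := by
    apply NatTrans.ext
    funext Z
    apply ModuleCat.hom_ext
    refine symTot_ext fun d x => ?_
    exact (symTotMap_cls s (𝟙 F) x).trans (congrArg (cls s) (powApp_id F d Z x))
  map_comp η θ := by
    apply NatTrans.ext
    funext Z
    apply ModuleCat.hom_ext
    refine symTot_ext fun d x => ?_
    refine (symTotMap_cls s (η ≫ θ) x).trans ?_
    symm
    refine (congrArg ((symTotMap s θ).app Z).hom (symTotMap_cls s η x)).trans ?_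
    refine (symTotMap_cls s θ _).trans ?_
    exact congrArg (cls s) (powApp_comp η θ d Z x).symm

abbrev SStar (k : Type u) [Field k] : FBMod k ⥤ FBMod k := symFunctor k false

abbrev LambdaStar (k : Type u) [Field k] : FBMod k ⥤ FBMod k := symFunctor k true

lemma dayConvMap_id (F G : FBMod k) : dayConvMap (𝟙 F) (𝟙 G) = 𝟙 (dayConv F G) := by
  apply NatTrans.ext
  funext Z
  apply ModuleCat.hom_ext
  refine day_ext fun c a b => ?_
  exact dayApp_incl (𝟙 F) (𝟙 G) c a b

lemma dayConvMap_comp {F G F' G' F'' G'' : FBMod k} (η : F ⟶ F') (θ : G ⟶ G')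
    (η' : F' ⟶ F'') (θ' : G' ⟶ G'') :
    dayConvMap (η ≫ η') (θ ≫ θ') = dayConvMap η θ ≫ dayConvMap η' θ' := by
  apply NatTrans.ext
  funext Z
  apply ModuleCat.hom_ext
  refine day_ext fun c a b => ?_
  refine (dayApp_incl (η ≫ η') (θ ≫ θ') c a b).trans ?_
  symm
  refine (congrArg (dayApp η' θ' Z) (dayApp_incl η θ c a b)).trans ?_
  exact dayApp_incl η' θ' c _ _

/-- The map `F^{⊛ d} ⊛ F → F^{⊛ (d + 1)}` that appends a factor on the right. -/
def snoc {F : FBMod k} {d : ℕ} {A A' B B' : Type} [Finite A] [Finite A'] [Finite B] [Finite B'] :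
    val (convPow F d) A A' →ₗ[k] val F B B' →ₗ[k] val (convPow F (d + 1)) (A ⊕ B) (A' ⊕ B') :=
  powDesc fun c =>
    let c' : Coloring ⟨A ⊕ B, A' ⊕ B'⟩ (Fin (d + 1)) :=
      ⟨Sum.elim (fun x => (c.fst x).castSucc) fun _ => Fin.last d,
        Sum.elim (fun y => (c.snd y).castSucc) fun _ => Fin.last d⟩
    let φ (i : Fin d) : F.obj (c.part i) →ₗ[k] F.obj (c'.part i.castSucc) :=
      (F.map (X := c.part i) (Y := c'.part i.castSucc)
        ⟨inlSub (fun _ => (Fin.castSucc_inj).symm) (fun _ h => (Fin.castSucc_ne_last i h.symm)),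
          inlSub (fun _ => (Fin.castSucc_inj).symm)
            (fun _ h => (Fin.castSucc_ne_last i h.symm))⟩).hom
    let ψ : F.obj ⟨B, B'⟩ →ₗ[k] F.obj (c'.part (Fin.last d)) :=
      (F.map (X := ⟨B, B'⟩) (Y := c'.part (Fin.last d))
        ⟨inrAll (fun x h => (Fin.castSucc_ne_last (c.fst x) h)) (fun _ => rfl),
          inrAll (fun y h => (Fin.castSucc_ne_last (c.snd y) h)) (fun _ => rfl)⟩).hom
    LinearMap.compr₂ (LinearMap.compl₂ (PiTensorProduct.lift
      ((PiTensorProduct.tprod k (s := fun i => F.obj (c'.part i))).curryRight.compLinearMap φ)) ψ)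
      (powIncl F c')

/-- The augmentation `F^{⊛ d} → k`, where `k` is regarded as concentrated in `(∅, ∅)`: it is the
canonical isomorphism for `d = 0` and zero for `d > 0`. -/
def powAug (F : FBMod k) : ∀ (d : ℕ) (Z : FB2), PowObj F d Z →ₗ[k] k
  | 0, _ => powDesc fun _ => (PiTensorProduct.isEmptyEquiv (Fin 0)).toLinearMap
  | _ + 1, _ => 0

lemma powAug_incl (F : FBMod k) {Z : FB2} (c : Coloring Z (Fin 0)) (x) :
    powAug F 0 Z (powIncl F c (PiTensorProduct.tprod k x)) = 1 := by
  refine (powDesc_incl _ _ _).trans ?_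
  simp

lemma powAug_transport (F : FBMod k) (d : ℕ) {Z W : FB2} (f : Z ⟶ W) (t : PowObj F d Z) :
    powAug F d W (powTransport F d f t) = powAug F d Z t := by
  cases d with
  | succ d => rfl
  | zero =>
    refine LinearMap.congr_fun (f := powAug F 0 W ∘ₗ powTransport F 0 f) (pow_ext fun c x => ?_) t
    refine (congrArg (powAug F 0 W) (powTransport_incl F f c x)).trans ?_
    exact (powAug_incl F (c.push f) _).trans (powAug_incl F c x).symm

lemma powAug_perm (F : FBMod k) (d : ℕ) (σ : Equiv.Perm (Fin d)) (Z : FB2) (t : PowObj F d Z) :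
    powAug F d Z (powPerm F σ Z t) = powAug F d Z t := by
  cases d with
  | succ d => rfl
  | zero =>
    refine LinearMap.congr_fun (f := powAug F 0 Z ∘ₗ powPerm F σ Z) (pow_ext fun c x => ?_) t
    refine (congrArg (powAug F 0 Z) (powPerm_incl F σ c x)).trans ?_
    exact (powAug_incl F (c.recolor σ) _).trans (powAug_incl F c x).symm

lemma powAug_app {F G : FBMod k} (η : F ⟶ G) (d : ℕ) (Z : FB2) (t : PowObj F d Z) :
    powAug G d Z (powApp η d Z t) = powAug F d Z t := by
  cases d with
  | succ d => rfl
  | zero =>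
    refine LinearMap.congr_fun (f := powAug G 0 Z ∘ₗ powApp η 0 Z) (pow_ext fun c x => ?_) t
    refine (congrArg (powAug G 0 Z) (powApp_incl η c x)).trans ?_
    exact (powAug_incl G c _).trans (powAug_incl F c x).symm

lemma symSub_le_ker (F : FBMod k) (d : ℕ) (Z : FB2) :
    symSub false F d Z ≤ LinearMap.ker (powAug F d Z) := by
  refine Submodule.span_le.2 ?_
  rintro _ ⟨σ, x, rfl⟩
  refine (map_sub (powAug F d Z) _ _).trans ?_
  refine (congrArg₂ (· - ·) (powAug_perm F d σ Z x) (map_zsmul (powAug F d Z) _ x)).trans ?_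
  simp [character]

/-- The augmentation `S* F → k` induced by `F → 0`. -/
def symAug (F : FBMod k) (Z : FB2) : ((SStar k).obj F).obj Z →ₗ[k] k :=
  DirectSum.toModule k ℕ k fun d => (symSub false F d Z).liftQ (powAug F d Z) (symSub_le_ker F d Z)

lemma symAug_cls (F : FBMod k) {d : ℕ} {Z : FB2} (x : PowObj F d Z) :
    symAug F Z (cls false x) = powAug F d Z x :=
  DirectSum.toModule_lof _ _ _

lemma symAug_transport (F : FBMod k) {Z W : FB2} (f : Z ⟶ W) (t) :
    symAug F W ((((SStar k).obj F).map f).hom t) = symAug F Z t := by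
  refine LinearMap.congr_fun (f := symAug F W ∘ₗ (((SStar k).obj F).map f).hom)
    (symTot_ext fun d x => ?_) t
  refine (congrArg (symAug F W) (symTot_map_cls false F f x)).trans ?_
  exact (symAug_cls F _).trans ((powAug_transport F d f x).trans (symAug_cls F x).symm)

lemma symAug_app {F G : FBMod k} (η : F ⟶ G) {Z : FB2} (t) :
    symAug G Z ((((SStar k).map η).app Z).hom t) = symAug F Z t := by
  refine LinearMap.congr_fun (f := symAug G Z ∘ₗ (((SStar k).map η).app Z).hom)
    (symTot_ext fun d x => ?_) t
  refine (congrArg (symAug G Z) (symTotMap_cls false η x)).trans ?_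
  exact (symAug_cls G _).trans ((powAug_app η d Z x).trans (symAug_cls F x).symm)

/-- If all of `Z` has the colour `false`, the corresponding part is `Z`. -/
def partAll {Z : FB2} (c : Coloring Z Bool)
    (h : (∀ x, c.fst x = false) ∧ ∀ y, c.snd y = false) : c.part false ⟶ Z :=
  ⟨Equiv.subtypeUnivEquiv h.1, Equiv.subtypeUnivEquiv h.2⟩

open Classical in
/-- The component at `Z` of the surjection `P ⊛ S* F → P` induced by `F → 0`. -/
def projObj (P F : FBMod k) (Z : FB2) : DayObj P ((SStar k).obj F) Z →ₗ[k] P.obj Z :=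
  dayDesc fun c =>
    if h : (∀ x, c.fst x = false) ∧ ∀ y, c.snd y = false then
      TensorProduct.lift (((LinearMap.lsmul k (P.obj Z)).flip ∘ₗ (P.map (partAll c h)).hom).compl₂
        (symAug F (c.part true)))
    else 0

lemma projObj_incl_pos (P F : FBMod k) {Z : FB2} (c : Coloring Z Bool)
    (h : (∀ x, c.fst x = false) ∧ ∀ y, c.snd y = false) (a b) :
    projObj P F Z (dayIncl P _ c (a ⊗ₜ[k] b)) =
      symAug F (c.part true) b • (P.map (partAll c h)).hom a := by
  rw [projObj, dayDesc_incl, dif_pos h]; rfl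

lemma projObj_incl_neg (P F : FBMod k) {Z : FB2} (c : Coloring Z Bool)
    (h : ¬ ((∀ x, c.fst x = false) ∧ ∀ y, c.snd y = false)) (t) :
    projObj P F Z (dayIncl P _ c t) = 0 := by
  rw [projObj, dayDesc_incl, dif_neg h]; rfl

/-- The surjection `P ⊛ S* F → P` induced by `F → 0`. -/
def proj (P F : FBMod k) : dayConv P ((SStar k).obj F) ⟶ P where
  app Z := ModuleCat.ofHom (projObj P F Z)
  naturality {Z W} f := by
    apply ModuleCat.hom_ext
    refine day_ext fun c a b => ?_
    refine (congrArg (projObj P F W) (dayTransport_incl P _ f c a b)).trans ?_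
    by_cases h : (∀ x, c.fst x = false) ∧ ∀ y, c.snd y = false
    · have h' : (∀ x, (c.push f).fst x = false) ∧ ∀ y, (c.push f).snd y = false :=
        ⟨fun x => h.1 _, fun y => h.2 _⟩
      refine (projObj_incl_pos P F (c.push f) h' _ _).trans ?_
      symm
      refine (congrArg (P.map f).hom (projObj_incl_pos P F c h a b)).trans ?_
      refine (map_smul (P.map f).hom _ _).trans ?_
      refine congrArg₂ (· • ·) (symAug_transport F (c.partHom f true) b).symm ?_
      refine (congrArg (fun f => f.hom a) (P.map_comp (partAll c h) f)).symm.trans ?_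
      exact congrArg (fun f => f.hom a)
        (P.map_comp (c.partHom f false) (partAll (c.push f) h'))
    · have h' : ¬ ((∀ x, (c.push f).fst x = false) ∧ ∀ y, (c.push f).snd y = false) := by
        rintro ⟨h1, h2⟩
        refine h ⟨fun x => ?_, fun y => ?_⟩
        · simpa [Coloring.push] using h1 (f.fst x)
        · simpa [Coloring.push] using h2 (f.snd y)
      refine (projObj_incl_neg P F (c.push f) h' _).trans ?_
      symm
      exact (congrArg (P.map f).hom (projObj_incl_neg P F c h _)).trans (map_zero _)

lemma proj_naturality {P P' F F' : FBMod k} (η : P ⟶ P') (θ : F ⟶ F') :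
    dayConvMap η ((SStar k).map θ) ≫ proj P' F' = proj P F ≫ η := by
  apply NatTrans.ext
  funext Z
  apply ModuleCat.hom_ext
  refine day_ext fun c a b => ?_
  refine (congrArg (projObj P' F' Z) (dayApp_incl η ((SStar k).map θ) c a b)).trans ?_
  by_cases h : (∀ x, c.fst x = false) ∧ ∀ y, c.snd y = false
  · refine (projObj_incl_pos P' F' c h _ _).trans ?_
    symm
    refine (congrArg (η.app Z).hom (projObj_incl_pos P F c h a b)).trans ?_
    refine (map_smul (η.app Z).hom _ _).trans ?_
    refine congrArg₂ (· • ·) (symAug_app θ b).symm ?_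
    exact congrArg (fun f => f.hom a) (η.naturality (partAll c h))
  · refine (projObj_incl_neg P' F' c h _).trans ?_
    symm
    exact (congrArg (η.app Z).hom (projObj_incl_neg P F c h _)).trans (map_zero _)

end Constructions

section Operads

/-- `(A ⊔ B) ⊔ C ≅ (A ⊔ C) ⊔ B` -/
def sumRightComm (A B C : Type) : (A ⊕ B) ⊕ C ≃ (A ⊕ C) ⊕ B where
  toFun
    | Sum.inl (Sum.inl a) => Sum.inl (Sum.inl a)
    | Sum.inl (Sum.inr b) => Sum.inr b
    | Sum.inr c => Sum.inl (Sum.inr c)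
  invFun
    | Sum.inl (Sum.inl a) => Sum.inl (Sum.inl a)
    | Sum.inl (Sum.inr c) => Sum.inr c
    | Sum.inr b => Sum.inl (Sum.inr b)
  left_inv := by rintro ((a | b) | c) <;> rfl
  right_inv := by rintro ((a | b) | c) <;> rfl

/-- `X ⊔ {1}` -/
abbrev Pt (X : Type) : Type := X ⊕ Fin 1

abbrev onPt {X Y : Type} (e : X ≃ Y) : Pt X ≃ Pt Y := e.sumCongr (Equiv.refl (Fin 1))

/-- An operad without unit, presented by its partial compositions: `toMod (X, Y)` is zero unless
`Y` is a singleton, and for `Y` a singleton it is the space of operations with set of inputs `X`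
and with output labelled by `Y`. The element `comp p q` is the composite in which the output of `q`
labelled by the added point is plugged into the input of `p` labelled by the added point; the
family of all `comp` is a morphism `δ_{1,0} O ⊛ δ_{0,1} O → O`. -/
structure NUOperad (k : Type u) [Field k] where
  toMod : FBMod k
  supported : ∀ Z : FB2, Nat.card Z.snd ≠ 1 → Subsingleton (toMod.obj Z)
  comp : ∀ {A A' B B' : Type} [Finite A] [Finite A'] [Finite B] [Finite B'],
    val toMod (Pt A) A' →ₗ[k] val toMod B (Pt B') →ₗ[k] val toMod (A ⊕ B) (A' ⊕ B')
  comp_act : ∀ {A A' B B' C C' D D' : Type} [Finite A] [Finite A'] [Finite B] [Finite B']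
    [Finite C] [Finite C'] [Finite D] [Finite D'] (e : A ≃ C) (e' : A' ≃ C') (f : B ≃ D)
    (f' : B' ≃ D') (p : val toMod (Pt A) A') (q : val toMod B (Pt B')),
    comp (act toMod (onPt e) e' p) (act toMod f (onPt f') q) =
      act toMod (e.sumCongr f) (e'.sumCongr f') (comp p q)
  /-- `(p ∘ q) ∘ r = p ∘ (q ∘ r)`, where `r` is plugged into an input of `q`. -/
  seq_assoc : ∀ {A A' B B' C C' : Type} [Finite A] [Finite A'] [Finite B] [Finite B']
    [Finite C] [Finite C'] (p : val toMod (Pt A) A') (q : val toMod (Pt B) (Pt B'))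
    (r : val toMod C (Pt C')),
    act toMod (Equiv.sumAssoc A B C) (Equiv.sumAssoc A' B' C')
        (comp (act toMod (Equiv.sumAssoc A B (Fin 1)).symm (Equiv.refl _) (comp p q)) r) =
      comp p (act toMod (Equiv.refl _) (sumRightComm B' (Fin 1) C') (comp q r))
  /-- `(p ∘ q) ∘ r = (p ∘ r) ∘ q`, where `q` and `r` are plugged into different inputs of `p`. -/
  par_assoc : ∀ {A A' B B' C C' : Type} [Finite A] [Finite A'] [Finite B] [Finite B']
    [Finite C] [Finite C'] (p : val toMod (Pt (Pt A)) A') (q : val toMod B (Pt B'))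
    (r : val toMod C (Pt C')),
    act toMod (sumRightComm A B C) (sumRightComm A' B' C')
        (comp (act toMod (sumRightComm A (Fin 1) B) (Equiv.refl _) (comp p q)) r) =
      comp (act toMod (sumRightComm A (Fin 1) C) (Equiv.refl _)
        (comp (act toMod (sumRightComm A (Fin 1) (Fin 1)) (Equiv.refl _) p) r)) q

namespace NUOperad

variable {k : Type u} [Field k]

/-- A morphism of operads without unit. -/
@[ext]
structure Hom (O P : NUOperad k) where
  toMod : O.toMod ⟶ P.toMod
  comp_app : ∀ {A A' B B' : Type} [Finite A] [Finite A'] [Finite B] [Finite B']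
    (p : val O.toMod (Pt A) A') (q : val O.toMod B (Pt B')),
    (toMod.app ⟨A ⊕ B, A' ⊕ B'⟩).hom (O.comp p q) =
      P.comp ((toMod.app ⟨Pt A, A'⟩).hom p) ((toMod.app ⟨B, Pt B'⟩).hom q)

instance : Category (NUOperad k) where
  Hom := Hom
  id O := ⟨𝟙 O.toMod, fun _ _ => rfl⟩
  comp f g := ⟨f.toMod ≫ g.toMod, fun p q =>
    (congrArg _ (f.comp_app p q)).trans (g.comp_app _ _)⟩

/-- The forgetful functor to `FB × FB`-modules. -/
def forget (k : Type u) [Field k] : NUOperad k ⥤ FBMod k where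
  obj O := O.toMod
  map f := f.toMod

/-- `δ_{1,1} O` -/
def delta (O : NUOperad k) : FBMod k where
  obj Z := O.toMod.obj ⟨Pt Z.fst, Pt Z.snd⟩
  map {Z W} f := O.toMod.map (X := ⟨Pt Z.fst, Pt Z.snd⟩) (Y := ⟨Pt W.fst, Pt W.snd⟩)
    ⟨onPt f.fst, onPt f.snd⟩
  map_id Z := by
    refine Eq.trans ?_ (O.toMod.map_id ⟨Pt Z.fst, Pt Z.snd⟩)
    refine congrArg (fun f : (⟨Pt Z.fst, Pt Z.snd⟩ : FB2) ⟶ ⟨Pt Z.fst, Pt Z.snd⟩ => O.toMod.map f) ?_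
    refine FB2.Hom.ext ?_ ?_ <;> exact Equiv.sumCongr_refl
  map_comp {Z W V} f g := by
    refine Eq.trans ?_ (O.toMod.map_comp (X := ⟨Pt Z.fst, Pt Z.snd⟩)
      (Y := ⟨Pt W.fst, Pt W.snd⟩) (Z := ⟨Pt V.fst, Pt V.snd⟩) ⟨onPt f.fst, onPt f.snd⟩
      ⟨onPt g.fst, onPt g.snd⟩)
    refine congrArg (fun f : (⟨Pt Z.fst, Pt Z.snd⟩ : FB2) ⟶ ⟨Pt V.fst, Pt V.snd⟩ => O.toMod.map f) ?_
    refine FB2.Hom.ext ?_ ?_ <;> exact Equiv.ext (by rintro (x | x) <;> rfl)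

/-- The product on `δ_{1,1} O`: the marked output of `b` is plugged into the marked input of `a`;
the marked input of the composite is that of `b`, its marked output is that of `a`. -/
def deltaMul (O : NUOperad k) {A A' B B' : Type} [Finite A] [Finite A'] [Finite B] [Finite B'] :
    val O.toMod (Pt A) (Pt A') →ₗ[k] val O.toMod (Pt B) (Pt B') →ₗ[k]
      val O.toMod (Pt (A ⊕ B)) (Pt (A' ⊕ B')) :=
  (O.comp (A := A) (A' := Pt A') (B := Pt B) (B' := B')).compr₂
    (act O.toMod (Equiv.sumAssoc A B (Fin 1)).symm (sumRightComm A' (Fin 1) B'))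

/-- The commutators in `δ_{1,1} O (Z)`. -/
def commSub (O : NUOperad k) (Z : FB2) : Submodule k (O.delta.obj Z) :=
  Submodule.span k {t | ∃ (A A' B B' : Type) (_ : Finite A) (_ : Finite A') (_ : Finite B)
    (_ : Finite B') (e : A ⊕ B ≃ Z.fst) (e' : A' ⊕ B' ≃ Z.snd)
    (a : val O.toMod (Pt A) (Pt A')) (b : val O.toMod (Pt B) (Pt B')),
    t = act O.toMod (onPt e) (onPt e') (O.deltaMul a b) -
      act O.toMod (onPt ((Equiv.sumComm B A).trans e)) (onPt ((Equiv.sumComm B' A').trans e'))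
        (O.deltaMul b a)}

lemma commSub_map (O : NUOperad k) {Z W : FB2} (f : Z ⟶ W) :
    O.commSub Z ≤ (O.commSub W).comap (O.delta.map f).hom := by
  refine Submodule.span_le.2 ?_
  rintro _ ⟨A, A', B, B', _, _, _, _, e, e', a, b, rfl⟩
  refine Submodule.subset_span ⟨A, A', B, B', ‹_›, ‹_›, ‹_›, ‹_›, e.trans f.fst, e'.trans f.snd,
    a, b, ?_⟩
  refine (map_sub (O.delta.map f).hom _ _).trans (congrArg₂ (· - ·) ?_ ?_)
  · refine (act_act O.toMod (onPt e) (onPt e') (onPt f.fst) (onPt f.snd) _).trans ?_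
    rw [Equiv.sumCongr_trans, Equiv.sumCongr_trans]; rfl
  · refine (act_act O.toMod _ _ (onPt f.fst) (onPt f.snd) _).trans ?_
    rw [Equiv.sumCongr_trans, Equiv.sumCongr_trans]; rfl

/-- The commutator quotient `|δ_{1,1} O|`. -/
def wheel (O : NUOperad k) : FBMod k := quotFun O.delta O.commSub O.commSub_map

/-- The projection `δ_{1,1} O → |δ_{1,1} O|`. -/
def toWheel (O : NUOperad k) {A A' : Type} [Finite A] [Finite A'] :
    val O.toMod (Pt A) (Pt A') →ₗ[k] val O.wheel A A' := (O.commSub ⟨A, A'⟩).mkQ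

def deltaMap {O P : NUOperad k} (f : O ⟶ P) : O.delta ⟶ P.delta where
  app Z := f.toMod.app ⟨Pt Z.fst, Pt Z.snd⟩
  naturality {Z W} g := f.toMod.naturality (X := ⟨Pt Z.fst, Pt Z.snd⟩)
    (Y := ⟨Pt W.fst, Pt W.snd⟩) ⟨onPt g.fst, onPt g.snd⟩

lemma deltaMul_app {O P : NUOperad k} (f : O ⟶ P) {A A' B B' : Type} [Finite A] [Finite A']
    [Finite B] [Finite B'] (a : val O.toMod (Pt A) (Pt A')) (b : val O.toMod (Pt B) (Pt B')) :
    (f.toMod.app ⟨Pt (A ⊕ B), Pt (A' ⊕ B')⟩).hom (O.deltaMul a b) =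
      P.deltaMul ((f.toMod.app ⟨Pt A, Pt A'⟩).hom a) ((f.toMod.app ⟨Pt B, Pt B'⟩).hom b) :=
  (app_act f.toMod _ _ _).trans (congrArg (act P.toMod _ _) (f.comp_app _ _))

lemma commSub_le {O P : NUOperad k} (f : O ⟶ P) (Z : FB2) :
    O.commSub Z ≤ (P.commSub Z).comap ((deltaMap f).app Z).hom := by
  refine Submodule.span_le.2 ?_
  rintro _ ⟨A, A', B, B', _, _, _, _, e, e', a, b, rfl⟩
  refine Submodule.subset_span ⟨A, A', B, B', ‹_›, ‹_›, ‹_›, ‹_›, e, e',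
    (f.toMod.app ⟨Pt A, Pt A'⟩).hom a, (f.toMod.app ⟨Pt B, Pt B'⟩).hom b, ?_⟩
  refine (map_sub ((deltaMap f).app Z).hom _ _).trans (congrArg₂ (· - ·) ?_ ?_)
  · exact (app_act f.toMod _ _ _).trans (congrArg (act P.toMod _ _) (deltaMul_app f a b))
  · exact (app_act f.toMod _ _ _).trans (congrArg (act P.toMod _ _) (deltaMul_app f b a))

def wheelMap {O P : NUOperad k} (f : O ⟶ P) : O.wheel ⟶ P.wheel :=
  quotFunMap (deltaMap f) (commSub_le f)

/-- `O ↦ |δ_{1,1} O|` as a functor. -/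
def wheelFunctor (k : Type u) [Field k] : NUOperad k ⥤ FBMod k where
  obj O := O.wheel
  map f := wheelMap f
  map_id O := by
    apply NatTrans.ext
    funext Z
    apply ModuleCat.hom_ext
    apply Submodule.linearMap_qext
    rfl
  map_comp f g := by
    apply NatTrans.ext
    funext Z
    apply ModuleCat.hom_ext
    apply Submodule.linearMap_qext
    rfl

/-- The right action of `O` on `δ_{1,1} O`: the marked output of `q` is plugged into the last
marked input of `r`. -/
def deltaAct (O : NUOperad k) {A A' B B' : Type} [Finite A] [Finite A'] [Finite B] [Finite B'] :
    val O.toMod (Pt (Pt A)) (Pt A') →ₗ[k] val O.toMod B (Pt B') →ₗ[k]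
      val O.toMod (Pt (A ⊕ B)) (Pt (A' ⊕ B')) :=
  ((O.comp (A := Pt A) (A' := Pt A') (B := B) (B' := B')).compr₂
    (act O.toMod (sumRightComm A (Fin 1) B) (sumRightComm A' (Fin 1) B'))) ∘ₗ
      act O.toMod (sumRightComm A (Fin 1) (Fin 1)) (Equiv.refl (Pt A'))

lemma act_congr {F : FBMod k} {A A' B B' : Type} [Finite A] [Finite A'] [Finite B] [Finite B']
    {e f : A ≃ B} {e' f' : A' ≃ B'} {x y : val F A A'} (h : e = f) (h' : e' = f') (hx : x = y) :
    act F e e' x = act F f f' y := by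
  rw [h, h', hx]

lemma comp_act_left (O : NUOperad k) {A A' B B' C C' : Type} [Finite A] [Finite A'] [Finite B]
    [Finite B'] [Finite C] [Finite C'] (e : A ≃ C) (e' : A' ≃ C')
    (p : val O.toMod (Pt A) A') (q : val O.toMod B (Pt B')) :
    O.comp (act O.toMod (onPt e) e' p) q =
      act O.toMod (e.sumCongr (Equiv.refl B)) (e'.sumCongr (Equiv.refl B')) (O.comp p q) := by
  rw [← O.comp_act]
  refine congrArg (O.comp _) ?_
  refine (act_refl O.toMod q).symm.trans (act_congr rfl ?_ rfl)
  exact Equiv.sumCongr_refl.symm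

lemma comp_act_right (O : NUOperad k) {A A' B B' D D' : Type} [Finite A] [Finite A'] [Finite B]
    [Finite B'] [Finite D] [Finite D'] (f : B ≃ D) (f' : B' ≃ D')
    (p : val O.toMod (Pt A) A') (q : val O.toMod B (Pt B')) :
    O.comp p (act O.toMod f (onPt f') q) =
      act O.toMod ((Equiv.refl A).sumCongr f) ((Equiv.refl A').sumCongr f') (O.comp p q) := by
  rw [← O.comp_act]
  refine congrArg (fun x => O.comp x _) ?_
  refine (act_refl O.toMod p).symm.trans (act_congr ?_ rfl rfl)
  exact Equiv.sumCongr_refl.symm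

lemma deltaAct_act_left (O : NUOperad k) {A A' B B' C C' : Type} [Finite A] [Finite A'] [Finite B]
    [Finite B'] [Finite C] [Finite C'] (e : A ≃ C) (e' : A' ≃ C')
    (r : val O.toMod (Pt (Pt A)) (Pt A')) (q : val O.toMod B (Pt B')) :
    O.deltaAct (act O.toMod (onPt (onPt e)) (onPt e') r) q =
      act O.toMod (onPt (e.sumCongr (Equiv.refl B))) (onPt (e'.sumCongr (Equiv.refl B')))
        (O.deltaAct r q) := by
  have h : act O.toMod (sumRightComm C (Fin 1) (Fin 1)) (Equiv.refl (Pt C'))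
      (act O.toMod (onPt (onPt e)) (onPt e') r) =
      act O.toMod (onPt (onPt e)) (onPt e')
        (act O.toMod (sumRightComm A (Fin 1) (Fin 1)) (Equiv.refl (Pt A')) r) := by
    rw [act_act, act_act]
    exact act_congr (Equiv.ext (by rintro ((x | x) | x) <;> rfl)) rfl rfl
  change act O.toMod _ _ (O.comp (act O.toMod _ _ _) q) = act O.toMod _ _ (act O.toMod _ _ _)
  rw [h, comp_act_left, act_act, act_act]
  exact act_congr (Equiv.ext (by rintro ((x | x) | x) <;> rfl))
    (Equiv.ext (by rintro ((x | x) | x) <;> rfl)) rfl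

lemma deltaMul_act_left (O : NUOperad k) {A A' B B' C C' : Type} [Finite A] [Finite A'] [Finite B]
    [Finite B'] [Finite C] [Finite C'] (e : A ≃ C) (e' : A' ≃ C')
    (a : val O.toMod (Pt A) (Pt A')) (b : val O.toMod (Pt B) (Pt B')) :
    O.deltaMul (act O.toMod (onPt e) (onPt e') a) b =
      act O.toMod (onPt (e.sumCongr (Equiv.refl B))) (onPt (e'.sumCongr (Equiv.refl B')))
        (O.deltaMul a b) := by
  change act O.toMod _ _ (O.comp (act O.toMod _ _ _) b) = act O.toMod _ _ (act O.toMod _ _ _)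
  rw [comp_act_left, act_act, act_act]
  exact act_congr (Equiv.ext (by rintro (x | x | x) <;> rfl))
    (Equiv.ext (by rintro ((x | x) | x) <;> rfl)) rfl

lemma deltaMul_act_right (O : NUOperad k) {A A' B B' C C' : Type} [Finite A] [Finite A'] [Finite B]
    [Finite B'] [Finite C] [Finite C'] (e : B ≃ C) (e' : B' ≃ C')
    (a : val O.toMod (Pt A) (Pt A')) (b : val O.toMod (Pt B) (Pt B')) :
    O.deltaMul a (act O.toMod (onPt e) (onPt e') b) =
      act O.toMod (onPt ((Equiv.refl A).sumCongr e)) (onPt ((Equiv.refl A').sumCongr e'))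
        (O.deltaMul a b) := by
  change act O.toMod _ _ (O.comp a (act O.toMod _ _ _)) = act O.toMod _ _ (act O.toMod _ _ _)
  rw [comp_act_right, act_act, act_act]
  exact act_congr (Equiv.ext (by rintro (x | x | x) <;> rfl))
    (Equiv.ext (by rintro ((x | x) | x) <;> rfl)) rfl

lemma deltaAct_deltaMul_left (O : NUOperad k) {A A' B B' C C' : Type} [Finite A] [Finite A']
    [Finite B] [Finite B'] [Finite C] [Finite C'] (a : val O.toMod (Pt (Pt A)) (Pt A'))
    (b : val O.toMod (Pt B) (Pt B')) (q : val O.toMod C (Pt C')) :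
    O.deltaAct (act O.toMod (onPt (sumRightComm A (Fin 1) B)) (Equiv.refl _) (O.deltaMul a b)) q =
      act O.toMod (onPt (sumRightComm A C B)) (onPt (sumRightComm A' C' B'))
        (O.deltaMul (O.deltaAct a q) b) := by
  have h1 : act O.toMod (sumRightComm (A ⊕ B) (Fin 1) (Fin 1)) (Equiv.refl _)
      (act O.toMod (onPt (sumRightComm A (Fin 1) B)) (Equiv.refl _)
        (act O.toMod (Equiv.sumAssoc (Pt A) B (Fin 1)).symm (sumRightComm A' (Fin 1) B')
          (O.comp a b))) =
      act O.toMod (onPt (Equiv.sumAssoc A B (Fin 1)).symm) (sumRightComm A' (Fin 1) B')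
        (act O.toMod (sumRightComm A (Fin 1) (Pt B)) (Equiv.refl _) (O.comp a b)) := by
    rw [act_act, act_act, act_act]
    exact act_congr (Equiv.ext (by rintro ((x | x) | (x | x)) <;> rfl)) rfl rfl
  have h2 : act O.toMod (sumRightComm A (Fin 1) C) (sumRightComm A' (Fin 1) C')
        (O.comp (act O.toMod (sumRightComm A (Fin 1) (Fin 1)) (Equiv.refl _) a) q) =
      act O.toMod (onPt (Equiv.refl _)) (sumRightComm A' (Fin 1) C')
        (act O.toMod (sumRightComm A (Fin 1) C) (Equiv.refl _)
          (O.comp (act O.toMod (sumRightComm A (Fin 1) (Fin 1)) (Equiv.refl _) a) q)) := by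
    rw [act_act]
    exact act_congr (Equiv.ext (by rintro ((x | x) | x) <;> rfl)) rfl rfl
  change act O.toMod _ _ (O.comp (act O.toMod _ _ (act O.toMod _ _ (act O.toMod _ _ _))) q) =
    act O.toMod _ _ (act O.toMod _ _ (O.comp (act O.toMod _ _ (O.comp (act O.toMod _ _ a) q)) b))
  rw [h1, h2, comp_act_left, comp_act_left, ← O.par_assoc, act_act, act_act, act_act, act_act]
  exact act_congr (Equiv.ext (by rintro ((x | (x | x)) | x) <;> rfl))
    (Equiv.ext (by rintro (((x | x) | x) | x) <;> rfl)) rfl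

lemma deltaAct_deltaMul_right (O : NUOperad k) {A A' B B' C C' : Type} [Finite A] [Finite A']
    [Finite B] [Finite B'] [Finite C] [Finite C'] (a : val O.toMod (Pt (Pt A)) (Pt A'))
    (b : val O.toMod (Pt B) (Pt B')) (q : val O.toMod C (Pt C')) :
    O.deltaAct (act O.toMod (onPt (Equiv.sumAssoc B A (Fin 1)).symm) (Equiv.refl _)
        (O.deltaMul b a)) q =
      act O.toMod (onPt (Equiv.sumAssoc B A C).symm) (onPt (Equiv.sumAssoc B' A' C').symm)
        (O.deltaMul b (O.deltaAct a q)) := by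
  have h1 : act O.toMod (sumRightComm (B ⊕ A) (Fin 1) (Fin 1)) (Equiv.refl _)
      (act O.toMod (onPt (Equiv.sumAssoc B A (Fin 1)).symm) (Equiv.refl _)
        (act O.toMod (Equiv.sumAssoc B (Pt A) (Fin 1)).symm (sumRightComm B' (Fin 1) A')
          (O.comp b a))) =
      act O.toMod (onPt (Equiv.sumAssoc B A (Fin 1)).symm) (sumRightComm B' (Fin 1) A')
        (act O.toMod (Equiv.sumAssoc B (Pt A) (Fin 1)).symm (Equiv.refl _)
          (O.comp b (act O.toMod (sumRightComm A (Fin 1) (Fin 1)) (onPt (Equiv.refl _)) a))) := by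
    rw [comp_act_right, act_act, act_act, act_act, act_act]
    exact act_congr (Equiv.ext (by rintro (x | (x | x) | x) <;> rfl))
      (Equiv.ext (by rintro ((x | x) | x) <;> rfl)) rfl
  have h2 : act O.toMod (sumRightComm A (Fin 1) C) (sumRightComm A' (Fin 1) C')
        (O.comp (act O.toMod (sumRightComm A (Fin 1) (Fin 1)) (Equiv.refl _) a) q) =
      act O.toMod (sumRightComm A (Fin 1) C) (onPt (Equiv.refl _))
        (act O.toMod (Equiv.refl _) (sumRightComm A' (Fin 1) C')
          (O.comp (act O.toMod (sumRightComm A (Fin 1) (Fin 1)) (onPt (Equiv.refl _)) a) q)) := by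
    rw [act_act]
    refine act_congr rfl (Equiv.ext (by rintro ((x | x) | x) <;> rfl)) ?_
    exact congrArg (fun x => O.comp x q) (act_congr rfl Equiv.sumCongr_refl.symm rfl)
  change act O.toMod _ _ (O.comp (act O.toMod _ _ (act O.toMod _ _ (act O.toMod _ _ _))) q) =
    act O.toMod _ _ (act O.toMod _ _ (O.comp b (act O.toMod _ _ (O.comp (act O.toMod _ _ a) q))))
  rw [h1, h2]
  generalize act O.toMod (sumRightComm A (Fin 1) (Fin 1)) (onPt (Equiv.refl A')) a = a'
  rw [comp_act_left, comp_act_right, ← O.seq_assoc, act_act, act_act, act_act, act_act]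
  exact act_congr (Equiv.ext (by rintro ((x | (x | x)) | x) <;> rfl))
    (Equiv.ext (by rintro (((x | x) | x) | x) <;> rfl)) rfl

lemma exists_onPt {X Y : Type} (E : Pt X ≃ Pt Y) (h : E (Sum.inr 0) = Sum.inr 0) :
    ∃ f : X ≃ Y, E = onPt f := by
  have h1 (x : X) : ∃ y, E (Sum.inl x) = Sum.inl y := by
    rcases h' : E (Sum.inl x) with y | i
    · exact ⟨y, rfl⟩
    · rw [Subsingleton.elim i 0, ← h] at h'
      exact absurd (E.injective h') Sum.inl_ne_inr
  choose f hf using h1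
  refine ⟨Equiv.ofBijective f ⟨fun x y hxy => ?_, fun y => ?_⟩, Equiv.ext ?_⟩
  · have := (hf x).trans ((congrArg Sum.inl hxy).trans (hf y).symm)
    exact Sum.inl_injective (E.injective this)
  · obtain ⟨x | i, hx⟩ := E.surjective (Sum.inl y)
    · exact ⟨x, Sum.inl_injective ((hf x).symm.trans hx)⟩
    · rw [Subsingleton.elim i 0, h] at hx
      exact absurd hx Sum.inr_ne_inl
  · rintro (x | i)
    · exact hf x
    · rw [Subsingleton.elim i 0]; exact h

lemma exists_pt {X : Type} [Finite X] (x : X) :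
    ∃ (C : Type) (_ : Finite C) (g : Pt C ≃ X), g (Sum.inr 0) = x := by
  classical
  refine ⟨{y // y ≠ x}, inferInstance, Equiv.ofBijective (Sum.elim (fun y => y.1) fun _ => x)
    ⟨?_, fun y => ?_⟩, rfl⟩
  · rintro (y | i) (z | j) h
    · exact congrArg _ (Subtype.ext h)
    · exact absurd h y.2
    · exact absurd h.symm z.2
    · exact congrArg _ (Subsingleton.elim i j)
  · by_cases h : y = x
    · exact ⟨Sum.inr 0, h.symm⟩
    · exact ⟨Sum.inl ⟨y, h⟩, rfl⟩

lemma toWheel_comm (O : NUOperad k) {A A' B B' C C' : Type} [Finite A] [Finite A'] [Finite B]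
    [Finite B'] [Finite C] [Finite C'] (e : A ⊕ B ≃ C) (e' : A' ⊕ B' ≃ C')
    (a : val O.toMod (Pt A) (Pt A')) (b : val O.toMod (Pt B) (Pt B')) :
    O.toWheel (act O.toMod (onPt e) (onPt e') (O.deltaMul a b)) =
      O.toWheel (act O.toMod (onPt ((Equiv.sumComm B A).trans e))
        (onPt ((Equiv.sumComm B' A').trans e')) (O.deltaMul b a)) := by
  refine (Submodule.Quotient.eq _).2 (Submodule.subset_span ?_)
  exact ⟨A, A', B, B', ‹_›, ‹_›, ‹_›, ‹_›, e, e', a, b, rfl⟩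

lemma toWheel_deltaAct_aux (O : NUOperad k) {A A' D D' E E' B B' : Type} [Finite A] [Finite A']
    [Finite B] [Finite B'] [Finite D] [Finite D'] [Finite E] [Finite E']
    (e : D ⊕ E ≃ Pt A) (e' : D' ⊕ E' ≃ A') (d : D) (hd : e (Sum.inl d) = Sum.inr 0)
    (a : val O.toMod (Pt D) (Pt D')) (b : val O.toMod (Pt E) (Pt E'))
    (q : val O.toMod B (Pt B')) :
    O.toWheel (O.deltaAct (act O.toMod (onPt e) (onPt e') (O.deltaMul a b)) q) =
      O.toWheel (O.deltaAct (act O.toMod (onPt ((Equiv.sumComm E D).trans e))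
        (onPt ((Equiv.sumComm E' D').trans e')) (O.deltaMul b a)) q) := by
  obtain ⟨C, _, g, hg⟩ := exists_pt d
  obtain ⟨h, hh⟩ := exists_onPt
    ((sumRightComm C E (Fin 1)).trans ((g.sumCongr (Equiv.refl E)).trans e))
    (by rw [← hd, ← hg]; rfl)
  have he : e = (g.sumCongr (Equiv.refl E)).symm.trans
      ((sumRightComm C (Fin 1) E).trans (onPt h)) := by
    rw [← hh]
    refine Equiv.ext fun x => ?_
    obtain ⟨y, rfl⟩ := (g.sumCongr (Equiv.refl E)).surjective x
    rw [Equiv.trans_apply, Equiv.symm_apply_apply]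
    rcases y with (y | y) | y <;> rfl
  obtain ⟨a, rfl⟩ : ∃ a₁ : val O.toMod (Pt (Pt C)) (Pt D'),
      act O.toMod (onPt g) (onPt (Equiv.refl D')) a₁ = a := by
    refine ⟨act O.toMod (onPt g.symm) (onPt (Equiv.refl D')) a, ?_⟩
    rw [act_act]
    refine (act_congr ?_ ?_ rfl).trans (act_refl O.toMod a)
    · exact Equiv.ext (by rintro (x | x) <;> simp)
    · exact Equiv.ext (by rintro (x | x) <;> rfl)
  have h1 : act O.toMod (onPt e) (onPt e')
      (O.deltaMul (act O.toMod (onPt g) (onPt (Equiv.refl D')) a) b) =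
      act O.toMod (onPt (onPt h)) (onPt e')
        (act O.toMod (onPt (sumRightComm C (Fin 1) E)) (Equiv.refl _) (O.deltaMul a b)) := by
    rw [deltaMul_act_left, act_act, act_act]
    refine act_congr ?_ ?_ rfl
    · rw [he]
      exact Equiv.ext (by rintro (((x | x) | x) | x) <;> simp)
    · exact Equiv.ext (by rintro ((x | x) | x) <;> rfl)
  have h2 : act O.toMod (onPt ((Equiv.sumComm E D).trans e))
      (onPt ((Equiv.sumComm E' D').trans e'))
      (O.deltaMul b (act O.toMod (onPt g) (onPt (Equiv.refl D')) a)) =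
      act O.toMod (onPt (onPt ((Equiv.sumComm E C).trans h)))
        (onPt ((Equiv.sumComm E' D').trans e'))
        (act O.toMod (onPt (Equiv.sumAssoc E C (Fin 1)).symm) (Equiv.refl _)
          (O.deltaMul b a)) := by
    rw [deltaMul_act_right, act_act, act_act]
    refine act_congr ?_ ?_ rfl
    · rw [he]
      exact Equiv.ext (by rintro ((x | (x | x)) | x) <;> simp [sumRightComm])
    · exact Equiv.ext (by rintro ((x | x) | x) <;> rfl)
  rw [h1, h2, deltaAct_act_left, deltaAct_act_left, deltaAct_deltaMul_left,
    deltaAct_deltaMul_right, act_act, act_act]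
  refine Eq.trans ?_ ((toWheel_comm O
    ((sumRightComm C B E).trans (h.sumCongr (Equiv.refl B)))
    ((sumRightComm D' B' E').trans (e'.sumCongr (Equiv.refl B'))) (O.deltaAct a q) b).trans ?_)
  · exact congrArg O.toWheel (act_congr (Equiv.ext (by rintro (((x | x) | x) | x) <;> rfl))
      (Equiv.ext (by rintro (((x | x) | x) | x) <;> rfl)) rfl)
  · exact congrArg O.toWheel (act_congr (Equiv.ext (by rintro ((x | (x | x)) | x) <;> rfl))
      (Equiv.ext (by rintro ((x | (x | x)) | x) <;> rfl)) rfl)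

def deltaActWheel (O : NUOperad k) {A A' B B' : Type} [Finite A] [Finite A'] [Finite B]
    [Finite B'] : O.delta.obj ⟨Pt A, A'⟩ →ₗ[k] val O.toMod B (Pt B') →ₗ[k]
      val O.wheel (A ⊕ B) (A' ⊕ B') :=
  (O.deltaAct (A := A) (A' := A') (B := B) (B' := B')).compr₂ O.toWheel

lemma commSub_le_ker (O : NUOperad k) {A A' B B' : Type} [Finite A] [Finite A'] [Finite B]
    [Finite B'] :
    O.commSub ⟨Pt A, A'⟩ ≤
      LinearMap.ker (O.deltaActWheel (A := A) (A' := A') (B := B) (B' := B')) := by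
  refine Submodule.span_le.2 ?_
  rintro _ ⟨D, D', E, E', _, _, _, _, e, e', a, b, rfl⟩
  refine (map_sub O.deltaActWheel _ _).trans (sub_eq_zero.2 (LinearMap.ext fun q => ?_))
  obtain ⟨d | d, hd⟩ := e.surjective (Sum.inr 0)
  · exact toWheel_deltaAct_aux O e e' d hd a b q
  · refine Eq.symm (Eq.trans ?_ ((toWheel_deltaAct_aux O ((Equiv.sumComm E D).trans e)
      ((Equiv.sumComm E' D').trans e') d hd b a q).trans ?_))
    · rfl
    · refine congrArg (fun x => O.toWheel (O.deltaAct x q)) ?_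
      exact act_congr (Equiv.ext (by rintro ((x | x) | x) <;> rfl))
        (Equiv.ext (by rintro ((x | x) | x) <;> rfl)) rfl

/-- The map `α : δ_{1,0} |δ_{1,1} O| ⊛ δ_{0,1} O → |δ_{1,1} O|` induced by `deltaAct`. -/
def wheelAct (O : NUOperad k) {A A' B B' : Type} [Finite A] [Finite A'] [Finite B] [Finite B'] :
    val O.wheel (Pt A) A' →ₗ[k] val O.toMod B (Pt B') →ₗ[k] val O.wheel (A ⊕ B) (A' ⊕ B') :=
  (O.commSub ⟨Pt A, A'⟩).liftQ O.deltaActWheel O.commSub_le_ker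

lemma wheelAct_toWheel (O : NUOperad k) {A A' B B' : Type} [Finite A] [Finite A'] [Finite B]
    [Finite B'] (r : val O.toMod (Pt (Pt A)) (Pt A')) (q : val O.toMod B (Pt B')) :
    O.wheelAct (O.toWheel r) q = O.toWheel (O.deltaAct r q) := rfl

end NUOperad

/-! The modules of the theorem and the contraction maps. -/

variable (k : Type u) [Field k]

/-- `O ↦ Λ* O` -/
def lambdaFunctor : NUOperad k ⥤ FBMod k := NUOperad.forget k ⋙ LambdaStar k

/-- `O ↦ S* |δ_{1,1} O|` -/
def symWheelFunctor : NUOperad k ⥤ FBMod k := NUOperad.wheelFunctor k ⋙ SStar k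

/-- `O ↦ Λ* O ⊛ S* |δ_{1,1} O|` -/
def lambdaSymFunctor : NUOperad k ⥤ FBMod k where
  obj O := dayConv ((lambdaFunctor k).obj O) ((symWheelFunctor k).obj O)
  map f := dayConvMap ((lambdaFunctor k).map f) ((symWheelFunctor k).map f)
  map_id O := by
    rw [CategoryTheory.Functor.map_id, CategoryTheory.Functor.map_id, dayConvMap_id]
  map_comp f g := by
    rw [CategoryTheory.Functor.map_comp, CategoryTheory.Functor.map_comp, dayConvMap_comp]

/-- The projection `Λ* O ⊛ S* |δ_{1,1} O| → Λ* O` induced by `|δ_{1,1} O| → 0`. -/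
def lambdaSymProj : lambdaSymFunctor k ⟶ lambdaFunctor k where
  app O := proj ((lambdaFunctor k).obj O) ((NUOperad.wheelFunctor k).obj O)
  naturality _ _ f := proj_naturality ((lambdaFunctor k).map f) ((NUOperad.wheelFunctor k).map f)

/-- The underlying `FB × FB`-module of a `(k dwb)_-`-module; `FB × FB` is identified with its
opposite by inversion. -/
def underlying : KDwbTwMod k ⥤ FBMod k :=
  ObjectProperty.ι _ ⋙ (Functor.whiskeringLeft _ _ (ModuleCat.{u} k)).obj (fb2ToKDwbTw k)

variable {k}

/-- The contraction of the added points of `X ⊔ {1}` and of `Y ⊔ {1}`, in a `(k dwb)_-`-module. -/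
def contraction (M : KDwbTwMod k) {X Y : Type} [Finite X] [Finite Y] :
    val ((underlying k).obj M) (Pt X) (Pt Y) →ₗ[k] val ((underlying k).obj M) X Y :=
  (M.obj.map ((uwbOrdToTw k).map (X := ⟨⟨X, Y⟩⟩) (Y := ⟨⟨Pt X, Pt Y⟩⟩)
    (UwbOrd.Hom.pair ⟨X, Y⟩)).op).hom

end Operads

section Induced

/-! Bijections that move the two added points to the end. -/

def shuffleOne (D A B E : Type) : ((D ⊕ Pt A) ⊕ B) ⊕ E ≃ Pt ((D ⊕ (A ⊕ B)) ⊕ E) where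
  toFun
    | Sum.inl (Sum.inl (Sum.inl d)) => Sum.inl (Sum.inl (Sum.inl d))
    | Sum.inl (Sum.inl (Sum.inr (Sum.inl a))) => Sum.inl (Sum.inl (Sum.inr (Sum.inl a)))
    | Sum.inl (Sum.inl (Sum.inr (Sum.inr i))) => Sum.inr i
    | Sum.inl (Sum.inr b) => Sum.inl (Sum.inl (Sum.inr (Sum.inr b)))
    | Sum.inr e => Sum.inl (Sum.inr e)
  invFun
    | Sum.inl (Sum.inl (Sum.inl d)) => Sum.inl (Sum.inl (Sum.inl d))
    | Sum.inl (Sum.inl (Sum.inr (Sum.inl a))) => Sum.inl (Sum.inl (Sum.inr (Sum.inl a)))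
    | Sum.inl (Sum.inl (Sum.inr (Sum.inr b))) => Sum.inl (Sum.inr b)
    | Sum.inl (Sum.inr e) => Sum.inr e
    | Sum.inr i => Sum.inl (Sum.inl (Sum.inr (Sum.inr i)))
  left_inv := by rintro (((d | (a | i)) | b) | e) <;> rfl
  right_inv := by rintro (((d | (a | b)) | e) | i) <;> rfl

def shuffleOne' (D A B E : Type) : ((D ⊕ A) ⊕ Pt B) ⊕ E ≃ Pt ((D ⊕ (A ⊕ B)) ⊕ E) where
  toFun
    | Sum.inl (Sum.inl (Sum.inl d)) => Sum.inl (Sum.inl (Sum.inl d))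
    | Sum.inl (Sum.inl (Sum.inr a)) => Sum.inl (Sum.inl (Sum.inr (Sum.inl a)))
    | Sum.inl (Sum.inr (Sum.inl b)) => Sum.inl (Sum.inl (Sum.inr (Sum.inr b)))
    | Sum.inl (Sum.inr (Sum.inr i)) => Sum.inr i
    | Sum.inr e => Sum.inl (Sum.inr e)
  invFun
    | Sum.inl (Sum.inl (Sum.inl d)) => Sum.inl (Sum.inl (Sum.inl d))
    | Sum.inl (Sum.inl (Sum.inr (Sum.inl a))) => Sum.inl (Sum.inl (Sum.inr a))
    | Sum.inl (Sum.inl (Sum.inr (Sum.inr b))) => Sum.inl (Sum.inr (Sum.inl b))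
    | Sum.inl (Sum.inr e) => Sum.inr e
    | Sum.inr i => Sum.inl (Sum.inr (Sum.inr i))
  left_inv := by rintro (((d | a) | (b | i)) | e) <;> rfl
  right_inv := by rintro (((d | (a | b)) | e) | i) <;> rfl

def shuffleTwo (D B E A : Type) : (D ⊕ B) ⊕ (E ⊕ Pt A) ≃ Pt (D ⊕ (E ⊕ (A ⊕ B))) where
  toFun
    | Sum.inl (Sum.inl d) => Sum.inl (Sum.inl d)
    | Sum.inl (Sum.inr b) => Sum.inl (Sum.inr (Sum.inr (Sum.inr b)))
    | Sum.inr (Sum.inl e) => Sum.inl (Sum.inr (Sum.inl e))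
    | Sum.inr (Sum.inr (Sum.inl a)) => Sum.inl (Sum.inr (Sum.inr (Sum.inl a)))
    | Sum.inr (Sum.inr (Sum.inr i)) => Sum.inr i
  invFun
    | Sum.inl (Sum.inl d) => Sum.inl (Sum.inl d)
    | Sum.inl (Sum.inr (Sum.inl e)) => Sum.inr (Sum.inl e)
    | Sum.inl (Sum.inr (Sum.inr (Sum.inl a))) => Sum.inr (Sum.inr (Sum.inl a))
    | Sum.inl (Sum.inr (Sum.inr (Sum.inr b))) => Sum.inl (Sum.inr b)
    | Sum.inr i => Sum.inr (Sum.inr (Sum.inr i))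
  left_inv := by rintro ((d | b) | (e | (a | i))) <;> rfl
  right_inv := by rintro ((d | (e | (a | b))) | i) <;> rfl

def shuffleTwo' (D B E A : Type) : (D ⊕ Pt B) ⊕ (E ⊕ A) ≃ Pt (D ⊕ (E ⊕ (A ⊕ B))) where
  toFun
    | Sum.inl (Sum.inl d) => Sum.inl (Sum.inl d)
    | Sum.inl (Sum.inr (Sum.inl b)) => Sum.inl (Sum.inr (Sum.inr (Sum.inr b)))
    | Sum.inl (Sum.inr (Sum.inr i)) => Sum.inr i
    | Sum.inr (Sum.inl e) => Sum.inl (Sum.inr (Sum.inl e))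
    | Sum.inr (Sum.inr a) => Sum.inl (Sum.inr (Sum.inr (Sum.inl a)))
  invFun
    | Sum.inl (Sum.inl d) => Sum.inl (Sum.inl d)
    | Sum.inl (Sum.inr (Sum.inl e)) => Sum.inr (Sum.inl e)
    | Sum.inl (Sum.inr (Sum.inr (Sum.inl a))) => Sum.inr (Sum.inr a)
    | Sum.inl (Sum.inr (Sum.inr (Sum.inr b))) => Sum.inl (Sum.inr (Sum.inl b))
    | Sum.inr i => Sum.inl (Sum.inr (Sum.inr i))
  left_inv := by rintro ((d | (b | i)) | (e | a)) <;> rfl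
  right_inv := by rintro ((d | (e | (a | b))) | i) <;> rfl

def shuffleThree (D A E : Type) : (D ⊕ Pt A) ⊕ E ≃ Pt (D ⊕ (E ⊕ A)) where
  toFun
    | Sum.inl (Sum.inl d) => Sum.inl (Sum.inl d)
    | Sum.inl (Sum.inr (Sum.inl a)) => Sum.inl (Sum.inr (Sum.inr a))
    | Sum.inl (Sum.inr (Sum.inr i)) => Sum.inr i
    | Sum.inr e => Sum.inl (Sum.inr (Sum.inl e))
  invFun
    | Sum.inl (Sum.inl d) => Sum.inl (Sum.inl d)
    | Sum.inl (Sum.inr (Sum.inl e)) => Sum.inr e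
    | Sum.inl (Sum.inr (Sum.inr a)) => Sum.inl (Sum.inr (Sum.inl a))
    | Sum.inr i => Sum.inl (Sum.inr (Sum.inr i))
  left_inv := by rintro ((d | (a | i)) | e) <;> rfl
  right_inv := by rintro ((d | (e | a)) | i) <;> rfl

variable {k : Type u} [Field k]

/-- The element `[w] ⊗ [v]` of `Λ* O ⊛ S* |δ_{1,1} O|`, for `w ∈ O^{⊛ d}` and
`v ∈ |δ_{1,1} O|^{⊛ e}`. -/
def corollasWheels (O : NUOperad k) {d e : ℕ} {D D' E E' : Type} [Finite D] [Finite D'] [Finite E]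
    [Finite E'] (w : val (convPow O.toMod d) D D') (v : val (convPow O.wheel e) E E') :
    val ((lambdaSymFunctor k).obj O) (D ⊕ E) (D' ⊕ E') :=
  dayMk (F := (lambdaFunctor k).obj O) (G := (symWheelFunctor k).obj O) (cls true w) (cls false v)

/-- A family of contraction maps `δ_{1,1} L → L`, where `L = Λ* O ⊛ S* |δ_{1,1} O|`, is induced by
the structure maps of `O` if, on decomposable elements,
* contracting an input of `p` with the output of `q` sends `(w ∧ p ∧ q) ⊗ v` to `(w ∧ p ∘ q) ⊗ v`;
* contracting an input of the wheel `a` with the output of `q` sends `(w ∧ q) ⊗ v a` to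
  `w ⊗ v α(a, q)`;
* contracting an input of `r` with the output of `r` sends `(w ∧ r) ⊗ v` to `w ⊗ v [r]`. -/
structure IsInducedContraction (O : NUOperad k)
    (κ : ∀ (X Y : Type) [Finite X] [Finite Y],
      val ((lambdaSymFunctor k).obj O) (Pt X) (Pt Y) →ₗ[k] val ((lambdaSymFunctor k).obj O) X Y) :
    Prop where
  corolla_corolla : ∀ {d e : ℕ} {D D' A A' B B' E E' : Type} [Finite D] [Finite D'] [Finite A]
    [Finite A'] [Finite B] [Finite B'] [Finite E] [Finite E']
    (w : val (convPow O.toMod d) D D') (p : val O.toMod (Pt A) A') (q : val O.toMod B (Pt B'))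
    (v : val (convPow O.wheel e) E E'),
    κ _ _ (act _ (shuffleOne D A B E) (shuffleOne' D' A' B' E')
        (corollasWheels O (snoc (snoc w p) q) v)) =
      corollasWheels O (snoc w (O.comp p q)) v
  wheel_corolla : ∀ {d e : ℕ} {D D' A A' B B' E E' : Type} [Finite D] [Finite D'] [Finite A]
    [Finite A'] [Finite B] [Finite B'] [Finite E] [Finite E']
    (w : val (convPow O.toMod d) D D') (q : val O.toMod B (Pt B'))
    (v : val (convPow O.wheel e) E E') (a : val O.wheel (Pt A) A'),
    κ _ _ (act _ (shuffleTwo D B E A) (shuffleTwo' D' B' E' A')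
        (corollasWheels O (snoc w q) (snoc v a))) =
      corollasWheels O w (snoc v (O.wheelAct a q))
  corolla_self : ∀ {d e : ℕ} {D D' A A' E E' : Type} [Finite D] [Finite D'] [Finite A]
    [Finite A'] [Finite E] [Finite E']
    (w : val (convPow O.toMod d) D D') (r : val O.toMod (Pt A) (Pt A'))
    (v : val (convPow O.wheel e) E E'),
    κ _ _ (act _ (shuffleThree D A E) (shuffleThree D' A' E')
        (corollasWheels O (snoc w r) v)) =
      corollasWheels O w (snoc v (O.toWheel r))

/-- The contraction maps of a `(k dwb)_-`-module `M`, transported along an isomorphism from the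
underlying `FB × FB`-module of `M` to `L`. -/
def transportedContraction {M : KDwbTwMod k} {L : FBMod k} (φ : (underlying k).obj M ≅ L)
    (X Y : Type) [Finite X] [Finite Y] : val L (Pt X) (Pt Y) →ₗ[k] val L X Y :=
  (φ.hom.app ⟨X, Y⟩).hom ∘ₗ contraction M ∘ₗ (φ.inv.app ⟨Pt X, Pt Y⟩).hom

end Induced

end Wheeled

end

open CategoryTheory Wheeled

noncomputable section

universe u

namespace Wheeled

/-! A `(k dwb)_-`-module can be built from an `FB × FB`-module `L` with natural contractions `L(X ⊔
1, Y ⊔ 1) → L(X, Y)` such that contracting two pairs of points in the two possible orders gives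
opposite results. A morphism of degree `n` acts by contracting its `n` labelled pairs one after the
other. Adjacent transpositions of labels change the sign, hence every permutation acts by its
signature (`Contraction.signAt`), and the action descends to the twisted category
(`Contraction.onHom_permute`, `Contraction.toModule`).

It remains to construct such contractions on `L = Λ* O ⊛ S* |δ_{1,1} O|`. Elements of `O` have
exactly one output and elements of `|δ_{1,1} O|` have none (`subsingleton_wheel`). So a chosen
output lies in a well defined factor `q` of `Λ* O`, which can be split off: the sum over all ways to
separate one factor (`coprod`) is followed by a map that keeps only the term in which the separated
factor contains the marked point (`dayLiftSnd_coprod`). Write the element as `m · q`. If the chosen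
input lies in `m`, then `q` is plugged into `m`, where partial composition in `O` and the action `α`
on wheels are extended to products as derivations (`symPlug`, `dayPlug`). If it lies in `q`, then
`q` is closed up to a wheel, which is multiplied with `m`. This is `ContrData.contr`.

For the anticommutation (`ContrData.contr_contr`), split off two factors and write the element as `m
· p · q` with one of the outputs in each of `p` and `q`; if both were outputs of the same factor,
that factor would be zero. Products of elements of `O` anticommute, so reversing the order of
contraction exchanges `p` and `q` and gives the sign, and the two composites have to agree exactly.
Each input lies in `m`, `p` or `q`, which makes nine cases. Three of them are stable under the
exchange of `p` and `q`: two plugs into `m` (parallel associativity), two separate loops (wheels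
commute), and a cycle through `p` and `q` (commutators vanish in `|δ_{1,1} O|`). The other six form
three pairs: a chain from `q` through `p` into `m` (sequential associativity), a loop together with
a plug into `m` (Leibniz rule), and a plug into a looped operation (definition of `α`).

`ContrData` collects what this argument uses, so that it also applies to `Λ* O` alone, with the
product by wheels set to zero. A morphism that preserves plugs and products preserves the
contractions (`ContrData.isHom`). This gives the naturality in `O`, and it shows that the projection
`L → Λ* O` is a morphism of modules, since the augmentation kills every product with a wheel. -/

open FBMod NUOperad
-- Universal property of the Day convolution, with and without a marked point
section DayUniversal

variable {k : Type u} [Field k] {F G : FBMod k}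
variable {A A' B B' C C' D D' X X' Y Y' : Type} [Finite A] [Finite A'] [Finite B] [Finite B']
  [Finite C] [Finite C'] [Finite D] [Finite D'] [Finite X] [Finite X'] [Finite Y] [Finite Y']

/-- The decomposition of `X` given by a function with values in `Bool`. -/
def boolSum (c : X → Bool) : {x // c x = false} ⊕ {x // c x = true} ≃ X where
  toFun := Sum.elim Subtype.val Subtype.val
  invFun x := if h : c x = false then Sum.inl ⟨x, h⟩ else Sum.inr ⟨x, by simpa using h⟩
  left_inv := by
    rintro (⟨x, h⟩ | ⟨x, h⟩) <;> simp [h]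
  right_inv x := by
    by_cases h : c x = false <;> simp [h]

/-- The left part of a decomposition `A ⊔ B ≅ X`. -/
def leftPart (e : A ⊕ B ≃ X) (c : X → Bool) (h : ∀ z, c (e z) = z.isRight) :
    A ≃ {x // c x = false} where
  toFun a := ⟨e (Sum.inl a), h _⟩
  invFun x := (e.symm x.1).getLeft
    (by simpa using Sum.isRight_eq_false.1 <| (h (e.symm x.1)).symm.trans (by simpa using x.2))
  left_inv a := by simp
  right_inv x := by ext; simp

/-- The right part of a decomposition `A ⊔ B ≅ X`. -/
def rightPart (e : A ⊕ B ≃ X) (c : X → Bool) (h : ∀ z, c (e z) = z.isRight) :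
    B ≃ {x // c x = true} where
  toFun a := ⟨e (Sum.inr a), h _⟩
  invFun x := (e.symm x.1).getRight
    (by simpa using (h (e.symm x.1)).symm.trans (by simpa using x.2))
  left_inv a := by simp
  right_inv x := by ext; simp

/-- Parts are subtypes that depend on the decomposition, so equal decompositions still have
different types as parts. Bijections onto them are compared through the underlying elements, which
reduces identities in `F ⊛ G` to identities of maps of sets. -/
lemma dayIncl_map_eq (F G : FBMod k) {Z P Q : FB2} {c c' : Coloring Z Bool} (h : c = c')
    (f : P ⟶ c.part false) (f' : P ⟶ c'.part false) (g : Q ⟶ c.part true) (g' : Q ⟶ c'.part true)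
    (hf : ∀ x, (f.fst x).1 = (f'.fst x).1) (hf' : ∀ x, (f.snd x).1 = (f'.snd x).1)
    (hg : ∀ x, (g.fst x).1 = (g'.fst x).1) (hg' : ∀ x, (g.snd x).1 = (g'.snd x).1) (a b) :
    dayIncl F G c ((F.map f).hom a ⊗ₜ[k] (G.map g).hom b) =
      dayIncl F G c' ((F.map f').hom a ⊗ₜ[k] (G.map g').hom b) := by
  subst h
  obtain rfl : f = f' := FB2.Hom.ext (Equiv.ext fun x => Subtype.ext (hf x))
    (Equiv.ext fun x => Subtype.ext (hf' x))
  obtain rfl : g = g' := FB2.Hom.ext (Equiv.ext fun x => Subtype.ext (hg x))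
    (Equiv.ext fun x => Subtype.ext (hg' x))
  rfl

/-- The hypotheses determine `c`. It is a variable so that it can be supplied in a form for which
its value at a marked point is known by `rfl`. -/
lemma act_dayMk (e : A ⊕ B ≃ X) (e' : A' ⊕ B' ≃ Y) (c : Coloring ⟨X, Y⟩ Bool)
    (h : ∀ z, c.fst (e z) = z.isRight) (h' : ∀ z, c.snd (e' z) = z.isRight)
    (a : val F A A') (b : val G B B') :
    act (dayConv F G) e e' (dayMk a b) =
      dayIncl F G c (act F (leftPart e c.fst h) (leftPart e' c.snd h') a ⊗ₜ[k]
        act G (rightPart e c.fst h) (rightPart e' c.snd h') b) := by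
  refine (dayTransport_incl F G _ _ _ _).trans ?_
  refine (congrArg₂ (fun f g => dayIncl F G _ (f.hom a ⊗ₜ[k] g.hom b)) (F.map_comp _ _)
    (G.map_comp _ _)).symm.trans ?_
  refine dayIncl_map_eq F G ?_ _ _ _ _ (fun _ => by rfl) (fun _ => by rfl)
    (fun _ => by rfl) (fun _ => by rfl) _ _
  ext x
  · obtain ⟨x, rfl⟩ := e.surjective x
    simpa [Coloring.push] using (h x).symm
  · obtain ⟨x, rfl⟩ := e'.surjective x
    simpa [Coloring.push] using (h' x).symm

lemma dayMk_act (f : A ≃ C) (f' : A' ≃ C') (g : B ≃ D) (g' : B' ≃ D') (a : val F A A')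
    (b : val G B B') :
    dayMk (act F f f' a) (act G g g' b) =
      act (dayConv F G) (f.sumCongr g) (f'.sumCongr g') (dayMk a b) := by
  -- An identity action is inserted so that `act_dayMk` applies to both sides with the same
  -- decomposition.
  rw [← act_refl (dayConv F G) (dayMk (act F f f' a) (act G g g' b)),
    act_dayMk _ _ ⟨Sum.isRight, Sum.isRight⟩ (fun _ => rfl) (fun _ => rfl),
    act_dayMk _ _ ⟨Sum.isRight, Sum.isRight⟩ (by rintro (x | x) <;> rfl)
      (by rintro (x | x) <;> rfl), act_act, act_act]
  exact dayIncl_map_eq F G rfl _ _ _ _ (fun _ => by rfl) (fun _ => by rfl)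
    (fun _ => by rfl) (fun _ => by rfl) _ _

/-- This permits working with external products of arbitrary finite sets instead of the parts of a
decomposition. -/
lemma dayIncl_eq_act {Z : FB2} (c : Coloring Z Bool) (a : F.obj (c.part false))
    (b : G.obj (c.part true)) :
    dayIncl F G c (a ⊗ₜ[k] b) =
      act (dayConv F G) (boolSum c.fst) (boolSum c.snd)
        (dayMk (A := {x // c.fst x = false}) (A' := {x // c.snd x = false})
          (B := {x // c.fst x = true}) (B' := {x // c.snd x = true}) a b) := by
  refine Eq.trans ?_ (act_dayMk _ _ c (by rintro (⟨x, h⟩ | ⟨x, h⟩) <;> exact h)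
    (by rintro (⟨x, h⟩ | ⟨x, h⟩) <;> exact h) _ _).symm
  have h1 : (F.map (𝟙 (c.part false))).hom a = a := by rw [F.map_id]; rfl
  have h2 : (G.map (𝟙 (c.part true))).hom b = b := by rw [G.map_id]; rfl
  refine (congrArg₂ (fun a b => dayIncl F G c (a ⊗ₜ[k] b)) h1 h2).symm.trans ?_
  exact dayIncl_map_eq F G rfl _ _ _ _ (fun _ => by rfl) (fun _ => by rfl)
    (fun _ => by rfl) (fun _ => by rfl) _ _

/-- The external products span `F ⊛ G`. -/
lemma day_induction {P : val (dayConv F G) X Y → Prop} (h0 : P 0)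
    (hadd : ∀ s t, P s → P t → P (s + t))
    (hmk : ∀ {A A' B B' : Type} [Finite A] [Finite A'] [Finite B] [Finite B'] (e : A ⊕ B ≃ X)
      (e' : A' ⊕ B' ≃ Y) (a : val F A A') (b : val G B B'),
      P (act (dayConv F G) e e' (dayMk a b))) (t) : P t := by
  refine DirectSum.induction_on (motive := P) t h0 (fun c x => ?_) hadd
  refine TensorProduct.induction_on (motive := fun x => P (dayIncl F G c x)) x ?_ ?_ ?_
  · rw [map_zero]; exact h0
  · intro a b
    rw [dayIncl_eq_act]
    exact hmk _ _ _ _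
  · intro a b ha hb
    rw [map_add]; exact hadd _ _ ha hb

/-- Families of bilinear maps on the external decompositions of `(X, Y)`. -/
abbrev BiFam (F G : FBMod k) (X Y : Type) (M : Type u) [AddCommGroup M] [Module k M] : Type _ :=
  ∀ {A A' B B' : Type} [Finite A] [Finite A'] [Finite B] [Finite B'], (A ⊕ B ≃ X) →
    (A' ⊕ B' ≃ Y) → (val F A A' →ₗ[k] val G B B' →ₗ[k] M)

variable {M : Type u} [AddCommGroup M] [Module k M]

/-- Naturality of a family of bilinear maps. -/
def IsNat (Θ : BiFam F G X Y M) : Prop :=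
  ∀ {A A' B B' C C' D D' : Type} [Finite A] [Finite A'] [Finite B] [Finite B'] [Finite C]
    [Finite C'] [Finite D] [Finite D'] (f : A ≃ C) (f' : A' ≃ C') (g : B ≃ D) (g' : B' ≃ D')
    (e : C ⊕ D ≃ X) (e' : C' ⊕ D' ≃ Y) (a : val F A A') (b : val G B B'),
    Θ e e' (act F f f' a) (act G g g' b) =
      Θ ((f.sumCongr g).trans e) ((f'.sumCongr g').trans e') a b

/-- The map out of `F ⊛ G` given by a family of bilinear maps. -/
def dayLift (Θ : BiFam F G X Y M) : val (dayConv F G) X Y →ₗ[k] M :=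
  dayDesc fun c => TensorProduct.lift (Θ (boolSum c.fst) (boolSum c.snd))

lemma dayLift_incl (Θ : BiFam F G X Y M) (c : Coloring ⟨X, Y⟩ Bool) (a b) :
    dayLift Θ (dayIncl F G c (a ⊗ₜ[k] b)) = Θ (boolSum c.fst) (boolSum c.snd) a b :=
  dayDesc_incl _ c _

/-- `A` and `B` are carried onto the two fibres by `leftPart` and `rightPart`, and naturality of the
family absorbs these bijections. -/
lemma dayLift_mk {Θ : BiFam F G X Y M} (h : IsNat Θ) (e : A ⊕ B ≃ X) (e' : A' ⊕ B' ≃ Y)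
    (a : val F A A') (b : val G B B') :
    dayLift Θ (act (dayConv F G) e e' (dayMk a b)) = Θ e e' a b := by
  rw [act_dayMk e e' ⟨fun x => (e.symm x).isRight, fun x => (e'.symm x).isRight⟩ (by simp)
    (by simp)]
  refine (dayLift_incl Θ _ _ _).trans ?_
  refine (h (leftPart e _ _) (leftPart e' _ _) (rightPart e _ _) (rightPart e' _ _)
    (boolSum fun x => (e.symm x).isRight)
    (boolSum fun x => (e'.symm x).isRight) a b).trans ?_
  congr 2
  congr 1
  · ext (x | x) <;> rfl
  · ext (x | x) <;> rfl

/-- `δ_{1,0} F` -/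
def delta10 (F : FBMod k) : FBMod k where
  obj Z := F.obj ⟨Pt Z.fst, Z.snd⟩
  map {Z W} f := F.map (X := ⟨Pt Z.fst, Z.snd⟩) (Y := ⟨Pt W.fst, W.snd⟩) ⟨onPt f.fst, f.snd⟩
  map_id Z := by
    refine Eq.trans ?_ (F.map_id ⟨Pt Z.fst, Z.snd⟩)
    congr 1
    exact FB2.Hom.ext Equiv.sumCongr_refl rfl
  map_comp {Z W V} f g := by
    refine Eq.trans ?_ (F.map_comp (X := ⟨Pt Z.fst, Z.snd⟩)
      (Y := ⟨Pt W.fst, W.snd⟩) (Z := ⟨Pt V.fst, V.snd⟩) ⟨onPt f.fst, f.snd⟩ ⟨onPt g.fst, g.snd⟩)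
    congr 1
    exact FB2.Hom.ext (Equiv.ext (by rintro (x | x) <;> rfl)) rfl

/-- `δ_{0,1} F` -/
def delta01 (F : FBMod k) : FBMod k where
  obj Z := F.obj ⟨Z.fst, Pt Z.snd⟩
  map {Z W} f := F.map (X := ⟨Z.fst, Pt Z.snd⟩) (Y := ⟨W.fst, Pt W.snd⟩) ⟨f.fst, onPt f.snd⟩
  map_id Z := by
    refine Eq.trans ?_ (F.map_id ⟨Z.fst, Pt Z.snd⟩)
    congr 1
    exact FB2.Hom.ext rfl Equiv.sumCongr_refl
  map_comp {Z W V} f g := by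
    refine Eq.trans ?_ (F.map_comp (X := ⟨Z.fst, Pt Z.snd⟩)
      (Y := ⟨W.fst, Pt W.snd⟩) (Z := ⟨V.fst, Pt V.snd⟩) ⟨f.fst, onPt f.snd⟩ ⟨g.fst, onPt g.snd⟩)
    congr 1
    exact FB2.Hom.ext rfl (Equiv.ext (by rintro (x | x) <;> rfl))

/-- The part of `X ⊔ {1}` given by a predicate that holds at the added point. -/
def ptPart (p : Pt X → Prop) (h : p (Sum.inr 0)) : {z // p z} ≃ Pt {x // p (Sum.inl x)} where
  toFun z := match z with
    | ⟨Sum.inl x, hx⟩ => Sum.inl ⟨x, hx⟩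
    | ⟨Sum.inr i, _⟩ => Sum.inr i
  invFun z := match z with
    | Sum.inl x => ⟨Sum.inl x.1, x.2⟩
    | Sum.inr i => ⟨Sum.inr i, Subsingleton.elim 0 i ▸ h⟩
  left_inv := by rintro ⟨x | i, h⟩ <;> rfl
  right_inv := by rintro (x | i) <;> rfl

/-- The part of `X ⊔ {1}` given by a predicate that does not hold at the added point. -/
def noPtPart (p : Pt X → Prop) (h : ¬ p (Sum.inr 0)) : {z // p z} ≃ {x // p (Sum.inl x)} :=
  (inlSub (fun _ => Iff.rfl) fun i => Subsingleton.elim 0 i ▸ h).symm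

/-- The map out of `(F ⊛ G)(X ⊔ {1}, Y)` given by two families of bilinear maps, according to the
factor that contains the added point. -/
def dayLiftFst (Θ₁ : BiFam (delta10 F) G X Y M) (Θ₂ : BiFam F (delta10 G) X Y M) :
    val (dayConv F G) (Pt X) Y →ₗ[k] M :=
  dayDesc fun c => if h : c.fst (Sum.inr 0) = false then
    TensorProduct.lift ((Θ₁ (boolSum fun x => c.fst (Sum.inl x)) (boolSum c.snd)).compl₁₂
      (act F (ptPart (fun x => c.fst x = false) h) (Equiv.refl _))
      (act G (noPtPart (fun x => c.fst x = true) (by simp [h])) (Equiv.refl _)))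
    else
    TensorProduct.lift ((Θ₂ (boolSum fun x => c.fst (Sum.inl x)) (boolSum c.snd)).compl₁₂
      (act F (noPtPart (fun x => c.fst x = false) h) (Equiv.refl _))
      (act G (ptPart (fun x => c.fst x = true) (by simpa using h)) (Equiv.refl _)))

lemma dayLiftFst_incl_left (Θ₁ : BiFam (delta10 F) G X Y M) (Θ₂ : BiFam F (delta10 G) X Y M)
    (c : Coloring ⟨Pt X, Y⟩ Bool) (h : c.fst (Sum.inr 0) = false) (a b) :
    dayLiftFst Θ₁ Θ₂ (dayIncl F G c (a ⊗ₜ[k] b)) =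
      Θ₁ (boolSum fun x => c.fst (Sum.inl x)) (boolSum c.snd)
        (act F (ptPart (fun x => c.fst x = false) h) (Equiv.refl _) a)
        (act G (noPtPart (fun x => c.fst x = true) (by simp [h])) (Equiv.refl _) b) := by
  refine (dayDesc_incl _ c _).trans ?_
  rw [dif_pos h]; rfl

lemma dayLiftFst_incl_right (Θ₁ : BiFam (delta10 F) G X Y M) (Θ₂ : BiFam F (delta10 G) X Y M)
    (c : Coloring ⟨Pt X, Y⟩ Bool) (h : c.fst (Sum.inr 0) = true) (a b) :
    dayLiftFst Θ₁ Θ₂ (dayIncl F G c (a ⊗ₜ[k] b)) =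
      Θ₂ (boolSum fun x => c.fst (Sum.inl x)) (boolSum c.snd)
        (act F (noPtPart (fun x => c.fst x = false) (by simp [h])) (Equiv.refl _) a)
        (act G (ptPart (fun x => c.fst x = true) h) (Equiv.refl _) b) := by
  refine (dayDesc_incl _ c _).trans ?_
  rw [dif_neg (by simp [h])]; rfl

lemma dayLiftFst_left {Θ₁ : BiFam (delta10 F) G X Y M} (Θ₂ : BiFam F (delta10 G) X Y M)
    (h : IsNat Θ₁) (e : A ⊕ B ≃ X) (e' : A' ⊕ B' ≃ Y) (a : val F (Pt A) A') (b : val G B B') :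
    dayLiftFst Θ₁ Θ₂ (act (dayConv F G) ((sumRightComm A (Fin 1) B).trans (onPt e)) e'
      (dayMk a b)) = Θ₁ e e' a b := by
  -- The added point gets the colour of the first factor, which decides the case distinction in
  -- `dayLiftFst` by `rfl`.
  rw [act_dayMk _ _ ⟨Sum.elim (fun x => (e.symm x).isRight) fun _ => false,
      fun x => (e'.symm x).isRight⟩
    (by rintro ((x | x) | x) <;> simp [sumRightComm])
    (by simp)]
  refine (dayLiftFst_incl_left Θ₁ Θ₂ _ rfl _ _).trans ?_
  rw [act_act, act_act]
  refine Eq.trans ?_ ((h (leftPart e (fun x => (e.symm x).isRight) (by simp))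
    (leftPart e' (fun x => (e'.symm x).isRight) (by simp))
    (rightPart e (fun x => (e.symm x).isRight) (by simp))
    (rightPart e' (fun x => (e'.symm x).isRight) (by simp)) (boolSum fun x => (e.symm x).isRight)
    (boolSum fun x => (e'.symm x).isRight) a b).trans ?_)
  · exact congrArg₂ (fun a b => Θ₁ _ _ a b) (act_congr (by ext (x | x) <;> rfl) rfl rfl)
      (act_congr (by ext x; rfl) rfl rfl)
  · congr 2
    congr 1
    · ext (x | x) <;> rfl
    · ext (x | x) <;> rfl

lemma dayLiftFst_right (Θ₁ : BiFam (delta10 F) G X Y M) {Θ₂ : BiFam F (delta10 G) X Y M}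
    (h : IsNat Θ₂) (e : A ⊕ B ≃ X) (e' : A' ⊕ B' ≃ Y) (a : val F A A') (b : val G (Pt B) B') :
    dayLiftFst Θ₁ Θ₂ (act (dayConv F G) ((Equiv.sumAssoc A B (Fin 1)).symm.trans (onPt e)) e'
      (dayMk a b)) = Θ₂ e e' a b := by
  rw [act_dayMk _ _ ⟨Sum.elim (fun x => (e.symm x).isRight) fun _ => true,
      fun x => (e'.symm x).isRight⟩
    (by rintro (x | x | x) <;> simp)
    (by simp)]
  refine (dayLiftFst_incl_right Θ₁ Θ₂ _ rfl _ _).trans ?_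
  rw [act_act, act_act]
  refine Eq.trans ?_ ((h (leftPart e (fun x => (e.symm x).isRight) (by simp))
    (leftPart e' (fun x => (e'.symm x).isRight) (by simp))
    (rightPart e (fun x => (e.symm x).isRight) (by simp))
    (rightPart e' (fun x => (e'.symm x).isRight) (by simp)) (boolSum fun x => (e.symm x).isRight)
    (boolSum fun x => (e'.symm x).isRight) a b).trans ?_)
  · exact congrArg₂ (fun a b => Θ₂ _ _ a b) (act_congr (by ext x; rfl) rfl rfl)
      (act_congr (by ext (x | x) <;> rfl) rfl rfl)
  · congr 2
    congr 1
    · ext (x | x) <;> rfl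
    · ext (x | x) <;> rfl

/-- With the zero family on the first factor, `dayLiftFst` retains only the terms whose added point
lies in the second factor. This is what singles out one term of `coprod`. -/
lemma dayLiftFst_zero_incl (Θ₂ : BiFam F (delta10 G) X Y M) (c : Coloring ⟨Pt X, Y⟩ Bool)
    (h : c.fst (Sum.inr 0) = false) (a b) :
    dayLiftFst (fun _ _ => 0) Θ₂ (dayIncl F G c (a ⊗ₜ[k] b)) = 0 := by
  exact dayLiftFst_incl_left _ _ c h a b

/-- The map out of `(F ⊛ G)(X, Y ⊔ {1})` given by two families of bilinear maps, according to the
factor that contains the added point. -/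
def dayLiftSnd (Θ₁ : BiFam (delta01 F) G X Y M) (Θ₂ : BiFam F (delta01 G) X Y M) :
    val (dayConv F G) X (Pt Y) →ₗ[k] M :=
  dayDesc fun c => if h : c.snd (Sum.inr 0) = false then
    TensorProduct.lift ((Θ₁ (boolSum c.fst) (boolSum fun x => c.snd (Sum.inl x))).compl₁₂
      (act F (Equiv.refl _) (ptPart (fun x => c.snd x = false) h))
      (act G (Equiv.refl _) (noPtPart (fun x => c.snd x = true) (by simp [h]))))
    else
    TensorProduct.lift ((Θ₂ (boolSum c.fst) (boolSum fun x => c.snd (Sum.inl x))).compl₁₂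
      (act F (Equiv.refl _) (noPtPart (fun x => c.snd x = false) h))
      (act G (Equiv.refl _) (ptPart (fun x => c.snd x = true) (by simpa using h))))

lemma dayLiftSnd_incl_left (Θ₁ : BiFam (delta01 F) G X Y M) (Θ₂ : BiFam F (delta01 G) X Y M)
    (c : Coloring ⟨X, Pt Y⟩ Bool) (h : c.snd (Sum.inr 0) = false) (a b) :
    dayLiftSnd Θ₁ Θ₂ (dayIncl F G c (a ⊗ₜ[k] b)) =
      Θ₁ (boolSum c.fst) (boolSum fun x => c.snd (Sum.inl x))
        (act F (Equiv.refl _) (ptPart (fun x => c.snd x = false) h) a)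
        (act G (Equiv.refl _) (noPtPart (fun x => c.snd x = true) (by simp [h])) b) := by
  refine (dayDesc_incl _ c _).trans ?_
  rw [dif_pos h]; rfl

lemma dayLiftSnd_incl_right (Θ₁ : BiFam (delta01 F) G X Y M) (Θ₂ : BiFam F (delta01 G) X Y M)
    (c : Coloring ⟨X, Pt Y⟩ Bool) (h : c.snd (Sum.inr 0) = true) (a b) :
    dayLiftSnd Θ₁ Θ₂ (dayIncl F G c (a ⊗ₜ[k] b)) =
      Θ₂ (boolSum c.fst) (boolSum fun x => c.snd (Sum.inl x))
        (act F (Equiv.refl _) (noPtPart (fun x => c.snd x = false) (by simp [h])) a)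
        (act G (Equiv.refl _) (ptPart (fun x => c.snd x = true) h) b) := by
  refine (dayDesc_incl _ c _).trans ?_
  rw [dif_neg (by simp [h])]; rfl

lemma dayLiftSnd_left {Θ₁ : BiFam (delta01 F) G X Y M} (Θ₂ : BiFam F (delta01 G) X Y M)
    (h : IsNat Θ₁) (e : A ⊕ B ≃ X) (e' : A' ⊕ B' ≃ Y) (a : val F A (Pt A')) (b : val G B B') :
    dayLiftSnd Θ₁ Θ₂ (act (dayConv F G) e ((sumRightComm A' (Fin 1) B').trans (onPt e'))
      (dayMk a b)) = Θ₁ e e' a b := by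
  rw [act_dayMk _ _ ⟨fun x => (e.symm x).isRight, Sum.elim (fun x => (e'.symm x).isRight) fun _ => false⟩
    (by simp)
    (by rintro ((x | x) | x) <;> simp [sumRightComm])]
  refine (dayLiftSnd_incl_left Θ₁ Θ₂ _ rfl _ _).trans ?_
  rw [act_act, act_act]
  refine Eq.trans ?_ ((h (leftPart e (fun x => (e.symm x).isRight) (by simp))
    (leftPart e' (fun x => (e'.symm x).isRight) (by simp))
    (rightPart e (fun x => (e.symm x).isRight) (by simp))
    (rightPart e' (fun x => (e'.symm x).isRight) (by simp)) (boolSum fun x => (e.symm x).isRight)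
    (boolSum fun x => (e'.symm x).isRight) a b).trans ?_)
  · exact congrArg₂ (fun a b => Θ₁ _ _ a b) (act_congr rfl (by ext (x | x) <;> rfl) rfl)
      (act_congr rfl (by ext x; rfl) rfl)
  · congr 2
    congr 1
    · ext (x | x) <;> rfl
    · ext (x | x) <;> rfl

lemma dayLiftSnd_right (Θ₁ : BiFam (delta01 F) G X Y M) {Θ₂ : BiFam F (delta01 G) X Y M}
    (h : IsNat Θ₂) (e : A ⊕ B ≃ X) (e' : A' ⊕ B' ≃ Y) (a : val F A A') (b : val G B (Pt B')) :
    dayLiftSnd Θ₁ Θ₂ (act (dayConv F G) e ((Equiv.sumAssoc A' B' (Fin 1)).symm.trans (onPt e'))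
      (dayMk a b)) = Θ₂ e e' a b := by
  rw [act_dayMk _ _ ⟨fun x => (e.symm x).isRight, Sum.elim (fun x => (e'.symm x).isRight) fun _ => true⟩
    (by simp)
    (by rintro (x | x | x) <;> simp)]
  refine (dayLiftSnd_incl_right Θ₁ Θ₂ _ rfl _ _).trans ?_
  rw [act_act, act_act]
  refine Eq.trans ?_ ((h (leftPart e (fun x => (e.symm x).isRight) (by simp))
    (leftPart e' (fun x => (e'.symm x).isRight) (by simp))
    (rightPart e (fun x => (e.symm x).isRight) (by simp))
    (rightPart e' (fun x => (e'.symm x).isRight) (by simp)) (boolSum fun x => (e.symm x).isRight)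
    (boolSum fun x => (e'.symm x).isRight) a b).trans ?_)
  · exact congrArg₂ (fun a b => Θ₂ _ _ a b) (act_congr rfl (by ext x; rfl) rfl)
      (act_congr rfl (by ext (x | x) <;> rfl) rfl)
  · congr 2
    congr 1
    · ext (x | x) <;> rfl
    · ext (x | x) <;> rfl

lemma dayLiftSnd_zero_incl (Θ₂ : BiFam F (delta01 G) X Y M) (c : Coloring ⟨X, Pt Y⟩ Bool)
    (h : c.snd (Sum.inr 0) = false) (a b) :
    dayLiftSnd (fun _ _ => 0) Θ₂ (dayIncl F G c (a ⊗ₜ[k] b)) = 0 := by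
  exact dayLiftSnd_incl_left _ _ c h a b

omit [Finite X] in
/-- A decomposition of `X ⊔ {1}` is the standard one, with the added point in one of the parts. -/
lemma sum_pt_cases (e : A ⊕ B ≃ Pt X) :
    (∃ (C : Type) (_ : Finite C) (f : A ≃ Pt C) (h : C ⊕ B ≃ X),
      e = (f.sumCongr (Equiv.refl B)).trans ((sumRightComm C (Fin 1) B).trans (onPt h))) ∨
    ∃ (C : Type) (_ : Finite C) (f : B ≃ Pt C) (h : A ⊕ C ≃ X),
      e = ((Equiv.refl A).sumCongr f).trans
        ((Equiv.sumAssoc A C (Fin 1)).symm.trans (onPt h)) := by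
  obtain ⟨a | b, hx⟩ := e.surjective (Sum.inr 0)
  · obtain ⟨C, _, f, hf⟩ := exists_pt a
    obtain ⟨h, hh⟩ := exists_onPt ((sumRightComm C (Fin 1) B).symm.trans
      ((f.sumCongr (Equiv.refl B)).trans e)) (by
        simp [sumRightComm, hf, hx])
    refine Or.inl ⟨C, ‹_›, f.symm, h, ?_⟩
    rw [← hh]
    ext x : 1
    rcases x with x | x <;> simp
  · obtain ⟨C, _, f, hf⟩ := exists_pt b
    obtain ⟨h, hh⟩ := exists_onPt ((Equiv.sumAssoc A C (Fin 1)).trans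
      (((Equiv.refl A).sumCongr f).trans e)) (by
        simp [hf, hx])
    refine Or.inr ⟨C, ‹_›, f.symm, h, ?_⟩
    rw [← hh]
    ext x : 1
    rcases x with x | x <;> simp

lemma dayMk_act_left (f : A ≃ C) (f' : A' ≃ C') (a : val F A A') (b : val G B B') :
    dayMk (act F f f' a) b =
      act (dayConv F G) (f.sumCongr (Equiv.refl B)) (f'.sumCongr (Equiv.refl B')) (dayMk a b) := by
  rw [← dayMk_act, act_refl]

lemma dayMk_act_right (g : B ≃ D) (g' : B' ≃ D') (a : val F A A') (b : val G B B') :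
    dayMk a (act G g g' b) =
      act (dayConv F G) ((Equiv.refl A).sumCongr g) ((Equiv.refl A').sumCongr g')
        (dayMk a b) := by
  rw [← dayMk_act, act_refl]

lemma eq_act_symm (f : A ≃ C) (f' : A' ≃ C') (a : val F A A') :
    a = act F f.symm f'.symm (act F f f' a) := by
  rw [act_act, Equiv.self_trans_symm, Equiv.self_trans_symm, act_refl]

/-- The added point lies in exactly one factor, so `δ_{1,0}(F ⊛ G)` is the sum of `δ_{1,0} F ⊛ G`
and `F ⊛ δ_{1,0} G`. -/
lemma dayFst_induction {P : val (dayConv F G) (Pt X) Y → Prop} (h0 : P 0)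
    (hadd : ∀ s t, P s → P t → P (s + t))
    (hl : ∀ {A A' B B' : Type} [Finite A] [Finite A'] [Finite B] [Finite B'] (e : A ⊕ B ≃ X)
      (e' : A' ⊕ B' ≃ Y) (a : val F (Pt A) A') (b : val G B B'),
      P (act (dayConv F G) ((sumRightComm A (Fin 1) B).trans (onPt e)) e' (dayMk a b)))
    (hr : ∀ {A A' B B' : Type} [Finite A] [Finite A'] [Finite B] [Finite B'] (e : A ⊕ B ≃ X)
      (e' : A' ⊕ B' ≃ Y) (a : val F A A') (b : val G (Pt B) B'),
      P (act (dayConv F G) ((Equiv.sumAssoc A B (Fin 1)).symm.trans (onPt e)) e' (dayMk a b)))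
    (t) : P t := by
  refine day_induction h0 hadd (fun {A A' B B'} _ _ _ _ e e' a b => ?_) t
  obtain ⟨C, _, f, h, rfl⟩ | ⟨C, _, f, h, rfl⟩ := sum_pt_cases e
  · have := hl h e' (act F f (Equiv.refl _) a) b
    rwa [dayMk_act_left, act_act, Equiv.sumCongr_refl, Equiv.refl_trans] at this
  · have := hr h e' a (act G f (Equiv.refl _) b)
    rwa [dayMk_act_right, act_act, Equiv.sumCongr_refl, Equiv.refl_trans] at this

lemma daySnd_induction {P : val (dayConv F G) X (Pt Y) → Prop} (h0 : P 0)
    (hadd : ∀ s t, P s → P t → P (s + t))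
    (hl : ∀ {A A' B B' : Type} [Finite A] [Finite A'] [Finite B] [Finite B'] (e : A ⊕ B ≃ X)
      (e' : A' ⊕ B' ≃ Y) (a : val F A (Pt A')) (b : val G B B'),
      P (act (dayConv F G) e ((sumRightComm A' (Fin 1) B').trans (onPt e')) (dayMk a b)))
    (hr : ∀ {A A' B B' : Type} [Finite A] [Finite A'] [Finite B] [Finite B'] (e : A ⊕ B ≃ X)
      (e' : A' ⊕ B' ≃ Y) (a : val F A A') (b : val G B (Pt B')),
      P (act (dayConv F G) e ((Equiv.sumAssoc A' B' (Fin 1)).symm.trans (onPt e')) (dayMk a b)))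
    (t) : P t := by
  refine day_induction h0 hadd (fun {A A' B B'} _ _ _ _ e e' a b => ?_) t
  obtain ⟨C, _, f, h, rfl⟩ | ⟨C, _, f, h, rfl⟩ := sum_pt_cases e'
  · have := hl e h (act F (Equiv.refl _) f a) b
    rwa [dayMk_act_left, act_act, Equiv.sumCongr_refl, Equiv.refl_trans] at this
  · have := hr e h a (act G (Equiv.refl _) f b)
    rwa [dayMk_act_right, act_act, Equiv.sumCongr_refl, Equiv.refl_trans] at this

end DayUniversal

/-! ### Tensor powers and appending a factor -/

section Powers

variable {k : Type u} [Field k] {F : FBMod k}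
variable {A A' B B' C C' D D' X X' Y Y' : Type} [Finite A] [Finite A'] [Finite B] [Finite B']
  [Finite C] [Finite C'] [Finite D] [Finite D'] [Finite X] [Finite X'] [Finite Y] [Finite Y']

lemma pow_induction {d : ℕ} {P : val (convPow F d) X Y → Prop} (h0 : P 0)
    (hadd : ∀ s t, P s → P t → P (s + t)) (hsmul : ∀ (a : k) t, P t → P (a • t))
    (hmk : ∀ (c : Coloring ⟨X, Y⟩ (Fin d)) (x : ∀ i, F.obj (c.part i)),
      P (powIncl F c (PiTensorProduct.tprod k x))) (t) : P t := by
  refine DirectSum.induction_on (motive := P) t h0 (fun c x => ?_) hadd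
  refine PiTensorProduct.induction_on (motive := fun x => P (powIncl F c x)) x ?_ ?_
  · intro r x
    rw [map_smul]; exact hsmul _ _ (hmk _ _)
  · intro a b ha hb
    rw [map_add]; exact hadd _ _ ha hb

/-- The identification of the parts of equal decompositions. -/
def castPart {Z : FB2} {ι : Type} {c c' : Coloring Z ι} (h : c = c') (i : ι) :
    c.part i ⟶ c'.part i :=
  ⟨Equiv.subtypeEquivRight fun _ => by rw [h], Equiv.subtypeEquivRight fun _ => by rw [h]⟩

lemma powIncl_eq {d : ℕ} {Z : FB2} {c c' : Coloring Z (Fin d)} (h : c = c')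
    {x : ∀ i, F.obj (c.part i)} {y : ∀ i, F.obj (c'.part i)}
    (hxy : ∀ i, (F.map (castPart h i)).hom (x i) = y i) :
    powIncl F c (PiTensorProduct.tprod k x) = powIncl F c' (PiTensorProduct.tprod k y) := by
  subst h
  obtain rfl : x = y := by
    funext i
    rw [← hxy]
    exact (congrArg (fun f => f.hom (x i)) (F.map_id (c.part i))).symm
  rfl

lemma map_map_eq (F : FBMod k) {P Q R : FB2} {f : P ⟶ Q} {g : Q ⟶ R} {f' : P ⟶ R} (h : f ≫ g = f') (x) :
    (F.map g).hom ((F.map f).hom x) = (F.map f').hom x := by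
  rw [← h, F.map_comp]; rfl

/-- A bijection onto a part is determined by the underlying elements, and in the applications these
agree by `rfl`. -/
lemma map_part_eq (F : FBMod k) {Z P Q : FB2} {ι : Type} {c : Coloring Z ι} {i : ι} (f : P ⟶ Q)
    (g : Q ⟶ c.part i) (h : P ⟶ c.part i) (h1 : ∀ x, (g.fst (f.fst x)).1 = (h.fst x).1)
    (h2 : ∀ x, (g.snd (f.snd x)).1 = (h.snd x).1) (x) :
    (F.map g).hom ((F.map f).hom x) = (F.map h).hom x :=
  map_map_eq F (FB2.Hom.ext (Equiv.ext fun x => Subtype.ext (h1 x))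
    (Equiv.ext fun x => Subtype.ext (h2 x))) x

lemma map_map_part_eq (F : FBMod k) {Z P Q R : FB2} {ι : Type} {c : Coloring Z ι} {i : ι}
    (f : P ⟶ Q) (g : Q ⟶ c.part i) (f' : P ⟶ R) (g' : R ⟶ c.part i)
    (h1 : ∀ x, (g.fst (f.fst x)).1 = (g'.fst (f'.fst x)).1)
    (h2 : ∀ x, (g.snd (f.snd x)).1 = (g'.snd (f'.snd x)).1) (x) :
    (F.map g).hom ((F.map f).hom x) = (F.map g').hom ((F.map f').hom x) :=
  (map_part_eq F f g (f' ≫ g') h1 h2 x).trans (map_map_eq F rfl x).symm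

/-- The decomposition of `(A ⊔ B, A' ⊔ B')` whose last part is `(B, B')`. -/
def snocCol {d : ℕ} (c : Coloring ⟨A, A'⟩ (Fin d)) : Coloring ⟨A ⊕ B, A' ⊕ B'⟩ (Fin (d + 1)) :=
  ⟨Sum.elim (fun x => (c.fst x).castSucc) fun _ => Fin.last d,
    Sum.elim (fun y => (c.snd y).castSucc) fun _ => Fin.last d⟩

def snocInl {d : ℕ} (c : Coloring ⟨A, A'⟩ (Fin d)) (i : Fin d) :
    c.part i ⟶ (snocCol (B := B) (B' := B') c).part i.castSucc :=
  ⟨inlSub (fun _ => (Fin.castSucc_inj).symm) (fun _ h => (Fin.castSucc_ne_last i h.symm)),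
    inlSub (fun _ => (Fin.castSucc_inj).symm) (fun _ h => (Fin.castSucc_ne_last i h.symm))⟩

def snocInr {d : ℕ} (c : Coloring ⟨A, A'⟩ (Fin d)) :
    (⟨B, B'⟩ : FB2) ⟶ (snocCol (B := B) (B' := B') c).part (Fin.last d) :=
  ⟨inrAll (fun x h => (Fin.castSucc_ne_last (c.fst x) h)) (fun _ => rfl),
    inrAll (fun y h => (Fin.castSucc_ne_last (c.snd y) h)) (fun _ => rfl)⟩

/-- The resulting family is a dependent `Fin.snoc`. Only its values at `castSucc i` and at the last
index are recorded, which is exactly what a proof by `Fin.lastCases` consumes. -/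
lemma snoc_incl {d : ℕ} (c : Coloring ⟨A, A'⟩ (Fin d)) (x : ∀ i, F.obj (c.part i))
    (b : val F B B') :
    ∃ y : ∀ i, F.obj ((snocCol (B := B) (B' := B') c).part i),
      snoc (F := F) (A := A) (A' := A') (powIncl F c (PiTensorProduct.tprod k x)) b =
        powIncl F (snocCol c) (PiTensorProduct.tprod k y) ∧
      (∀ i, y (Fin.castSucc i) = (F.map (snocInl c i)).hom (x i)) ∧
      y (Fin.last d) = (F.map (snocInr c)).hom b := by
  refine ⟨Fin.snoc (α := fun i => F.obj ((snocCol (B := B) (B' := B') c).part i))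
    (fun i => (F.map (snocInl c i)).hom (x i)) ((F.map (snocInr c)).hom b), ?_, ?_, ?_⟩
  · refine (congrArg (fun f : val F B B' →ₗ[k] val (convPow F (d + 1)) (A ⊕ B) (A' ⊕ B') => f b)
      (powDesc_incl _ c (PiTensorProduct.tprod k x))).trans ?_
    refine congrArg (powIncl F (snocCol c)) ?_
    refine (LinearMap.congr_fun (PiTensorProduct.lift.tprod (R := k)
      (φ := (PiTensorProduct.tprod k (s := fun i => F.obj ((snocCol (B := B) (B' := B') c).part
        i))).curryRight.compLinearMap fun i => (F.map (snocInl c i)).hom) x)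
      ((F.map (snocInr c)).hom b)).trans ?_
    rfl
  · intro i; exact Fin.snoc_castSucc _ _ _
  · exact Fin.snoc_last _ _

lemma act_powIncl {d : ℕ} (e : X ≃ X') (e' : Y ≃ Y') (c : Coloring ⟨X, Y⟩ (Fin d)) (x) :
    act (convPow F d) e e' (powIncl F c (PiTensorProduct.tprod k x)) =
      powIncl F (c.push (W := ⟨X', Y'⟩) ⟨e, e'⟩) (PiTensorProduct.tprod k fun i =>
        (F.map (c.partHom (W := ⟨X', Y'⟩) ⟨e, e'⟩ i)).hom (x i)) :=
  powTransport_incl F _ c x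

lemma snoc_act {d : ℕ} (e : A ≃ C) (e' : A' ≃ C') (f : B ≃ D) (f' : B' ≃ D')
    (w : val (convPow F d) A A') (b : val F B B') :
    snoc (act (convPow F d) e e' w) (act F f f' b) =
      act (convPow F (d + 1)) (e.sumCongr f) (e'.sumCongr f') (snoc w b) := by
  induction w using pow_induction with
  | h0 => simp only [map_zero, LinearMap.zero_apply]
  | hadd s t hs ht => simp only [map_add, LinearMap.add_apply, hs, ht]
  | hsmul a t ht => simp only [map_smul, LinearMap.smul_apply, ht]
  | hmk c x =>
    rw [act_powIncl]
    obtain ⟨y, h1, h2, h3⟩ := snoc_incl c x b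
    obtain ⟨z, h4, h5, h6⟩ := snoc_incl (c.push (W := ⟨C, C'⟩) ⟨e, e'⟩)
      (fun i => (F.map (c.partHom (W := ⟨C, C'⟩) ⟨e, e'⟩ i)).hom (x i)) (act F f f' b)
    refine h4.trans (Eq.trans (powIncl_eq ?_ fun i => ?_)
      ((congrArg _ h1).trans (act_powIncl (e.sumCongr f) (e'.sumCongr f') _ _)).symm)
    · ext (x | x) <;> rfl
    · refine Fin.lastCases ?_ (fun i => ?_) i
      · rw [h3, h6]
        exact (congrArg _ (map_map_eq F rfl _)).trans
          (map_map_part_eq F _ _ _ _ (fun _ => by rfl) (fun _ => by rfl) _)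
      · rw [h2, h5]
        exact (congrArg _ (map_map_eq F rfl _)).trans
          (map_map_part_eq F _ _ _ _ (fun _ => by rfl) (fun _ => by rfl) _)

/-- The elements of the part of `X` with index different from the last one. -/
abbrev InitPart {d : ℕ} (c : X → Fin (d + 1)) : Type := {x // ¬ c x = Fin.last d}

abbrev LastPart {d : ℕ} (c : X → Fin (d + 1)) : Type := {x // c x = Fin.last d}

def initLast {d : ℕ} (c : X → Fin (d + 1)) : InitPart c ⊕ LastPart c ≃ X :=
  (Equiv.sumComm _ _).trans (Equiv.sumCompl fun x => c x = Fin.last d)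

def initCol {d : ℕ} {Z : FB2} (c : Coloring Z (Fin (d + 1))) :
    Coloring ⟨InitPart c.fst, InitPart c.snd⟩ (Fin d) :=
  ⟨fun x => (c.fst x.1).castPred x.2, fun x => (c.snd x.1).castPred x.2⟩

def initEquiv {d : ℕ} (c : X → Fin (d + 1)) (i : Fin d) :
    {x // c x = i.castSucc} ≃ {x : InitPart c // (c x.1).castPred x.2 = i} where
  toFun x := ⟨⟨x.1, by rw [x.2]; exact Fin.castSucc_ne_last i⟩, by
    rw [Fin.castPred_eq_iff_eq_castSucc]; exact x.2⟩
  invFun x := ⟨x.1.1, by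
    have := x.2
    rwa [Fin.castPred_eq_iff_eq_castSucc] at this⟩
  left_inv _ := rfl
  right_inv _ := rfl

def initHom {d : ℕ} {Z : FB2} (c : Coloring Z (Fin (d + 1))) (i : Fin d) :
    c.part i.castSucc ⟶ (initCol c).part i :=
  ⟨initEquiv c.fst i, initEquiv c.snd i⟩

/-- The part of a decomposable element with index different from the last one. -/
def initTensor {d : ℕ} {Z : FB2} (c : Coloring Z (Fin (d + 1))) (x : ∀ i, F.obj (c.part i)) :
    val (convPow F d) (InitPart c.fst) (InitPart c.snd) :=
  powIncl F (initCol c) (PiTensorProduct.tprod k fun i => (F.map (initHom c i)).hom (x i.castSucc))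

/-- Cutting the sets into the elements of last index and the others displays a pure tensor as an
appended factor. Hence `F^{⊛ (d + 1)}` is spanned by relabelled values of `snoc`. -/
lemma powIncl_eq_snoc {d : ℕ} (c : Coloring ⟨X, Y⟩ (Fin (d + 1))) (x : ∀ i, F.obj (c.part i)) :
    powIncl F c (PiTensorProduct.tprod k x) =
      act (convPow F (d + 1)) (initLast c.fst) (initLast c.snd)
        (snoc (initTensor c x) (B := LastPart c.fst) (B' := LastPart c.snd) (x (Fin.last d))) := by
  obtain ⟨y, h1, h2, h3⟩ := snoc_incl (B := LastPart c.fst) (B' := LastPart c.snd) (initCol c)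
    (fun i => (F.map (initHom c i)).hom (x i.castSucc)) (x (Fin.last d))
  refine Eq.trans (powIncl_eq ?_ fun i => ?_)
    ((congrArg _ h1).trans (act_powIncl (initLast c.fst) (initLast c.snd) _ _)).symm
  · refine Coloring.ext (funext fun z => ?_) (funext fun z => ?_)
    -- The two decompositions are compared at a point given by its position in the initial or in the
    -- last part.
    · obtain ⟨z, rfl⟩ := (initLast c.fst).surjective z
      refine Eq.trans ?_ (congrArg (snocCol (initCol c)).fst ((initLast c.fst).symm_apply_apply z).symm)
      rcases z with ⟨z, hz⟩ | ⟨z, hz⟩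
      · exact (Fin.castSucc_castPred (c.fst z) hz).symm
      · exact hz
    · obtain ⟨z, rfl⟩ := (initLast c.snd).surjective z
      refine Eq.trans ?_ (congrArg (snocCol (initCol c)).snd ((initLast c.snd).symm_apply_apply z).symm)
      rcases z with ⟨z, hz⟩ | ⟨z, hz⟩
      · exact (Fin.castSucc_castPred (c.snd z) hz).symm
      · exact hz
  · refine Fin.lastCases ?_ (fun i => ?_) i
    · rw [h3]
      exact (map_part_eq F _ _ _ (fun _ => by rfl) (fun _ => by rfl) _).symm
    · rw [h2, map_map_eq F rfl]
      exact (map_part_eq F _ _ _ (fun _ => by rfl) (fun _ => by rfl) _).symm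

end Powers

/-! ### Coinvariants and the product with one factor -/

section SymmetricPowers

variable {k : Type u} [Field k] {F : FBMod k}
variable {A A' B B' C C' D D' X X' Y Y' : Type} [Finite A] [Finite A'] [Finite B] [Finite B']
  [Finite C] [Finite C'] [Finite D] [Finite D'] [Finite X] [Finite X'] [Finite Y] [Finite Y']

/-- The inclusion `S_d → S_{d + 1}`. -/
def liftPerm {d : ℕ} (ρ : Equiv.Perm (Fin d)) : Equiv.Perm (Fin (d + 1)) :=
  finSumFinEquiv.permCongr (ρ.sumCongr (Equiv.refl (Fin 1)))

lemma liftPerm_castSucc {d : ℕ} (ρ : Equiv.Perm (Fin d)) (i : Fin d) :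
    liftPerm ρ i.castSucc = (ρ i).castSucc := by
  have : (finSumFinEquiv (n := 1)).symm i.castSucc = Sum.inl i :=
    (Equiv.symm_apply_eq _).2 rfl
  rw [liftPerm, Equiv.permCongr_apply, this]; rfl

lemma liftPerm_last {d : ℕ} (ρ : Equiv.Perm (Fin d)) : liftPerm ρ (Fin.last d) = Fin.last d := by
  have : (finSumFinEquiv (n := 1)).symm (Fin.last d) = Sum.inr 0 :=
    (Equiv.symm_apply_eq _).2 rfl
  rw [liftPerm, Equiv.permCongr_apply, this]; rfl

/-- Under `Fin d ⊔ {1} ≃ Fin (d + 1)` the last index is the added point, so `exists_onPt` applies.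
-/
lemma exists_liftPerm {d : ℕ} (σ : Equiv.Perm (Fin (d + 1))) (h : σ (Fin.last d) = Fin.last d) :
    ∃ ρ, σ = liftPerm ρ := by
  obtain ⟨ρ, hρ⟩ := exists_onPt (X := Fin d) (Y := Fin d)
    ((finSumFinEquiv (n := 1)).trans (σ.trans (finSumFinEquiv (n := 1)).symm)) (by
      have h1 : finSumFinEquiv (n := 1) (Sum.inr 0) = Fin.last d := rfl
      rw [Equiv.trans_apply, Equiv.trans_apply, h1, h, ← h1, Equiv.symm_apply_apply])
  refine ⟨ρ, ?_⟩
  have h2 : Equiv.Perm.sumCongr ρ (Equiv.refl (Fin 1)) = onPt ρ := rfl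
  rw [liftPerm, h2, ← hρ]
  ext i : 1
  simp [Equiv.permCongr_apply]

lemma character_liftPerm (s : Bool) {d : ℕ} (ρ : Equiv.Perm (Fin d)) :
    character s (d + 1) (liftPerm ρ) = character s d ρ := by
  cases s
  · rfl
  · change Equiv.Perm.sign _ = Equiv.Perm.sign _
    rw [liftPerm, Equiv.Perm.sign_permCongr, Equiv.Perm.sign_sumCongr, Equiv.Perm.sign_refl,
      mul_one]

def recolorPart {d : ℕ} {Z : FB2} {c c' : Coloring Z (Fin d)} {σ : Equiv.Perm (Fin d)}
    (h : c' = c.recolor σ) {i j : Fin d} (hij : σ i = j) : c.part i ⟶ c'.part j :=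
  ⟨Equiv.subtypeEquivRight fun x => by subst h hij; exact σ.injective.eq_iff.symm,
    Equiv.subtypeEquivRight fun x => by subst h hij; exact σ.injective.eq_iff.symm⟩

/-- The condition is stated for pairs with `σ i = j`, so that places can be treated case by case
without transport along `σ.symm`. -/
lemma powPerm_incl_eq {d : ℕ} {Z : FB2} (σ : Equiv.Perm (Fin d)) {c c' : Coloring Z (Fin d)}
    (h : c' = c.recolor σ) {x : ∀ i, F.obj (c.part i)} {z : ∀ i, F.obj (c'.part i)}
    (hz : ∀ i j (hij : σ i = j), (F.map (recolorPart h hij)).hom (x i) = z j) :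
    powPerm F σ Z (powIncl F c (PiTensorProduct.tprod k x)) =
      powIncl F c' (PiTensorProduct.tprod k z) := by
  subst h
  rw [powPerm_incl]
  congr 2
  funext j
  exact hz (σ.symm j) j (by simp)

lemma powPerm_powPerm {d : ℕ} (σ τ : Equiv.Perm (Fin d)) (t : val (convPow F d) X Y) :
    powPerm F σ ⟨X, Y⟩ (powPerm F τ ⟨X, Y⟩ t) = powPerm F (σ * τ) ⟨X, Y⟩ t := by
  induction t using pow_induction with
  | h0 => exact ((congrArg _ (map_zero _)).trans (map_zero _)).trans (map_zero _).symm
  | hadd s t hs ht =>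
    refine ((congrArg _ (map_add _ s t)).trans (map_add _ _ _)).trans ?_
    exact (congrArg₂ (· + ·) hs ht).trans (map_add _ s t).symm
  | hsmul a t ht =>
    refine ((congrArg _ (map_smul _ a t)).trans (map_smul _ _ _)).trans ?_
    exact (congrArg (a • ·) ht).trans (map_smul _ a t).symm
  | hmk c x =>
    refine (congrArg (powPerm F σ ⟨X, Y⟩) (powPerm_incl F τ c x)).trans ?_
    have h : (c.recolor τ).recolor σ = c.recolor (σ * τ) := Coloring.ext rfl rfl
    refine (powPerm_incl F σ _ _).trans (powPerm_incl_eq (σ * τ) h fun i j hij => ?_).symm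
    obtain rfl : i = τ.symm (σ.symm j) := by simp [← hij]
    exact (map_part_eq F _ _ _ (fun _ => by rfl) (fun _ => by rfl) _).symm

lemma powPerm_one {d : ℕ} (t : val (convPow F d) X Y) : powPerm F 1 ⟨X, Y⟩ t = t := by
  refine LinearMap.congr_fun (g := LinearMap.id) (pow_ext fun c x => ?_) t
  refine powPerm_incl_eq _ rfl fun i j hij => ?_
  subst hij
  exact congrArg (fun f => f.hom (x i)) (F.map_id (c.part i))

lemma act_powPerm {d : ℕ} (σ : Equiv.Perm (Fin d)) (e : X ≃ X') (e' : Y ≃ Y')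
    (t : val (convPow F d) X Y) :
    act (convPow F d) e e' (powPerm F σ ⟨X, Y⟩ t) =
      powPerm F σ ⟨X', Y'⟩ (act (convPow F d) e e' t) :=
  powPerm_transport F σ _ t

/-- Since `liftPerm ρ` has the same character as `ρ`, this makes `snoc` descend to coinvariants in
its first argument. -/
lemma snoc_powPerm {d : ℕ} (ρ : Equiv.Perm (Fin d)) (w : val (convPow F d) A A') (b : val F B B') :
    snoc (F := F) (A := A) (A' := A') (powPerm F ρ ⟨A, A'⟩ w) b =
      powPerm F (liftPerm ρ) ⟨A ⊕ B, A' ⊕ B'⟩ (snoc w b) := by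
  refine LinearMap.congr_fun (f := (snoc (F := F)).flip b ∘ₗ powPerm F ρ ⟨A, A'⟩)
    (g := powPerm F (liftPerm ρ) ⟨A ⊕ B, A' ⊕ B'⟩ ∘ₗ (snoc (F := F)).flip b)
    (pow_ext fun c x => ?_) w
  obtain ⟨y, h1, h2, h3⟩ := snoc_incl c x b
  obtain ⟨z, h4, h5, h6⟩ := snoc_incl (c.recolor ρ)
    (fun i => (F.map (c.recolorHom ρ i)).hom (x (ρ.symm i))) b
  refine (congrArg (fun w => snoc (F := F) (A := A) (A' := A') w b)
    (powPerm_incl F ρ c x)).trans (h4.trans ?_)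
  refine ((congrArg (powPerm F (liftPerm ρ) ⟨A ⊕ B, A' ⊕ B'⟩) h1).trans
    (powPerm_incl_eq _ ?_ fun i j => ?_)).symm
  · refine Coloring.ext (funext ?_) (funext ?_)
    · rintro (x | x)
      · exact (liftPerm_castSucc ρ _).symm
      · exact (liftPerm_last ρ).symm
    · rintro (x | x)
      · exact (liftPerm_castSucc ρ _).symm
      · exact (liftPerm_last ρ).symm
  · refine Fin.lastCases (fun hij => ?_) (fun i hij => ?_) i
    · obtain rfl : Fin.last d = j := by rw [← hij, liftPerm_last]
      rw [h3, h6]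
      exact map_part_eq F _ _ _ (fun _ => by rfl) (fun _ => by rfl) _
    · obtain ⟨i, rfl⟩ := ρ.symm.surjective i
      obtain rfl : i.castSucc = j := by rw [← hij, liftPerm_castSucc, ρ.apply_symm_apply]
      rw [h2, h5]
      exact map_map_part_eq F _ _ _ _ (fun _ => by rfl) (fun _ => by rfl) _

lemma cls_powPerm (s : Bool) {d : ℕ} (σ : Equiv.Perm (Fin d)) (t : val (convPow F d) X Y) :
    cls s (Z := ⟨X, Y⟩) (F := F) (powPerm F σ ⟨X, Y⟩ t) = ((character s d σ : ℤˣ) : ℤ) • cls s t := by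
  rw [← map_zsmul]
  refine congrArg (DirectSum.lof k ℕ (fun d => (symPow s F d).obj ⟨X, Y⟩) d) ?_
  exact (Submodule.Quotient.eq _).2 (Submodule.subset_span ⟨σ, t, rfl⟩)

lemma act_cls (s : Bool) {d : ℕ} (e : X ≃ X') (e' : Y ≃ Y') (t : val (convPow F d) X Y) :
    act (symTot s F) e e' (cls s t) = cls s (act (convPow F d) e e' t) :=
  symTot_map_cls s F _ t

lemma symTot_induction {s : Bool} {P : val (symTot s F) X Y → Prop} (h0 : P 0)
    (hadd : ∀ s t, P s → P t → P (s + t))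
    (hmk : ∀ d (x : val (convPow F d) X Y), P (cls s x)) (t) : P t := by
  refine DirectSum.induction_on (motive := P) t h0 (fun d x => ?_) hadd
  obtain ⟨x, rfl⟩ := Submodule.mkQ_surjective _ x
  exact hmk d x

/-- The map out of `S*` or `Λ*` given by maps that are compatible with the characters. -/
def symTotLift (s : Bool) {M : Type u} [AddCommGroup M] [Module k M]
    (φ : ∀ d, val (convPow F d) X Y →ₗ[k] M)
    (h : ∀ d (σ : Equiv.Perm (Fin d)) (t : val (convPow F d) X Y),
      φ d (powPerm F σ ⟨X, Y⟩ t) = ((character s d σ : ℤˣ) : ℤ) • φ d t) :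
    val (symTot s F) X Y →ₗ[k] M :=
  DirectSum.toModule k ℕ M fun d => (symSub s F d ⟨X, Y⟩).liftQ (φ d) <| by
    -- -
    refine Submodule.span_le.2 ?_
    rintro _ ⟨σ, x, rfl⟩
    refine (map_sub (φ d) _ _).trans ?_
    exact sub_eq_zero.2 ((h d σ x).trans (map_zsmul (φ d) _ _).symm)

lemma symTotLift_cls (s : Bool) {M : Type u} [AddCommGroup M] [Module k M]
    (φ : ∀ d, val (convPow F d) X Y →ₗ[k] M) (h) {d : ℕ} (t : val (convPow F d) X Y) :
    symTotLift s φ h (cls s t) = φ d t :=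
  DirectSum.toModule_lof _ _ _

/-- The product `S* F ⊗ F → S* F`, or `Λ* F ⊗ F → Λ* F`. -/
def mul (s : Bool) :
    val (symTot s F) A A' →ₗ[k] val F B B' →ₗ[k] val (symTot s F) (A ⊕ B) (A' ⊕ B') :=
  symTotLift s (fun _ => snoc.compr₂ (cls s)) fun d ρ t => by
    ext b
    refine (congrArg (cls s) (snoc_powPerm ρ t b)).trans ?_
    refine (cls_powPerm s _ _).trans ?_
    rw [character_liftPerm]; rfl

lemma mul_cls (s : Bool) {d : ℕ} (w : val (convPow F d) A A') (b : val F B B') :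
    mul s (cls s w) b = cls s (snoc w b) :=
  LinearMap.congr_fun (symTotLift_cls s _ _ w) b

lemma mul_act (s : Bool) (e : A ≃ C) (e' : A' ≃ C') (f : B ≃ D) (f' : B' ≃ D')
    (w : val (symTot s F) A A') (b : val F B B') :
    mul s (act (symTot s F) e e' w) (act F f f' b) =
      act (symTot s F) (e.sumCongr f) (e'.sumCongr f') (mul s w b) := by
  induction w using symTot_induction with
  | h0 => simp only [map_zero, LinearMap.zero_apply]
  | hadd s t hs ht => simp only [map_add, LinearMap.add_apply, hs, ht]
  | hmk d x => rw [act_cls, mul_cls, mul_cls, act_cls, snoc_act]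

/-- The sign of the transposition of two factors. -/
def swapSign : Bool → ℤ
  | false => 1
  | true => -1

/-- Relabelling the two appended blocks has the effect of transposing the last two places. In the
coinvariants this becomes commutativity in `S*` and anticommutativity in `Λ*`. -/
lemma snoc_snoc_swap {d : ℕ} (w : val (convPow F d) A A') (p : val F B B') (q : val F C C') :
    act (convPow F (d + 2)) (sumRightComm A B C) (sumRightComm A' B' C') (snoc (snoc w p) q) =
      powPerm F (Equiv.swap (Fin.last d).castSucc (Fin.last (d + 1))) ⟨(A ⊕ C) ⊕ B, (A' ⊕ C') ⊕ B'⟩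
        (snoc (snoc w q) p) := by
  refine LinearMap.congr_fun
    (f := act (convPow F (d + 2)) (sumRightComm A B C) (sumRightComm A' B' C') ∘ₗ
      (snoc (F := F)).flip q ∘ₗ (snoc (F := F)).flip p)
    (g := powPerm F (Equiv.swap (Fin.last d).castSucc (Fin.last (d + 1)))
      ⟨(A ⊕ C) ⊕ B, (A' ⊕ C') ⊕ B'⟩ ∘ₗ (snoc (F := F)).flip p ∘ₗ (snoc (F := F)).flip q)
    (pow_ext fun c x => ?_) w
  have hs1 : Equiv.swap (Fin.last d).castSucc (Fin.last (d + 1)) (Fin.last (d + 1)) =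
    (Fin.last d).castSucc := Equiv.swap_apply_right _ _
  have hs2 : Equiv.swap (Fin.last d).castSucc (Fin.last (d + 1)) (Fin.last d).castSucc =
    Fin.last (d + 1) := Equiv.swap_apply_left _ _
  have hs3 (i : Fin d) : Equiv.swap (Fin.last d).castSucc (Fin.last (d + 1)) i.castSucc.castSucc =
      i.castSucc.castSucc :=
    Equiv.swap_apply_of_ne_of_ne
      (fun h => Fin.castSucc_ne_last i (Fin.castSucc_injective _ h)) (Fin.castSucc_ne_last _)
  obtain ⟨y, h1, h2, h3⟩ := snoc_incl c x p
  obtain ⟨z, h4, h5, h6⟩ := snoc_incl (snocCol c) y q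
  obtain ⟨y', h1', h2', h3'⟩ := snoc_incl c x q
  obtain ⟨z', h4', h5', h6'⟩ := snoc_incl (snocCol c) y' p
  refine (congrArg (fun w => act (convPow F (d + 2)) (sumRightComm A B C) (sumRightComm A' B' C')
    (snoc w q)) h1).trans ((congrArg _ h4).trans ((act_powIncl _ _ _ _).trans ?_))
  refine ((congrArg (fun w => powPerm F _ _ (snoc w p)) h1').trans ((congrArg _ h4').trans
    (powPerm_incl_eq _ ?_ fun i j hij => ?_))).symm
  · refine Coloring.ext (funext ?_) (funext ?_)
    · rintro ((x | x) | x)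
      · exact (hs3 _).symm
      · exact hs2.symm
      · exact hs1.symm
    · rintro ((x | x) | x)
      · exact (hs3 _).symm
      · exact hs2.symm
      · exact hs1.symm
  · induction i using Fin.lastCases with
    | last =>
      obtain rfl := hs1.symm.trans hij
      rw [h5, h3, h6']
      exact (map_map_part_eq F _ _ _ _ (fun _ => by rfl) (fun _ => by rfl) _).trans
        (congrArg _ (map_map_eq F rfl _)).symm
    | cast i =>
      induction i using Fin.lastCases with
      | last =>
        obtain rfl := hs2.symm.trans hij
        rw [h6, h5', h3']
        exact ((congrArg _ (map_map_eq F rfl _)).trans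
          (map_map_part_eq F _ _ _ _ (fun _ => by rfl) (fun _ => by rfl) _))
      | cast i =>
        obtain rfl := (hs3 i).symm.trans hij
        rw [h5, h2, h5', h2']
        exact (congrArg _ (map_map_eq F rfl _)).trans ((map_map_part_eq F _ _ _ _
          (fun _ => by rfl) (fun _ => by rfl) _).trans (congrArg _ (map_map_eq F rfl _)).symm)

end SymmetricPowers

/-! ### Separating the factor that contains a marked point -/

section Extraction

variable {k : Type u} [Field k] {F : FBMod k}
variable {A A' B B' C C' D D' X X' Y Y' : Type} [Finite A] [Finite A'] [Finite B] [Finite B']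
  [Finite C] [Finite C'] [Finite D] [Finite D'] [Finite X] [Finite X'] [Finite Y] [Finite Y']
variable {M : Type u} [AddCommGroup M] [Module k M]

lemma mul_act_left (s : Bool) (e : A ≃ C) (e' : A' ≃ C') (w : val (symTot s F) A A')
    (b : val F B B') :
    mul s (act (symTot s F) e e' w) b =
      act (symTot s F) (e.sumCongr (Equiv.refl B)) (e'.sumCongr (Equiv.refl B')) (mul s w b) := by
  rw [← mul_act, act_refl]

lemma mul_act_right (s : Bool) (f : B ≃ D) (f' : B' ≃ D') (w : val (symTot s F) A A')
    (b : val F B B') :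
    mul s w (act F f f' b) =
      act (symTot s F) ((Equiv.refl A).sumCongr f) ((Equiv.refl A').sumCongr f') (mul s w b) := by
  rw [← mul_act, act_refl]

/-- The transposition of the last two places acts on the coinvariants through its character, which
is `swapSign s`. -/
lemma mul_mul_swap (s : Bool) (w : val (symTot s F) A A') (p : val F B B') (q : val F C C') :
    act (symTot s F) (sumRightComm A B C) (sumRightComm A' B' C') (mul s (mul s w p) q) =
      swapSign s • mul s (mul s w q) p := by
  induction w using symTot_induction with
  | h0 => simp only [map_zero, LinearMap.zero_apply, smul_zero]
  | hadd s t hs ht => simp only [map_add, LinearMap.add_apply, hs, ht, smul_add]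
  | hmk d x =>
    rw [mul_cls, mul_cls, mul_cls, mul_cls, act_cls, snoc_snoc_swap]
    refine (cls_powPerm s _ _).trans (congrArg (· • _) ?_)
    cases s
    · rfl
    · refine congrArg (Units.val (α := ℤ)) (Equiv.Perm.sign_swap ?_)
      exact Fin.castSucc_ne_last _

/-- The map `F^{⊛ (d + 1)} → Λ* F ⊛ F` or `S* F ⊛ F` that separates the last factor. -/
def unsnoc (s : Bool) {d : ℕ} :
    val (convPow F (d + 1)) X Y →ₗ[k] val (dayConv (symTot s F) F) X Y :=
  powDesc fun c =>
    let L : (⨂[k] i, F.obj ((initCol c).part i)) →ₗ[k] (F.obj (c.part (Fin.last d)) →ₗ[k]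
        val (dayConv (symTot s F) F) X Y) :=
      (dayMk (A := InitPart c.fst) (A' := InitPart c.snd) (B := LastPart c.fst)
        (B' := LastPart c.snd)).compr₂ (act _ (initLast c.fst) (initLast c.snd)) ∘ₗ cls s ∘ₗ
        powIncl F (initCol c)
    PiTensorProduct.lift (MultilinearMap.uncurryRight (M := fun i => F.obj (c.part i))
      (L.compMultilinearMap ((PiTensorProduct.tprod k).compLinearMap
        fun i => (F.map (initHom c i)).hom)))

lemma unsnoc_incl (s : Bool) {d : ℕ} (c : Coloring ⟨X, Y⟩ (Fin (d + 1)))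
    (x : ∀ i, F.obj (c.part i)) :
    unsnoc s (powIncl F c (PiTensorProduct.tprod k x)) =
      act (dayConv (symTot s F) F) (initLast c.fst) (initLast c.snd)
        (dayMk (B := LastPart c.fst) (B' := LastPart c.snd) (cls s (initTensor c x))
          (x (Fin.last d))) := by
  refine (powDesc_incl _ c _).trans ?_
  exact PiTensorProduct.lift.tprod x

/-- The first part of a decomposition of `X`. -/
def initPartEquiv {d : ℕ} (e : A ⊕ B ≃ X) (c : X → Fin (d + 1))
    (hl : ∀ a, ¬ c (e (Sum.inl a)) = Fin.last d) (hr : ∀ b, c (e (Sum.inr b)) = Fin.last d) :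
    A ≃ InitPart c :=
  Equiv.ofBijective (fun a => ⟨e (Sum.inl a), hl a⟩) ⟨fun a b h => by simpa using h, by
    rintro ⟨x, hx⟩
    obtain ⟨a | b, rfl⟩ := e.surjective x
    · exact ⟨a, rfl⟩
    · exact absurd (hr b) hx⟩

/-- The second part of a decomposition of `X`. -/
def lastPartEquiv {d : ℕ} (e : A ⊕ B ≃ X) (c : X → Fin (d + 1))
    (hl : ∀ a, ¬ c (e (Sum.inl a)) = Fin.last d) (hr : ∀ b, c (e (Sum.inr b)) = Fin.last d) :
    B ≃ LastPart c :=
  Equiv.ofBijective (fun b => ⟨e (Sum.inr b), hr b⟩) ⟨fun a b h => by simpa using h, by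
    rintro ⟨x, hx⟩
    obtain ⟨a | b, rfl⟩ := e.surjective x
    · exact absurd hx (hl a)
    · exact ⟨b, rfl⟩⟩

omit [Finite X] [Finite A] [Finite B] in
lemma initPartEquiv_trans {d : ℕ} (e : A ⊕ B ≃ X) (c : X → Fin (d + 1)) (hl) (hr) :
    ((initPartEquiv e c hl hr).sumCongr (lastPartEquiv e c hl hr)).trans (initLast c) = e := by
  ext (x | x) <;> rfl

lemma act_dayMk_parts {G H : FBMod k} {d : ℕ} (f : A ⊕ B ≃ X) (f' : A' ⊕ B' ≃ Y)
    (c : Coloring ⟨X, Y⟩ (Fin (d + 1))) (hl) (hr) (hl') (hr') (u : val G A A') (b : val H B B') :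
    act (dayConv G H) f f' (dayMk u b) = act (dayConv G H) (initLast c.fst) (initLast c.snd)
      (dayMk (act G (initPartEquiv f c.fst hl hr) (initPartEquiv f' c.snd hl' hr') u)
        (act H (lastPartEquiv f c.fst hl hr) (lastPartEquiv f' c.snd hl' hr') b)) := by
  rw [dayMk_act, act_act, initPartEquiv_trans, initPartEquiv_trans]

/-- `unsnoc` refers to the fibre over the last index and its complement, `snoc` to given sets `A`
and `B`. After relabelling by `f` the two are identified by `initPartEquiv` and `lastPartEquiv`, and
naturality of the external product removes the difference. -/
lemma unsnoc_snoc (s : Bool) {d : ℕ} (f : A ⊕ B ≃ X) (f' : A' ⊕ B' ≃ Y)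
    (w : val (convPow F d) A A') (b : val F B B') :
    unsnoc s (act (convPow F (d + 1)) f f' (snoc w b)) =
      act (dayConv (symTot s F) F) f f' (dayMk (cls s w) b) := by
  induction w using pow_induction with
  | h0 => simp only [map_zero, LinearMap.zero_apply]
  | hadd s t hs ht => simp only [map_add, LinearMap.add_apply, hs, ht]
  | hsmul a t ht => simp only [map_smul, LinearMap.smul_apply, ht]
  | hmk c x =>
    obtain ⟨y, h1, h2, h3⟩ := snoc_incl c x b
    refine (congrArg (fun t => unsnoc s (act (convPow F (d + 1)) f f' t)) h1).trans ?_
    refine (congrArg (unsnoc s) (act_powIncl f f' _ y)).trans ?_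
    refine (unsnoc_incl s _ _).trans ?_
    have hl (a) : ¬ ((snocCol c).push (W := ⟨X, Y⟩) ⟨f, f'⟩).fst (f (Sum.inl a)) = Fin.last d := by
      simp [snocCol, Coloring.push]
    have hr (a) : ((snocCol c).push (W := ⟨X, Y⟩) ⟨f, f'⟩).fst (f (Sum.inr a)) = Fin.last d := by
      simp [snocCol, Coloring.push]
    have hl' (a) : ¬ ((snocCol c).push (W := ⟨X, Y⟩) ⟨f, f'⟩).snd (f' (Sum.inl a)) = Fin.last d := by
      simp [snocCol, Coloring.push]
    have hr' (a) : ((snocCol c).push (W := ⟨X, Y⟩) ⟨f, f'⟩).snd (f' (Sum.inr a)) = Fin.last d := by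
      simp [snocCol, Coloring.push]
    refine Eq.trans ?_ (act_dayMk_parts f f' _ hl hr hl' hr' _ b).symm
    refine congrArg (act (dayConv (symTot s F) F) _ _) ?_
    refine congrArg₂ (fun w b => dayMk (F := symTot s F) (G := F) w b) ?_ ?_
    · refine Eq.trans ?_ (act_cls s (initPartEquiv f _ hl hr) (initPartEquiv f' _ hl' hr') _).symm
      refine congrArg (cls s) ?_
      refine Eq.trans ?_ (act_powIncl (initPartEquiv f _ hl hr) (initPartEquiv f' _ hl' hr')
        c x).symm
      refine powIncl_eq ?_ fun i => ?_
      · refine Coloring.ext (funext fun z => ?_) (funext fun z => ?_)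
        · obtain ⟨z, rfl⟩ := (initPartEquiv f _ hl hr).surjective z
          rw [initCol, Fin.castPred_eq_iff_eq_castSucc]
          change (snocCol (B := B) (B' := B') c).fst (f.symm (f (Sum.inl z))) = (c.fst ((initPartEquiv f _ hl hr).symm
            (initPartEquiv f _ hl hr z))).castSucc
          rw [Equiv.symm_apply_apply, Equiv.symm_apply_apply]; rfl
        · obtain ⟨z, rfl⟩ := (initPartEquiv f' _ hl' hr').surjective z
          rw [initCol, Fin.castPred_eq_iff_eq_castSucc]
          change (snocCol (B := B) (B' := B') c).snd (f'.symm (f' (Sum.inl z))) =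
            (c.snd ((initPartEquiv f' _ hl' hr').symm (initPartEquiv f' _ hl' hr' z))).castSucc
          rw [Equiv.symm_apply_apply, Equiv.symm_apply_apply]; rfl
      · refine (congrArg (fun u => (F.map (castPart _ i)).hom ((F.map (initHom _ i)).hom
          ((F.map ((snocCol c).partHom (W := ⟨X, Y⟩) ⟨f, f'⟩ i.castSucc)).hom u))) (h2 i)).trans ?_
        exact (congrArg _ (congrArg _ (map_map_eq F rfl _))).trans ((congrArg _
          (map_map_eq F rfl _)).trans
            (map_part_eq F _ _ _ (fun _ => by rfl) (fun _ => by rfl) _))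
    · rw [h3]
      exact map_part_eq F (c := (snocCol c).push (W := ⟨X, Y⟩) ⟨f, f'⟩) _ _ _ (fun _ => by rfl)
        (fun _ => by rfl) _

lemma exists_powIncl_eq_snoc {d : ℕ} (c : Coloring ⟨X, Y⟩ (Fin (d + 1)))
    (x : ∀ i, F.obj (c.part i)) :
    ∃ (w : val (convPow F d) (InitPart c.fst) (InitPart c.snd))
      (b : val F (LastPart c.fst) (LastPart c.snd)), powIncl F c (PiTensorProduct.tprod k x) =
        act (convPow F (d + 1)) (initLast c.fst) (initLast c.snd) (snoc w b) :=
  ⟨_, _, powIncl_eq_snoc c x⟩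

/-- A permutation that fixes the last place only affects the first `d` factors, and `unsnoc` has
already replaced these by their class in the coinvariants. -/
lemma unsnoc_powPerm (s : Bool) {d : ℕ} (ρ : Equiv.Perm (Fin d)) (t : val (convPow F (d + 1)) X Y) :
    unsnoc s (F := F) (X := X) (Y := Y) (powPerm F (liftPerm ρ) ⟨X, Y⟩ t) =
      ((character s d ρ : ℤˣ) : ℤ) • unsnoc s t := by
  induction t using pow_induction with
  | h0 =>
    refine (congrArg (unsnoc s) (map_zero _)).trans ?_
    rw [map_zero, smul_zero]
  | hadd u v hu hv =>
    refine ((congrArg (unsnoc s) (map_add _ u v)).trans (map_add (unsnoc s) _ _)).trans ?_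
    refine (congrArg₂ (· + ·) hu hv).trans ?_
    exact (smul_add _ _ _).symm.trans (congrArg _ (map_add (unsnoc s) u v)).symm
  | hsmul a u hu =>
    refine ((congrArg (unsnoc s) (map_smul _ a u)).trans (map_smul (unsnoc s) _ _)).trans ?_
    refine (congrArg (a • ·) hu).trans ?_
    exact (smul_comm _ _ _).trans (congrArg _ (map_smul (unsnoc s) a u)).symm
  | hmk c x =>
    obtain ⟨w, b, h⟩ := exists_powIncl_eq_snoc c x
    rw [h]
    refine (congrArg (unsnoc s) (act_powPerm (liftPerm ρ) _ _ _)).symm.trans ?_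
    rw [← snoc_powPerm]
    refine (unsnoc_snoc s _ _ _ b).trans ?_
    rw [unsnoc_snoc]
    refine (congrArg (fun u => act (dayConv (symTot s F) F) (initLast c.fst) (initLast c.snd)
      (dayMk (F := symTot s F) (G := F) u b)) (cls_powPerm s ρ w)).trans ?_
    simp only [map_zsmul, LinearMap.smul_apply]

/-- The map `F^{⊛ d} → Λ* F ⊛ F` or `F^{⊛ d} → S* F ⊛ F` that separates one factor. -/
def powCoprod (s : Bool) : ∀ d : ℕ, val (convPow F d) X Y →ₗ[k] val (dayConv (symTot s F) F) X Y
  | 0 => 0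
  | d + 1 => ∑ j : Fin (d + 1),
    ((character s (d + 1) (Equiv.swap j (Fin.last d)) : ℤˣ) : ℤ) •
      (unsnoc s ∘ₗ show val (convPow F (d + 1)) X Y →ₗ[k] val (convPow F (d + 1)) X Y from
        powPerm F (Equiv.swap j (Fin.last d)) ⟨X, Y⟩)

lemma powCoprod_succ (s : Bool) {d : ℕ} (t : val (convPow F (d + 1)) X Y) :
    powCoprod s (d + 1) t = ∑ j : Fin (d + 1),
      ((character s (d + 1) (Equiv.swap j (Fin.last d)) : ℤˣ) : ℤ) •
        unsnoc s (F := F) (powPerm F (Equiv.swap j (Fin.last d)) ⟨X, Y⟩ t) := by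
  refine (LinearMap.sum_apply _ _ _).trans ?_
  rfl

/-- The transpositions with the last index are coset representatives for `S_d` in `S_{d + 1}`. The
permutation `σ` permutes the cosets, up to elements of `S_d`, and these act through their character
by `unsnoc_powPerm`. -/
lemma powCoprod_powPerm (s : Bool) (d : ℕ) (σ : Equiv.Perm (Fin d)) (t : val (convPow F d) X Y) :
    powCoprod s d (powPerm F σ ⟨X, Y⟩ t) = ((character s d σ : ℤˣ) : ℤ) • powCoprod s d t := by
  cases d with
  | zero => exact (smul_zero _).symm
  | succ d =>
    refine (powCoprod_succ s _).trans ?_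
    rw [powCoprod_succ, Finset.smul_sum]
    -- The term of index `σ i` on the left is matched with the term of index `i` on the right.
    refine ((Equiv.sum_comp σ _).symm.trans (Finset.sum_congr rfl fun i _ => ?_))
    -- This product sends the last index to `i`, then to `σ i`, and back to the last index.
    obtain ⟨ρ, hρ⟩ := exists_liftPerm
      (Equiv.swap (σ i) (Fin.last d) * σ * (Equiv.swap i (Fin.last d))⁻¹) (by simp)
    have hρ' : Equiv.swap (σ i) (Fin.last d) * σ = liftPerm ρ * Equiv.swap i (Fin.last d) := by
      rw [← hρ, inv_mul_cancel_right]
    rw [powPerm_powPerm, hρ']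
    refine (congrArg (fun t => _ • unsnoc s t) (powPerm_powPerm _ _ t)).symm.trans ?_
    refine (congrArg _ (unsnoc_powPerm s ρ _)).trans ?_
    rw [smul_smul, smul_smul, ← Units.val_mul, ← Units.val_mul]
    congr 2
    have h2 := congrArg (character s (d + 1)) hρ'
    rw [map_mul, map_mul, character_liftPerm] at h2
    -- The characters have values `±1`, so each is its own inverse and can be moved to the other
    -- side.
    have h3 : character s d ρ = character s (d + 1) (Equiv.swap (σ i) (Fin.last d)) *
        character s (d + 1) σ * character s (d + 1) (Equiv.swap i (Fin.last d)) := by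
      rw [h2, mul_assoc, Int.units_mul_self, mul_one]
    rw [h3, ← mul_assoc, ← mul_assoc, Int.units_mul_self, one_mul]

/-- The map `Λ* F → Λ* F ⊛ F` or `S* F → S* F ⊛ F` that separates one factor. -/
def coprod (s : Bool) : val (symTot s F) X Y →ₗ[k] val (dayConv (symTot s F) F) X Y :=
  symTotLift s (powCoprod s) (powCoprod_powPerm s)

lemma dayLiftFst_zero {G : FBMod k} (Θ : BiFam F (delta10 G) X Y M) (e : A ⊕ B ≃ Pt X)
    (e' : A' ⊕ B' ≃ Y) (a₀ : A) (h : e (Sum.inl a₀) = Sum.inr 0) (a : val F A A')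
    (b : val G B B') :
    dayLiftFst (fun _ _ => 0) Θ (act (dayConv F G) e e' (dayMk a b)) = 0 := by
  rw [act_dayMk e e' ⟨fun x => (e.symm x).isRight, fun x => (e'.symm x).isRight⟩ (by simp)
    (by simp)]
  exact dayLiftFst_zero_incl Θ _ (by rw [← h]; simp) _ _

lemma dayLiftSnd_zero {G : FBMod k} (Θ : BiFam F (delta01 G) X Y M) (e : A ⊕ B ≃ X)
    (e' : A' ⊕ B' ≃ Pt Y) (a₀ : A') (h : e' (Sum.inl a₀) = Sum.inr 0) (a : val F A A')
    (b : val G B B') :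
    dayLiftSnd (fun _ _ => 0) Θ (act (dayConv F G) e e' (dayMk a b)) = 0 := by
  rw [act_dayMk e e' ⟨fun x => (e.symm x).isRight, fun x => (e'.symm x).isRight⟩ (by simp)
    (by simp)]
  exact dayLiftSnd_zero_incl Θ _ (by rw [← h]; simp) _ _

/-- The factor with the added point stands last. A transposition with `j ≠ last` moves it to place
`j`, hence into the part that stays on the left, where the family is zero; only `j = last`
contributes, and there the transposition is the identity. -/
lemma dayLiftFst_powCoprod (s : Bool) {d : ℕ} (Θ : BiFam (symTot s F) (delta10 F) X Y M)
    (c : Coloring ⟨Pt X, Y⟩ (Fin (d + 1))) (h : c.fst (Sum.inr 0) = Fin.last d) (x) :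
    dayLiftFst (fun _ _ => 0) Θ (powCoprod s (d + 1) (powIncl F c (PiTensorProduct.tprod k x))) =
      dayLiftFst (fun _ _ => 0) Θ (unsnoc s (powIncl F c (PiTensorProduct.tprod k x))) := by
  refine (congrArg _ (powCoprod_succ s _)).trans ?_
  rw [map_sum, Finset.sum_eq_single (Fin.last d)]
  · rw [Equiv.swap_self]
    have h1 : character s (d + 1) (Equiv.refl _) = 1 := map_one _
    rw [h1, Units.val_one, one_smul]
    exact congrArg (fun t => dayLiftFst (fun _ _ => 0) Θ (unsnoc s t)) (powPerm_one _)
  · intro j _ hj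
    rw [map_zsmul]
    refine (congrArg (_ • ·) ?_).trans (smul_zero _)
    refine (congrArg (fun t => dayLiftFst (fun _ _ => 0) Θ (unsnoc s t))
      (powPerm_incl F (Equiv.swap j (Fin.last d)) c x)).trans ?_
    refine (congrArg _ (unsnoc_incl s _ _)).trans ?_
    -- After the transposition the added point has index `j`, so it belongs to the initial part.
    refine dayLiftFst_zero Θ _ _ ⟨Sum.inr 0, ?_⟩ rfl _ _
    change ¬ Equiv.swap j (Fin.last d) (c.fst (Sum.inr 0)) = _
    rwa [h, Equiv.swap_apply_right]
  · intro h; exact absurd (Finset.mem_univ _) h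

lemma dayLiftSnd_powCoprod (s : Bool) {d : ℕ} (Θ : BiFam (symTot s F) (delta01 F) X Y M)
    (c : Coloring ⟨X, Pt Y⟩ (Fin (d + 1))) (h : c.snd (Sum.inr 0) = Fin.last d) (x) :
    dayLiftSnd (fun _ _ => 0) Θ (powCoprod s (d + 1) (powIncl F c (PiTensorProduct.tprod k x))) =
      dayLiftSnd (fun _ _ => 0) Θ (unsnoc s (powIncl F c (PiTensorProduct.tprod k x))) := by
  refine (congrArg _ (powCoprod_succ s _)).trans ?_
  rw [map_sum, Finset.sum_eq_single (Fin.last d)]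
  · rw [Equiv.swap_self]
    have h1 : character s (d + 1) (Equiv.refl _) = 1 := map_one _
    rw [h1, Units.val_one, one_smul]
    exact congrArg (fun t => dayLiftSnd (fun _ _ => 0) Θ (unsnoc s t)) (powPerm_one _)
  · intro j _ hj
    rw [map_zsmul]
    refine (congrArg (_ • ·) ?_).trans (smul_zero _)
    refine (congrArg (fun t => dayLiftSnd (fun _ _ => 0) Θ (unsnoc s t))
      (powPerm_incl F (Equiv.swap j (Fin.last d)) c x)).trans ?_
    refine (congrArg _ (unsnoc_incl s _ _)).trans ?_
    refine dayLiftSnd_zero Θ _ _ ⟨Sum.inr 0, ?_⟩ rfl _ _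
    change ¬ Equiv.swap j (Fin.last d) (c.snd (Sum.inr 0)) = _
    rwa [h, Equiv.swap_apply_right]
  · intro h; exact absurd (Finset.mem_univ _) h

lemma coprod_cls (s : Bool) {d : ℕ} (t : val (convPow F d) X Y) :
    coprod s (cls s t) = powCoprod s d t :=
  symTotLift_cls s _ _ t

/-- The coproduct runs over all factors, but the marked point selects a single one. This gives a
well defined way to apply an operation to the factor that contains the point, independent of the
chosen representative in the coinvariants. -/
lemma dayLiftFst_coprod (s : Bool) {Θ : BiFam (symTot s F) (delta10 F) X Y M} (hΘ : IsNat Θ)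
    (e : A ⊕ B ≃ X) (e' : A' ⊕ B' ≃ Y) (w : val (symTot s F) A A') (b : val F (Pt B) B') :
    dayLiftFst (fun _ _ => 0) Θ (coprod s (act (symTot s F)
      ((Equiv.sumAssoc A B (Fin 1)).symm.trans (onPt e)) e' (mul s w b))) = Θ e e' w b := by
  induction w using symTot_induction with
  | h0 => simp only [map_zero, LinearMap.zero_apply]; rfl
  | hadd s t hs ht => simp only [map_add, LinearMap.add_apply, hs, ht]; rfl
  | hmk d w =>
    -- The right-hand side becomes the value on `unsnoc` of the same tensor, so that only
    -- `powCoprod` and `unsnoc` have to be compared.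
    rw [mul_cls, act_cls, coprod_cls, ← dayLiftFst_right (fun _ _ => 0) hΘ, ← unsnoc_snoc]
    induction w using pow_induction with
    | h0 => simp only [map_zero, LinearMap.zero_apply]
    | hadd s t hs ht => simp only [map_add, LinearMap.add_apply, hs, ht]
    | hsmul a t ht => simp only [map_smul, LinearMap.smul_apply, ht]
    | hmk c x =>
      obtain ⟨y, h1, h2, h3⟩ := snoc_incl c x b
      have h4 := (congrArg (act (convPow F (d + 1))
        ((Equiv.sumAssoc A B (Fin 1)).symm.trans (onPt e)) e') h1).trans (act_powIncl _ _ _ _)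
      refine (congrArg (fun t => dayLiftFst (fun _ _ => 0) Θ (powCoprod s (d + 1) t)) h4).trans ?_
      refine (dayLiftFst_powCoprod s Θ _ rfl _).trans ?_
      exact (congrArg (fun t => dayLiftFst (fun _ _ => 0) Θ (unsnoc s t)) h4).symm

lemma dayLiftSnd_coprod (s : Bool) {Θ : BiFam (symTot s F) (delta01 F) X Y M} (hΘ : IsNat Θ)
    (e : A ⊕ B ≃ X) (e' : A' ⊕ B' ≃ Y) (w : val (symTot s F) A A') (b : val F B (Pt B')) :
    dayLiftSnd (fun _ _ => 0) Θ (coprod s (act (symTot s F) e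
      ((Equiv.sumAssoc A' B' (Fin 1)).symm.trans (onPt e')) (mul s w b))) = Θ e e' w b := by
  induction w using symTot_induction with
  | h0 => simp only [map_zero, LinearMap.zero_apply]; rfl
  | hadd s t hs ht => simp only [map_add, LinearMap.add_apply, hs, ht]; rfl
  | hmk d w =>
    rw [mul_cls, act_cls, coprod_cls, ← dayLiftSnd_right (fun _ _ => 0) hΘ, ← unsnoc_snoc]
    induction w using pow_induction with
    | h0 => simp only [map_zero, LinearMap.zero_apply]
    | hadd s t hs ht => simp only [map_add, LinearMap.add_apply, hs, ht]
    | hsmul a t ht => simp only [map_smul, LinearMap.smul_apply, ht]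
    | hmk c x =>
      obtain ⟨y, h1, h2, h3⟩ := snoc_incl c x b
      have h4 := (congrArg (act (convPow F (d + 1)) e
        ((Equiv.sumAssoc A' B' (Fin 1)).symm.trans (onPt e'))) h1).trans (act_powIncl _ _ _ _)
      refine (congrArg (fun t => dayLiftSnd (fun _ _ => 0) Θ (powCoprod s (d + 1) t)) h4).trans ?_
      refine (dayLiftSnd_powCoprod s Θ _ rfl _).trans ?_
      exact (congrArg (fun t => dayLiftSnd (fun _ _ => 0) Θ (unsnoc s t)) h4).symm

/-- In the coinvariants any factor can be moved to the last place at the cost of a sign, whose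
square is one. -/
lemma cls_powIncl (s : Bool) {d : ℕ} (c : Coloring ⟨X, Y⟩ (Fin (d + 1))) (x) (j : Fin (d + 1)) :
    ∃ z, cls s (F := F) (powIncl F c (PiTensorProduct.tprod k x)) =
      ((character s (d + 1) (Equiv.swap j (Fin.last d)) : ℤˣ) : ℤ) •
        cls s (F := F) (powIncl F (c.recolor (Equiv.swap j (Fin.last d)))
          (PiTensorProduct.tprod k z)) := by
  refine ⟨fun i => (F.map (c.recolorHom (Equiv.swap j (Fin.last d)) i)).hom
    (x ((Equiv.swap j (Fin.last d)).symm i)), ?_⟩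
  refine Eq.trans ?_ (congrArg (fun t => ((character s (d + 1) (Equiv.swap j (Fin.last d)) : ℤˣ) : ℤ) •
    cls s (F := F) (Z := ⟨X, Y⟩) t) (powPerm_incl F (Equiv.swap j (Fin.last d)) c x))
  refine Eq.trans ?_ (congrArg (_ • ·) (cls_powPerm s _ _)).symm
  rw [smul_smul, ← Units.val_mul, Int.units_mul_self, Units.val_one, one_smul]

/-- The factor that contains the added point is moved to the last place, so products with the point
in the last factor suffice. -/
lemma symTotFst_induction {s : Bool} {P : val (symTot s F) (Pt X) Y → Prop} (h0 : P 0)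
    (hadd : ∀ s t, P s → P t → P (s + t)) (hsmul : ∀ (a : k) t, P t → P (a • t))
    (hmk : ∀ {A A' B B' : Type} [Finite A] [Finite A'] [Finite B] [Finite B'] (e : A ⊕ B ≃ X)
      (e' : A' ⊕ B' ≃ Y) (w : val (symTot s F) A A') (b : val F (Pt B) B'),
      P (act (symTot s F) ((Equiv.sumAssoc A B (Fin 1)).symm.trans (onPt e)) e' (mul s w b)))
    (t) : P t := by
  refine symTot_induction h0 hadd (fun d x => ?_) t
  refine pow_induction (P := fun x => P (cls s x)) ?_ ?_ ?_ (fun c x => ?_) x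
  · rw [map_zero]; exact h0
  · intro a b ha hb
    rw [map_add]; exact hadd _ _ ha hb
  · intro a b hb
    rw [map_smul]; exact hsmul _ _ hb
  · cases d with
    -- In degree zero there is no factor that could contain the added point.
    | zero => exact (c.fst (Sum.inr 0)).elim0
    | succ d =>
      obtain ⟨z, hz⟩ := cls_powIncl s c x (c.fst (Sum.inr 0))
      -- The sign is turned into a scalar of `k`, for which `hsmul` is available.
      rw [hz, ← Int.cast_smul_eq_zsmul k]
      refine hsmul _ _ ?_
      have h : (c.recolor (Equiv.swap (c.fst (Sum.inr 0)) (Fin.last d))).fst (Sum.inr 0) =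
        Fin.last d := Equiv.swap_apply_left _ _
      generalize c.recolor (Equiv.swap (c.fst (Sum.inr 0)) (Fin.last d)) = c at h z
      obtain ⟨w, b, hw⟩ := exists_powIncl_eq_snoc c z
      rw [hw, ← act_cls, ← mul_cls]
      generalize cls s w = w
      obtain ⟨C, _, f, g, hg⟩ | ⟨C, _, f, g, hg⟩ := sum_pt_cases (initLast c.fst)
      -- The added point has the last index by `h`, so it cannot lie in the initial part.
      · have h1 := congrArg (fun f => f (Sum.inr ⟨Sum.inr 0, h⟩)) hg
        cases h1
      · have := hmk g (initLast c.snd) w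
          (act F (A := LastPart c.fst) (A' := LastPart c.snd) f (Equiv.refl _) b)
        rw [mul_act_right, act_act, Equiv.sumCongr_refl, Equiv.refl_trans, ← hg] at this
        exact this

lemma symTotSnd_induction {s : Bool} {P : val (symTot s F) X (Pt Y) → Prop} (h0 : P 0)
    (hadd : ∀ s t, P s → P t → P (s + t)) (hsmul : ∀ (a : k) t, P t → P (a • t))
    (hmk : ∀ {A A' B B' : Type} [Finite A] [Finite A'] [Finite B] [Finite B'] (e : A ⊕ B ≃ X)
      (e' : A' ⊕ B' ≃ Y) (w : val (symTot s F) A A') (b : val F B (Pt B')),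
      P (act (symTot s F) e ((Equiv.sumAssoc A' B' (Fin 1)).symm.trans (onPt e')) (mul s w b)))
    (t) : P t := by
  refine symTot_induction h0 hadd (fun d x => ?_) t
  refine pow_induction (P := fun x => P (cls s x)) ?_ ?_ ?_ (fun c x => ?_) x
  · rw [map_zero]; exact h0
  · intro a b ha hb
    rw [map_add]; exact hadd _ _ ha hb
  · intro a b hb
    rw [map_smul]; exact hsmul _ _ hb
  · cases d with
    | zero => exact (c.snd (Sum.inr 0)).elim0
    | succ d =>
      obtain ⟨z, hz⟩ := cls_powIncl s c x (c.snd (Sum.inr 0))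
      rw [hz, ← Int.cast_smul_eq_zsmul k]
      refine hsmul _ _ ?_
      have h : (c.recolor (Equiv.swap (c.snd (Sum.inr 0)) (Fin.last d))).snd (Sum.inr 0) =
        Fin.last d := Equiv.swap_apply_left _ _
      generalize c.recolor (Equiv.swap (c.snd (Sum.inr 0)) (Fin.last d)) = c at h z
      obtain ⟨w, b, hw⟩ := exists_powIncl_eq_snoc c z
      rw [hw, ← act_cls, ← mul_cls]
      generalize cls s w = w
      obtain ⟨C, _, f, g, hg⟩ | ⟨C, _, f, g, hg⟩ := sum_pt_cases (initLast c.snd)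
      · have h1 := congrArg (fun f => f (Sum.inr ⟨Sum.inr 0, h⟩)) hg
        cases h1
      · have := hmk (initLast c.fst) g w
          (act F (A := LastPart c.fst) (A' := LastPart c.snd) (Equiv.refl _) f b)
        rw [mul_act_right, act_act, Equiv.sumCongr_refl, Equiv.refl_trans, ← hg] at this
        exact this

end Extraction

/-! ### Right actions of an operad, their associativity and the Leibniz rule -/

section Modules

variable {k : Type u} [Field k] {O : NUOperad k} {F G H : FBMod k}
variable {A A' B B' C C' D D' X X' Y Y' : Type} [Finite A] [Finite A'] [Finite B] [Finite B']
  [Finite C] [Finite C'] [Finite D] [Finite D'] [Finite X] [Finite X'] [Finite Y] [Finite Y']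

/-- A natural family of bilinear maps, that is, a morphism `F ⊛ G → H`. -/
structure Pairing (F G H : FBMod k) where
  mul : ∀ {A A' B B' : Type} [Finite A] [Finite A'] [Finite B] [Finite B'],
    val F A A' →ₗ[k] val G B B' →ₗ[k] val H (A ⊕ B) (A' ⊕ B')
  mul_act : ∀ {A A' B B' C C' D D' : Type} [Finite A] [Finite A'] [Finite B] [Finite B']
    [Finite C] [Finite C'] [Finite D] [Finite D'] (e : A ≃ C) (e' : A' ≃ C') (f : B ≃ D)
    (f' : B' ≃ D') (a : val F A A') (b : val G B B'),
    mul (act F e e' a) (act G f f' b) = act H (e.sumCongr f) (e'.sumCongr f') (mul a b)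

namespace Pairing

variable (μ : Pairing F G H)

lemma mul_act_left (e : A ≃ C) (e' : A' ≃ C') (a : val F A A') (b : val G B B') :
    μ.mul (act F e e' a) b =
      act H (e.sumCongr (Equiv.refl B)) (e'.sumCongr (Equiv.refl B')) (μ.mul a b) := by
  rw [← μ.mul_act, act_refl]

lemma mul_act_right (f : B ≃ D) (f' : B' ≃ D') (a : val F A A') (b : val G B B') :
    μ.mul a (act G f f' b) =
      act H ((Equiv.refl A).sumCongr f) ((Equiv.refl A').sumCongr f') (μ.mul a b) := by
  rw [← μ.mul_act, act_refl]

end Pairing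

/-- A morphism `δ_{1,0} F ⊛ δ_{0,1} O → F`. -/
structure Plug (O : NUOperad k) (F : FBMod k) where
  plug : ∀ {A A' B B' : Type} [Finite A] [Finite A'] [Finite B] [Finite B'],
    val F (Pt A) A' →ₗ[k] val O.toMod B (Pt B') →ₗ[k] val F (A ⊕ B) (A' ⊕ B')
  plug_act : ∀ {A A' B B' C C' D D' : Type} [Finite A] [Finite A'] [Finite B] [Finite B']
    [Finite C] [Finite C'] [Finite D] [Finite D'] (e : A ≃ C) (e' : A' ≃ C') (f : B ≃ D)
    (f' : B' ≃ D') (p : val F (Pt A) A') (q : val O.toMod B (Pt B')),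
    plug (act F (onPt e) e' p) (act O.toMod f (onPt f') q) =
      act F (e.sumCongr f) (e'.sumCongr f') (plug p q)

namespace Plug

variable (P : Plug O F)

lemma plug_act_left (e : A ≃ C) (e' : A' ≃ C') (p : val F (Pt A) A') (q : val O.toMod B (Pt B')) :
    P.plug (act F (onPt e) e' p) q =
      act F (e.sumCongr (Equiv.refl B)) (e'.sumCongr (Equiv.refl B')) (P.plug p q) := by
  rw [← P.plug_act]
  refine congrArg (P.plug _) ?_
  refine (act_refl O.toMod q).symm.trans (act_congr rfl ?_ rfl)
  exact Equiv.sumCongr_refl.symm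

lemma plug_act_right (f : B ≃ D) (f' : B' ≃ D') (p : val F (Pt A) A')
    (q : val O.toMod B (Pt B')) :
    P.plug p (act O.toMod f (onPt f') q) =
      act F ((Equiv.refl A).sumCongr f) ((Equiv.refl A').sumCongr f') (P.plug p q) := by
  rw [← P.plug_act]
  refine congrArg (fun x => P.plug x _) ?_
  refine (act_refl F p).symm.trans (act_congr ?_ rfl rfl)
  exact Equiv.sumCongr_refl.symm

/-- The sequential associativity at `p`. -/
structure SeqAt (p : val F (Pt A) A') : Prop where
  out : ∀ {B B' C C' : Type} [Finite B] [Finite B'] [Finite C] [Finite C']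
    (q : val O.toMod (Pt B) (Pt B')) (r : val O.toMod C (Pt C')),
    act F (Equiv.sumAssoc A B C) (Equiv.sumAssoc A' B' C')
        (P.plug (act F (Equiv.sumAssoc A B (Fin 1)).symm (Equiv.refl _) (P.plug p q)) r) =
      P.plug p (act O.toMod (Equiv.refl _) (sumRightComm B' (Fin 1) C') (O.comp q r))

/-- The parallel associativity at `p`. -/
structure ParAt (p : val F (Pt (Pt A)) A') : Prop where
  out : ∀ {B B' C C' : Type} [Finite B] [Finite B'] [Finite C] [Finite C']
    (q : val O.toMod B (Pt B')) (r : val O.toMod C (Pt C')),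
    act F (sumRightComm A B C) (sumRightComm A' B' C')
        (P.plug (act F (sumRightComm A (Fin 1) B) (Equiv.refl _) (P.plug p q)) r) =
      P.plug (act F (sumRightComm A (Fin 1) C) (Equiv.refl _)
        (P.plug (act F (sumRightComm A (Fin 1) (Fin 1)) (Equiv.refl _) p) r)) q

/-- For fixed `q` and `r` both axioms are linear in `p` and stable under bijections. They are
formulated at a single `p` so that they can be verified on generators. -/
structure IsAssoc : Prop where
  seq : ∀ {A A' : Type} [Finite A] [Finite A'] (p : val F (Pt A) A'), P.SeqAt p
  par : ∀ {A A' : Type} [Finite A] [Finite A'] (p : val F (Pt (Pt A)) A'), P.ParAt p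

variable {P}

lemma seqAt_zero : P.SeqAt (0 : val F (Pt A) A') := by
  constructor
  intro B B' C C' _ _ _ _ q r
  simp only [map_zero, LinearMap.zero_apply]

lemma SeqAt.add {p p' : val F (Pt A) A'} (h : P.SeqAt p) (h' : P.SeqAt p') :
    P.SeqAt (p + p') := by
  constructor
  intro B B' C C' _ _ _ _ q r
  simp only [map_add, LinearMap.add_apply, h.out q r, h'.out q r]

lemma SeqAt.smul {p : val F (Pt A) A'} (a : k) (h : P.SeqAt p) : P.SeqAt (a • p) := by
  constructor
  intro B B' C C' _ _ _ _ q r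
  simp only [map_smul, LinearMap.smul_apply, h.out q r]

lemma parAt_zero : P.ParAt (0 : val F (Pt (Pt A)) A') := by
  constructor
  intro B B' C C' _ _ _ _ q r
  simp only [map_zero, LinearMap.zero_apply]

lemma ParAt.add {p p' : val F (Pt (Pt A)) A'} (h : P.ParAt p) (h' : P.ParAt p') :
    P.ParAt (p + p') := by
  constructor
  intro B B' C C' _ _ _ _ q r
  simp only [map_add, LinearMap.add_apply, h.out q r, h'.out q r]

lemma ParAt.smul {p : val F (Pt (Pt A)) A'} (a : k) (h : P.ParAt p) : P.ParAt (a • p) := by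
  constructor
  intro B B' C C' _ _ _ _ q r
  simp only [map_smul, LinearMap.smul_apply, h.out q r]

lemma SeqAt.act {p : val F (Pt A) A'} (h : P.SeqAt p) (e : A ≃ C) (e' : A' ≃ C') :
    P.SeqAt (act F (onPt e) e' p) := by
  constructor
  intro B B' D D' _ _ _ _ q r
  have h1 : FBMod.act F (Equiv.sumAssoc C B (Fin 1)).symm (Equiv.refl _)
      (P.plug (FBMod.act F (onPt e) e' p) q) =
      FBMod.act F (onPt (e.sumCongr (Equiv.refl B))) (e'.sumCongr (Equiv.refl _))
        (FBMod.act F (Equiv.sumAssoc A B (Fin 1)).symm (Equiv.refl _) (P.plug p q)) := by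
    rw [plug_act_left, act_act, act_act]
    exact act_congr (Equiv.ext (by rintro (x | x | x) <;> rfl)) rfl rfl
  rw [h1, plug_act_left, plug_act_left, ← h.out q r, act_act, act_act]
  exact act_congr (Equiv.ext (by rintro ((x | x) | x) <;> rfl))
    (Equiv.ext (by rintro ((x | x) | x) <;> rfl)) rfl

lemma ParAt.act {p : val F (Pt (Pt A)) A'} (h : P.ParAt p) (e : A ≃ C) (e' : A' ≃ C') :
    P.ParAt (act F (onPt (onPt e)) e' p) := by
  constructor
  intro B B' D D' _ _ _ _ q r
  have h1 : FBMod.act F (sumRightComm C (Fin 1) B) (Equiv.refl _)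
      (P.plug (FBMod.act F (onPt (onPt e)) e' p) q) =
      FBMod.act F (onPt (e.sumCongr (Equiv.refl B))) (e'.sumCongr (Equiv.refl _))
        (FBMod.act F (sumRightComm A (Fin 1) B) (Equiv.refl _) (P.plug p q)) := by
    rw [plug_act_left, act_act, act_act]
    exact act_congr (Equiv.ext (by rintro ((x | x) | x) <;> rfl)) rfl rfl
  have h2 : FBMod.act F (sumRightComm C (Fin 1) (Fin 1)) (Equiv.refl _)
      (FBMod.act F (onPt (onPt e)) e' p) = FBMod.act F (onPt (onPt e)) e'
        (FBMod.act F (sumRightComm A (Fin 1) (Fin 1)) (Equiv.refl _) p) := by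
    rw [act_act, act_act]
    exact act_congr (Equiv.ext (by rintro ((x | x) | x) <;> rfl)) rfl rfl
  have h3 (p : val F (Pt (Pt A)) A') : FBMod.act F (sumRightComm C (Fin 1) D) (Equiv.refl _)
      (P.plug (FBMod.act F (onPt (onPt e)) e' p) r) =
      FBMod.act F (onPt (e.sumCongr (Equiv.refl D))) (e'.sumCongr (Equiv.refl _))
        (FBMod.act F (sumRightComm A (Fin 1) D) (Equiv.refl _) (P.plug p r)) := by
    rw [plug_act_left, act_act, act_act]
    exact act_congr (Equiv.ext (by rintro ((x | x) | x) <;> rfl)) rfl rfl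
  rw [h1, h2, h3, plug_act_left, plug_act_left, ← h.out q r, act_act, act_act]
  exact act_congr (Equiv.ext (by rintro ((x | x) | x) <;> rfl))
    (Equiv.ext (by rintro ((x | x) | x) <;> rfl)) rfl

/-- The parallel axiom is symmetric: exchanging the two inputs of `p` exchanges the roles of `q` and
`r`. -/
lemma ParAt.swap {p : val F (Pt (Pt A)) A'} (h : P.ParAt p) :
    P.ParAt (FBMod.act F (sumRightComm A (Fin 1) (Fin 1)) (Equiv.refl _) p) := by
  constructor
  intro B B' D D' _ _ _ _ q r
  have h2 : FBMod.act F (sumRightComm A (Fin 1) (Fin 1)) (Equiv.refl _)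
      (FBMod.act F (sumRightComm A (Fin 1) (Fin 1)) (Equiv.refl _) p) = p := by
    rw [act_act]
    refine (act_congr (Equiv.ext (by rintro ((x | x) | x) <;> rfl)) rfl rfl).trans (act_refl F p)
  rw [h2, ← h.out r q, act_act]
  exact (act_congr (Equiv.ext (by rintro ((x | x) | x) <;> rfl))
    (Equiv.ext (by rintro ((x | x) | x) <;> rfl)) rfl).trans (act_refl F _)

end Plug

/-- `μ` satisfies the Leibniz rule with respect to the right actions of `O`. -/
structure Pairing.Leibniz (μ : Pairing F G H) (P : Plug O F) (Q : Plug O G) (R : Plug O H) :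
    Prop where
  left : ∀ {A A' B B' C C' : Type} [Finite A] [Finite A'] [Finite B] [Finite B'] [Finite C]
    [Finite C'] (a : val F (Pt A) A') (b : val G B B') (q : val O.toMod C (Pt C')),
    R.plug (act H (sumRightComm A (Fin 1) B) (Equiv.refl _) (μ.mul a b)) q =
      act H (sumRightComm A C B) (sumRightComm A' C' B') (μ.mul (P.plug a q) b)
  right : ∀ {A A' B B' C C' : Type} [Finite A] [Finite A'] [Finite B] [Finite B'] [Finite C]
    [Finite C'] (a : val F A A') (b : val G (Pt B) B') (q : val O.toMod C (Pt C')),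
    R.plug (act H (Equiv.sumAssoc A B (Fin 1)).symm (Equiv.refl _) (μ.mul a b)) q =
      act H (Equiv.sumAssoc A B C).symm (Equiv.sumAssoc A' B' C').symm (μ.mul a (Q.plug b q))

namespace Pairing.Leibniz

variable {μ : Pairing F G H} {P : Plug O F} {Q : Plug O G} {R : Plug O H}

/-- By the Leibniz rule both plugs take place inside `b`, so this is the identity at `b`, multiplied
by `a`. -/
lemma seqAt_right (h : μ.Leibniz P Q R) (a : val F A A') {b : val G (Pt B) B'} (hb : Q.SeqAt b) :
    R.SeqAt (act H (Equiv.sumAssoc A B (Fin 1)).symm (Equiv.refl _) (μ.mul a b)) := by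
  constructor
  intro C C' D D' _ _ _ _ q r
  have h1 : act H (Equiv.sumAssoc (A ⊕ B) C (Fin 1)).symm (Equiv.refl _)
      (act H (Equiv.sumAssoc A B (Pt C)).symm (Equiv.sumAssoc A' B' C').symm
        (μ.mul a (Q.plug b q))) =
      act H (onPt (Equiv.sumAssoc A B C).symm) (Equiv.sumAssoc A' B' C').symm
        (act H (Equiv.sumAssoc A (B ⊕ C) (Fin 1)).symm (Equiv.refl _)
          (μ.mul a (act G (Equiv.sumAssoc B C (Fin 1)).symm (Equiv.refl _) (Q.plug b q)))) := by
    rw [μ.mul_act_right, act_act, act_act, act_act]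
    exact act_congr (Equiv.ext (by rintro (x | x | x | x) <;> rfl))
      (Equiv.ext (by rintro (x | x | x) <;> rfl)) rfl
  rw [h.right, h1, R.plug_act_left, h.right, h.right, ← hb.out q r, μ.mul_act_right, act_act, act_act,
    act_act]
  exact act_congr (Equiv.ext (by rintro (x | (x | x) | x) <;> rfl))
    (Equiv.ext (by rintro (x | (x | x) | x) <;> rfl)) rfl

lemma seqAt_left (h : μ.Leibniz P Q R) {a : val F (Pt A) A'} (b : val G B B') (ha : P.SeqAt a) :
    R.SeqAt (act H (sumRightComm A (Fin 1) B) (Equiv.refl _) (μ.mul a b)) := by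
  constructor
  intro C C' D D' _ _ _ _ q r
  have h1 : act H (Equiv.sumAssoc (A ⊕ B) C (Fin 1)).symm (Equiv.refl _)
      (act H (sumRightComm A (Pt C) B) (sumRightComm A' C' B')
        (μ.mul (P.plug a q) b)) =
      act H (onPt (sumRightComm A C B)) (sumRightComm A' C' B')
        (act H (sumRightComm (A ⊕ C) (Fin 1) B) (Equiv.refl _)
          (μ.mul (act F (Equiv.sumAssoc A C (Fin 1)).symm (Equiv.refl _) (P.plug a q)) b)) := by
    rw [μ.mul_act_left, act_act, act_act, act_act]
    exact act_congr (Equiv.ext (by rintro ((x | x | x) | x) <;> rfl))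
      (Equiv.ext (by rintro ((x | x) | x) <;> rfl)) rfl
  rw [h.left, h1, R.plug_act_left, h.left, h.left, ← ha.out q r, μ.mul_act_left, act_act, act_act,
    act_act]
  exact act_congr (Equiv.ext (by rintro (((x | x) | x) | x) <;> rfl))
    (Equiv.ext (by rintro (((x | x) | x) | x) <;> rfl)) rfl

/-- `A ⊔ ((B ⊔ {1}) ⊔ {1}) ≅ ((A ⊔ B) ⊔ {1}) ⊔ {1}` -/
def ptsRight (A B : Type) : A ⊕ Pt (Pt B) ≃ Pt (Pt (A ⊕ B)) :=
  (Equiv.sumAssoc A (Pt B) (Fin 1)).symm.trans (onPt (Equiv.sumAssoc A B (Fin 1)).symm)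

/-- `((A ⊔ {1}) ⊔ {1}) ⊔ B ≅ ((A ⊔ B) ⊔ {1}) ⊔ {1}` -/
def ptsLeft (A B : Type) : Pt (Pt A) ⊕ B ≃ Pt (Pt (A ⊕ B)) :=
  (sumRightComm (Pt A) (Fin 1) B).trans (onPt (sumRightComm A (Fin 1) B))

/-- `(A ⊔ {1}) ⊔ (B ⊔ {1}) ≅ ((A ⊔ B) ⊔ {1}) ⊔ {1}`, where the second point comes last. -/
def ptsBoth (A B : Type) : Pt A ⊕ Pt B ≃ Pt (Pt (A ⊕ B)) :=
  (Equiv.sumAssoc (Pt A) B (Fin 1)).symm.trans (onPt (sumRightComm A (Fin 1) B))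

lemma parAt_right (h : μ.Leibniz P Q R) (a : val F A A') {b : val G (Pt (Pt B)) B'}
    (hb : Q.ParAt b) : R.ParAt (act H (ptsRight A B) (Equiv.refl _) (μ.mul a b)) := by
  -- One plug into `b`, after which the remaining point is brought to the outside. It serves for the
  -- first plug in either order.
  have key {C C' : Type} [Finite C] [Finite C'] (b : val G (Pt (Pt B)) B')
      (q : val O.toMod C (Pt C')) : act H (sumRightComm (A ⊕ B) (Fin 1) C) (Equiv.refl _)
        (R.plug (act H (ptsRight A B) (Equiv.refl _) (μ.mul a b)) q) =
      act H (onPt (Equiv.sumAssoc A B C).symm) (Equiv.sumAssoc A' B' C').symm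
        (act H (Equiv.sumAssoc A (B ⊕ C) (Fin 1)).symm (Equiv.refl _)
          (μ.mul a (act G (sumRightComm B (Fin 1) C) (Equiv.refl _) (Q.plug b q)))) := by
    have h1 : act H (ptsRight A B) (Equiv.refl _) (μ.mul a b) =
        act H (onPt (Equiv.sumAssoc A B (Fin 1)).symm) (Equiv.refl _)
          (act H (Equiv.sumAssoc A (Pt B) (Fin 1)).symm (Equiv.refl _) (μ.mul a b)) := by
      rw [act_act]; rfl
    rw [h1, R.plug_act_left, h.right, μ.mul_act_right, act_act, act_act, act_act, act_act]
    exact act_congr (Equiv.ext (by rintro (x | (x | x) | x) <;> rfl))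
      (Equiv.ext (by rintro (x | x | x) <;> rfl)) rfl
  constructor
  intro C C' D D' _ _ _ _ q r
  have h2 : act H (sumRightComm (A ⊕ B) (Fin 1) (Fin 1)) (Equiv.refl _)
      (act H (ptsRight A B) (Equiv.refl _) (μ.mul a b)) =
      act H (ptsRight A B) (Equiv.refl _)
        (μ.mul a (act G (sumRightComm B (Fin 1) (Fin 1)) (Equiv.refl _) b)) := by
    rw [μ.mul_act_right, act_act, act_act]
    exact act_congr (Equiv.ext (by rintro (x | (x | x) | x) <;> rfl))
      (Equiv.ext (by rintro (x | x) <;> rfl)) rfl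
  rw [key, h2, key, R.plug_act_left, R.plug_act_left, h.right, h.right, ← hb.out q r, μ.mul_act_right,
    act_act, act_act, act_act, act_act]
  exact act_congr (Equiv.ext (by rintro (x | (x | x) | x) <;> rfl))
    (Equiv.ext (by rintro (x | (x | x) | x) <;> rfl)) rfl

lemma parAt_left (h : μ.Leibniz P Q R) {a : val F (Pt (Pt A)) A'} (b : val G B B')
    (ha : P.ParAt a) : R.ParAt (act H (ptsLeft A B) (Equiv.refl _) (μ.mul a b)) := by
  have key {C C' : Type} [Finite C] [Finite C'] (a : val F (Pt (Pt A)) A')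
      (q : val O.toMod C (Pt C')) : act H (sumRightComm (A ⊕ B) (Fin 1) C) (Equiv.refl _)
        (R.plug (act H (ptsLeft A B) (Equiv.refl _) (μ.mul a b)) q) =
      act H (onPt (sumRightComm A C B)) (sumRightComm A' C' B')
        (act H (sumRightComm (A ⊕ C) (Fin 1) B) (Equiv.refl _)
          (μ.mul (act F (sumRightComm A (Fin 1) C) (Equiv.refl _) (P.plug a q)) b)) := by
    have h1 : act H (ptsLeft A B) (Equiv.refl _) (μ.mul a b) =
        act H (onPt (sumRightComm A (Fin 1) B)) (Equiv.refl _)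
          (act H (sumRightComm (Pt A) (Fin 1) B) (Equiv.refl _) (μ.mul a b)) := by
      rw [act_act]; rfl
    rw [h1, R.plug_act_left, h.left, μ.mul_act_left, act_act, act_act, act_act, act_act]
    exact act_congr (Equiv.ext (by rintro (((x | x) | x) | x) <;> rfl))
      (Equiv.ext (by rintro ((x | x) | x) <;> rfl)) rfl
  constructor
  intro C C' D D' _ _ _ _ q r
  have h2 : act H (sumRightComm (A ⊕ B) (Fin 1) (Fin 1)) (Equiv.refl _)
      (act H (ptsLeft A B) (Equiv.refl _) (μ.mul a b)) =
      act H (ptsLeft A B) (Equiv.refl _)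
        (μ.mul (act F (sumRightComm A (Fin 1) (Fin 1)) (Equiv.refl _) a) b) := by
    rw [μ.mul_act_left, act_act, act_act]
    exact act_congr (Equiv.ext (by rintro (((x | x) | x) | x) <;> rfl))
      (Equiv.ext (by rintro (x | x) <;> rfl)) rfl
  rw [key, h2, key, R.plug_act_left, R.plug_act_left, h.left, h.left, ← ha.out q r, μ.mul_act_left,
    act_act, act_act, act_act, act_act]
  exact act_congr (Equiv.ext (by rintro (((x | x) | x) | x) <;> rfl))
    (Equiv.ext (by rintro (((x | x) | x) | x) <;> rfl)) rfl

/-- No associativity is needed when the inputs lie in different factors: in either order the Leibniz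
rule leads to the product of `P.plug a r` and `Q.plug b q`. -/
lemma parAt_both (h : μ.Leibniz P Q R) (a : val F (Pt A) A') (b : val G (Pt B) B') :
    R.ParAt (act H (ptsBoth A B) (Equiv.refl _) (μ.mul a b)) := by
  constructor
  intro C C' D D' _ _ _ _ q r
  have h1 : act H (ptsBoth A B) (Equiv.refl _) (μ.mul a b) =
      act H (onPt (sumRightComm A (Fin 1) B)) (Equiv.refl _)
        (act H (Equiv.sumAssoc (Pt A) B (Fin 1)).symm (Equiv.refl _) (μ.mul a b)) := by
    rw [act_act]; rfl
  have h2 : act H (sumRightComm (A ⊕ B) (Fin 1) (Fin 1)) (Equiv.refl _)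
      (act H (ptsBoth A B) (Equiv.refl _) (μ.mul a b)) =
      act H (onPt (Equiv.sumAssoc A B (Fin 1)).symm) (Equiv.refl _)
        (act H (sumRightComm A (Fin 1) (Pt B)) (Equiv.refl _) (μ.mul a b)) := by
    rw [act_act, act_act]
    exact act_congr (Equiv.ext (by rintro ((x | x) | x | x) <;> rfl)) rfl rfl
  have h3 : act H (sumRightComm (A ⊕ B) (Fin 1) C) (Equiv.refl _)
      (R.plug (act H (ptsBoth A B) (Equiv.refl _) (μ.mul a b)) q) =
      act H (onPt (Equiv.sumAssoc A B C).symm) (Equiv.sumAssoc A' B' C').symm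
        (act H (sumRightComm A (Fin 1) (B ⊕ C)) (Equiv.refl _) (μ.mul a (Q.plug b q))) := by
    rw [h1, R.plug_act_left, h.right, act_act, act_act, act_act]
    exact act_congr (Equiv.ext (by rintro ((x | x) | x | x) <;> rfl))
      (Equiv.ext (by rintro (x | x | x) <;> rfl)) rfl
  have h4 : act H (sumRightComm (A ⊕ B) (Fin 1) D) (Equiv.refl _)
      (R.plug (act H (sumRightComm (A ⊕ B) (Fin 1) (Fin 1)) (Equiv.refl _)
        (act H (ptsBoth A B) (Equiv.refl _) (μ.mul a b))) r) =
      act H (onPt (sumRightComm A D B)) (sumRightComm A' D' B')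
        (act H (Equiv.sumAssoc (A ⊕ D) B (Fin 1)).symm (Equiv.refl _)
          (μ.mul (P.plug a r) b)) := by
    rw [h2, R.plug_act_left, h.left, act_act, act_act, act_act]
    exact act_congr (Equiv.ext (by rintro ((x | x) | x | x) <;> rfl))
      (Equiv.ext (by rintro ((x | x) | x) <;> rfl)) rfl
  rw [h3, h4, R.plug_act_left, R.plug_act_left, h.left, h.right, act_act, act_act, act_act]
  exact act_congr (Equiv.ext (by rintro ((x | x) | x | x) <;> rfl))
    (Equiv.ext (by rintro ((x | x) | x | x) <;> rfl)) rfl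

end Pairing.Leibniz

/-- The partial compositions of `O`. -/
def NUOperad.plug (O : NUOperad k) : Plug O O.toMod := ⟨O.comp, O.comp_act⟩

lemma NUOperad.plug_isAssoc (O : NUOperad k) : O.plug.IsAssoc :=
  ⟨fun p => ⟨fun q r => O.seq_assoc p q r⟩, fun p => ⟨fun q r => O.par_assoc p q r⟩⟩

lemma toWheel_surjective (t : val O.wheel A A') : ∃ r, O.toWheel r = t :=
  Submodule.mkQ_surjective _ t

lemma act_toWheel (e : A ≃ C) (e' : A' ≃ C') (r : val O.toMod (Pt A) (Pt A')) :
    act O.wheel e e' (O.toWheel r) = O.toWheel (act O.toMod (onPt e) (onPt e') r) := rfl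

lemma deltaAct_act_right (f : B ≃ D) (f' : B' ≃ D') (r : val O.toMod (Pt (Pt A)) (Pt A'))
    (q : val O.toMod B (Pt B')) :
    O.deltaAct r (act O.toMod f (onPt f') q) =
      act O.toMod (onPt ((Equiv.refl A).sumCongr f)) (onPt ((Equiv.refl A').sumCongr f'))
        (O.deltaAct r q) := by
  change act O.toMod _ _ (O.comp _ (act O.toMod _ _ _)) = act O.toMod _ _ (act O.toMod _ _ _)
  rw [comp_act_right, act_act, act_act]
  exact act_congr (Equiv.ext (by rintro ((x | x) | x) <;> rfl))
    (Equiv.ext (by rintro ((x | x) | x) <;> rfl)) rfl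

/-- The right action `α` of `O` on `|δ_{1,1} O|`. -/
def NUOperad.wheelPlug (O : NUOperad k) : Plug O O.wheel where
  plug := O.wheelAct
  plug_act e e' f f' p q := by
    obtain ⟨r, rfl⟩ := toWheel_surjective p
    rw [act_toWheel, wheelAct_toWheel, wheelAct_toWheel, act_toWheel, deltaAct_act_left,
      deltaAct_act_right, act_act]
    refine congrArg O.toWheel (act_congr ?_ ?_ rfl) <;>
      exact Equiv.ext (by rintro ((x | x) | x) <;> rfl)

lemma deltaAct_eq (r : val O.toMod (Pt (Pt A)) (Pt A')) (q : val O.toMod B (Pt B')) :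
    O.deltaAct r q = act O.toMod (sumRightComm A (Fin 1) B) (sumRightComm A' (Fin 1) B')
      (O.comp (act O.toMod (sumRightComm A (Fin 1) (Fin 1)) (Equiv.refl (Pt A')) r) q) := rfl

/-- Wheels lift to `δ_{1,1} O`, where plugging is partial composition at an unmarked input. Both
axioms are those of `O`, with the marked input and output carried along. -/
lemma NUOperad.wheelPlug_isAssoc (O : NUOperad k) : O.wheelPlug.IsAssoc where
  seq {A A'} _ _ p := by
    constructor
    intro B B' C C' _ _ _ _ q s
    obtain ⟨r, rfl⟩ := toWheel_surjective p
    refine congrArg O.toWheel (?_ : act O.toMod (onPt (Equiv.sumAssoc A B C))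
      (onPt (Equiv.sumAssoc A' B' C')) (O.deltaAct (act O.toMod
        (onPt (Equiv.sumAssoc A B (Fin 1)).symm) (onPt (Equiv.refl (A' ⊕ B')))
          (O.deltaAct r q)) s) = O.deltaAct r (act O.toMod (Equiv.refl (B ⊕ C))
            (sumRightComm B' (Fin 1) C') (O.comp q s)))
    rw [deltaAct_eq r, deltaAct_eq r, ← O.seq_assoc, deltaAct_eq]
    have h1 (x : val O.toMod (Pt A ⊕ Pt B) (Pt A' ⊕ B')) :
        act O.toMod (sumRightComm (A ⊕ B) (Fin 1) (Fin 1)) (Equiv.refl _)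
          (act O.toMod (onPt (Equiv.sumAssoc A B (Fin 1)).symm) (onPt (Equiv.refl (A' ⊕ B')))
            (act O.toMod (sumRightComm A (Fin 1) (Pt B)) (sumRightComm A' (Fin 1) B') x)) =
        act O.toMod (onPt (sumRightComm A (Fin 1) B)) (sumRightComm A' (Fin 1) B')
          (act O.toMod (Equiv.sumAssoc (Pt A) B (Fin 1)).symm (Equiv.refl _) x) := by
      rw [act_act, act_act, act_act]
      exact act_congr (Equiv.ext (by rintro ((x | x) | x | x) <;> rfl))
        (Equiv.ext (by rintro ((x | x) | x) <;> rfl)) rfl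
    rw [h1, comp_act_left, act_act, act_act, act_act]
    exact act_congr (Equiv.ext (by rintro (((x | x) | x) | x) <;> rfl))
      (Equiv.ext (by rintro (((x | x) | x) | x) <;> rfl)) rfl
  par {A A'} _ _ p := by
    constructor
    intro B B' C C' _ _ _ _ q s
    obtain ⟨r, rfl⟩ := toWheel_surjective p
    refine congrArg O.toWheel (?_ : act O.toMod (onPt (sumRightComm A B C))
      (onPt (sumRightComm A' B' C')) (O.deltaAct (act O.toMod
        (onPt (sumRightComm A (Fin 1) B)) (onPt (Equiv.refl (A' ⊕ B')))
          (O.deltaAct r q)) s) = O.deltaAct (act O.toMod (onPt (sumRightComm A (Fin 1) C))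
            (onPt (Equiv.refl (A' ⊕ C'))) (O.deltaAct (act O.toMod
              (onPt (sumRightComm A (Fin 1) (Fin 1))) (onPt (Equiv.refl A')) r) s)) q)
    -- In the new `r` the marked input is moved inside the two inputs to be plugged, which is the
    -- order that `O.par_assoc` expects.
    obtain ⟨r, rfl⟩ : ∃ r₁, r = act O.toMod ((sumRightComm (Pt A) (Fin 1) (Fin 1)).trans
        (onPt (sumRightComm A (Fin 1) (Fin 1)))).symm (Equiv.refl _).symm r₁ :=
      ⟨_, eq_act_symm _ _ r⟩
    have h1 {D D' : Type} [Finite D] [Finite D'] (r : val O.toMod (Pt (Pt (Pt A))) (Pt A'))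
        (q : val O.toMod D (Pt D')) : act O.toMod (sumRightComm (A ⊕ D) (Fin 1) (Fin 1))
          (Equiv.refl _) (act O.toMod (onPt (sumRightComm A (Fin 1) D)) (onPt (Equiv.refl (A' ⊕ D')))
            (O.deltaAct (act O.toMod ((sumRightComm (Pt A) (Fin 1) (Fin 1)).trans
              (onPt (sumRightComm A (Fin 1) (Fin 1)))).symm (Equiv.refl _).symm r) q)) =
        act O.toMod (onPt (sumRightComm A (Fin 1) D)) (sumRightComm A' (Fin 1) D')
          (act O.toMod (sumRightComm (Pt A) (Fin 1) D) (Equiv.refl _) (O.comp r q)) := by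
      have h2 : act O.toMod (sumRightComm (Pt A) (Fin 1) (Fin 1)) (Equiv.refl (Pt A'))
          (act O.toMod ((sumRightComm (Pt A) (Fin 1) (Fin 1)).trans
            (onPt (sumRightComm A (Fin 1) (Fin 1)))).symm (Equiv.refl _).symm r) =
          act O.toMod (onPt (sumRightComm A (Fin 1) (Fin 1))) (Equiv.refl _) r := by
        rw [act_act]
        exact act_congr (Equiv.ext (by rintro (((x | x) | x) | x) <;> rfl)) rfl rfl
      rw [deltaAct_eq, h2, comp_act_left, act_act, act_act, act_act, act_act]
      exact act_congr (Equiv.ext (by rintro (((x | x) | x) | x) <;> rfl))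
        (Equiv.ext (by rintro ((x | x) | x) <;> rfl)) rfl
    have h3 : act O.toMod (onPt (sumRightComm A (Fin 1) (Fin 1))) (onPt (Equiv.refl A'))
        (act O.toMod ((sumRightComm (Pt A) (Fin 1) (Fin 1)).trans
          (onPt (sumRightComm A (Fin 1) (Fin 1)))).symm (Equiv.refl _).symm r) =
        act O.toMod ((sumRightComm (Pt A) (Fin 1) (Fin 1)).trans
          (onPt (sumRightComm A (Fin 1) (Fin 1)))).symm (Equiv.refl _).symm
          (act O.toMod (sumRightComm (Pt A) (Fin 1) (Fin 1)) (Equiv.refl _) r) := by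
      rw [act_act, act_act]
      exact act_congr (Equiv.ext (by rintro (((x | x) | x) | x) <;> rfl))
        (Equiv.ext (by rintro (x | x) <;> rfl)) rfl
    rw [h3, deltaAct_eq, deltaAct_eq (act O.toMod (onPt _) _ _), h1, h1, comp_act_left,
      comp_act_left, ← O.par_assoc, act_act, act_act, act_act, act_act]
    exact act_congr (Equiv.ext (by rintro (((x | x) | x) | x) <;> rfl))
      (Equiv.ext (by rintro (((x | x) | x) | x) <;> rfl)) rfl

end Modules

/-! ### Extension of right actions to products as derivations -/

section Products

variable {k : Type u} [Field k] {O : NUOperad k} {F G H : FBMod k}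
variable {A A' B B' C C' D D' X X' Y Y' : Type} [Finite A] [Finite A'] [Finite B] [Finite B']
  [Finite C] [Finite C'] [Finite D] [Finite D'] [Finite X] [Finite X'] [Finite Y] [Finite Y']

namespace Pairing.Leibniz

variable {μ : Pairing F G H} {P : Plug O F} {Q : Plug O G} {R : Plug O H}

lemma seqAt_of_right (h : μ.Leibniz P Q R) (hQ : Q.IsAssoc) (e : A ⊕ B ≃ X) (e' : A' ⊕ B' ≃ Y)
    (a : val F A A') (b : val G (Pt B) B') :
    R.SeqAt (act H ((Equiv.sumAssoc A B (Fin 1)).symm.trans (onPt e)) e' (μ.mul a b)) := by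
  have := Plug.SeqAt.act (h.seqAt_right a (hQ.seq b)) e e'
  rwa [act_act, Equiv.refl_trans] at this

lemma seqAt_of_left (h : μ.Leibniz P Q R) (hP : P.IsAssoc) (e : A ⊕ B ≃ X) (e' : A' ⊕ B' ≃ Y)
    (a : val F (Pt A) A') (b : val G B B') :
    R.SeqAt (act H ((sumRightComm A (Fin 1) B).trans (onPt e)) e' (μ.mul a b)) := by
  have := Plug.SeqAt.act (h.seqAt_left b (hP.seq a)) e e'
  rwa [act_act, Equiv.refl_trans] at this

lemma parAt_of_right (h : μ.Leibniz P Q R) (hQ : Q.IsAssoc) (e : A ⊕ B ≃ Pt X)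
    (e' : A' ⊕ B' ≃ Y) (a : val F A A') (b : val G (Pt B) B') :
    R.ParAt (act H ((Equiv.sumAssoc A B (Fin 1)).symm.trans (onPt e)) e' (μ.mul a b)) := by
  obtain ⟨C, _, f, g, rfl⟩ | ⟨C, _, f, g, rfl⟩ := sum_pt_cases e
  · have := Plug.ParAt.act (h.parAt_both (act F f (Equiv.refl _) a) b) g e'
    rw [μ.mul_act_left, act_act, act_act] at this
    refine (congrArg R.ParAt (act_congr ?_ ?_ rfl)).mp this
    · exact Equiv.ext (by rintro (x | x | x) <;> rfl)
    · exact Equiv.ext (by rintro (x | x) <;> rfl)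
  · have := Plug.ParAt.act (h.parAt_right a (hQ.par (act G (onPt f) (Equiv.refl _) b))) g e'
    rw [μ.mul_act_right, act_act, act_act] at this
    refine (congrArg R.ParAt (act_congr ?_ ?_ rfl)).mp this
    · exact Equiv.ext (by rintro (x | x | x) <;> rfl)
    · exact Equiv.ext (by rintro (x | x) <;> rfl)

lemma parAt_of_left (h : μ.Leibniz P Q R) (hP : P.IsAssoc) (e : A ⊕ B ≃ Pt X)
    (e' : A' ⊕ B' ≃ Y) (a : val F (Pt A) A') (b : val G B B') :
    R.ParAt (act H ((sumRightComm A (Fin 1) B).trans (onPt e)) e' (μ.mul a b)) := by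
  obtain ⟨C, _, f, g, rfl⟩ | ⟨C, _, f, g, rfl⟩ := sum_pt_cases e
  · have := Plug.ParAt.act (h.parAt_left b (hP.par (act F (onPt f) (Equiv.refl _) a))) g e'
    rw [μ.mul_act_left, act_act, act_act] at this
    refine (congrArg R.ParAt (act_congr ?_ ?_ rfl)).mp this
    · exact Equiv.ext (by rintro ((x | x) | x) <;> rfl)
    · exact Equiv.ext (by rintro (x | x) <;> rfl)
  -- Here the outer point lies in the first factor and the inner one in the second, opposite to
  -- `parAt_both`.
  · have := Plug.ParAt.act (Plug.ParAt.swap (h.parAt_both a (act G f (Equiv.refl _) b))) g e'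
    rw [μ.mul_act_right, act_act, act_act, act_act] at this
    refine (congrArg R.ParAt (act_congr ?_ ?_ rfl)).mp this
    · refine Equiv.ext ?_
      rintro ((x | x) | x)
      · rfl
      · rfl
      · rcases hx : f x with y | y <;> simp [hx, Pairing.Leibniz.ptsBoth, sumRightComm]
    · exact Equiv.ext (by rintro (x | x) <;> rfl)

end Pairing.Leibniz

namespace Pairing

/-- The right action on the first factor, as a bilinear map. -/
def leftBil (μ : Pairing F G H) (P : Plug O F) (e : A ⊕ B ≃ X) (e' : A' ⊕ B' ≃ Y) :
    val F (Pt A) A' →ₗ[k] val G B B' →ₗ[k] val O.toMod D (Pt D') →ₗ[k] val H (X ⊕ D) (Y ⊕ D') :=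
  LinearMap.mk₂ k
    (fun a b => act H ((sumRightComm A D B).trans (e.sumCongr (Equiv.refl D)))
      ((sumRightComm A' D' B').trans (e'.sumCongr (Equiv.refl D'))) ∘ₗ
        (μ.mul (A := A ⊕ D) (A' := A' ⊕ D')).flip b ∘ₗ P.plug a)
    (fun a a' b => by ext; simp) (fun c a b => by ext; simp) (fun a b b' => by ext; simp)
    (fun c a b => by ext; simp)

/-- The right action on the first factor, as a family of bilinear maps. -/
def leftFam (μ : Pairing F G H) (P : Plug O F) : BiFam (delta10 F) G X Y
    (val O.toMod D (Pt D') →ₗ[k] val H (X ⊕ D) (Y ⊕ D')) :=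
  fun e e' => leftBil μ P e e'

lemma leftFam_apply (μ : Pairing F G H) (P : Plug O F) (e : A ⊕ B ≃ X) (e' : A' ⊕ B' ≃ Y)
    (a : val F (Pt A) A') (b : val G B B') (q : val O.toMod D (Pt D')) :
    leftFam μ P e e' a b q = act H ((sumRightComm A D B).trans (e.sumCongr (Equiv.refl D)))
      ((sumRightComm A' D' B').trans (e'.sumCongr (Equiv.refl D'))) (μ.mul (P.plug a q) b) := rfl

lemma isNat_leftFam (μ : Pairing F G H) (P : Plug O F) :
    IsNat (leftFam (X := X) (Y := Y) (D := D) (D' := D') μ P) := by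
  intro A A' B B' C C' D D' _ _ _ _ _ _ _ _ f f' g g' e e' a b
  refine LinearMap.ext fun q => ?_
  refine (leftFam_apply μ P e e' _ _ q).trans ?_
  refine (congrArg (fun x => act H _ _ (μ.mul x _)) (P.plug_act_left f f' a q)).trans ?_
  refine Eq.trans ?_ (leftFam_apply μ P _ _ a b q).symm
  rw [μ.mul_act, act_act]
  exact act_congr (Equiv.ext (by rintro ((x | x) | x) <;> rfl))
    (Equiv.ext (by rintro ((x | x) | x) <;> rfl)) rfl

/-- The right action on the second factor, as a bilinear map. -/
def rightBil (μ : Pairing F G H) (Q : Plug O G) (e : A ⊕ B ≃ X) (e' : A' ⊕ B' ≃ Y) :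
    val F A A' →ₗ[k] val G (Pt B) B' →ₗ[k] val O.toMod D (Pt D') →ₗ[k] val H (X ⊕ D) (Y ⊕ D') :=
  LinearMap.mk₂ k
    (fun a b => act H ((Equiv.sumAssoc A B D).symm.trans (e.sumCongr (Equiv.refl D)))
      ((Equiv.sumAssoc A' B' D').symm.trans (e'.sumCongr (Equiv.refl D'))) ∘ₗ
        μ.mul (B := B ⊕ D) (B' := B' ⊕ D') a ∘ₗ Q.plug b)
    (fun a a' b => by ext; simp) (fun c a b => by ext; simp) (fun a b b' => by ext; simp)
    (fun c a b => by ext; simp)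

/-- The right action on the second factor, as a family of bilinear maps. -/
def rightFam (μ : Pairing F G H) (Q : Plug O G) : BiFam F (delta10 G) X Y
    (val O.toMod D (Pt D') →ₗ[k] val H (X ⊕ D) (Y ⊕ D')) :=
  fun e e' => rightBil μ Q e e'

lemma rightFam_apply (μ : Pairing F G H) (Q : Plug O G) (e : A ⊕ B ≃ X) (e' : A' ⊕ B' ≃ Y)
    (a : val F A A') (b : val G (Pt B) B') (q : val O.toMod D (Pt D')) :
    rightFam μ Q e e' a b q =
      act H ((Equiv.sumAssoc A B D).symm.trans (e.sumCongr (Equiv.refl D)))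
        ((Equiv.sumAssoc A' B' D').symm.trans (e'.sumCongr (Equiv.refl D')))
          (μ.mul a (Q.plug b q)) := rfl

lemma isNat_rightFam (μ : Pairing F G H) (Q : Plug O G) :
    IsNat (rightFam (X := X) (Y := Y) (D := D) (D' := D') μ Q) := by
  intro A A' B B' C C' D D' _ _ _ _ _ _ _ _ f f' g g' e e' a b
  refine LinearMap.ext fun q => ?_
  refine (rightFam_apply μ Q e e' _ _ q).trans ?_
  refine (congrArg (fun x => act H _ _ (μ.mul _ x)) (Q.plug_act_left g g' b q)).trans ?_
  refine Eq.trans ?_ (rightFam_apply μ Q _ _ a b q).symm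
  rw [μ.mul_act, act_act]
  exact act_congr (Equiv.ext (by rintro (x | x | x) <;> rfl))
    (Equiv.ext (by rintro (x | x | x) <;> rfl)) rfl

end Pairing

/-- The product `S* F ⊛ F → S* F` or `Λ* F ⊛ F → Λ* F`. -/
def mulPairing (s : Bool) (F : FBMod k) : Pairing (symTot s F) F (symTot s F) := ⟨mul s, mul_act s⟩

/-- The universal pairing. -/
def dayPairing (F G : FBMod k) : Pairing F G (dayConv F G) := ⟨dayMk, dayMk_act⟩

/-- The coproduct isolates the factor with the added input, and `q` is plugged into that factor
alone. By `symTotFst_induction` this formula determines the action. -/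
lemma symPlug_aux (s : Bool) (P : Plug O F) (e : A ⊕ B ≃ X) (e' : A' ⊕ B' ≃ Y)
    (w : val (symTot s F) A A') (p : val F (Pt B) B') (q : val O.toMod D (Pt D')) :
    dayLiftFst (fun _ _ => 0) ((mulPairing s F).rightFam P) (coprod s (act (symTot s F)
      ((Equiv.sumAssoc A B (Fin 1)).symm.trans (onPt e)) e' (mul s w p))) q =
      act (symTot s F) ((Equiv.sumAssoc A B D).symm.trans (e.sumCongr (Equiv.refl D)))
        ((Equiv.sumAssoc A' B' D').symm.trans (e'.sumCongr (Equiv.refl D')))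
          (mul s w (P.plug p q)) :=
  congrArg (fun f => f q) (dayLiftFst_coprod s ((mulPairing s F).isNat_rightFam P) e e' w p)

/-- The right action of `O` on `S* F` or `Λ* F` by derivations. -/
def symPlug (s : Bool) (P : Plug O F) : Plug O (symTot s F) where
  plug := dayLiftFst (fun _ _ => 0) ((mulPairing s F).rightFam P) ∘ₗ coprod s
  plug_act {A A' B B' C C' D D'} _ _ _ _ _ _ _ _ e e' f f' t q := by
    induction t using symTotFst_induction with
    | h0 => simp only [map_zero, LinearMap.zero_apply]
    | hadd s t hs ht => simp only [map_add, LinearMap.add_apply, hs, ht]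
    | hsmul a t ht => simp only [map_smul, LinearMap.smul_apply, ht]
    | hmk g g' w b =>
      refine Eq.trans ?_ (congrArg (act (symTot s F) _ _) (symPlug_aux s P g g' w b q)).symm
      have h : act (symTot s F) (onPt e) e' (act (symTot s F)
          ((Equiv.sumAssoc _ _ (Fin 1)).symm.trans (onPt g)) g' (mul s w b)) =
          act (symTot s F) ((Equiv.sumAssoc _ _ (Fin 1)).symm.trans (onPt (g.trans e)))
            (g'.trans e') (mul s w b) := by
        rw [act_act]
        exact act_congr (Equiv.ext (by rintro (x | x | x) <;> rfl)) rfl rfl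
      refine (congrArg (fun x => dayLiftFst (fun _ _ => 0) ((mulPairing s F).rightFam P)
        (coprod s x) _) h).trans ?_
      refine (symPlug_aux s P _ _ w b _).trans ?_
      rw [P.plug_act_right, mul_act_right, act_act, act_act]
      exact act_congr (Equiv.ext (by rintro (x | x | x) <;> rfl))
        (Equiv.ext (by rintro (x | x | x) <;> rfl)) rfl

lemma symPlug_mul (s : Bool) (P : Plug O F) (e : A ⊕ B ≃ X) (e' : A' ⊕ B' ≃ Y)
    (w : val (symTot s F) A A') (p : val F (Pt B) B') (q : val O.toMod D (Pt D')) :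
    (symPlug s P).plug (act (symTot s F)
      ((Equiv.sumAssoc A B (Fin 1)).symm.trans (onPt e)) e' (mul s w p)) q =
      act (symTot s F) ((Equiv.sumAssoc A B D).symm.trans (e.sumCongr (Equiv.refl D)))
        ((Equiv.sumAssoc A' B' D').symm.trans (e'.sumCongr (Equiv.refl D')))
          (mul s w (P.plug p q)) :=
  symPlug_aux s P e e' w p q

/-- The sign can be moved to the other side of `mul_mul_swap` because its square is one. -/
lemma mul_mul_swap' (s : Bool) (w : val (symTot s F) A A') (p : val F B B') (q : val F C C') :
    mul s (mul s w q) p = swapSign s • act (symTot s F) (sumRightComm A B C) (sumRightComm A' B' C')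
      (mul s (mul s w p) q) := by
  rw [mul_mul_swap, smul_smul]
  cases s <;> exact (one_smul ℤ _).symm

/-- The right rule is the defining formula. For the left rule the input lies in a factor `p` of `t`:
exchanging `b` with `p` brings `p` to the end, `q` is plugged there, and a second exchange restores
the order. The two signs match. -/
lemma mulPairing_leibniz (s : Bool) (P : Plug O F) :
    (mulPairing s F).Leibniz (symPlug s P) P (symPlug s P) where
  left {A A' B B' C C'} _ _ _ _ _ _ t b q := by
    change (symPlug s P).plug (act (symTot s F) (sumRightComm A (Fin 1) B) (Equiv.refl _)
      (mul s t b)) q = act (symTot s F) (sumRightComm A C B) (sumRightComm A' C' B')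
        (mul s ((symPlug s P).plug t q) b)
    induction t using symTotFst_induction with
    | h0 => simp only [map_zero, LinearMap.zero_apply]
    | hadd s t hs ht => simp only [map_add, LinearMap.add_apply, hs, ht]
    | hsmul a t ht => simp only [map_smul, LinearMap.smul_apply, ht]
    | @hmk D D' E E' _ _ _ _ g g' w p =>
      rw [symPlug_mul, mul_act_left, mul_act_left, mul_mul_swap' s w b p, mul_mul_swap' s w b,
        map_zsmul,
        map_zsmul, map_zsmul, map_zsmul, map_zsmul, LinearMap.smul_apply, act_act, act_act, act_act,
        act_act]
      refine congrArg (swapSign s • ·) ?_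
      have h := symPlug_mul s P ((sumRightComm D B E).trans (g.sumCongr (Equiv.refl B)))
        ((sumRightComm D' B' E').trans (g'.sumCongr (Equiv.refl B'))) (mul s w b) p q
      refine Eq.trans (congrArg (fun x => (symPlug s P).plug x q) (act_congr ?_ ?_ rfl))
        (h.trans (act_congr ?_ ?_ rfl))
      · exact Equiv.ext (by rintro ((x | x) | x | x) <;> rfl)
      · exact Equiv.ext (by rintro ((x | x) | x) <;> rfl)
      · exact Equiv.ext (by rintro ((x | x) | x | x) <;> rfl)
      · exact Equiv.ext (by rintro ((x | x) | x | x) <;> rfl)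
  right {A A' B B' C C'} _ _ _ _ _ _ w p q := by
    refine Eq.trans (congrArg (fun x => (symPlug s P).plug x q) (act_congr ?_ rfl rfl))
      ((symPlug_mul s P (Equiv.refl _) (Equiv.refl _) w p q).trans (act_congr ?_ ?_ rfl))
    · exact Equiv.ext (by rintro (x | x | x) <;> rfl)
    · exact Equiv.ext (by rintro (x | x | x) <;> rfl)
    · exact Equiv.ext (by rintro (x | x | x) <;> rfl)

/-- The elements with an added input are spanned by products with that input in the last factor.
There the Leibniz rule either reduces the axioms to `P` or, for two inputs in different factors,
proves them outright. -/
lemma symPlug_isAssoc (s : Bool) {P : Plug O F} (hP : P.IsAssoc) : (symPlug s P).IsAssoc where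
  seq t := symTotFst_induction Plug.seqAt_zero (fun _ _ => Plug.SeqAt.add)
    (fun a _ => Plug.SeqAt.smul a)
    (fun e e' w b => (mulPairing_leibniz s P).seqAt_of_right hP e e' w b) t
  par t := symTotFst_induction Plug.parAt_zero (fun _ _ => Plug.ParAt.add)
    (fun a _ => Plug.ParAt.smul a)
    (fun e e' w b => (mulPairing_leibniz s P).parAt_of_right hP e e' w b) t

/-- The map underlying the right action of `O` on `F ⊛ G` by derivations. -/
def dayPlugMap (P : Plug O F) (Q : Plug O G) :
    val (dayConv F G) (Pt A) A' →ₗ[k] val O.toMod B (Pt B') →ₗ[k]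
      val (dayConv F G) (A ⊕ B) (A' ⊕ B') :=
  dayLiftFst ((dayPairing F G).leftFam P) ((dayPairing F G).rightFam Q)

lemma dayPlugMap_left (P : Plug O F) (Q : Plug O G) (e : A ⊕ B ≃ X) (e' : A' ⊕ B' ≃ Y)
    (a : val F (Pt A) A') (b : val G B B') (q : val O.toMod D (Pt D')) :
    dayPlugMap P Q (act (dayConv F G) ((sumRightComm A (Fin 1) B).trans (onPt e)) e' (dayMk a b)) q =
      act (dayConv F G) ((sumRightComm A D B).trans (e.sumCongr (Equiv.refl D)))
        ((sumRightComm A' D' B').trans (e'.sumCongr (Equiv.refl D'))) (dayMk (P.plug a q) b) :=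
  congrArg (fun f => f q) (dayLiftFst_left _ ((dayPairing F G).isNat_leftFam P) e e' a b)

lemma dayPlugMap_right (P : Plug O F) (Q : Plug O G) (e : A ⊕ B ≃ X) (e' : A' ⊕ B' ≃ Y)
    (a : val F A A') (b : val G (Pt B) B') (q : val O.toMod D (Pt D')) :
    dayPlugMap P Q (act (dayConv F G) ((Equiv.sumAssoc A B (Fin 1)).symm.trans (onPt e)) e'
      (dayMk a b)) q =
      act (dayConv F G) ((Equiv.sumAssoc A B D).symm.trans (e.sumCongr (Equiv.refl D)))
        ((Equiv.sumAssoc A' B' D').symm.trans (e'.sumCongr (Equiv.refl D')))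
          (dayMk a (Q.plug b q)) :=
  congrArg (fun f => f q) (dayLiftFst_right _ ((dayPairing F G).isNat_rightFam Q) e e' a b)

/-- The right action of `O` on `F ⊛ G` by derivations. -/
def dayPlug (P : Plug O F) (Q : Plug O G) : Plug O (dayConv F G) where
  plug := dayPlugMap P Q
  plug_act {A A' B B' C C' D D'} _ _ _ _ _ _ _ _ e e' f f' t q := by
    induction t using dayFst_induction with
    | h0 => simp only [map_zero, LinearMap.zero_apply]
    | hadd s t hs ht => simp only [map_add, LinearMap.add_apply, hs, ht]
    | hl g g' a b =>
      rw [dayPlugMap_left, act_act, act_act]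
      refine (congrArg (fun x => dayPlugMap P Q x _) (act_congr ?_ rfl rfl)).trans
        ((dayPlugMap_left P Q (g.trans e) (g'.trans e') a b _).trans ?_)
      · exact Equiv.ext (by rintro ((x | x) | x) <;> rfl)
      rw [P.plug_act_right, dayMk_act_left, act_act]
      exact act_congr (Equiv.ext (by rintro ((x | x) | x) <;> rfl))
        (Equiv.ext (by rintro ((x | x) | x) <;> rfl)) rfl
    | hr g g' a b =>
      rw [dayPlugMap_right, act_act, act_act]
      refine (congrArg (fun x => dayPlugMap P Q x _) (act_congr ?_ rfl rfl)).trans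
        ((dayPlugMap_right P Q (g.trans e) (g'.trans e') a b _).trans ?_)
      · exact Equiv.ext (by rintro (x | x | x) <;> rfl)
      rw [Q.plug_act_right, dayMk_act_right, act_act]
      exact act_congr (Equiv.ext (by rintro (x | x | x) <;> rfl))
        (Equiv.ext (by rintro (x | x | x) <;> rfl)) rfl

/-- Both rules are the formulas that define the action on `F ⊛ G`, according to the factor that
contains the input. -/
lemma dayPairing_leibniz (P : Plug O F) (Q : Plug O G) :
    (dayPairing F G).Leibniz P Q (dayPlug P Q) where
  left {A A' B B' C C'} _ _ _ _ _ _ a b q := by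
    refine Eq.trans (congrArg (fun x => dayPlugMap P Q x q) (act_congr ?_ rfl rfl))
      ((dayPlugMap_left P Q (Equiv.refl _) (Equiv.refl _) a b q).trans (act_congr ?_ ?_ rfl))
    · exact Equiv.ext (by rintro ((x | x) | x) <;> rfl)
    · exact Equiv.ext (by rintro ((x | x) | x) <;> rfl)
    · exact Equiv.ext (by rintro ((x | x) | x) <;> rfl)
  right {A A' B B' C C'} _ _ _ _ _ _ a b q := by
    refine Eq.trans (congrArg (fun x => dayPlugMap P Q x q) (act_congr ?_ rfl rfl))
      ((dayPlugMap_right P Q (Equiv.refl _) (Equiv.refl _) a b q).trans (act_congr ?_ ?_ rfl))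
    · exact Equiv.ext (by rintro (x | x | x) <;> rfl)
    · exact Equiv.ext (by rintro (x | x | x) <;> rfl)
    · exact Equiv.ext (by rintro (x | x | x) <;> rfl)

lemma dayPlug_isAssoc {P : Plug O F} {Q : Plug O G} (hP : P.IsAssoc) (hQ : Q.IsAssoc) :
    (dayPlug P Q).IsAssoc where
  seq t := dayFst_induction Plug.seqAt_zero (fun _ _ => Plug.SeqAt.add)
    (fun e e' a b => (dayPairing_leibniz P Q).seqAt_of_left hP e e' a b)
    (fun e e' a b => (dayPairing_leibniz P Q).seqAt_of_right hQ e e' a b) t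
  par t := dayFst_induction Plug.parAt_zero (fun _ _ => Plug.ParAt.add)
    (fun e e' a b => (dayPairing_leibniz P Q).parAt_of_left hP e e' a b)
    (fun e e' a b => (dayPairing_leibniz P Q).parAt_of_right hQ e e' a b) t

end Products

/-! ### Construction of the contraction and the double contractions -/

section Contractions

variable {k : Type u} [Field k] {O : NUOperad k} {L : FBMod k}
variable {A A' B B' C C' E E' X X' Y Y' : Type} [Finite A] [Finite A'] [Finite B] [Finite B']
  [Finite C] [Finite C'] [Finite E] [Finite E'] [Finite X] [Finite X'] [Finite Y] [Finite Y']

/-- The structure on an `FB × FB`-module `L` from which contraction maps are built: a right action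
of `O`, products with elements of `O` and of `|δ_{1,1} O|`, and a way to separate a factor in `O`
with a given output. -/
structure ContrData (O : NUOperad k) (L : FBMod k) where
  plug : Plug O L
  assoc : plug.IsAssoc
  mulO : Pairing L O.toMod L
  mulW : Pairing L O.wheel L
  leibO : mulO.Leibniz plug O.plug plug
  leibW : mulW.Leibniz plug O.wheelPlug plug
  mulO_mulO : ∀ {A A' B B' C C' : Type} [Finite A] [Finite A'] [Finite B] [Finite B'] [Finite C]
    [Finite C'] (m : val L A A') (p : val O.toMod B B') (q : val O.toMod C C'),
    mulO.mul (mulO.mul m p) q =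
      -act L (sumRightComm A C B) (sumRightComm A' C' B') (mulO.mul (mulO.mul m q) p)
  mulW_mulO : ∀ {A A' B B' C C' : Type} [Finite A] [Finite A'] [Finite B] [Finite B'] [Finite C]
    [Finite C'] (m : val L A A') (p : val O.toMod B B') (a : val O.wheel C C'),
    mulW.mul (mulO.mul m p) a =
      act L (sumRightComm A C B) (sumRightComm A' C' B') (mulO.mul (mulW.mul m a) p)
  mulW_mulW : ∀ {A A' B B' C C' : Type} [Finite A] [Finite A'] [Finite B] [Finite B'] [Finite C]
    [Finite C'] (m : val L A A') (a : val O.wheel B B') (b : val O.wheel C C'),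
    mulW.mul (mulW.mul m a) b =
      act L (sumRightComm A C B) (sumRightComm A' C' B') (mulW.mul (mulW.mul m b) a)
  split : ∀ {X Y : Type} [Finite X] [Finite Y],
    val L X (Pt Y) →ₗ[k] val (dayConv L (delta01 O.toMod)) X Y
  split_mul : ∀ {A A' B B' X Y : Type} [Finite A] [Finite A'] [Finite B] [Finite B'] [Finite X]
    [Finite Y] (e : A ⊕ B ≃ X) (e' : A' ⊕ B' ≃ Y) (m : val L A A') (q : val O.toMod B (Pt B')),
    split (act L e ((Equiv.sumAssoc A' B' (Fin 1)).symm.trans (onPt e')) (mulO.mul m q)) =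
      act (dayConv L (delta01 O.toMod)) e e' (dayMk (G := delta01 O.toMod) m q)
  induction : ∀ {X Y : Type} [Finite X] [Finite Y] {P : val L X (Pt Y) → Prop}, P 0 →
    (∀ s t, P s → P t → P (s + t)) → (∀ (a : k) t, P t → P (a • t)) →
    (∀ {A A' B B' : Type} [Finite A] [Finite A'] [Finite B] [Finite B'] (e : A ⊕ B ≃ X)
      (e' : A' ⊕ B' ≃ Y) (m : val L A A') (q : val O.toMod B (Pt B')),
      P (act L e ((Equiv.sumAssoc A' B' (Fin 1)).symm.trans (onPt e')) (mulO.mul m q))) → ∀ t, P t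

namespace ContrData

variable (D : ContrData O L)

/-- The contraction of an input of `m` with the output of `q`. -/
def plugFam : BiFam (delta10 L) (delta01 O.toMod) X Y (val L X Y) :=
  fun {A A' B B'} _ _ _ _ e e' => (D.plug.plug (A := A) (A' := A') (B := B) (B' := B')).compr₂
    (act L e e')

/-- The contraction of an input of `q` with the output of `q`. -/
def wheelFam : BiFam L (delta10 (delta01 O.toMod)) X Y (val L X Y) :=
  fun {A A' B B'} _ _ _ _ e e' => ((D.mulW.mul (A := A) (A' := A') (B := B) (B' := B')).compl₂
    O.toWheel).compr₂ (act L e e')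

lemma isNat_plugFam : IsNat (D.plugFam (X := X) (Y := Y)) := by
  intro A A' B B' C C' E E' _ _ _ _ _ _ _ _ f f' g g' e e' m q
  refine (congrArg (act L e e') (D.plug.plug_act f f' g g' m q)).trans ?_
  exact act_act L _ _ _ _ _

lemma isNat_wheelFam : IsNat (D.wheelFam (X := X) (Y := Y)) := by
  intro A A' B B' C C' E E' _ _ _ _ _ _ _ _ f f' g g' e e' m q
  refine (congrArg (act L e e') (D.mulW.mul_act f f' g g' m (O.toWheel q))).trans ?_
  exact act_act L _ _ _ _ _

/-- The contraction of the added points. -/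
def contr (X Y : Type) [Finite X] [Finite Y] : val L (Pt X) (Pt Y) →ₗ[k] val L X Y :=
  dayLiftFst D.plugFam D.wheelFam ∘ₗ D.split

/-- `split` isolates the factor `q` with the added output. The added input then lies in `m` or in
`q`, and this decides between plugging and closing up (`contr_right'`). -/
lemma contr_left' (e : A ⊕ B ≃ X) (e' : A' ⊕ B' ≃ Y) (m : val L (Pt A) A')
    (q : val O.toMod B (Pt B')) :
    D.contr X Y (act L ((sumRightComm A (Fin 1) B).trans (onPt e))
      ((Equiv.sumAssoc A' B' (Fin 1)).symm.trans (onPt e')) (D.mulO.mul m q)) =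
        act L e e' (D.plug.plug m q) := by
  refine (congrArg (dayLiftFst D.plugFam D.wheelFam) (D.split_mul _ e' m q)).trans ?_
  exact dayLiftFst_left _ D.isNat_plugFam e e' m q

lemma contr_right' (e : A ⊕ B ≃ X) (e' : A' ⊕ B' ≃ Y) (m : val L A A')
    (q : val O.toMod (Pt B) (Pt B')) :
    D.contr X Y (act L ((Equiv.sumAssoc A B (Fin 1)).symm.trans (onPt e))
      ((Equiv.sumAssoc A' B' (Fin 1)).symm.trans (onPt e')) (D.mulO.mul m q)) =
        act L e e' (D.mulW.mul m (O.toWheel q)) := by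
  refine (congrArg (dayLiftFst D.plugFam D.wheelFam) (D.split_mul _ e' m q)).trans ?_
  exact dayLiftFst_right _ D.isNat_wheelFam e e' m q

/-- Here the points may sit anywhere in the sets `C` and `C'`, and the position is described by `f`
and `f'`. The equations on `g` and `g'` are meant to be checked on elements. -/
lemma contr_left (f : C ≃ Pt A) (f' : C' ≃ Pt B') (e : A ⊕ B ≃ X) (e' : A' ⊕ B' ≃ Y)
    {g : C ⊕ B ≃ Pt X} {g' : A' ⊕ C' ≃ Pt Y}
    (hg : g = (f.sumCongr (Equiv.refl B)).trans ((sumRightComm A (Fin 1) B).trans (onPt e)))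
    (hg' : g' = ((Equiv.refl A').sumCongr f').trans
      ((Equiv.sumAssoc A' B' (Fin 1)).symm.trans (onPt e')))
    (m : val L C A') (q : val O.toMod B C') :
    D.contr X Y (act L g g' (D.mulO.mul m q)) =
      act L e e' (D.plug.plug (act L f (Equiv.refl _) m) (act O.toMod (Equiv.refl _) f' q)) := by
  rw [← D.contr_left', D.mulO.mul_act, act_act, hg, hg']

lemma contr_right (f : C ≃ Pt B) (f' : C' ≃ Pt B') (e : A ⊕ B ≃ X) (e' : A' ⊕ B' ≃ Y)
    {g : A ⊕ C ≃ Pt X} {g' : A' ⊕ C' ≃ Pt Y}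
    (hg : g = ((Equiv.refl A).sumCongr f).trans ((Equiv.sumAssoc A B (Fin 1)).symm.trans (onPt e)))
    (hg' : g' = ((Equiv.refl A').sumCongr f').trans
      ((Equiv.sumAssoc A' B' (Fin 1)).symm.trans (onPt e')))
    (m : val L A A') (q : val O.toMod C C') :
    D.contr X Y (act L g g' (D.mulO.mul m q)) =
      act L e e' (D.mulW.mul m (O.toWheel (act O.toMod f f' q))) := by
  rw [← D.contr_right', D.mulO.mul_act_right, act_act, hg, hg']

/-- Once the factor with the added output is split off, only two positions of the added input are
left, and on both the contraction is given by an explicit formula. -/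
lemma pt_induction {P : val L (Pt X) (Pt Y) → Prop} (h0 : P 0)
    (hadd : ∀ s t, P s → P t → P (s + t)) (hsmul : ∀ (a : k) t, P t → P (a • t))
    (hl : ∀ {A A' B B' : Type} [Finite A] [Finite A'] [Finite B] [Finite B'] (e : A ⊕ B ≃ X)
      (e' : A' ⊕ B' ≃ Y) (m : val L (Pt A) A') (q : val O.toMod B (Pt B')),
      P (act L ((sumRightComm A (Fin 1) B).trans (onPt e))
        ((Equiv.sumAssoc A' B' (Fin 1)).symm.trans (onPt e')) (D.mulO.mul m q)))
    (hr : ∀ {A A' B B' : Type} [Finite A] [Finite A'] [Finite B] [Finite B'] (e : A ⊕ B ≃ X)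
      (e' : A' ⊕ B' ≃ Y) (m : val L A A') (q : val O.toMod (Pt B) (Pt B')),
      P (act L ((Equiv.sumAssoc A B (Fin 1)).symm.trans (onPt e))
        ((Equiv.sumAssoc A' B' (Fin 1)).symm.trans (onPt e')) (D.mulO.mul m q))) (t) : P t := by
  refine D.induction h0 hadd hsmul (fun {A A' B B'} _ _ _ _ e e' m q => ?_) t
  obtain ⟨C, _, f, h, rfl⟩ | ⟨C, _, f, h, rfl⟩ := sum_pt_cases e
  · have := hl h e' (act L f (Equiv.refl _) m) q
    rwa [D.mulO.mul_act_left, act_act, Equiv.sumCongr_refl, Equiv.refl_trans] at this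
  · have := hr h e' m (act O.toMod f (Equiv.refl _) q)
    rwa [D.mulO.mul_act_right, act_act, Equiv.sumCongr_refl, Equiv.refl_trans] at this

lemma contr_act (f : X ≃ X') (f' : Y ≃ Y') (t : val L (Pt X) (Pt Y)) :
    D.contr X' Y' (act L (onPt f) (onPt f') t) = act L f f' (D.contr X Y t) := by
  refine D.pt_induction (P := fun t => D.contr X' Y' (act L (onPt f) (onPt f') t) =
    act L f f' (D.contr X Y t)) ?_ (fun s t hs ht => ?_) (fun a t ht => ?_)
    (fun e e' m q => ?_) (fun e e' m q => ?_) t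
  · simp only [map_zero]
  · simp only [map_add, hs, ht]
  · simp only [map_smul, ht]
  · rw [contr_left', act_act, act_act, ← contr_left']
    refine congrArg (D.contr X' Y') (act_congr ?_ ?_ rfl)
    · exact Equiv.ext (by rintro ((x | x) | x) <;> rfl)
    · exact Equiv.ext (by rintro (x | x | x) <;> rfl)
  · rw [contr_right', act_act, act_act, ← contr_right']
    refine congrArg (D.contr X' Y') (act_congr ?_ ?_ rfl)
    · exact Equiv.ext (by rintro (x | x | x) <;> rfl)
    · exact Equiv.ext (by rintro (x | x | x) <;> rfl)

/-- The added point lies in the third summand. -/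
def ptThird (A C B : Type) : (A ⊕ C) ⊕ Pt B ≃ Pt ((A ⊕ C) ⊕ B) :=
  (Equiv.sumAssoc (A ⊕ C) B (Fin 1)).symm

/-- The added point lies in the second summand. -/
def ptSecond (A C B : Type) : (A ⊕ Pt C) ⊕ B ≃ Pt ((A ⊕ C) ⊕ B) :=
  ((Equiv.sumAssoc A C (Fin 1)).symm.sumCongr (Equiv.refl B)).trans (sumRightComm (A ⊕ C) (Fin 1) B)

/-- The added point lies in the first summand. -/
def ptFirst (A C B : Type) : (Pt A ⊕ C) ⊕ B ≃ Pt ((A ⊕ C) ⊕ B) :=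
  ((sumRightComm A (Fin 1) C).sumCongr (Equiv.refl B)).trans (sumRightComm (A ⊕ C) (Fin 1) B)

/-- The outer added point lies in the third summand, the inner one in the second summand. -/
def outPts (A C B : Type) : (A ⊕ Pt C) ⊕ Pt B ≃ Pt (Pt ((A ⊕ C) ⊕ B)) :=
  (ptThird A (Pt C) B).trans (onPt (ptSecond A C B))

/-- This and the next eight lemmas evaluate a double contraction of `m · p · q`, where `q` has the
outer and `p` the inner added output. The names tell in which of `m`, `p`, `q` (first, second,
third) the outer and then the inner added input lies; the outer pair is contracted first. Here `q`
and `p` are both closed up on themselves. -/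
lemma contr_third_second (m : val L A A') (p : val O.toMod (Pt C) (Pt C'))
    (q : val O.toMod (Pt B) (Pt B')) :
    D.contr _ _ (D.contr _ _ (act L (outPts A C B) (outPts A' C' B')
      (D.mulO.mul (D.mulO.mul m p) q))) =
      act L (sumRightComm A B C) (sumRightComm A' B' C')
        (D.mulW.mul (D.mulW.mul m (O.toWheel q)) (O.toWheel p)) := by
  refine (congrArg (D.contr _ _) (D.contr_right' (ptSecond A C B) (ptSecond A' C' B') _ q)).trans ?_
  -- The new wheel is moved in front of `p`, so that `p` is again the last factor.
  rw [D.mulW_mulO, act_act]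
  refine (D.contr_right (Equiv.refl _) (Equiv.refl _) (sumRightComm A B C) (sumRightComm A' B' C')
    ?_ ?_ _ p).trans ?_
  · exact Equiv.ext (by rintro ((x | x) | x | x) <;> rfl)
  · exact Equiv.ext (by rintro ((x | x) | x | x) <;> rfl)
  · rw [act_refl]

/-- First `q` is plugged into `p`, then the input that came from `q` is closed with the output that
came from `p`: a cycle with two vertices. -/
lemma contr_second_third (m : val L A A') (p : val O.toMod (Pt C) (Pt C'))
    (q : val O.toMod (Pt B) (Pt B')) :
    D.contr _ _ (D.contr _ _ (act L ((ptSecond A C (Pt B)).trans (onPt (ptThird A C B)))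
      (outPts A' C' B') (D.mulO.mul (D.mulO.mul m p) q))) =
      act L (Equiv.sumAssoc A C B).symm (Equiv.sumAssoc A' C' B').symm
        (D.mulW.mul m (O.toWheel (O.deltaMul p q))) := by
  refine (congrArg (D.contr _ _) (D.contr_left (Equiv.sumAssoc A C (Fin 1)).symm (Equiv.refl _)
    (ptThird A C B) (ptSecond A' C' B') ?_ ?_ _ q)).trans ?_
  · exact Equiv.ext (by rintro ((x | x | x) | x | x) <;> rfl)
  · exact Equiv.ext (by rintro ((x | x | x) | x | x) <;> rfl)
  rw [act_refl, D.leibO.right, act_act]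
  refine (D.contr_right (Equiv.sumAssoc C B (Fin 1)).symm (sumRightComm C' (Fin 1) B')
    (Equiv.sumAssoc A C B).symm (Equiv.sumAssoc A' C' B').symm ?_ ?_ m (O.comp p q)).trans rfl
  · exact Equiv.ext (by rintro (x | x | x | x) <;> rfl)
  · exact Equiv.ext (by rintro (x | (x | x) | x) <;> rfl)

/-- Two successive plugs into `m`, first `q` and then `p`. -/
lemma contr_first_first (m : val L (Pt (Pt A)) A') (p : val O.toMod C (Pt C'))
    (q : val O.toMod B (Pt B')) :
    D.contr _ _ (D.contr _ _ (act L ((ptFirst (Pt A) C B).trans (onPt (ptFirst A C B)))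
      (outPts A' C' B') (D.mulO.mul (D.mulO.mul m p) q))) =
      act L (sumRightComm A B C) (sumRightComm A' B' C')
        (D.plug.plug (act L (sumRightComm A (Fin 1) B) (Equiv.refl _) (D.plug.plug m q)) p) := by
  refine (congrArg (D.contr _ _) (D.contr_left (sumRightComm (Pt A) (Fin 1) C) (Equiv.refl _)
    (ptFirst A C B) (ptSecond A' C' B') ?_ ?_ _ q)).trans ?_
  · exact Equiv.ext (by rintro (((((x | x) | x) | x)) | x) <;> rfl)
  · exact Equiv.ext (by rintro ((x | x | x) | x | x) <;> rfl)
  rw [act_refl, D.leibO.left, act_act]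
  refine (D.contr_left (sumRightComm A (Fin 1) B) (Equiv.refl _)
    (sumRightComm A B C) (sumRightComm A' B' C') ?_ ?_ _ p).trans ?_
  · exact Equiv.ext (by rintro (((x | x) | x) | x) <;> rfl)
  · exact Equiv.ext (by rintro ((x | x) | x | x) <;> rfl)
  · rw [act_refl]

/-- First `q` is closed up to a wheel, then `p` is plugged into an input of that wheel. -/
lemma contr_third_third (m : val L A A') (p : val O.toMod C (Pt C'))
    (q : val O.toMod (Pt (Pt B)) (Pt B')) :
    D.contr _ _ (D.contr _ _ (act L ((ptThird A C (Pt B)).trans (onPt (ptThird A C B)))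
      (outPts A' C' B') (D.mulO.mul (D.mulO.mul m p) q))) =
      act L ((Equiv.sumAssoc A B C).symm.trans (sumRightComm A B C))
        ((Equiv.sumAssoc A' B' C').symm.trans (sumRightComm A' B' C'))
          (D.mulW.mul m (O.toWheel (O.deltaAct q p))) := by
  refine (congrArg (D.contr _ _) (D.contr_right' (ptThird A C B) (ptSecond A' C' B') _ q)).trans ?_
  rw [D.mulW_mulO, act_act]
  refine (D.contr_left (Equiv.sumAssoc A B (Fin 1)).symm (Equiv.refl _) (sumRightComm A B C)
    (sumRightComm A' B' C') ?_ ?_ _ p).trans ?_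
  · exact Equiv.ext (by rintro ((x | x | x) | x) <;> rfl)
  · exact Equiv.ext (by rintro ((x | x) | x | x) <;> rfl)
  · rw [act_refl, D.leibW.right, act_act]; rfl

/-- First `q` is plugged into `p`, then the composite is closed up at an input of `p`. -/
lemma contr_second_second (m : val L A A') (p : val O.toMod (Pt (Pt C)) (Pt C'))
    (q : val O.toMod B (Pt B')) :
    D.contr _ _ (D.contr _ _ (act L ((ptSecond A (Pt C) B).trans (onPt (ptSecond A C B)))
      (outPts A' C' B') (D.mulO.mul (D.mulO.mul m p) q))) =
      act L (Equiv.sumAssoc A C B).symm (Equiv.sumAssoc A' C' B').symm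
          (D.mulW.mul m (O.toWheel (act O.toMod (sumRightComm C (Fin 1) B)
            (sumRightComm C' (Fin 1) B') (O.comp p q)))) := by
  refine (congrArg (D.contr _ _) (D.contr_left (Equiv.sumAssoc A (Pt C) (Fin 1)).symm
    (Equiv.refl _) (ptSecond A C B) (ptSecond A' C' B') ?_ ?_ _ q)).trans ?_
  · exact Equiv.ext (by rintro ((x | (x | x) | x) | x) <;> rfl)
  · exact Equiv.ext (by rintro ((x | x | x) | x | x) <;> rfl)
  rw [act_refl, D.leibO.right, act_act]
  refine (D.contr_right (sumRightComm C (Fin 1) B) (sumRightComm C' (Fin 1) B')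
    (Equiv.sumAssoc A C B).symm (Equiv.sumAssoc A' C' B').symm ?_ ?_ m (O.comp p q))
  · exact Equiv.ext (by rintro (x | (x | x) | x) <;> rfl)
  · exact Equiv.ext (by rintro (x | (x | x) | x) <;> rfl)

lemma contr_third_first (m : val L (Pt A) A') (p : val O.toMod C (Pt C'))
    (q : val O.toMod (Pt B) (Pt B')) :
    D.contr _ _ (D.contr _ _ (act L ((ptThird (Pt A) C B).trans (onPt (ptFirst A C B)))
      (outPts A' C' B') (D.mulO.mul (D.mulO.mul m p) q))) =
      D.mulW.mul (D.plug.plug m p) (O.toWheel q) := by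
  refine (congrArg (D.contr _ _) (D.contr_right' (ptFirst A C B) (ptSecond A' C' B') _ q)).trans ?_
  rw [D.mulW_mulO, act_act]
  refine (D.contr_left (sumRightComm A (Fin 1) B) (Equiv.refl _) (sumRightComm A B C)
    (sumRightComm A' B' C') ?_ ?_ _ p).trans ?_
  · exact Equiv.ext (by rintro (((x | x) | x) | x) <;> rfl)
  · exact Equiv.ext (by rintro ((x | x) | x | x) <;> rfl)
  -- The plug acts on `m` and leaves the wheel of `q` untouched.
  · rw [act_refl, D.leibW.left, act_act]
    refine (act_congr ?_ ?_ rfl).trans (act_refl L _)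
    · exact Equiv.ext (by rintro ((x | x) | x) <;> rfl)
    · exact Equiv.ext (by rintro ((x | x) | x) <;> rfl)

lemma contr_first_second (m : val L (Pt A) A') (p : val O.toMod (Pt C) (Pt C'))
    (q : val O.toMod B (Pt B')) :
    D.contr _ _ (D.contr _ _ (act L ((ptFirst A (Pt C) B).trans (onPt (ptSecond A C B)))
      (outPts A' C' B') (D.mulO.mul (D.mulO.mul m p) q))) =
      act L (sumRightComm A B C) (sumRightComm A' B' C')
        (D.mulW.mul (D.plug.plug m q) (O.toWheel p)) := by
  refine (congrArg (D.contr _ _) (D.contr_left (sumRightComm A (Fin 1) (Pt C)) (Equiv.refl _)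
    (ptSecond A C B) (ptSecond A' C' B') ?_ ?_ _ q)).trans ?_
  · exact Equiv.ext (by rintro (((x | x) | x | x) | x) <;> rfl)
  · exact Equiv.ext (by rintro ((x | x | x) | x | x) <;> rfl)
  rw [act_refl, D.leibO.left, act_act]
  refine (D.contr_right (Equiv.refl _) (Equiv.refl _) (sumRightComm A B C)
    (sumRightComm A' B' C') ?_ ?_ _ p).trans ?_
  · exact Equiv.ext (by rintro ((x | x) | x | x) <;> rfl)
  · exact Equiv.ext (by rintro ((x | x) | x | x) <;> rfl)
  · rw [act_refl]

/-- A chain: `q` enters `p`, and the composite enters `m`. -/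
lemma contr_second_first (m : val L (Pt A) A') (p : val O.toMod (Pt C) (Pt C'))
    (q : val O.toMod B (Pt B')) :
    D.contr _ _ (D.contr _ _ (act L ((ptSecond (Pt A) C B).trans (onPt (ptFirst A C B)))
      (outPts A' C' B') (D.mulO.mul (D.mulO.mul m p) q))) =
      act L (Equiv.sumAssoc A C B).symm (Equiv.sumAssoc A' C' B').symm
        (D.plug.plug m (act O.toMod (Equiv.refl _) (sumRightComm C' (Fin 1) B') (O.comp p q))) := by
  refine (congrArg (D.contr _ _) (D.contr_left (Equiv.sumAssoc (Pt A) C (Fin 1)).symm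
    (Equiv.refl _) (ptFirst A C B) (ptSecond A' C' B') ?_ ?_ _ q)).trans ?_
  · exact Equiv.ext (by rintro (((x | x) | x | x) | x) <;> rfl)
  · exact Equiv.ext (by rintro ((x | x | x) | x | x) <;> rfl)
  rw [act_refl, D.leibO.right, act_act]
  refine (D.contr_left (Equiv.refl _) (sumRightComm C' (Fin 1) B') (Equiv.sumAssoc A C B).symm
    (Equiv.sumAssoc A' C' B').symm ?_ ?_ m (O.comp p q)).trans ?_
  · exact Equiv.ext (by rintro ((x | x) | x | x) <;> rfl)
  · exact Equiv.ext (by rintro (x | (x | x) | x) <;> rfl)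
  · rw [act_refl]

/-- A chain built in the other order: `q` enters `m`, and `p` then enters the input that came from
`q`. -/
lemma contr_first_third (m : val L (Pt A) A') (p : val O.toMod C (Pt C'))
    (q : val O.toMod (Pt B) (Pt B')) :
    D.contr _ _ (D.contr _ _ (act L ((ptFirst A C (Pt B)).trans (onPt (ptThird A C B)))
      (outPts A' C' B') (D.mulO.mul (D.mulO.mul m p) q))) =
      act L (sumRightComm A B C) (sumRightComm A' B' C')
        (D.plug.plug (act L (Equiv.sumAssoc A B (Fin 1)).symm (Equiv.refl _)
          (D.plug.plug m q)) p) := by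
  refine (congrArg (D.contr _ _) (D.contr_left (sumRightComm A (Fin 1) C) (Equiv.refl _)
    (ptThird A C B) (ptSecond A' C' B') ?_ ?_ _ q)).trans ?_
  · exact Equiv.ext (by rintro (((x | x) | x) | x | x) <;> rfl)
  · exact Equiv.ext (by rintro ((x | x | x) | x | x) <;> rfl)
  rw [act_refl, D.leibO.left, act_act]
  refine (D.contr_left (Equiv.sumAssoc A B (Fin 1)).symm (Equiv.refl _) (sumRightComm A B C)
    (sumRightComm A' B' C') ?_ ?_ _ p).trans ?_
  · exact Equiv.ext (by rintro ((x | x | x) | x) <;> rfl)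
  · exact Equiv.ext (by rintro ((x | x) | x | x) <;> rfl)
  · rw [act_refl]

/-- The two iterated contractions of `t` are opposite. -/
def Anti (t : val L (Pt (Pt X)) (Pt (Pt Y))) : Prop :=
  D.contr _ _ (D.contr _ _ t) = -D.contr _ _ (D.contr _ _ (act L (sumRightComm X (Fin 1) (Fin 1))
    (sumRightComm Y (Fin 1) (Fin 1)) t))

variable {D}

lemma anti_zero : D.Anti (0 : val L (Pt (Pt X)) (Pt (Pt Y))) := by
  simp only [Anti, map_zero, neg_zero]

lemma Anti.add {s t : val L (Pt (Pt X)) (Pt (Pt Y))} (hs : D.Anti s) (ht : D.Anti t) :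
    D.Anti (s + t) := by
  unfold Anti at *
  simp only [map_add, hs, ht, neg_add]

lemma Anti.smul {t : val L (Pt (Pt X)) (Pt (Pt Y))} (a : k) (ht : D.Anti t) :
    D.Anti (a • t) := by
  unfold Anti at *
  simp only [map_smul, ht, smul_neg]

lemma Anti.neg {t : val L (Pt (Pt X)) (Pt (Pt Y))} (ht : D.Anti t) : D.Anti (-t) := by
  unfold Anti at *
  simp only [map_neg, ht]

lemma Anti.act {t : val L (Pt (Pt X)) (Pt (Pt Y))} (ht : D.Anti t) (e : X ≃ X') (e' : Y ≃ Y') :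
    D.Anti (FBMod.act L (onPt (onPt e)) (onPt (onPt e')) t) := by
  unfold Anti at *
  have h : FBMod.act L (sumRightComm X' (Fin 1) (Fin 1)) (sumRightComm Y' (Fin 1) (Fin 1))
      (FBMod.act L (onPt (onPt e)) (onPt (onPt e')) t) =
      FBMod.act L (onPt (onPt e)) (onPt (onPt e')) (FBMod.act L (sumRightComm X (Fin 1) (Fin 1))
        (sumRightComm Y (Fin 1) (Fin 1)) t) := by
    rw [act_act, act_act]
    refine act_congr ?_ ?_ rfl
    · exact Equiv.ext (by rintro ((x | x) | x) <;> rfl)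
    · exact Equiv.ext (by rintro ((x | x) | x) <;> rfl)
  rw [h, contr_act, contr_act, contr_act, contr_act, ht, map_neg]

/-- The exchange of the two points is an involution and the sign is its own inverse. So only one of
two exchanged configurations has to be treated. -/
lemma Anti.of_swap {t : val L (Pt (Pt X)) (Pt (Pt Y))}
    (ht : D.Anti (FBMod.act L (sumRightComm X (Fin 1) (Fin 1)) (sumRightComm Y (Fin 1) (Fin 1)) t)) :
    D.Anti t := by
  unfold Anti at *
  rw [ht, act_act, neg_neg]
  refine congrArg (fun x => D.contr _ _ (D.contr _ _ x)) ?_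
  refine (act_refl L t).symm.trans (act_congr ?_ ?_ rfl)
  · exact Equiv.ext (by rintro ((x | x) | x) <;> rfl)
  · exact Equiv.ext (by rintro ((x | x) | x) <;> rfl)

section Swap

variable {A₁ B₁ C₁ : Type} [Finite A₁] [Finite B₁] [Finite C₁]

/-- This is the source of the sign: exchanging the outer and the inner point amounts to exchanging
`p` and `q`, which anticommute under `mulO`. The outputs have the same form after the exchange; the
condition `hgh` concerns the inputs. -/
lemma act_swap (D : ContrData O L) (m : val L A₁ A') (p : val O.toMod C₁ (Pt C'))
    (q : val O.toMod B₁ (Pt B'))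
    {g : (A₁ ⊕ C₁) ⊕ B₁ ≃ Pt (Pt ((A ⊕ C) ⊕ B))} {h : (A₁ ⊕ B₁) ⊕ C₁ ≃ Pt (Pt ((A ⊕ B) ⊕ C))}
    (hgh : (sumRightComm A₁ B₁ C₁).trans (g.trans (sumRightComm ((A ⊕ C) ⊕ B) (Fin 1) (Fin 1))) =
      h.trans (onPt (onPt (sumRightComm A B C)))) :
    act L (sumRightComm ((A ⊕ C) ⊕ B) (Fin 1) (Fin 1))
      (sumRightComm ((A' ⊕ C') ⊕ B') (Fin 1) (Fin 1)) (act L g (outPts A' C' B')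
        (D.mulO.mul (D.mulO.mul m p) q)) =
      -act L (onPt (onPt (sumRightComm A B C))) (onPt (onPt (sumRightComm A' B' C')))
        (act L h (outPts A' B' C') (D.mulO.mul (D.mulO.mul m q) p)) := by
  rw [D.mulO_mulO m p q, map_neg, map_neg, act_act, act_act, act_act]
  refine congrArg Neg.neg (act_congr hgh ?_ rfl)
  exact Equiv.ext (by rintro ((x | x | x) | x | x) <;> rfl)

/-- The sign of `act_swap` cancels the sign in `Anti`. What is left is an unsigned comparison of the
two orders of contraction. -/
lemma anti_of (m : val L A₁ A') (p : val O.toMod C₁ (Pt C')) (q : val O.toMod B₁ (Pt B'))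
    {g : (A₁ ⊕ C₁) ⊕ B₁ ≃ Pt (Pt ((A ⊕ C) ⊕ B))} (h : (A₁ ⊕ B₁) ⊕ C₁ ≃ Pt (Pt ((A ⊕ B) ⊕ C)))
    (hgh : (sumRightComm A₁ B₁ C₁).trans (g.trans (sumRightComm ((A ⊕ C) ⊕ B) (Fin 1) (Fin 1))) =
      h.trans (onPt (onPt (sumRightComm A B C))))
    (hv : D.contr _ _ (D.contr _ _ (act L g (outPts A' C' B')
        (D.mulO.mul (D.mulO.mul m p) q))) =
      act L (sumRightComm A B C) (sumRightComm A' B' C') (D.contr _ _ (D.contr _ _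
        (act L h (outPts A' B' C') (D.mulO.mul (D.mulO.mul m q) p))))) :
    D.Anti (act L g (outPts A' C' B') (D.mulO.mul (D.mulO.mul m p) q)) := by
  rw [Anti, act_swap D m p q hgh, map_neg, map_neg, neg_neg, contr_act, contr_act, hv]

lemma anti_of_swap (m : val L A₁ A') (p : val O.toMod C₁ (Pt C')) (q : val O.toMod B₁ (Pt B'))
    {g : (A₁ ⊕ C₁) ⊕ B₁ ≃ Pt (Pt ((A ⊕ C) ⊕ B))} (h : (A₁ ⊕ B₁) ⊕ C₁ ≃ Pt (Pt ((A ⊕ B) ⊕ C)))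
    (hgh : (sumRightComm A₁ B₁ C₁).trans (g.trans (sumRightComm ((A ⊕ C) ⊕ B) (Fin 1) (Fin 1))) =
      h.trans (onPt (onPt (sumRightComm A B C))))
    (hv : D.Anti (act L h (outPts A' B' C') (D.mulO.mul (D.mulO.mul m q) p))) :
    D.Anti (act L g (outPts A' C' B') (D.mulO.mul (D.mulO.mul m p) q)) := by
  refine Anti.of_swap ?_
  rw [act_swap D m p q hgh]
  exact (hv.act _ _).neg

end Swap

/-- Two disjoint loops are formed, and wheels commute. -/
lemma anti_third_second (m : val L A A') (p : val O.toMod (Pt C) (Pt C'))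
    (q : val O.toMod (Pt B) (Pt B')) :
    D.Anti (act L (outPts A C B) (outPts A' C' B') (D.mulO.mul (D.mulO.mul m p) q)) := by
  refine anti_of m p q (outPts A B C) ?_ ?_
  · exact Equiv.ext (by rintro ((x | x | x) | x | x) <;> rfl)
  · rw [contr_third_second, contr_third_second, D.mulW_mulW m (O.toWheel q)]

/-- The two orders give the wheels of `O.deltaMul p q` and `O.deltaMul q p`, which agree because
commutators vanish in `|δ_{1,1} O|`. -/
lemma anti_second_third (m : val L A A') (p : val O.toMod (Pt C) (Pt C'))
    (q : val O.toMod (Pt B) (Pt B')) :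
    D.Anti (act L ((ptSecond A C (Pt B)).trans (onPt (ptThird A C B))) (outPts A' C' B')
      (D.mulO.mul (D.mulO.mul m p) q)) := by
  refine anti_of m p q ((ptSecond A B (Pt C)).trans (onPt (ptThird A B C))) ?_ ?_
  · exact Equiv.ext (by rintro ((x | x | x) | x | x) <;> rfl)
  · rw [contr_second_third, contr_second_third]
    have h := toWheel_comm O (Equiv.refl (C ⊕ B)) (Equiv.refl (C' ⊕ B')) p q
    rw [← act_toWheel, ← act_toWheel, act_refl] at h
    rw [h, D.mulW.mul_act_right, act_act, act_act]
    refine act_congr ?_ ?_ rfl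
    · exact Equiv.ext (by rintro (x | x | x) <;> rfl)
    · exact Equiv.ext (by rintro (x | x | x) <;> rfl)

/-- Parallel associativity of the action on `L`. The exchange of the points also exchanges the two
inputs of `m`. -/
lemma anti_first_first (m : val L (Pt (Pt A)) A') (p : val O.toMod C (Pt C'))
    (q : val O.toMod B (Pt B')) :
    D.Anti (act L ((ptFirst (Pt A) C B).trans (onPt (ptFirst A C B))) (outPts A' C' B')
      (D.mulO.mul (D.mulO.mul m p) q)) := by
  refine anti_of m p q ((((sumRightComm A (Fin 1) (Fin 1)).sumCongr (Equiv.refl B)).sumCongr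
    (Equiv.refl C)).trans ((ptFirst (Pt A) B C).trans (onPt (ptFirst A B C)))) ?_ ?_
  · exact Equiv.ext (by rintro ((((x | x) | x) | x) | x) <;> rfl)
  · have h : act L ((((sumRightComm A (Fin 1) (Fin 1)).sumCongr (Equiv.refl B)).sumCongr
        (Equiv.refl C)).trans ((ptFirst (Pt A) B C).trans (onPt (ptFirst A B C)))) (outPts A' B' C')
          (D.mulO.mul (D.mulO.mul m q) p) =
        act L ((ptFirst (Pt A) B C).trans (onPt (ptFirst A B C))) (outPts A' B' C')
          (D.mulO.mul (D.mulO.mul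
            (act L (sumRightComm A (Fin 1) (Fin 1)) (Equiv.refl _) m) q) p) := by
      rw [D.mulO.mul_act_left, D.mulO.mul_act_left, act_act]
      exact act_congr rfl (Equiv.ext (by rintro ((x | x) | x) <;> rfl)) rfl
    rw [h, contr_first_first, contr_first_first, ← (D.assoc.par m).out q p, act_act, act_act]
    refine act_congr ?_ ?_ rfl
    · exact Equiv.ext (by rintro ((x | x) | x) <;> rfl)
    · exact Equiv.ext (by rintro ((x | x) | x) <;> rfl)

/-- Closing `q` and then plugging `p` agrees with plugging first and closing afterwards: this is the
definition of `α`. -/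
lemma anti_third_third (m : val L A A') (p : val O.toMod C (Pt C'))
    (q : val O.toMod (Pt (Pt B)) (Pt B')) :
    D.Anti (act L ((ptThird A C (Pt B)).trans (onPt (ptThird A C B))) (outPts A' C' B')
      (D.mulO.mul (D.mulO.mul m p) q)) := by
  refine anti_of m p q ((((Equiv.refl A).sumCongr (sumRightComm B (Fin 1) (Fin 1))).sumCongr
    (Equiv.refl C)).trans ((ptSecond A (Pt B) C).trans (onPt (ptSecond A B C)))) ?_ ?_
  · exact Equiv.ext (by rintro ((x | (x | x) | x) | x) <;> rfl)
  · have h : act L ((((Equiv.refl A).sumCongr (sumRightComm B (Fin 1) (Fin 1))).sumCongr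
        (Equiv.refl C)).trans ((ptSecond A (Pt B) C).trans (onPt (ptSecond A B C))))
          (outPts A' B' C') (D.mulO.mul (D.mulO.mul m q) p) =
        act L ((ptSecond A (Pt B) C).trans (onPt (ptSecond A B C))) (outPts A' B' C')
          (D.mulO.mul (D.mulO.mul m
            (act O.toMod (sumRightComm B (Fin 1) (Fin 1)) (Equiv.refl _) q)) p) := by
      rw [D.mulO.mul_act_right, D.mulO.mul_act_left, act_act]
      exact act_congr rfl (Equiv.ext (by rintro ((x | x | x) | x) <;> rfl)) rfl
    rw [h, contr_third_third, contr_second_second, act_act, deltaAct_eq]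

/-- The loop at `q` and the plug of `p` into `m` do not interact; the Leibniz rule for products with
wheels has been used in the evaluation. -/
lemma anti_third_first (m : val L (Pt A) A') (p : val O.toMod C (Pt C'))
    (q : val O.toMod (Pt B) (Pt B')) :
    D.Anti (act L ((ptThird (Pt A) C B).trans (onPt (ptFirst A C B))) (outPts A' C' B')
      (D.mulO.mul (D.mulO.mul m p) q)) := by
  refine anti_of m p q ((ptFirst A (Pt B) C).trans (onPt (ptSecond A B C))) ?_ ?_
  · exact Equiv.ext (by rintro (((x | x) | x | x) | x) <;> rfl)
  · rw [contr_third_first, contr_first_second, act_act]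
    refine ((act_congr ?_ ?_ rfl).trans (act_refl L _)).symm
    · exact Equiv.ext (by rintro ((x | x) | x) <;> rfl)
    · exact Equiv.ext (by rintro ((x | x) | x) <;> rfl)

/-- Sequential associativity of the action on `L`. -/
lemma anti_second_first (m : val L (Pt A) A') (p : val O.toMod (Pt C) (Pt C'))
    (q : val O.toMod B (Pt B')) :
    D.Anti (act L ((ptSecond (Pt A) C B).trans (onPt (ptFirst A C B))) (outPts A' C' B')
      (D.mulO.mul (D.mulO.mul m p) q)) := by
  refine anti_of m p q ((ptFirst A B (Pt C)).trans (onPt (ptThird A B C))) ?_ ?_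
  · exact Equiv.ext (by rintro (((x | x) | x) | x | x) <;> rfl)
  · rw [contr_second_first, contr_first_third, act_act, ← (D.assoc.seq m).out p q, act_act]
    refine (act_congr ?_ ?_ rfl)
    · exact Equiv.ext (by rintro ((x | x) | x) <;> rfl)
    · exact Equiv.ext (by rintro ((x | x) | x) <;> rfl)

lemma anti_first_third (m : val L (Pt A) A') (p : val O.toMod C (Pt C'))
    (q : val O.toMod (Pt B) (Pt B')) :
    D.Anti (act L ((ptFirst A C (Pt B)).trans (onPt (ptThird A C B))) (outPts A' C' B')
      (D.mulO.mul (D.mulO.mul m p) q)) := by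
  refine anti_of_swap m p q ((ptSecond (Pt A) B C).trans (onPt (ptFirst A B C))) ?_
    (anti_second_first m q p)
  exact Equiv.ext (by rintro (((x | x) | x | x) | x) <;> rfl)

lemma anti_first_second (m : val L (Pt A) A') (p : val O.toMod (Pt C) (Pt C'))
    (q : val O.toMod B (Pt B')) :
    D.Anti (act L ((ptFirst A (Pt C) B).trans (onPt (ptSecond A C B))) (outPts A' C' B')
      (D.mulO.mul (D.mulO.mul m p) q)) := by
  refine anti_of_swap m p q ((ptThird (Pt A) B C).trans (onPt (ptFirst A B C))) ?_
    (anti_third_first m q p)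
  exact Equiv.ext (by rintro (((x | x) | x) | x | x) <;> rfl)

lemma anti_second_second (m : val L A A') (p : val O.toMod (Pt (Pt C)) (Pt C'))
    (q : val O.toMod B (Pt B')) :
    D.Anti (act L ((ptSecond A (Pt C) B).trans (onPt (ptSecond A C B))) (outPts A' C' B')
      (D.mulO.mul (D.mulO.mul m p) q)) := by
  refine anti_of_swap m p q (((Equiv.refl _).sumCongr (sumRightComm C (Fin 1) (Fin 1))).trans
    ((ptThird A B (Pt C)).trans (onPt (ptThird A B C)))) ?_ ?_
  · exact Equiv.ext (by rintro ((x | x) | (x | x) | x) <;> rfl)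
  · have := anti_third_third (D := D) m q
      (act O.toMod (sumRightComm C (Fin 1) (Fin 1)) (Equiv.refl _) p)
    rw [D.mulO.mul_act_right, act_act] at this
    refine (congrArg D.Anti (act_congr rfl ?_ rfl)).mp this
    exact Equiv.ext (by rintro ((x | x) | x | x) <;> rfl)

end ContrData

end Contractions

/-! ### Contractions anticommute -/

section ContractionsAnticommute

variable {k : Type u} [Field k] {O : NUOperad k} {L : FBMod k}
variable {A A' B B' C C' E E' X X' Y Y' : Type} [Finite A] [Finite A'] [Finite B] [Finite B']
  [Finite C] [Finite C'] [Finite E] [Finite E'] [Finite X] [Finite X'] [Finite Y] [Finite Y']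

namespace ContrData

omit [Finite X] in
/-- A decomposition of `X ⊔ {1}` in three parts is the standard one, with the added point in one of
the parts. -/
lemma sum_sum_pt_cases (e : (A ⊕ C) ⊕ B ≃ Pt X) :
    (∃ (D : Type) (_ : Finite D) (f : A ≃ Pt D) (h : (D ⊕ C) ⊕ B ≃ X),
      e = ((f.sumCongr (Equiv.refl C)).sumCongr (Equiv.refl B)).trans
        ((ptFirst D C B).trans (onPt h))) ∨
    (∃ (D : Type) (_ : Finite D) (f : C ≃ Pt D) (h : (A ⊕ D) ⊕ B ≃ X),
      e = (((Equiv.refl A).sumCongr f).sumCongr (Equiv.refl B)).trans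
        ((ptSecond A D B).trans (onPt h))) ∨
    (∃ (D : Type) (_ : Finite D) (f : B ≃ Pt D) (h : (A ⊕ C) ⊕ D ≃ X),
      e = ((Equiv.refl (A ⊕ C)).sumCongr f).trans ((ptThird A C D).trans (onPt h))) := by
  obtain ⟨D, _, f, h, rfl⟩ | ⟨D, _, f, h, rfl⟩ := sum_pt_cases e
  · obtain ⟨D', _, f, h', rfl⟩ | ⟨D', _, f, h', rfl⟩ := sum_pt_cases f
    · refine Or.inl ⟨D', ‹_›, f, (h'.sumCongr (Equiv.refl B)).trans h, ?_⟩
      refine Equiv.ext ?_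
      rintro ((x | x) | x)
      · rcases hx : f x with y | y <;> simp [hx, ptFirst, sumRightComm]
      · rfl
      · rfl
    · refine Or.inr (Or.inl ⟨D', ‹_›, f, (h'.sumCongr (Equiv.refl B)).trans h, ?_⟩)
      refine Equiv.ext ?_
      rintro ((x | x) | x)
      · rfl
      · rcases hx : f x with y | y <;> simp [hx, ptSecond, sumRightComm]
      · rfl
  · exact Or.inr (Or.inr ⟨D, ‹_›, f, h, rfl⟩)

variable {D : ContrData O L}

/-- Three positions of the outer input and three of the inner one give the nine configurations
treated before, up to relabelling the inputs of the factors. -/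
lemma anti_mul (e : (A ⊕ C) ⊕ B ≃ Pt (Pt X)) (e' : (A' ⊕ C') ⊕ B' ≃ Y) (m : val L A A')
    (p : val O.toMod C (Pt C')) (q : val O.toMod B (Pt B')) :
    D.Anti (act L e ((outPts A' C' B').trans (onPt (onPt e'))) (D.mulO.mul (D.mulO.mul m p) q)) := by
  obtain ⟨E, _, f, h, rfl⟩ | ⟨E, _, f, h, rfl⟩ | ⟨E, _, f, h, rfl⟩ := sum_sum_pt_cases e <;>
  obtain ⟨J, _, g, i, rfl⟩ | ⟨J, _, g, i, rfl⟩ | ⟨J, _, g, i, rfl⟩ := sum_sum_pt_cases h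
  · have := (anti_first_first (D := D) (act L (f.trans (onPt g)) (Equiv.refl _) m) p
      q).act i e'
    simp only [D.mulO.mul_act_left, act_act] at this
    refine (congrArg D.Anti (act_congr ?_ ?_ rfl)).mp this
    · refine Equiv.ext ?_
      rintro ((x | x) | x)
      · rcases hx : f x with y | y
        · rcases hy : g y with z | z <;> simp [hx, hy, ptFirst, sumRightComm]
        · simp [hx, ptFirst, sumRightComm]
      · rfl
      · rfl
    · exact Equiv.ext (by rintro ((x | x | x) | x | x) <;> rfl)
  · have := (anti_first_second (D := D) (act L f (Equiv.refl _) m) (act O.toMod g (Equiv.refl _) p)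
      q).act i e'
    simp only [D.mulO.mul_act_left, D.mulO.mul_act_right, act_act] at this
    refine (congrArg D.Anti (act_congr ?_ ?_ rfl)).mp this
    · refine Equiv.ext ?_
      rintro ((x | x) | x)
      · rcases hx : f x with y | y <;> simp [hx, ptFirst, ptSecond, sumRightComm]
      · rcases hx : g x with y | y <;> simp [hx, ptFirst, ptSecond, sumRightComm]
      · rfl
    · exact Equiv.ext (by rintro ((x | x | x) | x | x) <;> rfl)
  · have := (anti_first_third (D := D) (act L f (Equiv.refl _) m) p
      (act O.toMod g (Equiv.refl _) q)).act i e'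
    simp only [D.mulO.mul_act_left, D.mulO.mul_act_right, act_act] at this
    refine (congrArg D.Anti (act_congr ?_ ?_ rfl)).mp this
    · refine Equiv.ext ?_
      rintro ((x | x) | x)
      · rcases hx : f x with y | y <;> simp [hx, ptFirst, ptThird, sumRightComm]
      · rfl
      · rcases hx : g x with y | y <;> simp [hx, ptFirst, ptThird, sumRightComm]
    · exact Equiv.ext (by rintro ((x | x | x) | x | x) <;> rfl)
  · have := (anti_second_first (D := D) (act L g (Equiv.refl _) m) (act O.toMod f (Equiv.refl _) p)
      q).act i e'
    simp only [D.mulO.mul_act_left, D.mulO.mul_act_right, act_act] at this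
    refine (congrArg D.Anti (act_congr ?_ ?_ rfl)).mp this
    · refine Equiv.ext ?_
      rintro ((x | x) | x)
      · rcases hx : g x with y | y <;> simp [hx, ptSecond, ptFirst, sumRightComm]
      · rcases hx : f x with y | y <;> simp [hx, ptSecond, ptFirst, sumRightComm]
      · rfl
    · exact Equiv.ext (by rintro ((x | x | x) | x | x) <;> rfl)
  · have := (anti_second_second (D := D) m (act O.toMod (f.trans (onPt g)) (Equiv.refl _) p)
      q).act i e'
    simp only [D.mulO.mul_act_left, D.mulO.mul_act_right, act_act] at this
    refine (congrArg D.Anti (act_congr ?_ ?_ rfl)).mp this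
    · refine Equiv.ext ?_
      rintro ((x | x) | x)
      · rfl
      · rcases hx : f x with y | y
        · rcases hy : g y with z | z <;> simp [hx, hy, ptSecond, sumRightComm]
        · simp [hx, ptSecond, sumRightComm]
      · rfl
    · exact Equiv.ext (by rintro ((x | x | x) | x | x) <;> rfl)
  · have := (anti_second_third (D := D) m (act O.toMod f (Equiv.refl _) p)
      (act O.toMod g (Equiv.refl _) q)).act i e'
    simp only [D.mulO.mul_act_left, D.mulO.mul_act_right, act_act] at this
    refine (congrArg D.Anti (act_congr ?_ ?_ rfl)).mp this
    · refine Equiv.ext ?_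
      rintro ((x | x) | x)
      · rfl
      · rcases hx : f x with y | y <;> simp [hx, ptSecond, ptThird, sumRightComm]
      · rcases hx : g x with y | y <;> simp [hx, ptSecond, ptThird, sumRightComm]
    · exact Equiv.ext (by rintro ((x | x | x) | x | x) <;> rfl)
  · have := (anti_third_first (D := D) (act L g (Equiv.refl _) m) p
      (act O.toMod f (Equiv.refl _) q)).act i e'
    simp only [D.mulO.mul_act_left, D.mulO.mul_act_right, act_act] at this
    refine (congrArg D.Anti (act_congr ?_ ?_ rfl)).mp this
    · refine Equiv.ext ?_
      rintro ((x | x) | x)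
      · rcases hx : g x with y | y <;> simp [hx, ptThird, ptFirst, sumRightComm]
      · rfl
      · rcases hx : f x with y | y <;> simp [hx, ptThird, ptFirst, sumRightComm]
    · exact Equiv.ext (by rintro ((x | x | x) | x | x) <;> rfl)
  · have := (anti_third_second (D := D) m (act O.toMod g (Equiv.refl _) p)
      (act O.toMod f (Equiv.refl _) q)).act i e'
    simp only [D.mulO.mul_act_left, D.mulO.mul_act_right, act_act] at this
    refine (congrArg D.Anti (act_congr ?_ ?_ rfl)).mp this
    · refine Equiv.ext ?_
      rintro ((x | x) | x)
      · rfl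
      · rcases hx : g x with y | y <;> simp [hx, outPts, ptThird, ptSecond, sumRightComm]
      · rcases hx : f x with y | y <;> simp [hx, outPts, ptThird, ptSecond, sumRightComm]
    · exact Equiv.ext (by rintro ((x | x | x) | x | x) <;> rfl)
  · have := (anti_third_third (D := D) m p
      (act O.toMod (f.trans (onPt g)) (Equiv.refl _) q)).act i e'
    simp only [D.mulO.mul_act_right, act_act] at this
    refine (congrArg D.Anti (act_congr ?_ ?_ rfl)).mp this
    · refine Equiv.ext ?_
      rintro ((x | x) | x)
      · rfl
      · rfl
      · rcases hx : f x with y | y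
        · rcases hy : g y with z | z <;> simp [hx, hy, ptThird]
        · simp [hx, ptThird]
    · exact Equiv.ext (by rintro ((x | x | x) | x | x) <;> rfl)

/-- The factor with the outer output is split off. If the inner output lies in another factor, that
factor is split off as well and `anti_mul` applies; otherwise a single operation would have two
outputs. -/
lemma contr_contr (t : val L (Pt (Pt X)) (Pt (Pt Y))) :
    D.contr _ _ (D.contr _ _ t) = -D.contr _ _ (D.contr _ _ (act L (sumRightComm X (Fin 1) (Fin 1))
      (sumRightComm Y (Fin 1) (Fin 1)) t)) := by
  change D.Anti t
  refine D.induction anti_zero (fun _ _ => Anti.add) (fun a _ => Anti.smul a)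
    (fun {A A' B B'} _ _ _ _ e e' m q => ?_) t
  obtain ⟨C, _, f, h, rfl⟩ | ⟨C, _, f, h, rfl⟩ := sum_pt_cases e'
  -- The inner output lies in `m`. Relabelling displays it as an added point, so that `m` can be
  -- split in turn.
  · obtain ⟨m, rfl⟩ : ∃ m₁, m = act L (Equiv.refl A).symm f.symm m₁ := ⟨_, eq_act_symm _ _ m⟩
    refine D.induction (P := fun m => D.Anti (act L e _ (D.mulO.mul (act L _ _ m) q)))
      ?_ (fun s t hs ht => ?_) (fun a t ht => ?_) (fun {E E' J J'} _ _ _ _ g g' m p => ?_) m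
    · simp only [map_zero, LinearMap.zero_apply]; exact anti_zero
    · simp only [map_add, LinearMap.add_apply]; exact hs.add ht
    · simp only [map_smul, LinearMap.smul_apply]; exact ht.smul a
    · have := anti_mul (D := D) ((g.sumCongr (Equiv.refl B)).trans e)
        ((g'.sumCongr (Equiv.refl B')).trans h) m p q
      rw [D.mulO.mul_act_left, D.mulO.mul_act_left, act_act, act_act]
      refine (congrArg D.Anti (act_congr ?_ ?_ rfl)).mp this
      · exact Equiv.ext (by rintro ((x | x) | x) <;> rfl)
      · refine Equiv.ext (by rintro ((x | x | x) | x | x) <;> simp [outPts, ptThird, ptSecond, sumRightComm])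
  -- Both outputs lie in `q`, which vanishes because `O` is supported on one output.
  · have hq : q = 0 := by
      refine (O.supported ⟨B, Pt B'⟩ ?_).elim _ _
      have : Nat.card (Pt B') = Nat.card C + 1 + 1 := by
        rw [Nat.card_sum, Nat.card_congr f, Nat.card_sum, Nat.card_unique (α := Fin 1)]
      change Nat.card (Pt B') ≠ 1
      omega
    rw [hq, map_zero, map_zero]
    exact anti_zero

end ContrData

end ContractionsAnticommute

/-! ### Products and derivations on a Day convolution -/

section DayProducts

variable {k : Type u} [Field k] {O : NUOperad k} {F G H K F' G' : FBMod k}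
variable {A A' B B' C C' D D' X X' Y Y' : Type} [Finite A] [Finite A'] [Finite B] [Finite B']
  [Finite C] [Finite C'] [Finite D] [Finite D'] [Finite X] [Finite X'] [Finite Y] [Finite Y']

namespace Pairing

/-- The product with an element of `G` on the first factor, as a bilinear map. -/
def fstBil (μ : Pairing F G K) (e : A ⊕ B ≃ X) (e' : A' ⊕ B' ≃ Y) :
    val F A A' →ₗ[k] val H B B' →ₗ[k] val G D D' →ₗ[k] val (dayConv K H) (X ⊕ D) (Y ⊕ D') :=
  LinearMap.mk₂ k
    (fun a b => act (dayConv K H) ((sumRightComm A D B).trans (e.sumCongr (Equiv.refl D)))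
      ((sumRightComm A' D' B').trans (e'.sumCongr (Equiv.refl D'))) ∘ₗ
        (dayMk (A := A ⊕ D) (A' := A' ⊕ D')).flip b ∘ₗ μ.mul a)
    (fun a a' b => by ext; simp) (fun c a b => by ext; simp) (fun a b b' => by ext; simp)
    (fun c a b => by ext; simp)

/-- The product with an element of `G` on the first factor, as a family of bilinear maps. -/
def fstFam (μ : Pairing F G K) (H : FBMod k) : BiFam F H X Y
    (val G D D' →ₗ[k] val (dayConv K H) (X ⊕ D) (Y ⊕ D')) :=
  fun e e' => fstBil μ e e'

lemma fstFam_apply (μ : Pairing F G K) (e : A ⊕ B ≃ X) (e' : A' ⊕ B' ≃ Y)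
    (a : val F A A') (b : val H B B') (q : val G D D') :
    fstFam μ H e e' a b q =
      act (dayConv K H) ((sumRightComm A D B).trans (e.sumCongr (Equiv.refl D)))
        ((sumRightComm A' D' B').trans (e'.sumCongr (Equiv.refl D'))) (dayMk (μ.mul a q) b) := rfl

lemma isNat_fstFam (μ : Pairing F G K) :
    IsNat (fstFam (X := X) (Y := Y) (D := D) (D' := D') μ H) := by
  intro A A' B B' C C' D D' _ _ _ _ _ _ _ _ f f' g g' e e' a b
  refine LinearMap.ext fun q => ?_
  refine (fstFam_apply μ e e' _ _ q).trans ?_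
  refine Eq.trans ?_ (fstFam_apply μ _ _ a b q).symm
  rw [μ.mul_act_left, dayMk_act, act_act]
  exact act_congr (Equiv.ext (by rintro ((x | x) | x) <;> rfl))
    (Equiv.ext (by rintro ((x | x) | x) <;> rfl)) rfl

/-- The product with an element of `G` on the second factor, as a bilinear map. -/
def sndBil (ν : Pairing H G K) (e : A ⊕ B ≃ X) (e' : A' ⊕ B' ≃ Y) :
    val F A A' →ₗ[k] val H B B' →ₗ[k] val G D D' →ₗ[k] val (dayConv F K) (X ⊕ D) (Y ⊕ D') :=
  LinearMap.mk₂ k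
    (fun a b => act (dayConv F K) ((Equiv.sumAssoc A B D).symm.trans (e.sumCongr (Equiv.refl D)))
      ((Equiv.sumAssoc A' B' D').symm.trans (e'.sumCongr (Equiv.refl D'))) ∘ₗ
        dayMk (B := B ⊕ D) (B' := B' ⊕ D') a ∘ₗ ν.mul b)
    (fun a a' b => by ext; simp) (fun c a b => by ext; simp) (fun a b b' => by ext; simp)
    (fun c a b => by ext; simp)

/-- The product with an element of `G` on the second factor, as a family of bilinear maps. -/
def sndFam (ν : Pairing H G K) (F : FBMod k) : BiFam F H X Y
    (val G D D' →ₗ[k] val (dayConv F K) (X ⊕ D) (Y ⊕ D')) :=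
  fun e e' => sndBil ν e e'

lemma sndFam_apply (ν : Pairing H G K) (e : A ⊕ B ≃ X) (e' : A' ⊕ B' ≃ Y)
    (a : val F A A') (b : val H B B') (q : val G D D') :
    sndFam ν F e e' a b q =
      act (dayConv F K) ((Equiv.sumAssoc A B D).symm.trans (e.sumCongr (Equiv.refl D)))
        ((Equiv.sumAssoc A' B' D').symm.trans (e'.sumCongr (Equiv.refl D')))
          (dayMk a (ν.mul b q)) := rfl

lemma isNat_sndFam (ν : Pairing H G K) :
    IsNat (sndFam (X := X) (Y := Y) (D := D) (D' := D') ν F) := by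
  intro A A' B B' C C' D D' _ _ _ _ _ _ _ _ f f' g g' e e' a b
  refine LinearMap.ext fun q => ?_
  refine (sndFam_apply ν e e' _ _ q).trans ?_
  refine Eq.trans ?_ (sndFam_apply ν _ _ a b q).symm
  rw [ν.mul_act_left, dayMk_act, act_act]
  exact act_congr (Equiv.ext (by rintro (x | x | x) <;> rfl))
    (Equiv.ext (by rintro (x | x | x) <;> rfl)) rfl

/-- The product with elements of `G` on the first factor. -/
def fst (μ : Pairing F G K) (H : FBMod k) : Pairing (dayConv F H) G (dayConv K H) where
  mul := dayLift (fstFam μ H)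
  mul_act {A A' B B' C C' D D'} _ _ _ _ _ _ _ _ e e' f f' t q := by
    induction t using day_induction with
    | h0 => simp only [map_zero, LinearMap.zero_apply]
    | hadd s t hs ht => simp only [map_add, LinearMap.add_apply, hs, ht]
    | hmk g g' a b =>
      rw [dayLift_mk μ.isNat_fstFam, fstFam_apply, act_act, act_act,
        dayLift_mk μ.isNat_fstFam, fstFam_apply, μ.mul_act_right, dayMk_act_left, act_act]
      exact act_congr (Equiv.ext (by rintro ((x | x) | x) <;> rfl))
        (Equiv.ext (by rintro ((x | x) | x) <;> rfl)) rfl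

/-- The product with elements of `G` on the second factor. -/
def snd (ν : Pairing H G K) (F : FBMod k) : Pairing (dayConv F H) G (dayConv F K) where
  mul := dayLift (sndFam ν F)
  mul_act {A A' B B' C C' D D'} _ _ _ _ _ _ _ _ e e' f f' t q := by
    induction t using day_induction with
    | h0 => simp only [map_zero, LinearMap.zero_apply]
    | hadd s t hs ht => simp only [map_add, LinearMap.add_apply, hs, ht]
    | hmk g g' a b =>
      rw [dayLift_mk ν.isNat_sndFam, sndFam_apply, act_act, act_act,
        dayLift_mk ν.isNat_sndFam, sndFam_apply, ν.mul_act_right, dayMk_act_right, act_act]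
      exact act_congr (Equiv.ext (by rintro (x | x | x) <;> rfl))
        (Equiv.ext (by rintro (x | x | x) <;> rfl)) rfl

lemma fst_mul (μ : Pairing F G K) (e : A ⊕ B ≃ X) (e' : A' ⊕ B' ≃ Y)
    (a : val F A A') (b : val H B B') (q : val G D D') :
    (μ.fst H).mul (act (dayConv F H) e e' (dayMk a b)) q =
      act (dayConv K H) ((sumRightComm A D B).trans (e.sumCongr (Equiv.refl D)))
        ((sumRightComm A' D' B').trans (e'.sumCongr (Equiv.refl D'))) (dayMk (μ.mul a q) b) :=
  congrArg (fun f => f q) (dayLift_mk μ.isNat_fstFam e e' a b)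

lemma snd_mul (ν : Pairing H G K) (e : A ⊕ B ≃ X) (e' : A' ⊕ B' ≃ Y)
    (a : val F A A') (b : val H B B') (q : val G D D') :
    (ν.snd F).mul (act (dayConv F H) e e' (dayMk a b)) q =
      act (dayConv F K) ((Equiv.sumAssoc A B D).symm.trans (e.sumCongr (Equiv.refl D)))
        ((Equiv.sumAssoc A' B' D').symm.trans (e'.sumCongr (Equiv.refl D')))
          (dayMk a (ν.mul b q)) :=
  congrArg (fun f => f q) (dayLift_mk ν.isNat_sndFam e e' a b)

/-- The factor in `H` is not affected, so the commutation rule of `μ` persists with the same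
coefficient. For `Λ*` this coefficient is `-1`. -/
lemma fst_mul_fst_mul (μ : Pairing F G F) (n : ℤ)
    (h : ∀ {A A' B B' C C' : Type} [Finite A] [Finite A'] [Finite B] [Finite B'] [Finite C]
      [Finite C'] (m : val F A A') (p : val G B B') (q : val G C C'), μ.mul (μ.mul m p) q =
        n • act F (sumRightComm A C B) (sumRightComm A' C' B') (μ.mul (μ.mul m q) p))
    (m : val (dayConv F H) A A') (p : val G B B') (q : val G C C') :
    (μ.fst H).mul ((μ.fst H).mul m p) q = n • act (dayConv F H) (sumRightComm A C B)
      (sumRightComm A' C' B') ((μ.fst H).mul ((μ.fst H).mul m q) p) := by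
  induction m using day_induction with
  | h0 => simp only [map_zero, LinearMap.zero_apply, smul_zero]
  | hadd s t hs ht => simp only [map_add, LinearMap.add_apply, hs, ht, smul_add]
  | hmk g g' a b =>
    rw [fst_mul, fst_mul, fst_mul, fst_mul, h, map_zsmul, LinearMap.smul_apply, map_zsmul,
      dayMk_act_left, act_act, act_act]
    refine congrArg (n • ·) (act_congr ?_ ?_ rfl)
    · exact Equiv.ext (by rintro (((x | x) | x) | x) <;> rfl)
    · exact Equiv.ext (by rintro (((x | x) | x) | x) <;> rfl)

lemma snd_mul_snd_mul (ν : Pairing H G H)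
    (h : ∀ {A A' B B' C C' : Type} [Finite A] [Finite A'] [Finite B] [Finite B'] [Finite C]
      [Finite C'] (m : val H A A') (p : val G B B') (q : val G C C'), ν.mul (ν.mul m p) q =
        act H (sumRightComm A C B) (sumRightComm A' C' B') (ν.mul (ν.mul m q) p))
    (m : val (dayConv F H) A A') (p : val G B B') (q : val G C C') :
    (ν.snd F).mul ((ν.snd F).mul m p) q = act (dayConv F H) (sumRightComm A C B)
      (sumRightComm A' C' B') ((ν.snd F).mul ((ν.snd F).mul m q) p) := by
  induction m using day_induction with
  | h0 => simp only [map_zero, LinearMap.zero_apply]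
  | hadd s t hs ht => simp only [map_add, LinearMap.add_apply, hs, ht]
  | hmk g g' a b =>
    rw [snd_mul, snd_mul, snd_mul, snd_mul, h, dayMk_act_right, act_act, act_act]
    refine act_congr ?_ ?_ rfl
    · exact Equiv.ext (by rintro (x | (x | x) | x) <;> rfl)
    · exact Equiv.ext (by rintro (x | (x | x) | x) <;> rfl)

/-- Products on different factors of `F ⊛ H` are independent, and no sign appears. -/
lemma snd_mul_fst_mul (μ : Pairing F G F) (ν : Pairing H K H)
    (m : val (dayConv F H) A A') (p : val G B B') (q : val K C C') :
    (ν.snd F).mul ((μ.fst H).mul m p) q = act (dayConv F H) (sumRightComm A C B)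
      (sumRightComm A' C' B') ((μ.fst H).mul ((ν.snd F).mul m q) p) := by
  induction m using day_induction with
  | h0 => simp only [map_zero, LinearMap.zero_apply]
  | hadd s t hs ht => simp only [map_add, LinearMap.add_apply, hs, ht]
  | hmk g g' a b =>
    rw [fst_mul, snd_mul, snd_mul, fst_mul, act_act]
    refine act_congr ?_ ?_ rfl
    · exact Equiv.ext (by rintro ((x | x) | x | x) <;> rfl)
    · exact Equiv.ext (by rintro ((x | x) | x | x) <;> rfl)

variable {P : Plug O F} {Q : Plug O H} {R : Plug O G}

/-- The input lies in the part in `F`, in the part in `H`, or in the new element `b`. The first and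
the last case are the rules for `μ`; in the second one the plug and the product concern different
factors. -/
lemma Leibniz.fst {μ : Pairing F G F} (h : μ.Leibniz P R P) (Q : Plug O H) :
    (μ.fst H).Leibniz (dayPlug P Q) R (dayPlug P Q) where
  left {A A' B B' C C'} _ _ _ _ _ _ t b q := by
    change dayPlugMap P Q (act (dayConv F H) (sumRightComm A (Fin 1) B) (Equiv.refl _)
      ((μ.fst H).mul t b)) q = act (dayConv F H) (sumRightComm A C B) (sumRightComm A' C' B')
        ((μ.fst H).mul (dayPlugMap P Q t q) b)
    induction t using dayFst_induction with
    | h0 => simp only [map_zero, LinearMap.zero_apply]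
    | hadd s t hs ht => simp only [map_add, LinearMap.add_apply, hs, ht]
    | @hl D D' E E' _ _ _ _ g g' a c =>
      rw [dayPlugMap_left, fst_mul, fst_mul, act_act, act_act]
      have h1 := dayPlugMap_left P Q ((sumRightComm D B E).trans (g.sumCongr (Equiv.refl B)))
        ((sumRightComm D' B' E').trans (g'.sumCongr (Equiv.refl B')))
        (act F (sumRightComm D (Fin 1) B) (Equiv.refl _) (μ.mul a b)) c q
      rw [h.left, dayMk_act_left, dayMk_act_left, act_act, act_act] at h1
      refine (congrArg (fun x => dayPlugMap P Q x q) (act_congr ?_ ?_ rfl)).trans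
        (h1.trans (act_congr ?_ ?_ rfl))
      · exact Equiv.ext (by rintro (((x | x) | x) | x) <;> rfl)
      · exact Equiv.ext (by rintro ((x | x) | x) <;> rfl)
      · exact Equiv.ext (by rintro (((x | x) | x) | x) <;> rfl)
      · exact Equiv.ext (by rintro (((x | x) | x) | x) <;> rfl)
    | @hr D D' E E' _ _ _ _ g g' a c =>
      rw [dayPlugMap_right, fst_mul, fst_mul, act_act, act_act]
      have h1 := dayPlugMap_right P Q ((sumRightComm D B E).trans (g.sumCongr (Equiv.refl B)))
        ((sumRightComm D' B' E').trans (g'.sumCongr (Equiv.refl B'))) (μ.mul a b) c q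
      refine (congrArg (fun x => dayPlugMap P Q x q) (act_congr ?_ ?_ rfl)).trans
        (h1.trans (act_congr ?_ ?_ rfl))
      · exact Equiv.ext (by rintro ((x | x) | x | x) <;> rfl)
      · exact Equiv.ext (by rintro ((x | x) | x) <;> rfl)
      · exact Equiv.ext (by rintro ((x | x) | x | x) <;> rfl)
      · exact Equiv.ext (by rintro ((x | x) | x | x) <;> rfl)
  right {A A' B B' C C'} _ _ _ _ _ _ t b q := by
    change dayPlugMap P Q (act (dayConv F H) (Equiv.sumAssoc A B (Fin 1)).symm (Equiv.refl _)
      ((μ.fst H).mul t b)) q = act (dayConv F H) (Equiv.sumAssoc A B C).symm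
        (Equiv.sumAssoc A' B' C').symm ((μ.fst H).mul t (R.plug b q))
    induction t using day_induction with
    | h0 => simp only [map_zero, LinearMap.zero_apply]
    | hadd s t hs ht => simp only [map_add, LinearMap.add_apply, hs, ht]
    | @hmk D D' E E' _ _ _ _ g g' a c =>
      rw [fst_mul, fst_mul, act_act, act_act]
      have h1 := dayPlugMap_left P Q ((sumRightComm D B E).trans (g.sumCongr (Equiv.refl B)))
        ((sumRightComm D' B' E').trans (g'.sumCongr (Equiv.refl B')))
        (act F (Equiv.sumAssoc D B (Fin 1)).symm (Equiv.refl _) (μ.mul a b)) c q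
      rw [h.right, dayMk_act_left, dayMk_act_left, act_act, act_act] at h1
      refine (congrArg (fun x => dayPlugMap P Q x q) (act_congr ?_ ?_ rfl)).trans
        (h1.trans (act_congr ?_ ?_ rfl))
      · exact Equiv.ext (by rintro ((x | x | x) | x) <;> rfl)
      · exact Equiv.ext (by rintro ((x | x) | x) <;> rfl)
      · exact Equiv.ext (by rintro ((x | x | x) | x) <;> rfl)
      · exact Equiv.ext (by rintro ((x | x | x) | x) <;> rfl)

lemma Leibniz.snd {ν : Pairing H G H} (h : ν.Leibniz Q R Q) (P : Plug O F) :
    (ν.snd F).Leibniz (dayPlug P Q) R (dayPlug P Q) where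
  left {A A' B B' C C'} _ _ _ _ _ _ t b q := by
    change dayPlugMap P Q (act (dayConv F H) (sumRightComm A (Fin 1) B) (Equiv.refl _)
      ((ν.snd F).mul t b)) q = act (dayConv F H) (sumRightComm A C B) (sumRightComm A' C' B')
        ((ν.snd F).mul (dayPlugMap P Q t q) b)
    induction t using dayFst_induction with
    | h0 => simp only [map_zero, LinearMap.zero_apply]
    | hadd s t hs ht => simp only [map_add, LinearMap.add_apply, hs, ht]
    | @hl D D' E E' _ _ _ _ g g' a c =>
      rw [dayPlugMap_left, snd_mul, snd_mul, act_act, act_act]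
      have h1 := dayPlugMap_left P Q ((Equiv.sumAssoc D E B).symm.trans
        (g.sumCongr (Equiv.refl B))) ((Equiv.sumAssoc D' E' B').symm.trans
          (g'.sumCongr (Equiv.refl B'))) a (ν.mul c b) q
      refine (congrArg (fun x => dayPlugMap P Q x q) (act_congr ?_ ?_ rfl)).trans
        (h1.trans (act_congr ?_ ?_ rfl))
      · exact Equiv.ext (by rintro ((x | x) | x | x) <;> rfl)
      · exact Equiv.ext (by rintro (x | x | x) <;> rfl)
      · exact Equiv.ext (by rintro ((x | x) | x | x) <;> rfl)
      · exact Equiv.ext (by rintro ((x | x) | x | x) <;> rfl)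
    | @hr D D' E E' _ _ _ _ g g' a c =>
      rw [dayPlugMap_right, snd_mul, snd_mul, act_act, act_act]
      have h1 := dayPlugMap_right P Q ((Equiv.sumAssoc D E B).symm.trans
        (g.sumCongr (Equiv.refl B))) ((Equiv.sumAssoc D' E' B').symm.trans
          (g'.sumCongr (Equiv.refl B'))) a
          (act H (sumRightComm E (Fin 1) B) (Equiv.refl _) (ν.mul c b)) q
      rw [h.left, dayMk_act_right, dayMk_act_right, act_act, act_act] at h1
      refine (congrArg (fun x => dayPlugMap P Q x q) (act_congr ?_ ?_ rfl)).trans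
        (h1.trans (act_congr ?_ ?_ rfl))
      · exact Equiv.ext (by rintro (x | (x | x) | x) <;> rfl)
      · exact Equiv.ext (by rintro (x | x | x) <;> rfl)
      · exact Equiv.ext (by rintro (x | (x | x) | x) <;> rfl)
      · exact Equiv.ext (by rintro (x | (x | x) | x) <;> rfl)
  right {A A' B B' C C'} _ _ _ _ _ _ t b q := by
    change dayPlugMap P Q (act (dayConv F H) (Equiv.sumAssoc A B (Fin 1)).symm (Equiv.refl _)
      ((ν.snd F).mul t b)) q = act (dayConv F H) (Equiv.sumAssoc A B C).symm
        (Equiv.sumAssoc A' B' C').symm ((ν.snd F).mul t (R.plug b q))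
    induction t using day_induction with
    | h0 => simp only [map_zero, LinearMap.zero_apply]
    | hadd s t hs ht => simp only [map_add, LinearMap.add_apply, hs, ht]
    | @hmk D D' E E' _ _ _ _ g g' a c =>
      rw [snd_mul, snd_mul, act_act, act_act]
      have h1 := dayPlugMap_right P Q ((Equiv.sumAssoc D E B).symm.trans
        (g.sumCongr (Equiv.refl B))) ((Equiv.sumAssoc D' E' B').symm.trans
          (g'.sumCongr (Equiv.refl B'))) a
          (act H (Equiv.sumAssoc E B (Fin 1)).symm (Equiv.refl _) (ν.mul c b)) q
      rw [h.right, dayMk_act_right, dayMk_act_right, act_act, act_act] at h1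
      refine (congrArg (fun x => dayPlugMap P Q x q) (act_congr ?_ ?_ rfl)).trans
        (h1.trans (act_congr ?_ ?_ rfl))
      · exact Equiv.ext (by rintro (x | x | x | x) <;> rfl)
      · exact Equiv.ext (by rintro (x | x | x) <;> rfl)
      · exact Equiv.ext (by rintro (x | x | x | x) <;> rfl)
      · exact Equiv.ext (by rintro (x | x | x | x) <;> rfl)

end Pairing

end DayProducts

/-! ### The contraction data on `Λ* O` and on `Λ* O ⊛ S* |δ_{1,1} O|` -/

section ContractionData

variable {k : Type u} [Field k] {O : NUOperad k} {F G H : FBMod k}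
variable {A A' B B' C C' D D' X X' Y Y' : Type} [Finite A] [Finite A'] [Finite B] [Finite B']
  [Finite C] [Finite C'] [Finite D] [Finite D'] [Finite X] [Finite X'] [Finite Y] [Finite Y']

/-- The external products, as a family of bilinear maps. -/
def mkFam (F G : FBMod k) : BiFam F G X Y (val (dayConv F G) X Y) :=
  fun {A A' B B'} _ _ _ _ e e' => (dayMk (A := A) (A' := A') (B := B) (B' := B')).compr₂
    (act (dayConv F G) e e')

lemma isNat_mkFam : IsNat (mkFam (X := X) (Y := Y) F G) := by
  intro A A' B B' C C' D D' _ _ _ _ _ _ _ _ f f' g g' e e' a b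
  refine (congrArg (act (dayConv F G) e e') (dayMk_act f f' g g' a b)).trans ?_
  exact act_act (dayConv F G) _ _ _ _ _

/-- The identity, as a map to `δ_{0,1} F`. -/
def toDelta01 : val F A (Pt A') →ₗ[k] val (delta01 F) A A' := LinearMap.id

/-- The map that separates the factor that contains the added point. -/
def separate (s : Bool) (F : FBMod k) :
    val (symTot s F) X (Pt Y) →ₗ[k] val (dayConv (symTot s F) (delta01 F)) X Y :=
  dayLiftSnd (fun _ _ => 0) (mkFam (symTot s F) (delta01 F)) ∘ₗ coprod s

lemma separate_mul (s : Bool) (e : A ⊕ B ≃ X) (e' : A' ⊕ B' ≃ Y) (w : val (symTot s F) A A')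
    (b : val F B (Pt B')) :
    separate s F (act (symTot s F) e ((Equiv.sumAssoc A' B' (Fin 1)).symm.trans (onPt e'))
      (mul s w b)) =
      act (dayConv (symTot s F) (delta01 F)) e e' (dayMk w (toDelta01 b)) :=
  dayLiftSnd_coprod s isNat_mkFam e e' w b

lemma separate_act (s : Bool) (f : X ≃ X') (f' : Y ≃ Y') (t : val (symTot s F) X (Pt Y)) :
    separate s F (act (symTot s F) f (onPt f') t) =
      act (dayConv (symTot s F) (delta01 F)) f f' (separate s F t) := by
  induction t using symTotSnd_induction with
  | h0 => simp only [map_zero]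
  | hadd s t hs ht => simp only [map_add, hs, ht]
  | hsmul a t ht => simp only [map_smul, ht]
  | hmk g g' w b =>
    rw [separate_mul, act_act, act_act, ← separate_mul]
    exact congrArg (separate s F) (act_congr rfl (Equiv.ext (by rintro (x | x | x) <;> rfl)) rfl)

lemma mul_mul_true (w : val (symTot true F) A A') (p : val F B B') (q : val F C C') :
    mul true (mul true w p) q = -act (symTot true F) (sumRightComm A C B) (sumRightComm A' C' B')
      (mul true (mul true w q) p) :=
  (mul_mul_swap' true w q p).trans (neg_one_smul ℤ _)

lemma mul_mul_false (w : val (symTot false F) A A') (p : val F B B') (q : val F C C') :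
    mul false (mul false w p) q = act (symTot false F) (sumRightComm A C B) (sumRightComm A' C' B')
      (mul false (mul false w q) p) :=
  (mul_mul_swap' false w q p).trans (one_smul ℤ _)

/-- The zero pairing. -/
def zeroPairing (F G H : FBMod k) : Pairing F G H where
  mul := 0
  mul_act _ _ _ _ _ _ := (map_zero _).symm

/-- The structure on `Λ* O` from which its contraction maps are built. -/
def lambdaData (O : NUOperad k) : ContrData O (symTot true O.toMod) where
  plug := symPlug true O.plug
  assoc := symPlug_isAssoc true O.plug_isAssoc
  mulO := mulPairing true O.toMod
  -- Operations that are closed up become zero, in accordance with the quotient `|δ_{1,1} O| → 0`.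
  mulW := zeroPairing _ _ _
  leibO := mulPairing_leibniz true O.plug
  leibW :=
    { left := fun _ _ _ => by
        change (symPlug true O.plug).plug (act _ _ _ 0) _ = act _ _ _ 0
        rw [map_zero, map_zero, map_zero]; rfl
      right := fun _ _ _ => by
        change (symPlug true O.plug).plug (act _ _ _ 0) _ = act _ _ _ 0
        rw [map_zero, map_zero, map_zero]; rfl }
  mulO_mulO := mul_mul_true
  mulW_mulO m p a := by
    change 0 = act _ _ _ (mul true 0 p)
    rw [map_zero, LinearMap.zero_apply, map_zero]
  mulW_mulW _ _ _ := (map_zero _).symm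
  split := separate true O.toMod
  split_mul e e' m q := separate_mul true e e' m q
  induction := symTotSnd_induction

/-- `Λ* O ⊛ S* |δ_{1,1} O|` -/
abbrev lambdaSym (O : NUOperad k) : FBMod k := dayConv (symTot true O.toMod) (symTot false O.wheel)

/-- The family of bilinear maps that defines `separateFst`. -/
def separateFam (O : NUOperad k) (G : FBMod k) : BiFam (delta01 (symTot true O.toMod)) G X Y
    (val (dayConv (dayConv (symTot true O.toMod) G) (delta01 O.toMod)) X Y) :=
  fun {A A' B B'} _ _ _ _ e e' =>
    (((dayPairing (symTot true O.toMod) G).fst (delta01 O.toMod)).mul (A := A) (A' := A') (B := B)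
      (B' := B') ∘ₗ separate (X := A) (Y := A') true O.toMod).compr₂ (act _ e e')

lemma separateFam_apply (e : A ⊕ B ≃ X) (e' : A' ⊕ B' ≃ Y)
    (w : val (symTot true O.toMod) A (Pt A')) (v : val G B B') :
    separateFam O G e e' (toDelta01 w) v =
      act (dayConv (dayConv (symTot true O.toMod) G) (delta01 O.toMod)) e e'
        (((dayPairing (symTot true O.toMod) G).fst (delta01 O.toMod)).mul
          (separate true O.toMod w) v) := rfl

lemma isNat_separateFam : IsNat (separateFam (X := X) (Y := Y) O G) := by
  intro A A' B B' C C' D D' _ _ _ _ _ _ _ _ f f' g g' e e' a b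
  obtain ⟨a, rfl⟩ : ∃ a₁ : val (symTot true O.toMod) A (Pt A'), toDelta01 a₁ = a := ⟨a, rfl⟩
  refine (separateFam_apply e e' (act (symTot true O.toMod) f (onPt f') a) (act G g g' b)).trans ?_
  rw [separate_act, Pairing.mul_act, act_act]
  exact (separateFam_apply _ _ a b).symm

/-- The map that separates the factor that contains the added point, on `Λ* O ⊛ G`. -/
def separateFst (O : NUOperad k) (G : FBMod k) :
    val (dayConv (symTot true O.toMod) G) X (Pt Y) →ₗ[k]
      val (dayConv (dayConv (symTot true O.toMod) G) (delta01 O.toMod)) X Y :=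
  -- For `G = S* |δ_{1,1} O|` nothing is lost by the value zero when the output lies in `G`, since
  -- wheels have no outputs.
  dayLiftSnd (separateFam O G) (fun _ _ => 0)

lemma separateFst_mk (e : A ⊕ B ≃ X) (e' : A' ⊕ B' ≃ Y) (w : val (symTot true O.toMod) A (Pt A'))
    (v : val G B B') :
    separateFst O G (act (dayConv (symTot true O.toMod) G) e
      ((sumRightComm A' (Fin 1) B').trans (onPt e')) (dayMk w v)) =
      act (dayConv (dayConv (symTot true O.toMod) G) (delta01 O.toMod)) e e'
        (((dayPairing (symTot true O.toMod) G).fst (delta01 O.toMod)).mul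
          (separate true O.toMod w) v) :=
  (dayLiftSnd_left _ isNat_separateFam e e' w v).trans (separateFam_apply e e' w v)

/-- On `w ⊗ v` the product with `q` is formed inside `Λ* O`. There `separate` recovers `q`, and `v`
is put back next to `w`. -/
lemma separateFst_mul (e : A ⊕ B ≃ X) (e' : A' ⊕ B' ≃ Y)
    (m : val (dayConv (symTot true O.toMod) G) A A') (q : val O.toMod B (Pt B')) :
    separateFst O G (act (dayConv (symTot true O.toMod) G) e
      ((Equiv.sumAssoc A' B' (Fin 1)).symm.trans (onPt e'))
        (((mulPairing true O.toMod).fst G).mul m q)) =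
      act (dayConv (dayConv (symTot true O.toMod) G) (delta01 O.toMod)) e e'
        (dayMk m (toDelta01 q)) := by
  induction m using day_induction with
  | h0 => simp only [map_zero, LinearMap.zero_apply]
  | hadd s t hs ht => simp only [map_add, LinearMap.add_apply, hs, ht]
  | @hmk D D' E E' _ _ _ _ g g' w v =>
    have h1 := separateFst_mk ((sumRightComm D B E).trans ((g.sumCongr (Equiv.refl B)).trans e))
      ((sumRightComm D' B' E').trans ((g'.sumCongr (Equiv.refl B')).trans e'))
      (act (symTot true O.toMod) (Equiv.refl _) ((Equiv.sumAssoc D' B' (Fin 1)).symm.trans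
        (onPt (Equiv.refl _))) (mul true w q)) v
    rw [separate_mul, Pairing.fst_mul, dayMk_act_left, act_act, act_act] at h1
    have h2 : ((dayPairing (symTot true O.toMod) G).mul w v) = dayMk w v := rfl
    rw [h2] at h1
    rw [Pairing.fst_mul, act_act]
    refine (congrArg (separateFst O G) (act_congr ?_ ?_ rfl)).trans (h1.trans ?_)
    · exact Equiv.ext (by rintro ((x | x) | x) <;> rfl)
    · exact Equiv.ext (by rintro ((x | x | x) | x) <;> rfl)
    rw [dayMk_act_left, act_act]
    refine act_congr ?_ ?_ rfl
    · exact Equiv.ext (by rintro ((x | x) | x) <;> rfl)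
    · exact Equiv.ext (by rintro ((x | x) | x) <;> rfl)

/-- A wheel with an output would come from an operation with at least two outputs. -/
lemma subsingleton_wheel (O : NUOperad k) (A A' : Type) [Finite A] [Finite A'] :
    Subsingleton (val O.wheel A (Pt A')) := by
  refine ⟨fun s t => ?_⟩
  obtain ⟨r, rfl⟩ := toWheel_surjective s
  obtain ⟨r', rfl⟩ := toWheel_surjective t
  refine congrArg O.toWheel ((O.supported ⟨Pt A, Pt (Pt A')⟩ ?_).elim r r')
  change Nat.card (Pt (Pt A')) ≠ 1
  rw [Nat.card_sum, Nat.card_sum, Nat.card_unique (α := Fin 1)]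
  omega

/-- The added output cannot belong to a wheel, hence lies in a factor of `Λ* O`, which can be moved
to the last place. -/
lemma lambdaSym_induction {P : val (lambdaSym O) X (Pt Y) → Prop} (h0 : P 0)
    (hadd : ∀ s t, P s → P t → P (s + t)) (hsmul : ∀ (a : k) t, P t → P (a • t))
    (hmk : ∀ {A A' B B' : Type} [Finite A] [Finite A'] [Finite B] [Finite B'] (e : A ⊕ B ≃ X)
      (e' : A' ⊕ B' ≃ Y) (m : val (lambdaSym O) A A') (q : val O.toMod B (Pt B')),
      P (act (lambdaSym O) e ((Equiv.sumAssoc A' B' (Fin 1)).symm.trans (onPt e'))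
        (((mulPairing true O.toMod).fst (symTot false O.wheel)).mul m q))) (t) : P t := by
  refine daySnd_induction h0 hadd (fun {A A' B B'} _ _ _ _ e e' w v => ?_)
    (fun {A A' B B'} _ _ _ _ e e' w v => ?_) t
  · induction w using symTotSnd_induction with
    | h0 => simp only [map_zero, LinearMap.zero_apply]; exact h0
    | hadd s t hs ht => simp only [map_add, LinearMap.add_apply]; exact hadd _ _ hs ht
    | hsmul a t ht => simp only [map_smul, LinearMap.smul_apply]; exact hsmul _ _ ht
    | @hmk D D' E E' _ _ _ _ g g' w q =>
      have := hmk ((sumRightComm D B E).trans ((g.sumCongr (Equiv.refl B)).trans e))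
        ((sumRightComm D' B' E').trans ((g'.sumCongr (Equiv.refl B')).trans e')) (dayMk w v) q
      rw [← act_refl (lambdaSym O) (dayMk w v), Pairing.fst_mul, act_act] at this
      rw [dayMk_act_left, act_act]
      refine (congrArg P (act_congr ?_ ?_ rfl)).mp this
      · exact Equiv.ext (by rintro ((x | x) | x) <;> rfl)
      · exact Equiv.ext (by rintro ((x | x | x) | x) <;> rfl)
  · induction v using symTotSnd_induction with
    | h0 => simp only [map_zero]; exact h0
    | hadd s t hs ht => simp only [map_add]; exact hadd _ _ hs ht
    | hsmul a t ht => simp only [map_smul]; exact hsmul _ _ ht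
    | @hmk D D' E E' _ _ _ _ g g' v b =>
      rw [(subsingleton_wheel O E E').elim b 0, map_zero, map_zero, map_zero, map_zero]
      exact h0

/-- The structure on `Λ* O ⊛ S* |δ_{1,1} O|` from which its contraction maps are built. -/
def lambdaSymData (O : NUOperad k) : ContrData O (lambdaSym O) where
  plug := dayPlug (symPlug true O.plug) (symPlug false O.wheelPlug)
  assoc := dayPlug_isAssoc (symPlug_isAssoc true O.plug_isAssoc)
    (symPlug_isAssoc false O.wheelPlug_isAssoc)
  mulO := (mulPairing true O.toMod).fst _
  mulW := (mulPairing false O.wheel).snd _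
  leibO := (mulPairing_leibniz true O.plug).fst _
  leibW := (mulPairing_leibniz false O.wheelPlug).snd _
  mulO_mulO m p q := ((mulPairing true O.toMod).fst_mul_fst_mul (-1)
    (fun m p q => (mul_mul_true m p q).trans (neg_one_smul ℤ _).symm) m p q).trans
      (neg_one_smul ℤ _)
  mulW_mulO := Pairing.snd_mul_fst_mul _ _
  mulW_mulW := (mulPairing false O.wheel).snd_mul_snd_mul mul_mul_false
  split := separateFst O _
  split_mul := separateFst_mul
  induction := lambdaSym_induction

end ContractionData

/-! ### Values of the contraction on decomposable elements -/

section InducedContraction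

variable {k : Type u} [Field k] {O : NUOperad k} {F G H K : FBMod k}
variable {A A' B B' C C' D D' E E' : Type} [Finite A] [Finite A'] [Finite B] [Finite B']
  [Finite C] [Finite C'] [Finite D] [Finite D'] [Finite E] [Finite E']

lemma dayMk_mul (μ : Pairing F G K) (a : val F A A') (b : val H B B') (q : val G D D') :
    dayMk (μ.mul a q) b = act (dayConv K H) (sumRightComm A B D) (sumRightComm A' B' D')
      ((μ.fst H).mul (dayMk a b) q) := by
  rw [← act_refl (dayConv F H) (dayMk a b), μ.fst_mul, act_act]
  refine (act_refl (dayConv K H) _).symm.trans (act_congr ?_ ?_ rfl)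
  · exact Equiv.ext (by rintro ((x | x) | x) <;> rfl)
  · exact Equiv.ext (by rintro ((x | x) | x) <;> rfl)

/-- The added point lies in the second summand of the second summand. -/
def ptNested (A B C : Type) : A ⊕ (B ⊕ Pt C) ≃ Pt (A ⊕ (B ⊕ C)) :=
  ((Equiv.refl A).sumCongr (Equiv.sumAssoc B C (Fin 1)).symm).trans
    (Equiv.sumAssoc A (B ⊕ C) (Fin 1)).symm

lemma wheelPlug_plug (p : val O.wheel (Pt A) A') (q : val O.toMod B (Pt B')) :
    O.wheelPlug.plug p q = O.wheelAct p q := rfl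

lemma dayMk_mulO (w : val (symTot true O.toMod) A A') (v : val (symTot false O.wheel) B B')
    (q : val O.toMod D D') :
    dayMk ((mulPairing true O.toMod).mul w q) v = act (lambdaSym O) (sumRightComm A B D)
      (sumRightComm A' B' D') ((lambdaSymData O).mulO.mul (dayMk w v) q) :=
  dayMk_mul _ w v q

lemma mulW_dayMk (w : val (symTot true O.toMod) A A') (v : val (symTot false O.wheel) B B')
    (a : val O.wheel D D') :
    (lambdaSymData O).mulW.mul (dayMk w v) a = act (lambdaSym O) (Equiv.sumAssoc A B D).symm
      (Equiv.sumAssoc A' B' D').symm (dayMk w ((mulPairing false O.wheel).mul v a)) := by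
  rw [← act_refl (lambdaSym O) (dayMk w v)]
  refine ((mulPairing false O.wheel).snd_mul (Equiv.refl _) (Equiv.refl _) w v a).trans ?_
  refine act_congr ?_ ?_ rfl
  · exact Equiv.ext (by rintro (x | x | x) <;> rfl)
  · exact Equiv.ext (by rintro (x | x | x) <;> rfl)

lemma dayPlug_ptSecond {μ : Pairing F H F} {P : Plug O F} {R : Plug O H} (h : μ.Leibniz P R P)
    (Q : Plug O G) (w : val F A A') (p : val H (Pt B) B') (v : val G C C')
    (q : val O.toMod D (Pt D')) :
    (dayPlug P Q).plug (act (dayConv F G) (ContrData.ptSecond A B C) (Equiv.refl _)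
      (dayMk (μ.mul w p) v)) q =
      act (dayConv F G) (((Equiv.sumAssoc A B D).symm.sumCongr (Equiv.refl C)).trans
        (sumRightComm (A ⊕ B) D C)) (((Equiv.sumAssoc A' B' D').symm.sumCongr (Equiv.refl C')).trans
          (sumRightComm (A' ⊕ B') D' C')) (dayMk (μ.mul w (R.plug p q)) v) := by
  have h1 := dayPlugMap_left P Q (Equiv.refl _) (Equiv.refl _)
    (act F (Equiv.sumAssoc A B (Fin 1)).symm (Equiv.refl _) (μ.mul w p)) v q
  rw [dayMk_act_left, act_act, h.right w p q, dayMk_act_left, act_act] at h1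
  refine (congrArg (fun x => dayPlugMap P Q x q) (act_congr ?_ ?_ rfl)).trans
    (h1.trans (act_congr ?_ ?_ rfl))
  · exact Equiv.ext (by rintro ((x | x | x) | x) <;> rfl)
  · exact Equiv.ext (by rintro ((x | x) | x) <;> rfl)
  · exact Equiv.ext (by rintro ((x | x | x) | x) <;> rfl)
  · exact Equiv.ext (by rintro ((x | x | x) | x) <;> rfl)

lemma dayPlug_ptNested {μ : Pairing G H G} {Q : Plug O G} {R : Plug O H} (P : Plug O F)
    (h : μ.Leibniz Q R Q) (w : val F A A') (v : val G B B') (a : val H (Pt C) C')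
    (q : val O.toMod D (Pt D')) :
    (dayPlug P Q).plug (act (dayConv F G) (ptNested A B C) (Equiv.refl _)
      (dayMk w (μ.mul v a))) q =
      act (dayConv F G) (((Equiv.refl A).sumCongr (Equiv.sumAssoc B C D).symm).trans
        (Equiv.sumAssoc A (B ⊕ C) D).symm) (((Equiv.refl A').sumCongr
          (Equiv.sumAssoc B' C' D').symm).trans (Equiv.sumAssoc A' (B' ⊕ C') D').symm)
            (dayMk w (μ.mul v (R.plug a q))) := by
  have h1 := dayPlugMap_right P Q (Equiv.refl _) (Equiv.refl _) w
    (act G (Equiv.sumAssoc B C (Fin 1)).symm (Equiv.refl _) (μ.mul v a)) q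
  rw [dayMk_act_right, act_act, h.right v a q, dayMk_act_right, act_act] at h1
  refine (congrArg (fun x => dayPlugMap P Q x q) (act_congr ?_ ?_ rfl)).trans
    (h1.trans (act_congr ?_ ?_ rfl))
  · exact Equiv.ext (by rintro (x | x | x | x) <;> rfl)
  · exact Equiv.ext (by rintro (x | x | x) <;> rfl)
  · exact Equiv.ext (by rintro (x | x | x | x) <;> rfl)
  · exact Equiv.ext (by rintro (x | x | x | x) <;> rfl)

lemma plug_dayMk_left (w : val (symTot true O.toMod) A A') (p : val O.toMod (Pt B) B')
    (v : val (symTot false O.wheel) C C') (q : val O.toMod D (Pt D')) :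
    (lambdaSymData O).plug.plug (act (lambdaSym O) (ContrData.ptSecond A B C) (Equiv.refl _)
      (dayMk ((mulPairing true O.toMod).mul w p) v)) q =
      act (lambdaSym O) (((Equiv.sumAssoc A B D).symm.sumCongr (Equiv.refl C)).trans
        (sumRightComm (A ⊕ B) D C)) (((Equiv.sumAssoc A' B' D').symm.sumCongr (Equiv.refl C')).trans
          (sumRightComm (A' ⊕ B') D' C'))
          (dayMk ((mulPairing true O.toMod).mul w (O.comp p q)) v) :=
  dayPlug_ptSecond (mulPairing_leibniz true O.plug) (symPlug false O.wheelPlug) w p v q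

lemma plug_dayMk_right (w : val (symTot true O.toMod) A A') (v : val (symTot false O.wheel) B B')
    (a : val O.wheel (Pt C) C') (q : val O.toMod D (Pt D')) :
    (lambdaSymData O).plug.plug (act (lambdaSym O) (ptNested A B C) (Equiv.refl _)
      (dayMk w ((mulPairing false O.wheel).mul v a))) q =
      act (lambdaSym O) (((Equiv.refl A).sumCongr (Equiv.sumAssoc B C D).symm).trans
        (Equiv.sumAssoc A (B ⊕ C) D).symm) (((Equiv.refl A').sumCongr
          (Equiv.sumAssoc B' C' D').symm).trans (Equiv.sumAssoc A' (B' ⊕ C') D').symm)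
            (dayMk w ((mulPairing false O.wheel).mul v (O.wheelAct a q))) :=
  dayPlug_ptNested (symPlug true O.plug) (mulPairing_leibniz false O.wheelPlug) w v a q

/-- The factor `q` is moved behind `v`, where it is the last factor for `mulO`. The added input then
lies in the rest, and the derivation rule places `q` in `p`. -/
lemma contr_corolla_corolla (w : val (symTot true O.toMod) D D') (p : val O.toMod (Pt A) A')
    (q : val O.toMod B (Pt B')) (v : val (symTot false O.wheel) E E') :
    (lambdaSymData O).contr _ _ (act (lambdaSym O) (shuffleOne D A B E) (shuffleOne' D' A' B' E')
      (dayMk ((mulPairing true O.toMod).mul ((mulPairing true O.toMod).mul w p) q) v)) =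
      dayMk ((mulPairing true O.toMod).mul w (O.comp p q)) v := by
  rw [dayMk_mulO, act_act]
  refine ((lambdaSymData O).contr_left (ContrData.ptSecond D A E) (Equiv.refl _)
    ((sumRightComm (D ⊕ A) E B).trans ((Equiv.sumAssoc D A B).sumCongr (Equiv.refl E)))
    ((sumRightComm (D' ⊕ A') E' B').trans ((Equiv.sumAssoc D' A' B').sumCongr (Equiv.refl E')))
    ?_ ?_ _ q).trans ?_
  · exact Equiv.ext (by rintro (((x | x | x) | x) | x) <;> rfl)
  · exact Equiv.ext (by rintro (((x | x) | x) | x | x) <;> rfl)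
  rw [act_refl, plug_dayMk_left, act_act]
  refine (act_congr ?_ ?_ rfl).trans (act_refl (lambdaSym O) _)
  · exact Equiv.ext (by rintro ((x | x | x) | x) <;> rfl)
  · exact Equiv.ext (by rintro ((x | x | x) | x) <;> rfl)

/-- As before `q` becomes the last factor; the derivation rule now leads into the wheel `a`. -/
lemma contr_wheel_corolla (w : val (symTot true O.toMod) D D') (q : val O.toMod B (Pt B'))
    (v : val (symTot false O.wheel) E E') (a : val O.wheel (Pt A) A') :
    (lambdaSymData O).contr _ _ (act (lambdaSym O) (shuffleTwo D B E A) (shuffleTwo' D' B' E' A')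
      (dayMk ((mulPairing true O.toMod).mul w q) ((mulPairing false O.wheel).mul v a))) =
      dayMk w ((mulPairing false O.wheel).mul v (O.wheelAct a q)) := by
  rw [dayMk_mulO, act_act]
  refine ((lambdaSymData O).contr_left (ptNested D E A) (Equiv.refl _)
    ((Equiv.sumAssoc D (E ⊕ A) B).trans ((Equiv.refl D).sumCongr (Equiv.sumAssoc E A B)))
    ((Equiv.sumAssoc D' (E' ⊕ A') B').trans ((Equiv.refl D').sumCongr (Equiv.sumAssoc E' A' B')))
    ?_ ?_ _ q).trans ?_
  · exact Equiv.ext (by rintro ((x | x | x | x) | x) <;> rfl)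
  · exact Equiv.ext (by rintro ((x | x | x) | x | x) <;> rfl)
  rw [act_refl, plug_dayMk_right, act_act]
  refine (act_congr ?_ ?_ rfl).trans (act_refl (lambdaSym O) _)
  · exact Equiv.ext (by rintro (x | x | x | x) <;> rfl)
  · exact Equiv.ext (by rintro (x | x | x | x) <;> rfl)

/-- Input and output lie in the separated factor `r`, so it is closed up and multiplied into the
symmetric part. -/
lemma contr_corolla_self (w : val (symTot true O.toMod) D D') (r : val O.toMod (Pt A) (Pt A'))
    (v : val (symTot false O.wheel) E E') :
    (lambdaSymData O).contr _ _ (act (lambdaSym O) (shuffleThree D A E) (shuffleThree D' A' E')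
      (dayMk ((mulPairing true O.toMod).mul w r) v)) =
      dayMk w ((mulPairing false O.wheel).mul v (O.toWheel r)) := by
  rw [dayMk_mulO, act_act]
  refine ((lambdaSymData O).contr_right (Equiv.refl _) (Equiv.refl _)
    (Equiv.sumAssoc D E A) (Equiv.sumAssoc D' E' A') ?_ ?_ _ r).trans ?_
  · exact Equiv.ext (by rintro ((x | x) | x | x) <;> rfl)
  · exact Equiv.ext (by rintro ((x | x) | x | x) <;> rfl)
  rw [act_refl, mulW_dayMk, act_act]
  refine (act_congr ?_ ?_ rfl).trans (act_refl (lambdaSym O) _)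
  · exact Equiv.ext (by rintro (x | x | x) <;> rfl)
  · exact Equiv.ext (by rintro (x | x | x) <;> rfl)

lemma mulPairing_cls (s : Bool) {d : ℕ} (w : val (convPow F d) A A') (b : val F B B') :
    (mulPairing s F).mul (cls s w) b = cls s (snoc w b) :=
  mul_cls s w b

end InducedContraction

/-! ### The contraction rules for classes of tensors -/

section InducedContraction

variable {k : Type u} [Field k] {O : NUOperad k}

/-- The rules of `IsInducedContraction`, for a module `L` with given decomposable elements. -/
structure IsInducedOn (O : NUOperad k) (L : FBMod k)
    (mk : ∀ {d e : ℕ} {D D' E E' : Type} [Finite D] [Finite D'] [Finite E] [Finite E'],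
      val (convPow O.toMod d) D D' → val (convPow O.wheel e) E E' → val L (D ⊕ E) (D' ⊕ E'))
    (κ : ∀ (X Y : Type) [Finite X] [Finite Y], val L (Pt X) (Pt Y) →ₗ[k] val L X Y) : Prop where
  corolla_corolla : ∀ {d e : ℕ} {D D' A A' B B' E E' : Type} [Finite D] [Finite D'] [Finite A]
    [Finite A'] [Finite B] [Finite B'] [Finite E] [Finite E']
    (w : val (convPow O.toMod d) D D') (p : val O.toMod (Pt A) A') (q : val O.toMod B (Pt B'))
    (v : val (convPow O.wheel e) E E'),
    κ _ _ (act L (shuffleOne D A B E) (shuffleOne' D' A' B' E') (mk (snoc (snoc w p) q) v)) =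
      mk (snoc w (O.comp p q)) v
  wheel_corolla : ∀ {d e : ℕ} {D D' A A' B B' E E' : Type} [Finite D] [Finite D'] [Finite A]
    [Finite A'] [Finite B] [Finite B'] [Finite E] [Finite E']
    (w : val (convPow O.toMod d) D D') (q : val O.toMod B (Pt B'))
    (v : val (convPow O.wheel e) E E') (a : val O.wheel (Pt A) A'),
    κ _ _ (act L (shuffleTwo D B E A) (shuffleTwo' D' B' E' A') (mk (snoc w q) (snoc v a))) =
      mk w (snoc v (O.wheelAct a q))
  corolla_self : ∀ {d e : ℕ} {D D' A A' E E' : Type} [Finite D] [Finite D'] [Finite A]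
    [Finite A'] [Finite E] [Finite E']
    (w : val (convPow O.toMod d) D D') (r : val O.toMod (Pt A) (Pt A'))
    (v : val (convPow O.wheel e) E E'),
    κ _ _ (act L (shuffleThree D A E) (shuffleThree D' A' E') (mk (snoc w r) v)) =
      mk w (snoc v (O.toWheel r))

lemma isInducedOn_lambdaSym (O : NUOperad k) :
    IsInducedOn O (lambdaSym O) (fun w v => dayMk (cls true w) (cls false v))
      (fun X Y _ _ => (lambdaSymData O).contr X Y) where
  corolla_corolla w p q v := by
    have h := contr_corolla_corolla (cls true w) p q (cls false v)
    rwa [mulPairing_cls, mulPairing_cls, mulPairing_cls] at h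
  wheel_corolla w q v a := by
    have h := contr_wheel_corolla (cls true w) q (cls false v) a
    rwa [mulPairing_cls, mulPairing_cls, mulPairing_cls] at h
  corolla_self w r v := by
    have h := contr_corolla_self (cls true w) r (cls false v)
    rwa [mulPairing_cls, mulPairing_cls] at h

/-- The structure `lambdaSymData`, for the value of `lambdaSymFunctor`. -/
def lambdaSymContrData (O : NUOperad k) : ContrData O ((lambdaSymFunctor k).obj O) :=
  lambdaSymData O

lemma isInducedOn_lambdaSymFunctor (O : NUOperad k) :
    IsInducedOn O ((lambdaSymFunctor k).obj O) (fun w v => corollasWheels O w v)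
      (fun X Y _ _ => (lambdaSymContrData O).contr X Y) :=
  isInducedOn_lambdaSym O

lemma isInducedContraction_contr (O : NUOperad k) :
    IsInducedContraction O fun X Y _ _ => (lambdaSymContrData O).contr X Y where
  corolla_corolla := (isInducedOn_lambdaSymFunctor O).corolla_corolla
  wheel_corolla := (isInducedOn_lambdaSymFunctor O).wheel_corolla
  corolla_self := (isInducedOn_lambdaSymFunctor O).corolla_self

end InducedContraction

/-! ### Naturality in the operad -/

section Compatibility

variable {k : Type u} [Field k] {O P : NUOperad k} {F G H F' G' H' K K' L L' : FBMod k}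
variable {A A' B B' C C' D D' X X' Y Y' : Type} [Finite A] [Finite A'] [Finite B] [Finite B']
  [Finite C] [Finite C'] [Finite D] [Finite D'] [Finite X] [Finite X'] [Finite Y] [Finite Y']

/-- The component of a morphism, as a linear map. -/
def ev (η : F ⟶ G) : val F A A' →ₗ[k] val G A A' := (η.app ⟨A, A'⟩).hom

lemma ev_act (η : F ⟶ G) (e : A ≃ B) (e' : A' ≃ B') (x : val F A A') :
    ev η (act F e e' x) = act G e e' (ev η x) := app_act η e e' x

lemma app_map (η : F ⟶ G) {Z W : FB2} (g : Z ⟶ W) (x : F.obj Z) :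
    (η.app W).hom ((F.map g).hom x) = (G.map g).hom ((η.app Z).hom x) :=
  congrArg (fun f => f.hom x) (η.naturality g)

lemma ev_id (x : val F A A') : ev (𝟙 F) x = x := rfl

/-- Morphisms that commute with pairings. -/
structure Pairing.Compat (μ : Pairing F G H) (μ' : Pairing F' G' H') (η : F ⟶ F') (θ : G ⟶ G')
    (ζ : H ⟶ H') : Prop where
  out : ∀ {A A' B B' : Type} [Finite A] [Finite A'] [Finite B] [Finite B'] (a : val F A A')
    (b : val G B B'), ev ζ (μ.mul a b) = μ'.mul (ev η a) (ev θ b)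

/-- Morphisms that commute with right actions of operads. -/
structure Plug.Compat (Q : Plug O F) (Q' : Plug P F') (f : O ⟶ P) (η : F ⟶ F') : Prop where
  out : ∀ {A A' B B' : Type} [Finite A] [Finite A'] [Finite B] [Finite B'] (p : val F (Pt A) A')
    (q : val O.toMod B (Pt B')), ev η (Q.plug p q) = Q'.plug (ev η p) (ev f.toMod q)

lemma ev_wheelMap (f : O ⟶ P) (r : val O.toMod (Pt A) (Pt A')) :
    ev (wheelMap f) (O.toWheel r) = P.toWheel (ev f.toMod r) := rfl

lemma plug_compat (f : O ⟶ P) : O.plug.Compat P.plug f f.toMod := ⟨f.comp_app⟩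

lemma ev_deltaAct (f : O ⟶ P) (r : val O.toMod (Pt (Pt A)) (Pt A')) (q : val O.toMod B (Pt B')) :
    ev f.toMod (O.deltaAct r q) = P.deltaAct (ev f.toMod r) (ev f.toMod q) := by
  refine (ev_act f.toMod (sumRightComm A (Fin 1) B) (sumRightComm A' (Fin 1) B') _).trans ?_
  refine congrArg (act P.toMod (sumRightComm A (Fin 1) B) (sumRightComm A' (Fin 1) B')) ?_
  refine (f.comp_app _ q).trans ?_
  exact congrArg (fun x => P.comp x (ev f.toMod q)) (ev_act f.toMod _ _ r)

lemma wheelPlug_compat (f : O ⟶ P) : O.wheelPlug.Compat P.wheelPlug f (wheelMap f) where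
  out p q := by
    obtain ⟨r, rfl⟩ := toWheel_surjective p
    rw [wheelPlug_plug, wheelPlug_plug, wheelAct_toWheel, ev_wheelMap, ev_wheelMap,
      wheelAct_toWheel, ev_deltaAct]

lemma ev_dayMk (η : F ⟶ F') (θ : G ⟶ G') (a : val F A A') (b : val G B B') :
    ev (dayConvMap η θ) (dayMk a b) = dayMk (ev η a) (ev θ b) := by
  refine (dayApp_incl η θ _ _ _).trans ?_
  refine congrArg (dayIncl F' G' _) (congrArg₂ (· ⊗ₜ[k] ·) ?_ ?_)
  · exact app_map η _ a
  · exact app_map θ _ b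

lemma ev_snoc (η : F ⟶ G) {d : ℕ} (w : val (convPow F d) A A') (b : val F B B') :
    ev (convPowMap η (d + 1)) (snoc w b) = snoc (ev (convPowMap η d) w) (ev η b) := by
  induction w using pow_induction with
  | h0 => simp only [map_zero, LinearMap.zero_apply]
  | hadd s t hs ht => simp only [map_add, LinearMap.add_apply, hs, ht]
  | hsmul a t ht => simp only [map_smul, LinearMap.smul_apply, ht]
  | hmk c x =>
    obtain ⟨y, h1, h2, h3⟩ := snoc_incl c x b
    obtain ⟨z, h4, h5, h6⟩ := snoc_incl c (fun i => (η.app (c.part i)).hom (x i)) (ev η b)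
    refine (congrArg (ev (convPowMap η (d + 1))) h1).trans ((powApp_incl η _ y).trans ?_)
    refine Eq.trans ?_ (h4.symm.trans ?_)
    · refine congrArg (fun y => powIncl G (snocCol c) (PiTensorProduct.tprod k y))
        (funext fun i => ?_)
      refine Fin.lastCases ?_ (fun i => ?_) i
      · rw [h3, h6]
        exact app_map η _ b
      · rw [h2, h5]
        exact app_map η _ (x i)
    · exact congrArg (fun x => snoc (A := A) (A' := A') x (ev η b)) (powApp_incl η c x).symm

lemma mulPairing_compat (s : Bool) (η : F ⟶ G) :
    (mulPairing s F).Compat (mulPairing s G) (symTotMap s η) η (symTotMap s η) where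
  out {A A' B B'} _ _ _ _ w b := by
    induction w using symTot_induction with
    | h0 => simp only [map_zero, LinearMap.zero_apply]
    | hadd s t hs ht => simp only [map_add, LinearMap.add_apply, hs, ht]
    | hmk d x =>
      rw [mulPairing_cls]
      refine (symTotMap_cls s η _).trans ((congrArg (cls s) (ev_snoc η x b)).trans ?_)
      refine (mul_cls s _ _).symm.trans ?_
      exact congrArg (fun w => mul s w (ev η b)) (symTotMap_cls s η x).symm

namespace Plug.Compat

variable {f : O ⟶ P} {η : F ⟶ F'} {θ : G ⟶ G'}

/-- Both actions are determined by their values on products with the input in the last factor, where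
they reduce to `Q` and `Q'`. -/
lemma sym (s : Bool) {Q : Plug O F} {Q' : Plug P F'} (h : Q.Compat Q' f η) :
    (symPlug s Q).Compat (symPlug s Q') f (symTotMap s η) where
  out t q := by
    induction t using symTotFst_induction with
    | h0 => simp only [map_zero, LinearMap.zero_apply]
    | hadd s t hs ht => simp only [map_add, LinearMap.add_apply, hs, ht]
    | hsmul a t ht => simp only [map_smul, LinearMap.smul_apply, ht]
    | hmk e e' w b =>
      have h1 := (mulPairing_compat s η).out w b
      have h2 := (mulPairing_compat s η).out w (Q.plug b q)
      rw [symPlug_mul, ev_act, ev_act]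
      refine (congrArg (act (symTot s F') _ _) h2).trans ?_
      refine Eq.trans ?_ (congrArg (fun x => (symPlug s Q').plug (act (symTot s F') _ _ x) _)
        h1).symm
      refine Eq.trans ?_ (symPlug_mul s Q' e e' _ _ _).symm
      exact congrArg (fun x => act (symTot s F') _ _ (mul s _ x)) (h.out b q)

lemma day {Q : Plug O F} {Q' : Plug P F'} {R : Plug O G} {R' : Plug P G'} (h : Q.Compat Q' f η)
    (h' : R.Compat R' f θ) : (dayPlug Q R).Compat (dayPlug Q' R') f (dayConvMap η θ) where
  out t q := by
    change ev _ (dayPlugMap Q R t q) = dayPlugMap Q' R' _ _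
    induction t using dayFst_induction with
    | h0 => simp only [map_zero, LinearMap.zero_apply]
    | hadd s t hs ht => simp only [map_add, LinearMap.add_apply, hs, ht]
    | hl e e' a b =>
      rw [dayPlugMap_left, ev_act, ev_act, ev_dayMk, ev_dayMk, dayPlugMap_left, h.out]
    | hr e e' a b =>
      rw [dayPlugMap_right, ev_act, ev_act, ev_dayMk, ev_dayMk, dayPlugMap_right, h'.out]

end Plug.Compat

namespace Pairing.Compat

lemma fst {μ : Pairing F G H} {μ' : Pairing F' G' H'} {η : F ⟶ F'} {θ : G ⟶ G'} {ζ : H ⟶ H'}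
    (h : μ.Compat μ' η θ ζ) (ξ : K ⟶ K') :
    (μ.fst K).Compat (μ'.fst K') (dayConvMap η ξ) θ (dayConvMap ζ ξ) where
  out t q := by
    induction t using day_induction with
    | h0 => simp only [map_zero, LinearMap.zero_apply]
    | hadd s t hs ht => simp only [map_add, LinearMap.add_apply, hs, ht]
    | hmk e e' a b => rw [fst_mul, ev_act, ev_act, ev_dayMk, ev_dayMk, fst_mul, h.out]

lemma snd {μ : Pairing F G H} {μ' : Pairing F' G' H'} {η : F ⟶ F'} {θ : G ⟶ G'} {ζ : H ⟶ H'}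
    (h : μ.Compat μ' η θ ζ) (ξ : K ⟶ K') :
    (μ.snd K).Compat (μ'.snd K') (dayConvMap ξ η) θ (dayConvMap ξ ζ) where
  out t q := by
    induction t using day_induction with
    | h0 => simp only [map_zero, LinearMap.zero_apply]
    | hadd s t hs ht => simp only [map_add, LinearMap.add_apply, hs, ht]
    | hmk e e' a b => rw [snd_mul, ev_act, ev_act, ev_dayMk, ev_dayMk, snd_mul, h.out]

end Pairing.Compat

/-- Natural contraction maps that anticommute. -/
structure Contraction (L : FBMod k) where
  map : ∀ (X Y : Type) [Finite X] [Finite Y], val L (Pt X) (Pt Y) →ₗ[k] val L X Y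
  map_act : ∀ {X X' Y Y' : Type} [Finite X] [Finite X'] [Finite Y] [Finite Y'] (f : X ≃ X')
    (f' : Y ≃ Y') (t : val L (Pt X) (Pt Y)),
    map X' Y' (act L (onPt f) (onPt f') t) = act L f f' (map X Y t)
  map_map : ∀ {X Y : Type} [Finite X] [Finite Y] (t : val L (Pt (Pt X)) (Pt (Pt Y))),
    map X Y (map (Pt X) (Pt Y) t) = -map X Y (map (Pt X) (Pt Y)
      (act L (sumRightComm X (Fin 1) (Fin 1)) (sumRightComm Y (Fin 1) (Fin 1)) t))

/-- Morphisms that commute with contraction maps. -/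
structure Contraction.IsHom (κ : Contraction L) (κ' : Contraction L') (η : L ⟶ L') : Prop where
  out : ∀ {X Y : Type} [Finite X] [Finite Y] (t : val L (Pt X) (Pt Y)),
    ev η (κ.map X Y t) = κ'.map X Y (ev η t)

/-- The contraction maps `ContrData.contr`. -/
def ContrData.toContraction (D : ContrData O L) : Contraction L where
  map := D.contr
  map_act := D.contr_act
  map_map := D.contr_contr

/-- On the elements of `pt_induction` the contraction is a plug or a product with a wheel.
Compatibility with `split` is not required, since these elements span. -/
lemma ContrData.isHom (D : ContrData O L) (D' : ContrData P L') {f : O ⟶ P} {η : L ⟶ L'}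
    (hP : D.plug.Compat D'.plug f η) (hO : D.mulO.Compat D'.mulO η f.toMod η)
    (hW : D.mulW.Compat D'.mulW η (wheelMap f) η) :
    D.toContraction.IsHom D'.toContraction η where
  out {X Y} _ _ t := by
    change ev η (D.contr X Y t) = D'.contr X Y (ev η t)
    refine D.pt_induction (P := fun t => ev η (D.contr X Y t) = D'.contr X Y (ev η t))
      ?_ ?_ ?_ ?_ ?_ t
    · simp only [map_zero]
    · intro s t hs ht
      simp only [map_add, hs, ht]
    · intro a t ht
      simp only [map_smul, ht]
    · intro A A' B B' _ _ _ _ e e' m q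
      rw [D.contr_left', ev_act, ev_act, hO.out, hP.out, D'.contr_left']
    · intro A A' B B' _ _ _ _ e e' m q
      rw [D.contr_right', ev_act, ev_act, hO.out, hW.out, ev_wheelMap, D'.contr_right']

/-- The structure `lambdaData`, for the value of `lambdaFunctor`. -/
def lambdaContrData (O : NUOperad k) : ContrData O ((lambdaFunctor k).obj O) := lambdaData O

lemma lambdaData_isHom (f : O ⟶ P) : (lambdaData O).toContraction.IsHom
    (lambdaData P).toContraction (symTotMap true f.toMod) :=
  ContrData.isHom _ _ ((plug_compat f).sym true) (mulPairing_compat true f.toMod)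
    ⟨fun _ _ => map_zero _⟩

lemma lambdaContrData_isHom (f : O ⟶ P) : (lambdaContrData O).toContraction.IsHom
    (lambdaContrData P).toContraction ((lambdaFunctor k).map f) :=
  lambdaData_isHom f

lemma lambdaSymData_isHom (f : O ⟶ P) : (lambdaSymData O).toContraction.IsHom
    (lambdaSymData P).toContraction
      (dayConvMap (symTotMap true f.toMod) (symTotMap false (wheelMap f))) :=
  ContrData.isHom _ _ (((plug_compat f).sym true).day ((wheelPlug_compat f).sym false))
    ((mulPairing_compat true f.toMod).fst _) ((mulPairing_compat false (wheelMap f)).snd _)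

lemma lambdaSymContrData_isHom (f : O ⟶ P) : (lambdaSymContrData O).toContraction.IsHom
    (lambdaSymContrData P).toContraction ((lambdaSymFunctor k).map f) := by
  delta lambdaSymContrData lambdaSymFunctor lambdaFunctor symWheelFunctor NUOperad.forget
    NUOperad.wheelFunctor LambdaStar SStar symFunctor Functor.comp
  with_reducible exact lambdaSymData_isHom f

end Compatibility

/-! ### The projection to `Λ* O` -/

section Projection

variable {k : Type u} [Field k] {O P : NUOperad k} {F G H L M : FBMod k}
variable {A A' B B' C C' D D' X X' Y Y' : Type} [Finite A] [Finite A'] [Finite B] [Finite B']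
  [Finite C] [Finite C'] [Finite D] [Finite D'] [Finite X] [Finite X'] [Finite Y] [Finite Y']

/-- The augmentation of `S* F`. -/
def aug (F : FBMod k) {A A' : Type} [Finite A] [Finite A'] : val (symTot false F) A A' →ₗ[k] k :=
  symAug F ⟨A, A'⟩

lemma aug_act (e : A ≃ B) (e' : A' ≃ B') (v : val (symTot false F) A A') :
    aug F (act (symTot false F) e e' v) = aug F v :=
  symAug_transport F _ v

/-- A product with a further factor has positive degree, where the augmentation vanishes. -/
lemma aug_mul (v : val (symTot false F) A A') (b : val F B B') :
    aug F ((mulPairing false F).mul v b) = 0 := by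
  induction v using symTot_induction with
  | h0 => simp only [map_zero, LinearMap.zero_apply]
  | hadd s t hs ht => simp only [map_add, LinearMap.add_apply, hs, ht, add_zero]
  | hmk d x =>
    rw [mulPairing_cls]
    exact symAug_cls F (snoc x b)

/-- An element with an added input has positive degree, and plugging preserves the number of
factors. -/
lemma aug_symPlug (Q : Plug O F) (v : val (symTot false F) (Pt A) A') (q : val O.toMod B (Pt B')) :
    aug F ((symPlug false Q).plug v q) = 0 := by
  induction v using symTotFst_induction with
  | h0 => simp only [map_zero, LinearMap.zero_apply]
  | hadd s t hs ht => simp only [map_add, LinearMap.add_apply, hs, ht, add_zero]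
  | hsmul a t ht => simp only [map_smul, LinearMap.smul_apply, ht, smul_zero]
  | hmk e e' w b =>
    rw [symPlug_mul, aug_act]
    exact aug_mul w _

/-- The projection `L ⊛ S* F → L`. -/
def projSym (L F : FBMod k) : dayConv L (symTot false F) ⟶ L := proj L F

lemma projSym_of_isEmpty [IsEmpty B] [IsEmpty B'] (a : val L A A')
    (v : val (symTot false F) B B') :
    ev (projSym L F) (dayMk a v) =
      aug F v • act L (Equiv.sumEmpty A B).symm (Equiv.sumEmpty A' B').symm a := by
  rw [← act_refl (dayConv L (symTot false F)) (dayMk a v),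
    act_dayMk (Equiv.refl _) (Equiv.refl _) ⟨Sum.isRight, Sum.isRight⟩ (fun _ => rfl) (fun _ => rfl)]
  have h : (∀ x : A ⊕ B, x.isRight = false) ∧ ∀ y : A' ⊕ B', y.isRight = false :=
    ⟨by rintro (x | x); exacts [rfl, isEmptyElim x], by rintro (x | x); exacts [rfl, isEmptyElim x]⟩
  refine (projObj_incl_pos L F _ h _ _).trans ?_
  refine congrArg₂ (· • ·) (aug_act _ _ v) ?_
  refine (act_act L _ _ (Equiv.subtypeUnivEquiv h.1) (Equiv.subtypeUnivEquiv h.2) a).trans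
    (act_congr ?_ ?_ rfl) <;> exact Equiv.ext fun _ => rfl

lemma projSym_of_nonempty (h : Nonempty B ∨ Nonempty B') (a : val L A A')
    (v : val (symTot false F) B B') : ev (projSym L F) (dayMk a v) = 0 := by
  rw [← act_refl (dayConv L (symTot false F)) (dayMk a v),
    act_dayMk (Equiv.refl _) (Equiv.refl _) ⟨Sum.isRight, Sum.isRight⟩ (fun _ => rfl) (fun _ => rfl)]
  refine projObj_incl_neg L F _ (fun h' => ?_) _
  rcases h with ⟨⟨b⟩⟩ | ⟨⟨b⟩⟩
  · exact Bool.noConfusion (h'.1 (Sum.inr b))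
  · exact Bool.noConfusion (h'.2 (Sum.inr b))

lemma projSym_eq_zero (a : val L A A') (v : val (symTot false F) B B') (hv : aug F v = 0) :
    ev (projSym L F) (dayMk a v) = 0 := by
  by_cases h : Nonempty B ∨ Nonempty B'
  · exact projSym_of_nonempty h a v
  · rw [not_or, not_nonempty_iff, not_nonempty_iff] at h
    obtain ⟨_, _⟩ := h
    rw [projSym_of_isEmpty, hv, zero_smul]

/-- If the input lies in the symmetric part, both sides are zero. If it lies in `L`, only a
symmetric part on empty sets can survive, and there it contributes the scalar `aug F v`. -/
lemma plug_compat_projSym (Q : Plug O L) (R : Plug O F) :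
    (dayPlug Q (symPlug false R)).Compat Q (𝟙 O) (projSym L F) where
  out t q := by
    change ev _ (dayPlugMap Q _ t q) = Q.plug _ q
    induction t using dayFst_induction with
    | h0 => simp only [map_zero, LinearMap.zero_apply]
    | hadd s t hs ht => simp only [map_add, LinearMap.add_apply, hs, ht]
    | @hl A A' B B' _ _ _ _ e e' a v =>
      rw [dayPlugMap_left, ev_act, ev_act]
      by_cases h : Nonempty B ∨ Nonempty B'
      · rw [projSym_of_nonempty h, projSym_of_nonempty h, map_zero, map_zero, map_zero]
        rfl
      · rw [not_or, not_nonempty_iff, not_nonempty_iff] at h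
        obtain ⟨_, _⟩ := h
        rw [projSym_of_isEmpty, projSym_of_isEmpty, map_smul, map_smul, map_smul, act_act, act_act]
        refine congrArg (aug F v • ·) (Eq.trans ?_ ((Q.plug_act_left
          ((Equiv.sumEmpty A B).symm.trans e) ((Equiv.sumEmpty A' B').symm.trans e') a q).symm.trans
          (congrArg (fun x => Q.plug x q) (act_congr ?_ rfl rfl))))
        · exact act_congr (Equiv.ext (by rintro (x | x) <;> rfl))
            (Equiv.ext (by rintro (x | x) <;> rfl)) rfl
        · exact Equiv.ext (by rintro (x | x) <;> rfl)
    | hr e e' a v =>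
      rw [dayPlugMap_right, ev_act, ev_act, projSym_eq_zero _ _ (aug_symPlug R v q),
        projSym_of_nonempty (Or.inl ⟨Sum.inr 0⟩), map_zero, map_zero, map_zero]
      rfl

lemma fst_compat_projSym (μ : Pairing L G M) :
    (μ.fst (symTot false F)).Compat μ (projSym L F) (𝟙 G) (projSym M F) where
  out t q := by
    induction t using day_induction with
    | h0 => simp only [map_zero, LinearMap.zero_apply]
    | hadd s t hs ht => simp only [map_add, LinearMap.add_apply, hs, ht]
    | @hmk A A' B B' _ _ _ _ e e' a v =>
      rw [Pairing.fst_mul, ev_act, ev_act, ev_id]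
      by_cases h : Nonempty B ∨ Nonempty B'
      · rw [projSym_of_nonempty h, projSym_of_nonempty h, map_zero, map_zero, map_zero]
        rfl
      · rw [not_or, not_nonempty_iff, not_nonempty_iff] at h
        obtain ⟨_, _⟩ := h
        rw [projSym_of_isEmpty, projSym_of_isEmpty, map_smul, map_smul, map_smul, act_act, act_act,
          LinearMap.smul_apply, μ.mul_act_left]
        exact congrArg (aug F v • ·) (act_congr (Equiv.ext (by rintro (x | x) <;> rfl))
          (Equiv.ext (by rintro (x | x) <;> rfl)) rfl)

/-- A product with a wheel has positive degree in `S*` and is killed by the projection. This is why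
the zero pairing is the right choice on `Λ* O`. -/
lemma snd_compat_projSym :
    ((mulPairing false F).snd L).Compat (zeroPairing L F L) (projSym L F) (𝟙 F) (projSym L F) where
  out t q := by
    refine Eq.trans ?_ (rfl : (0 : val L _ _) = _)
    induction t using day_induction with
    | h0 => simp only [map_zero, LinearMap.zero_apply]
    | hadd s t hs ht => simp only [map_add, LinearMap.add_apply, hs, ht, add_zero]
    | hmk e e' a v =>
      rw [Pairing.snd_mul, ev_act, projSym_eq_zero _ _ (aug_mul v q), map_zero]

lemma projSym_isHom (O : NUOperad k) : (lambdaSymData O).toContraction.IsHom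
    (lambdaData O).toContraction (projSym (symTot true O.toMod) O.wheel) :=
  ContrData.isHom _ _ (plug_compat_projSym _ _) (fst_compat_projSym _)
    ⟨fun a b => (snd_compat_projSym.out a b).trans rfl⟩

lemma lambdaSymProj_isHom (O : NUOperad k) : (lambdaSymContrData O).toContraction.IsHom
    (lambdaContrData O).toContraction ((lambdaSymProj k).app O) := by
  have h := projSym_isHom O
  unfold projSym at h
  delta lambdaSymContrData lambdaContrData lambdaSymProj lambdaSymFunctor lambdaFunctor
    symWheelFunctor NUOperad.forget NUOperad.wheelFunctor LambdaStar SStar symFunctor Functor.comp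
  with_reducible exact h

/-- The unit of `S* F`. -/
def symUnit (F : FBMod k) : val (symTot false F) Empty Empty :=
  cls false (F := F) (d := 0) (Z := ⟨Empty, Empty⟩)
    (powIncl F ⟨Empty.elim, Empty.elim⟩ (PiTensorProduct.tprod k fun i => i.elim0))

lemma aug_symUnit (F : FBMod k) : aug F (symUnit F) = 1 :=
  (symAug_cls F _).trans (powAug_incl F _ _)

/-- A preimage of `a` is `a ⊗ 1`, with the unit of `S* F` placed on empty sets. -/
lemma projSym_surjective (L F : FBMod k) :
    Function.Surjective (ev (projSym L F) : val (dayConv L (symTot false F)) X Y →ₗ[k] val L X Y) := by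
  intro a
  refine ⟨act (dayConv L (symTot false F)) (Equiv.sumEmpty X Empty) (Equiv.sumEmpty Y Empty)
    (dayMk a (symUnit F)), ?_⟩
  rw [ev_act, projSym_of_isEmpty, aug_symUnit, one_smul, act_act]
  refine (act_congr ?_ ?_ rfl).trans (act_refl L a)
  · exact (Equiv.sumEmpty X Empty).symm_trans_self
  · exact (Equiv.sumEmpty Y Empty).symm_trans_self

lemma lambdaSymProj_surjective (O : NUOperad k) (Z : FB2) :
    Function.Surjective (((lambdaSymProj k).app O).app Z).hom :=
  projSym_surjective (X := Z.fst) (Y := Z.snd) (symTot true O.toMod) O.wheel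

end Projection

/-! ### Iterated contractions and the sign of a permutation of labels -/

section Iteration

variable {k : Type u} [Field k] {L L' : FBMod k}
variable {X X' Y Y' : Type} [Finite X] [Finite X'] [Finite Y] [Finite Y']

lemma sumFinAdd_zero (X : Type) (n : ℕ) :
    (sumFinAdd X n 0).symm = Equiv.sumEmpty (X ⊕ Fin n) (Fin 0) :=
  Equiv.ext (by rintro ((x | i) | i); exacts [rfl, rfl, i.elim0])

lemma sumFinAdd_assoc (X : Type) (n m : ℕ) :
    (sumFinAdd X n (m + 1)).symm.trans (sumFinAdd X (n + m) 1) =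
      (sumFinAdd (X ⊕ Fin n) m 1).trans (onPt (sumFinAdd X n m).symm) := by
  refine Equiv.ext ?_
  rintro ((x | i) | i)
  · rfl
  · exact UwbOrd.sumFinAdd_castAdd X (n + m) 1 (Fin.castAdd m i)
  · refine Fin.addCases (fun i => ?_) (fun i => ?_) i
    · refine (UwbOrd.sumFinAdd_castAdd X (n + m) 1 (Fin.natAdd n i)).trans ?_
      exact (congrArg (onPt (sumFinAdd X n m).symm)
        (UwbOrd.sumFinAdd_castAdd (X ⊕ Fin n) m 1 i)).symm
    · refine Eq.trans (congrArg (fun j => sumFinAdd X (n + m) 1 (Sum.inr j))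
        (Fin.ext (Nat.add_assoc n m i).symm : _ = Fin.natAdd (n + m) i))
        ((UwbOrd.sumFinAdd_natAdd X (n + m) 1 i).trans ?_)
      exact (congrArg (onPt (sumFinAdd X n m).symm)
        (UwbOrd.sumFinAdd_natAdd (X ⊕ Fin n) m 1 i)).symm

lemma sumFinAdd_sumCongr {X X' : Type} (f : X ≃ X') (n : ℕ) :
    (f.sumCongr (Equiv.refl (Fin (n + 1)))).trans (sumFinAdd X' n 1) =
      (sumFinAdd X n 1).trans (onPt (f.sumCongr (Equiv.refl (Fin n)))) := by
  refine Equiv.ext ?_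
  rintro (x | i)
  · rfl
  · refine Fin.addCases (fun i => ?_) (fun i => ?_) i
    · simp [sumFinAdd]
    · simp [sumFinAdd]

lemma sumFinAdd_perm (X : Type) {n : ℕ} {σ : Equiv.Perm (Fin (n + 1))} {τ : Equiv.Perm (Fin n)}
    (h : ∀ i, σ (Fin.castSucc i) = Fin.castSucc (τ i)) (h' : σ (Fin.last n) = Fin.last n) :
    ((Equiv.refl X).sumCongr σ).trans (sumFinAdd X n 1) =
      (sumFinAdd X n 1).trans (onPt ((Equiv.refl X).sumCongr τ)) := by
  refine Equiv.ext ?_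
  rintro (x | i)
  · rfl
  · refine Fin.lastCases ?_ (fun i => ?_) i
    · change sumFinAdd X n 1 (Sum.inr (σ (Fin.last n))) = _
      rw [h']
      change sumFinAdd X n 1 (Sum.inr (Fin.natAdd n 0)) =
        Sum.map (Sum.map id τ) id (sumFinAdd X n 1 (Sum.inr (Fin.natAdd n 0)))
      rw [UwbOrd.sumFinAdd_natAdd]; rfl
    · change sumFinAdd X n 1 (Sum.inr (σ (Fin.castSucc i))) = _
      rw [h]
      change sumFinAdd X n 1 (Sum.inr (Fin.castAdd 1 (τ i))) =
        Sum.map (Sum.map id τ) id (sumFinAdd X n 1 (Sum.inr (Fin.castAdd 1 i)))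
      rw [UwbOrd.sumFinAdd_castAdd, UwbOrd.sumFinAdd_castAdd]; rfl

/-- When the last two labels are split off as added points, their transposition becomes
`sumRightComm`, the form in which anticommutation is stated. -/
lemma sumFinAdd_swap (X : Type) (n : ℕ) :
    (((Equiv.refl X).sumCongr (Equiv.swap (Fin.castSucc (Fin.last n)) (Fin.last (n + 1)))).trans
      (sumFinAdd X (n + 1) 1)).trans (onPt (sumFinAdd X n 1)) =
      ((sumFinAdd X (n + 1) 1).trans (onPt (sumFinAdd X n 1))).trans
        (sumRightComm (X ⊕ Fin n) (Fin 1) (Fin 1)) := by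
  have h1 : sumFinAdd X (n + 1) 1 (Sum.inr (Fin.last (n + 1))) = Sum.inr 0 :=
    UwbOrd.sumFinAdd_natAdd X (n + 1) 1 0
  have h2 (i : Fin (n + 1)) : sumFinAdd X (n + 1) 1 (Sum.inr (Fin.castSucc i)) =
      Sum.inl (Sum.inr i) := UwbOrd.sumFinAdd_castAdd X (n + 1) 1 i
  have h3 : sumFinAdd X n 1 (Sum.inr (Fin.last n)) = Sum.inr 0 := UwbOrd.sumFinAdd_natAdd X n 1 0
  have h4 (i : Fin n) : sumFinAdd X n 1 (Sum.inr (Fin.castSucc i)) = Sum.inl (Sum.inr i) :=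
    UwbOrd.sumFinAdd_castAdd X n 1 i
  refine Equiv.ext ?_
  rintro (x | i)
  · rfl
  · refine Fin.lastCases ?_ (fun i => Fin.lastCases ?_ (fun i => ?_) i) i
    · simp [h1, h2, h3, sumRightComm]
    · simp [h1, h2, h3, sumRightComm]
    · have h : Equiv.swap (Fin.castSucc (Fin.last n)) (Fin.last (n + 1))
          (Fin.castSucc (Fin.castSucc i)) = Fin.castSucc (Fin.castSucc i) :=
        Equiv.swap_apply_of_ne_of_ne (fun h => (Fin.castSucc_lt_last i).ne (Fin.castSucc_injective _ h))
          (Fin.castSucc_lt_last _).ne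
      simp [h, h2, h4, sumRightComm]

namespace Contraction

variable (κ : Contraction L) (κ' : Contraction L')

/-- The iterated contraction of labelled points. -/
def iter : ∀ (n : ℕ) (X Y : Type) [Finite X] [Finite Y],
    val L (X ⊕ Fin n) (Y ⊕ Fin n) →ₗ[k] val L X Y
  | 0, X, Y, _, _ => act L (Equiv.sumEmpty X (Fin 0)) (Equiv.sumEmpty Y (Fin 0))
  | n + 1, X, Y, _, _ => iter n X Y ∘ₗ κ.map (X ⊕ Fin n) (Y ⊕ Fin n) ∘ₗ
      act L (sumFinAdd X n 1) (sumFinAdd Y n 1)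

lemma iter_zero (t : val L (X ⊕ Fin 0) (Y ⊕ Fin 0)) : κ.iter 0 X Y t =
    act L (Equiv.sumEmpty X (Fin 0)) (Equiv.sumEmpty Y (Fin 0)) t := rfl

lemma iter_succ (n : ℕ) (t : val L (X ⊕ Fin (n + 1)) (Y ⊕ Fin (n + 1))) :
    κ.iter (n + 1) X Y t = κ.iter n X Y (κ.map (X ⊕ Fin n) (Y ⊕ Fin n)
      (act L (sumFinAdd X n 1) (sumFinAdd Y n 1) t)) := rfl

lemma iter_one (t : val L (Pt X) (Pt Y)) : κ.iter 1 X Y t = κ.map X Y t := by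
  refine (κ.iter_succ 0 t).trans ?_
  rw [iter_zero, ← κ.map_act, act_act]
  refine congrArg (κ.map X Y) ((act_congr ?_ ?_ rfl).trans (act_refl L t)) <;>
  · refine Equiv.ext ?_
    rintro (x | i)
    · rfl
    · obtain rfl : i = (0 : Fin 1) := Subsingleton.elim (α := Fin 1) i 0
      rfl

lemma iter_act (n : ℕ) (f : X ≃ X') (f' : Y ≃ Y') (t : val L (X ⊕ Fin n) (Y ⊕ Fin n)) :
    κ.iter n X' Y' (act L (f.sumCongr (Equiv.refl (Fin n))) (f'.sumCongr (Equiv.refl (Fin n))) t) =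
      act L f f' (κ.iter n X Y t) := by
  induction n with
  | zero =>
    rw [iter_zero, iter_zero, act_act, act_act]
    exact act_congr (Equiv.ext (by rintro (x | x); exacts [rfl, x.elim0]))
      (Equiv.ext (by rintro (x | x); exacts [rfl, x.elim0])) rfl
  | succ n ih =>
    rw [iter_succ, iter_succ, ← ih, ← κ.map_act, act_act, act_act, sumFinAdd_sumCongr,
      sumFinAdd_sumCongr]

/-- The last labels are contracted first. This fits the composition in `uwb^ord`, where the labels
of the first morphism come first, since modules over the opposite category apply the second morphism
first. -/
lemma iter_add (n m : ℕ) (t : val L ((X ⊕ Fin n) ⊕ Fin m) ((Y ⊕ Fin n) ⊕ Fin m)) :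
    κ.iter (n + m) X Y (act L (sumFinAdd X n m).symm (sumFinAdd Y n m).symm t) =
      κ.iter n X Y (κ.iter m (X ⊕ Fin n) (Y ⊕ Fin n) t) := by
  induction m with
  | zero =>
    rw [sumFinAdd_zero, sumFinAdd_zero]
    rfl
  | succ m ih =>
    rw [iter_succ, ← ih, ← κ.map_act, act_act, ← sumFinAdd_assoc, ← sumFinAdd_assoc]
    refine (κ.iter_succ (n + m) _).trans ?_
    rw [act_act]

/-- A permutation of the labels acts on the iterated contraction by its sign. -/
structure SignAt (n : ℕ) (σ : Equiv.Perm (Fin n)) : Prop where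
  out : ∀ {X Y : Type} [Finite X] [Finite Y] (t : val L (X ⊕ Fin n) (Y ⊕ Fin n)),
    κ.iter n X Y (act L ((Equiv.refl X).sumCongr σ) ((Equiv.refl Y).sumCongr σ) t) =
      ((σ.sign : ℤˣ) : ℤ) • κ.iter n X Y t

variable {κ}

lemma SignAt.one (n : ℕ) : κ.SignAt n 1 where
  out {X Y} _ _ t := by
    rw [Equiv.Perm.sign_one, Units.val_one, one_smul]
    refine congrArg (κ.iter n X Y) ((act_congr ?_ ?_ rfl).trans (act_refl L t)) <;>
      exact Equiv.sumCongr_refl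

lemma SignAt.mul {n : ℕ} {σ τ : Equiv.Perm (Fin n)} (hσ : κ.SignAt n σ) (hτ : κ.SignAt n τ) :
    κ.SignAt n (σ * τ) where
  out {X Y} _ _ t := by
    have h := hσ.out (act L ((Equiv.refl X).sumCongr τ) ((Equiv.refl Y).sumCongr τ) t)
    rw [hτ.out, act_act, smul_smul, ← Units.val_mul, ← map_mul] at h
    refine (congrArg (κ.iter n X Y) (act_congr ?_ ?_ rfl)).trans h <;>
      exact Equiv.ext (by rintro (x | x) <;> rfl)

/-- The last label is fixed and is contracted first; the permutation of the others passes through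
this contraction by naturality. -/
lemma SignAt.succ {n : ℕ} {σ : Equiv.Perm (Fin (n + 1))} {τ : Equiv.Perm (Fin n)}
    (h : ∀ i, σ (Fin.castSucc i) = Fin.castSucc (τ i)) (h' : σ (Fin.last n) = Fin.last n)
    (hs : σ.sign = τ.sign) (hτ : κ.SignAt n τ) : κ.SignAt (n + 1) σ where
  out t := by
    rw [iter_succ, iter_succ, act_act, sumFinAdd_perm _ h h', sumFinAdd_perm _ h h', ← act_act,
      κ.map_act, hτ.out, hs]

/-- The last two labels are contracted first, so this is the anticommutation `map_map` for two added
points. -/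
lemma SignAt.swap_last (n : ℕ) :
    κ.SignAt (n + 2) (Equiv.swap (Fin.castSucc (Fin.last n)) (Fin.last (n + 1))) where
  out t := by
    rw [Equiv.Perm.sign_swap (Fin.castSucc_lt_last _).ne, iter_succ, iter_succ, iter_succ,
      iter_succ, ← κ.map_act, ← κ.map_act, act_act, act_act, act_act,
      ← Equiv.trans_assoc, ← Equiv.trans_assoc, sumFinAdd_swap, sumFinAdd_swap, κ.map_map, act_act,
      map_neg]
    refine Eq.trans (congrArg Neg.neg ?_) (neg_one_smul ℤ _).symm
    refine congrArg (fun x => κ.iter n _ _ (κ.map _ _ (κ.map _ _ x))) (act_congr ?_ ?_ rfl) <;>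
    · rw [Equiv.trans_assoc]
      refine (congrArg _ ?_).trans (Equiv.trans_refl _)
      exact Equiv.ext (by rintro ((x | x) | x) <;> rfl)

-- Adjacent transpositions generate the symmetric group. The last one is `SignAt.swap_last`; the
-- others fix the last label and are covered by induction on `n`.
variable (κ) in
lemma signAt (n : ℕ) (σ : Equiv.Perm (Fin n)) : κ.SignAt n σ := by
  induction n with
  | zero => rw [Subsingleton.elim σ 1]; exact .one 0
  | succ n ih =>
    have h : σ ∈ Submonoid.closure (Set.range fun i : Fin n => Equiv.swap i.castSucc i.succ) := by
      rw [Equiv.Perm.mclosure_swap_castSucc_succ]; trivial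
    induction h using Submonoid.closure_induction with
    | one => exact .one _
    | mul _ _ _ _ h h' => exact h.mul h'
    | mem _ h =>
      obtain ⟨i, rfl⟩ := h
      obtain _ | n := n
      · exact i.elim0
      · refine Fin.lastCases ?_ (fun i => ?_) i
        · exact .swap_last n
        · refine .succ (τ := Equiv.swap i.castSucc i.succ) (fun j => ?_) ?_ ?_ (ih _)
          · exact (Fin.castSucc_injective _).swap_apply i.castSucc i.succ j
          · exact Equiv.swap_apply_of_ne_of_ne (Fin.castSucc_lt_last _).ne'
              (fun h => (Fin.castSucc_lt_last i).ne' (Fin.succ_injective _ h))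
          · rw [Equiv.Perm.sign_swap (Fin.castSucc_lt_succ).ne]
            exact (Equiv.Perm.sign_swap (Fin.castSucc_lt_succ).ne).symm

end Contraction

end Iteration

/-! ### From anticommuting contractions to modules over the twisted category -/

section TwistedModules

variable {k : Type u} [Field k] {L L' : FBMod k}
variable {X X' Y Y' : Type} [Finite X] [Finite X'] [Finite Y] [Finite Y']

namespace Contraction

lemma IsHom.iter {κ : Contraction L} {κ' : Contraction L'} {η : L ⟶ L'} (h : κ.IsHom κ' η) (n : ℕ)
    (t : val L (X ⊕ Fin n) (Y ⊕ Fin n)) :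
    ev η (κ.iter n X Y t) = κ'.iter n X Y (ev η t) := by
  induction n with
  | zero => rw [iter_zero, iter_zero, ev_act]
  | succ n ih => rw [iter_succ, iter_succ, ih, h.out, ev_act]

variable (κ : Contraction L)

/-- The map induced by a morphism of `uwb^ord`. -/
def onHom {Z W : UwbOrd} (f : UwbOrd.Hom Z W) :
    val L W.pair.fst W.pair.snd →ₗ[k] val L Z.pair.fst Z.pair.snd :=
  κ.iter f.deg Z.pair.fst Z.pair.snd ∘ₗ act L f.fst.symm f.snd.symm

lemma onHom_apply {Z W : UwbOrd} (f : UwbOrd.Hom Z W) (t : val L W.pair.fst W.pair.snd) :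
    κ.onHom f t = κ.iter f.deg Z.pair.fst Z.pair.snd (act L f.fst.symm f.snd.symm t) := rfl

/-- Naturality moves the bijections of `f` through the contraction of the labels of `g`, and
`iter_add` joins the two groups of labels. -/
lemma onHom_comp {Z W V : UwbOrd} (f : UwbOrd.Hom Z W) (g : UwbOrd.Hom W V)
    (t : val L V.pair.fst V.pair.snd) :
    κ.onHom (UwbOrd.Hom.comp f g) t = κ.onHom f (κ.onHom g t) := by
  rw [onHom_apply, onHom_apply κ f, onHom_apply, ← κ.iter_act, act_act, ← κ.iter_add, act_act]
  rfl

lemma onHom_ofIso {Z W : FB2} (f : Z ⟶ W) (t : val L W.fst W.snd) :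
    κ.onHom (UwbOrd.Hom.ofIso f) t = act L f.fst.symm f.snd.symm t := by
  refine (act_act L _ _ _ _ t).trans (act_congr ?_ ?_ rfl) <;> exact Equiv.ext fun _ => rfl

lemma onHom_pair {Z : FB2} (t : val L (Pt Z.fst) (Pt Z.snd)) :
    κ.onHom (UwbOrd.Hom.pair Z) t = κ.map Z.fst Z.snd t :=
  (congrArg (κ.iter 1 Z.fst Z.snd) (act_refl L t)).trans (κ.iter_one t)

lemma onHom_permute {Z W : UwbOrd} (f : UwbOrd.Hom Z W) (σ : Equiv.Perm (Fin f.deg))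
    (t : val L W.pair.fst W.pair.snd) :
    κ.onHom (UwbOrd.Hom.permute f σ) t = ((σ.sign : ℤˣ) : ℤ) • κ.onHom f t := by
  -- The bijections of `f` act through their inverses, so `σ` enters as `σ.symm`, which has the same
  -- sign.
  rw [← Equiv.Perm.sign_symm, onHom_apply κ f, ← (κ.signAt f.deg σ.symm).out, act_act]
  rfl

lemma IsHom.onHom {κ : Contraction L} {κ' : Contraction L'} {η : L ⟶ L'} (h : κ.IsHom κ' η)
    {Z W : UwbOrd} (f : UwbOrd.Hom Z W) (t : val L W.pair.fst W.pair.snd) :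
    ev η (κ.onHom f t) = κ'.onHom f (ev η t) := by
  rw [onHom_apply, onHom_apply, h.iter, ev_act]

/-- The linear extension of `onHom`. -/
def freeMap (Z W : Free k UwbOrd) :
    (Z ⟶ W) →ₗ[k] (L.obj (UwbOrd.pair W) →ₗ[k] L.obj (UwbOrd.pair Z)) :=
  Finsupp.linearCombination k fun f : UwbOrd.Hom Z W => κ.onHom f

lemma freeMap_arrow {Z W : Free k UwbOrd} (f : UwbOrd.Hom Z W) :
    κ.freeMap Z W (arrow k f) = κ.onHom f :=
  (Finsupp.linearCombination_single k 1 f).trans (one_smul k _)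

lemma freeMap_comp {Z W V : Free k UwbOrd} (s : Z ⟶ W) (t : W ⟶ V) :
    κ.freeMap Z V (s ≫ t) = κ.freeMap Z W s ∘ₗ κ.freeMap W V t := by
  refine free_induction k (fun s => κ.freeMap Z V (s ≫ t) = κ.freeMap Z W s ∘ₗ κ.freeMap W V t)
    ?_ ?_ ?_ ?_ s
  · rw [Limits.zero_comp, map_zero, map_zero, LinearMap.zero_comp]
  · intro a b ha hb
    rw [Preadditive.add_comp, map_add, map_add, ha, hb, LinearMap.add_comp]
  · intro a b hb
    rw [Linear.smul_comp, map_smul, map_smul, hb, LinearMap.smul_comp]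
  intro f
  refine free_induction k (fun t => κ.freeMap Z V (arrow k f ≫ t) =
    κ.freeMap Z W (arrow k f) ∘ₗ κ.freeMap W V t) ?_ ?_ ?_ ?_ t
  · rw [Limits.comp_zero, map_zero, map_zero, LinearMap.comp_zero]
  · intro a b ha hb
    rw [Preadditive.comp_add, map_add, map_add, ha, hb, LinearMap.comp_add]
  · intro a b hb
    rw [Linear.comp_smul, map_smul, map_smul, hb, LinearMap.comp_smul]
  · intro g
    rw [arrow_comp, freeMap_arrow, freeMap_arrow, freeMap_arrow]
    exact LinearMap.ext fun x => κ.onHom_comp f g x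

/-- The functor on `k uwb^ord` given by contraction maps. -/
def freeFunctor : Free k UwbOrd ⥤ (ModuleCat.{u} k)ᵒᵖ where
  obj Z := op (L.obj (UwbOrd.pair Z))
  map {Z W} f := (ModuleCat.ofHom (κ.freeMap Z W f)).op
  map_id Z := Quiver.Hom.unop_inj (ModuleCat.hom_ext ((κ.freeMap_arrow _).trans
    (LinearMap.ext fun t => (κ.onHom_ofIso (𝟙 (UwbOrd.pair Z)) t).trans (act_refl L t))))
  map_comp f g := Quiver.Hom.unop_inj (ModuleCat.hom_ext (κ.freeMap_comp f g))

instance : κ.freeFunctor.Additive where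
  map_add {Z W f g} := Quiver.Hom.unop_inj (ModuleCat.hom_ext (map_add (κ.freeMap Z W) f g))

instance : κ.freeFunctor.Linear k where
  map_smul {Z W} f a := Quiver.Hom.unop_inj (ModuleCat.hom_ext (map_smul (κ.freeMap Z W) a f))

lemma freeFunctor_arrow {Z W : Free k UwbOrd} (f : UwbOrd.Hom Z W) :
    κ.freeFunctor.map (arrow k f) = (ModuleCat.ofHom (κ.onHom f)).op :=
  congrArg (fun g => (ModuleCat.ofHom g).op) (κ.freeMap_arrow f)

/-- The sign rule for permuted labels is exactly the relation imposed in `(k uwb)_-`, so the functor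
descends to this quotient. -/
lemma twistSub_le_ker (Z W : Free k UwbOrd) :
    twistSub k Z W ≤ LinearMap.ker (κ.freeMap Z W) := by
  refine Submodule.span_le.2 ?_
  rintro _ ⟨f, σ, rfl⟩
  refine (map_sub (κ.freeMap Z W) _ _).trans (sub_eq_zero.2 ?_)
  rw [map_zsmul, freeMap_arrow, freeMap_arrow]
  exact LinearMap.ext fun t => κ.onHom_permute f σ t

lemma freeFunctor_eq {Z W : Free k UwbOrd} (s t : Z ⟶ W) (h : twistRel k s t) :
    κ.freeFunctor.map s = κ.freeFunctor.map t := by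
  refine Quiver.Hom.unop_inj (ModuleCat.hom_ext ?_)
  refine sub_eq_zero.1 ((map_sub (κ.freeMap Z W) s t).symm.trans ?_)
  exact κ.twistSub_le_ker Z W h

/-- The functor on `(k uwb)_-` given by contraction maps. -/
def twFunctor : KUwbTw k ⥤ (ModuleCat.{u} k)ᵒᵖ :=
  CategoryTheory.Quotient.lift (twistRel k) κ.freeFunctor fun _ _ => κ.freeFunctor_eq

instance : κ.twFunctor.Additive where
  map_add {Z W f g} := by
    obtain ⟨f, rfl⟩ := (CategoryTheory.Quotient.functor (twistRel k)).map_surjective (X := Z.as) (Y := W.as) f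
    obtain ⟨g, rfl⟩ := (CategoryTheory.Quotient.functor (twistRel k)).map_surjective (X := Z.as) (Y := W.as) g
    exact κ.freeFunctor.map_add

instance : κ.twFunctor.Linear k where
  map_smul {Z W} f a := by
    obtain ⟨f, rfl⟩ := (CategoryTheory.Quotient.functor (twistRel k)).map_surjective (X := Z.as) (Y := W.as) f
    exact Functor.Linear.map_smul (F := κ.freeFunctor) f a

/-- The `(k dwb)_-`-module given by contraction maps. -/
def toModule : KDwbTwMod k where
  obj := κ.twFunctor.leftOp
  property :=
    ⟨⟨fun {_ _ f g} => congrArg Quiver.Hom.unop (κ.twFunctor.map_add (f := f.unop) (g := g.unop))⟩,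
      ⟨fun f a => congrArg Quiver.Hom.unop (Functor.Linear.map_smul (F := κ.twFunctor) f.unop a)⟩⟩

lemma module_map {Z W : UwbOrd} (f : UwbOrd.Hom Z W) :
    κ.toModule.obj.map ((uwbOrdToTw k).map (X := Z) (Y := W) f).op = ModuleCat.ofHom (κ.onHom f) :=
  congrArg Quiver.Hom.unop (κ.freeFunctor_arrow f)

variable {κ} {κ' : Contraction L'} {η : L ⟶ L'}

lemma IsHom.free_naturality (h : κ.IsHom κ' η) {Z W : Free k UwbOrd} (f : Z ⟶ W) :
    (κ.freeFunctor.map f).unop ≫ η.app (UwbOrd.pair Z) =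
      η.app (UwbOrd.pair W) ≫ (κ'.freeFunctor.map f).unop := by
  refine free_induction k (fun f => (κ.freeFunctor.map f).unop ≫ η.app (UwbOrd.pair Z) =
      η.app (UwbOrd.pair W) ≫ (κ'.freeFunctor.map f).unop) ?_ ?_ ?_ ?_ f
  · rw [Functor.map_zero, Functor.map_zero]
    exact Limits.zero_comp.trans Limits.comp_zero.symm
  · intro s t hs ht
    rw [Functor.map_add, Functor.map_add]
    exact (Preadditive.add_comp _ _ _ _ _ _).trans ((congrArg₂ (· + ·) hs ht).trans
      (Preadditive.comp_add _ _ _ _ _ _).symm)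
  · intro a s hs
    rw [Functor.map_smul, Functor.map_smul]
    exact (Linear.smul_comp _ _ _ _ _ _).trans ((congrArg (a • ·) hs).trans
      (Linear.comp_smul _ _ _ _ _ _).symm)
  · intro f
    rw [freeFunctor_arrow, freeFunctor_arrow]
    exact ModuleCat.hom_ext (LinearMap.ext fun t => h.onHom f t)

/-- The morphism of `(k dwb)_-`-modules given by a morphism that commutes with contraction maps. -/
def IsHom.toModule (h : κ.IsHom κ' η) : κ.toModule ⟶ κ'.toModule :=
  ObjectProperty.homMk
    { app := fun Z => η.app (UwbOrd.pair Z.unop.as)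
      naturality := fun Z W f => by
        obtain ⟨g, hg⟩ := (CategoryTheory.Quotient.functor (twistRel k)).map_surjective (X := W.unop.as)
          (Y := Z.unop.as) f.unop
        obtain rfl : f = ((CategoryTheory.Quotient.functor (twistRel k)).map g).op := congrArg Quiver.Hom.op hg.symm
        exact h.free_naturality g }

variable (κ) in
/-- The underlying `FB × FB`-module of `κ.toModule`. -/
def moduleIso : (underlying k).obj κ.toModule ≅ L :=
  NatIso.ofComponents (fun Z => Iso.refl (L.obj Z)) fun {Z W} f => by
    refine (Category.comp_id _).trans (Eq.trans ?_ (Category.id_comp _).symm)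
    refine (κ.module_map _).trans ?_
    exact ModuleCat.hom_ext (LinearMap.ext fun t => κ.onHom_ofIso _ t)

-- The isomorphism has identity components, and the contraction of a module is its value on the
-- degree-one morphism, whose iterated contraction has a single step.
variable (κ) in
lemma transportedContraction_moduleIso (X Y : Type) [Finite X] [Finite Y] :
    transportedContraction κ.moduleIso X Y = κ.map X Y := by
  refine LinearMap.ext fun t => ?_
  refine (congrArg (fun f => f.hom t) (κ.module_map (UwbOrd.Hom.pair ⟨X, Y⟩))).trans ?_
  exact κ.onHom_pair (Z := ⟨X, Y⟩) t

variable {C : Type*} [Category* C] {T T' : C ⥤ FBMod k}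

/-- The functor to `(k dwb)_-`-modules given by natural contraction maps. -/
def moduleFunctor (κ : ∀ c, Contraction (T.obj c))
    (h : ∀ {c d : C} (f : c ⟶ d), (κ c).IsHom (κ d) (T.map f)) : C ⥤ KDwbTwMod k where
  obj c := (κ c).toModule
  map f := (h f).toModule
  map_id c := by
    apply ObjectProperty.hom_ext
    refine NatTrans.ext (funext fun Z => ?_)
    exact congrArg (fun η => η.app (UwbOrd.pair Z.unop.as)) (T.map_id c)
  map_comp f g := by
    apply ObjectProperty.hom_ext
    refine NatTrans.ext (funext fun Z => ?_)
    exact congrArg (fun η => η.app (UwbOrd.pair Z.unop.as)) (T.map_comp f g)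

/-- The underlying functor of `moduleFunctor`. -/
def moduleFunctorIso (κ : ∀ c, Contraction (T.obj c))
    (h : ∀ {c d : C} (f : c ⟶ d), (κ c).IsHom (κ d) (T.map f)) :
    moduleFunctor κ h ⋙ underlying k ≅ T :=
  NatIso.ofComponents (fun c => (κ c).moduleIso) fun {c d} f => by
    refine NatTrans.ext (funext fun Z => ?_)
    exact (Category.comp_id _).trans (Category.id_comp _).symm

/-- The transformation given by morphisms that commute with contraction maps. -/
def moduleFunctorMap {κ : ∀ c, Contraction (T.obj c)}
    {h : ∀ {c d : C} (f : c ⟶ d), (κ c).IsHom (κ d) (T.map f)}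
    {κ' : ∀ c, Contraction (T'.obj c)}
    {h' : ∀ {c d : C} (f : c ⟶ d), (κ' c).IsHom (κ' d) (T'.map f)} (α : T ⟶ T')
    (hα : ∀ c, (κ c).IsHom (κ' c) (α.app c)) : moduleFunctor κ h ⟶ moduleFunctor κ' h' where
  app c := (hα c).toModule
  naturality c d f := by
    apply ObjectProperty.hom_ext
    refine NatTrans.ext (funext fun Z => ?_)
    exact congrArg (fun η => η.app (UwbOrd.pair Z.unop.as)) (α.naturality f)

lemma whiskerRight_moduleFunctorMap {κ : ∀ c, Contraction (T.obj c)}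
    {h : ∀ {c d : C} (f : c ⟶ d), (κ c).IsHom (κ d) (T.map f)}
    {κ' : ∀ c, Contraction (T'.obj c)}
    {h' : ∀ {c d : C} (f : c ⟶ d), (κ' c).IsHom (κ' d) (T'.map f)} (α : T ⟶ T')
    (hα : ∀ c, (κ c).IsHom (κ' c) (α.app c)) :
    Functor.whiskerRight (moduleFunctorMap (h := h) (h' := h') α hα) (underlying k) ≫
      (moduleFunctorIso κ' h').hom = (moduleFunctorIso κ h).hom ≫ α := by
  refine NatTrans.ext (funext fun c => NatTrans.ext (funext fun Z => ?_))
  exact (Category.comp_id _).trans (Category.id_comp _).symm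

end Contraction

end TwistedModules

end Wheeled

end

theorem mainTheorem3 (k : Type*) [Field k] :
    ∃ (Φ Ψ : NUOperad k ⥤ KDwbTwMod k)
      (φ : Φ ⋙ underlying k ≅ lambdaSymFunctor k)
      (ψ : Ψ ⋙ underlying k ≅ lambdaFunctor k)
      (π : Φ ⟶ Ψ),
      (∀ O : NUOperad k, IsInducedContraction O (transportedContraction (φ.app O))) ∧
      Functor.whiskerRight π (underlying k) ≫ ψ.hom = φ.hom ≫ lambdaSymProj k ∧
      ∀ (O : NUOperad k) (Z : FB2),
        Function.Surjective (((lambdaSymProj k).app O).app Z).hom := by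
  refine ⟨_, _, Contraction.moduleFunctorIso (T := lambdaSymFunctor k)
      (fun O => (lambdaSymContrData O).toContraction) lambdaSymContrData_isHom,
    Contraction.moduleFunctorIso (T := lambdaFunctor k)
      (fun O => (lambdaContrData O).toContraction) lambdaContrData_isHom,
    Contraction.moduleFunctorMap (lambdaSymProj k) lambdaSymProj_isHom, fun O => ?_,
    Contraction.whiskerRight_moduleFunctorMap (lambdaSymProj k) lambdaSymProj_isHom,
    lambdaSymProj_surjective⟩
  have h := isInducedContraction_contr O
  -- The contraction recovered from the module is the one it was built from, for which the three
  -- rules are known.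
  have e : (fun (X Y : Type) [Finite X] [Finite Y] => (lambdaSymContrData O).contr X Y) =
      transportedContraction ((lambdaSymContrData O).toContraction.moduleIso) := by
    funext X Y _ _
    exact ((lambdaSymContrData O).toContraction.transportedContraction_moduleIso X Y).symm
  exact e ▸ h
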